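/- **Theorem 3.3 (LWE$_{n,q,D_{\mathbb Z_q,B_V}}$ $\le$ $\mathbb Z_q^n$-DCP).** *Setting.* For $B>0$ let $D_{\mathbb Z_q,B}$ be the distribution on $\mathbb Z_q$ with density proportional to $e^{-\pi|x|^2/B^2}$ on $\{x:|x|\le B\}$ and $0$ elsewhere, where $|x|$ is the absolute value of the representative of $x$ in $(-q/2,q/2]$, and let $D_{\mathbb Z_q^m,B}$ be the product of $m$ copies of it. Let $C_T>0$ be a constant and let $n,m,q,B_L,B_V,B_P$ be functions of the security parameter $\lambda$ with values in the positive integers, such that $q$ is prime, $n$ and $m$ are polynomially bounded, $m=\Omega(n\log_2 q)$, $B_P=\lfloor q/(2C_T\sqrt{mn\log_2 q})\rfloor$, $B_L<B_V<B_P$, and $B_V/B_L$ and $B_P/B_V$ are super-polynomial in $\lambda$ (hence so is the modulus $q$). A quantum algorithm is a program (one fixed text) for a classical random access machine (unit-cost addition, truncated subtraction, halving, bit length; branching and counted loops) that applies the gates $H,T,X$, CNOT and Toffoli to addressed qubits and measures qubits; its running time is the largest number of steps over all sequences of measurement outcomes. *$\mathbb Z_q^n$-DCP is solved efficiently* if there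 are a quantum algorithm and polynomials $r,t,p$ such that for all large $\lambda$, with $N=n\lceil\log_2 q\rceil$, for every $s\in\mathbb Z_q^n$ and all $x^{(1)},\dots,x^{(r(N))}\in\mathbb Z_q^n$, the algorithm, given $n,q$ and the registers $\frac1{\sqrt2}(|0,x^{(j)}\rangle+|1,x^{(j)}+s\rangle)$, $1\le j\le r(N)$, runs in time at most $t(N)$ and outputs $s$ with probability at least $1/p(N)$. *LWE$_{n,q,D_{\mathbb Z_q,B_V}}$ with $m$ samples is solved efficiently* if there are a quantum algorithm and polynomials $t,p$ such that for all large $\lambda$ the algorithm, given $n,m,q$ and $(A,u)\in\mathbb Z_q^{m\times n}\times\mathbb Z_q^m$, runs in time at most $t(\lambda)$ on every input, and, for $u=As+e$ with $A$ and $s$ uniform and $e\leftarrow D_{\mathbb Z_q^m,B_V}$, outputs $s$ with probability at least $1/p(\lambda)$. *Claim.* 1. If $\mathbb Z_q^n$-DCP is solved efficiently, then LWE$_{n,q,D_{\mathbb Z_q,B_V}}$ with $m$ samples is solved efficiently. 2. For a key $k=(A,As+e)$ let $f'_{k,b}(x)$ be the density $y\mapsto D_{\mathbb Z_q^m,B_P}(y-Ax-b(As+e))$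 on $\mathbb Z_q^m$, and let $$|\Psi'\rangle=\frac1{\sqrt{2q^n}}\sum_{b\in\{0,1\},\,x\in\mathbb Z_q^n,\,y\in\mathbb Z_q^m}\sqrt{f'_{k,b}(x)(y)}\;|b,x\rangle|y\rangle .$$ There is a negligible function $\varepsilon$ such that for every $\lambda$ and every $s\in\mathbb Z_q^n$, over uniform $A$, $e\leftarrow D_{\mathbb Z_q^m,B_V}$ and the outcome of measuring the register $|y\rangle$ of $|\Psi'\rangle$, with probability at least $1-\varepsilon(\lambda)$ the normalized state of the other two registers is, for some $x\in\mathbb Z_q^n$, at Euclidean distance at most $\varepsilon(\lambda)$ from $\frac1{\sqrt2}(|0,x\rangle+|1,x-s\rangle)$. -/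

import Mathlib

open Filter Topology Asymptotics

/-! ### A random access machine that controls a quantum memory

Classical memory: named arrays of natural numbers, with computed indices.
Quantum memory: named arrays of qubits, all but finitely many of them in state `|0⟩`.
A program is a fixed finite text (so the model is uniform).  It computes on the classical memory
with `+`, truncated `-`, halving and binary length, applies elementary gates to qubits with computed addresses,
and measures qubits.  There is no multiplication, so that with unit costs the length of the
numbers grows by at most one bit per time step, and polynomial time has its usual meaning.  Loops are counted; a polynomial-time algorithm of any
other shape is run under a counter up to its time bound, which `len` makes available. -/

/-- A qubit address: array name and index. -/
abbrev Qubit := ℕ × ℕ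

/-- A computational basis state of the quantum memory: the set of the qubits that are `1`. -/
abbrev Ket := Finset Qubit

/-- A (not necessarily normalized) state vector of the quantum memory. -/
abbrev QVec := Ket →₀ ℂ

/-- Squared norm of a state vector. -/
noncomputable def QVec.normSq (ψ : QVec) : ℝ := ψ.sum fun _ c => ‖c‖ ^ 2

/-- The Hadamard gate on qubit `a`. -/
noncomputable def gateH (a : Qubit) : QVec →ₗ[ℂ] QVec :=
  Finsupp.linearCombination ℂ fun S : Ket =>
    (((√2 : ℝ) : ℂ)⁻¹) •
      (Finsupp.single (S.erase a) (1 : ℂ) +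
        Finsupp.single (insert a S) (if a ∈ S then (-1 : ℂ) else 1))

/-- The gate `T = diag(1, exp(iπ/4))` on qubit `a`. -/
noncomputable def gateT (a : Qubit) : QVec →ₗ[ℂ] QVec :=
  Finsupp.linearCombination ℂ fun S : Ket =>
    Finsupp.single S (if a ∈ S then Complex.exp (Complex.I * (Real.pi / 4 : ℝ)) else 1)

/-- The NOT gate on qubit `a`. -/
noncomputable def gateX (a : Qubit) : QVec →ₗ[ℂ] QVec :=
  Finsupp.linearCombination ℂ fun S : Ket => Finsupp.single (symmDiff S {a}) 1

/-- The controlled NOT gate with control `c` and target `a` (the identity if `c = a`). -/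
noncomputable def gateCX (c a : Qubit) : QVec →ₗ[ℂ] QVec :=
  Finsupp.linearCombination ℂ fun S : Ket =>
    Finsupp.single (if c ≠ a ∧ c ∈ S then symmDiff S {a} else S) 1

/-- The Toffoli gate with controls `c`, `d` and target `a` (the identity if `a` is a control). -/
noncomputable def gateCCX (c d a : Qubit) : QVec →ₗ[ℂ] QVec :=
  Finsupp.linearCombination ℂ fun S : Ket =>
    Finsupp.single
      (if (c ≠ a ∧ d ≠ a) ∧ (c ∈ S ∧ d ∈ S) then symmDiff S {a} else S) 1

/-- Projection onto the states in which qubit `a` has the value `b`. -/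
noncomputable def projQubit (a : Qubit) (b : Bool) (ψ : QVec) : QVec :=
  ψ.filter fun S => (a ∈ S ↔ b = true)

/-- Classical memory: array name, index, content. -/
abbrev Store := ℕ → ℕ → ℕ

/-- Classical expressions. -/
inductive QExpr where
  | lit (c : ℕ)
  | get (a : ℕ) (i : QExpr)
  | add (e f : QExpr)
  | sub (e f : QExpr)
  | half (e : QExpr)
  | len (e : QExpr)

/-- Value of an expression (subtraction is truncated at `0`, halving rounds down, and `len`
is the number of binary digits). -/
def QExpr.eval (σ : Store) : QExpr → ℕ
  | .lit c => c
  | .get a i => σ a (i.eval σ)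
  | .add e f => e.eval σ + f.eval σ
  | .sub e f => e.eval σ - f.eval σ
  | .half e => e.eval σ / 2
  | .len e => (e.eval σ).size

/-- Number of operations in an expression. -/
def QExpr.size : QExpr → ℕ
  | .lit _ => 1
  | .get _ i => i.size + 1
  | .add e f => e.size + f.size + 1
  | .sub e f => e.size + f.size + 1
  | .half e => e.size + 1
  | .len e => e.size + 1

/-- Programs.  Array names are fixed in the text, indices are computed. -/
inductive QProg where
  | skip
  /-- `a[i] := e` -/
  | assign (a : ℕ) (i e : QExpr)
  /-- gates on the qubits `a[i]`, `b[j]`, `c[k]` -/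
  | had (a : ℕ) (i : QExpr)
  | tee (a : ℕ) (i : QExpr)
  | not (a : ℕ) (i : QExpr)
  | cnot (a : ℕ) (i : QExpr) (b : ℕ) (j : QExpr)
  | ccnot (a : ℕ) (i : QExpr) (b : ℕ) (j : QExpr) (c : ℕ) (k : QExpr)
  /-- measure the qubit `b[j]` and write the outcome, `0` or `1`, into the classical cell `a[i]` -/
  | meas (a : ℕ) (i : QExpr) (b : ℕ) (j : QExpr)
  | seq (p r : QProg)
  /-- if `e ≠ 0` then `p` else `r` -/
  | ite (e : QExpr) (p r : QProg)
  /-- run `p` as many times as the value that `e` has at the start -/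
  | rep (e : QExpr) (p : QProg)

/-- One branch of a computation, that is, one sequence of measurement outcomes: the classical
memory, the state vector, projected but not renormalized (so its squared norm is the probability
of the branch), and the elapsed time. -/
structure Branch where
  store : Store
  vec : QVec
  time : ℕ

/-- Let `t` time steps elapse. -/
def Branch.tick (β : Branch) (t : ℕ) : Branch := { β with time := β.time + t }

/-- Write `v` into the classical cell `a[i]`. -/
def Branch.write (β : Branch) (a i v : ℕ) : Branch :=
  { β with store := Function.update β.store a (Function.update (β.store a) i v) }

/-- Apply a linear map to the state vector. -/
noncomputable def Branch.apply (β : Branch) (U : QVec →ₗ[ℂ] QVec) : Branch :=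
  { β with vec := U β.vec }

/-- The list of all branches of the computation, one for each sequence of outcomes. -/
noncomputable def QProg.exec : QProg → Branch → List Branch
  | .skip, β => [β.tick 1]
  | .assign a i e, β =>
      [(β.write a (i.eval β.store) (e.eval β.store)).tick (i.size + e.size + 1)]
  | .had a i, β => [(β.apply (gateH (a, i.eval β.store))).tick (i.size + 1)]
  | .tee a i, β => [(β.apply (gateT (a, i.eval β.store))).tick (i.size + 1)]
  | .not a i, β => [(β.apply (gateX (a, i.eval β.store))).tick (i.size + 1)]
  | .cnot a i b j, β =>
      [(β.apply (gateCX (a, i.eval β.store) (b, j.eval β.store))).tick (i.size + j.size + 1)]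
  | .ccnot a i b j c k, β =>
      [(β.apply (gateCCX (a, i.eval β.store) (b, j.eval β.store) (c, k.eval β.store))).tick
        (i.size + j.size + k.size + 1)]
  | .meas a i b j, β =>
      [false, true].map fun o =>
        ({ β with vec := projQubit (b, j.eval β.store) o β.vec }.write a (i.eval β.store)
          o.toNat).tick (i.size + j.size + 1)
  | .seq p r, β => (p.exec β).flatMap fun γ => r.exec γ
  | .ite e p r, β =>
      if e.eval β.store ≠ 0 then p.exec (β.tick (e.size + 1)) else r.exec (β.tick (e.size + 1))
  | .rep e p, β =>
      (fun L : List Branch => L.flatMap fun γ => p.exec (γ.tick 1))^[e.eval β.store]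
        [β.tick (e.size + 1)]

/-- `p`, started with classical memory `σ` and state vector `ψ`, halts within `t` steps, whatever
the measurement outcomes are. -/
def QProg.HaltsWithin (p : QProg) (σ : Store) (ψ : QVec) (t : ℕ) : Prop :=
  ∀ β ∈ p.exec ⟨σ, ψ, 0⟩, β.time ≤ t

open Classical in
/-- Probability that `p`, started with classical memory `σ` and (unit) state vector `ψ`, halts with
the vector `s` in the cells `0, …, n - 1` of the classical array `0`. -/
noncomputable def QProg.outputProb (p : QProg) (σ : Store) (ψ : QVec) {n q : ℕ}
    (s : Fin n → ZMod q) : ℝ :=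
  ((p.exec ⟨σ, ψ, 0⟩).map fun β =>
    if ∀ i : Fin n, β.store 0 i = (s i).val then β.vec.normSq else 0).sum

/-! ### The dihedral coset problem over `ℤ_q^n` -/

/-- The coset state `(|0, x⟩ + |1, x + s⟩) / √2`. -/
noncomputable def dcpState {n q : ℕ} [NeZero q] (s x : Fin n → ZMod q) :
    EuclideanSpace ℂ (Bool × (Fin n → ZMod q)) :=
  (((√2 : ℝ) : ℂ)⁻¹) •
    (EuclideanSpace.single (false, x) (1 : ℂ) + EuclideanSpace.single (true, x + s) (1 : ℂ))

/-- The binary encoding of `r` registers `(b, x) ∈ {0,1} × ℤ_q^n` in the quantum memory.  With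
`L = ⌈log₂ q⌉`, the bit `b` of register `j` is the qubit `0[j]`, and binary digit `k` of
coordinate `i` of `x` is the qubit `1[(j * n + i) * L + k]`. -/
def encodeRegs {n q r : ℕ} (w : Fin r → Bool × (Fin n → ZMod q)) : Ket :=
  ((Finset.univ.filter fun j : Fin r => (w j).1 = true).image fun j : Fin r =>
    ((0, (j : ℕ)) : Qubit)) ∪
  ((Finset.univ.filter fun a : Fin r × Fin n × Fin (Nat.clog 2 q) =>
      ((w a.1).2 a.2.1).val.testBit a.2.2 = true).image
        fun a : Fin r × Fin n × Fin (Nat.clog 2 q) =>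
    ((1, ((a.1 : ℕ) * n + a.2.1) * Nat.clog 2 q + a.2.2) : Qubit))

/-- The quantum input: the tensor product of the coset states with secret `s` and offsets
`x 0, …, x (r - 1)`. -/
noncomputable def dcpInput {n q r : ℕ} [NeZero q] (s : Fin n → ZMod q)
    (x : Fin r → Fin n → ZMod q) : QVec :=
  ∑ w : Fin r → Bool × (Fin n → ZMod q),
    Finsupp.single (encodeRegs w) (∏ j, dcpState s (x j) (w j))

/-- The classical input: `n` and `q`, in the cells `0` and `1` of array `0`. -/
def dcpStore (n q : ℕ) : Store := fun a i =>
  if a = 0 ∧ i = 0 then n else if a = 0 ∧ i = 1 then q else 0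

/-- There is an efficient quantum algorithm for the `ℤ_q^n`-DCP, for `n = n(λ)` and `q = q(λ)` and
all large `λ`: one program that, with a number of registers and a running time polynomial in
`n log q`, outputs `s` with probability at least `1 / poly(n log q)`, for every secret `s` and
arbitrary offsets. -/
def EfficientlySolvesDCP (n q : ℕ → ℕ) [∀ k, Fact (q k).Prime] : Prop :=
  ∃ (P : QProg) (regs time loss : Polynomial ℕ), ∀ᶠ k in atTop,
    ∀ (s : Fin (n k) → ZMod (q k))
      (x : Fin (regs.eval (n k * Nat.clog 2 (q k))) → Fin (n k) → ZMod (q k)),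
      P.HaltsWithin (dcpStore (n k) (q k)) (dcpInput s x)
        (time.eval (n k * Nat.clog 2 (q k))) ∧
      1 ≤ ((loss.eval (n k * Nat.clog 2 (q k)) : ℕ) : ℝ) *
        P.outputProb (dcpStore (n k) (q k)) (dcpInput s x) s

/-! ### Learning with errors -/

/-- Density of the truncated discrete Gaussian `D_{ℤ_q, B}`; `|x|` is the absolute value of the
representative of `x` in `(-q/2, q/2]`. -/
noncomputable def gaussDensity (q : ℕ) [NeZero q] (B : ℝ) (x : ZMod q) : ℝ :=
  if |(x.valMinAbs : ℝ)| ≤ B then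
    Real.exp (-Real.pi * (x.valMinAbs : ℝ) ^ 2 / B ^ 2) /
      ∑ z : ZMod q with |(z.valMinAbs : ℝ)| ≤ B,
        Real.exp (-Real.pi * (z.valMinAbs : ℝ) ^ 2 / B ^ 2)
  else 0

/-- Density of the product distribution `D_{ℤ_q^m, B}`. -/
noncomputable def gaussVecDensity {m q : ℕ} [NeZero q] (B : ℝ) (e : Fin m → ZMod q) : ℝ :=
  ∏ i, gaussDensity q B (e i)

/-- The classical input: `n`, `m`, `q` in the cells `0`, `1`, `2` of array `0`, the matrix `A` row
by row in array `1`, and the vector `t` in array `2`. -/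
def lweStore {n m q : ℕ} (A : Matrix (Fin m) (Fin n) (ZMod q)) (t : Fin m → ZMod q) : Store :=
  fun a i =>
    if a = 0 then (if i = 0 then n else if i = 1 then m else if i = 2 then q else 0)
    else if a = 1 then
      (if h : i < m * n then
        (A (finProdFinEquiv.symm ⟨i, h⟩).1 (finProdFinEquiv.symm ⟨i, h⟩).2).val else 0)
    else if a = 2 then (if h : i < m then (t ⟨i, h⟩).val else 0)
    else 0

/-- Probability that `P`, started on `(A, As + e)` with all qubits `|0⟩`, outputs `s`, where `A` and
`s` are uniform and `e` has the density `D_{ℤ_q^m, B}`. -/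
noncomputable def lweSuccessProb (P : QProg) (n m q : ℕ) [NeZero q] (B : ℝ) : ℝ :=
  ∑ A : Matrix (Fin m) (Fin n) (ZMod q), ∑ s : Fin n → ZMod q, ∑ e : Fin m → ZMod q,
    ((q : ℝ) ^ (m * n))⁻¹ * ((q : ℝ) ^ n)⁻¹ * gaussVecDensity B e *
      P.outputProb (lweStore A (A.mulVec s + e)) (Finsupp.single ∅ 1) s

/-- There is an efficient quantum algorithm for search LWE with `m` samples and error distribution
`D_{ℤ_q, B}`: one program that runs in time polynomial in `λ` on all inputs and outputs `s` with
probability at least `1 / poly(λ)`, for all large `λ`. -/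
def EfficientlySolvesLWE (n m q : ℕ → ℕ) [∀ k, Fact (q k).Prime] (B : ℕ → ℝ) : Prop :=
  ∃ (P : QProg) (time loss : Polynomial ℕ), ∀ᶠ k in atTop,
    (∀ (A : Matrix (Fin (m k)) (Fin (n k)) (ZMod (q k))) (t : Fin (m k) → ZMod (q k)),
      P.HaltsWithin (lweStore A t) (Finsupp.single ∅ 1) (time.eval k)) ∧
    1 ≤ ((loss.eval k : ℕ) : ℝ) * lweSuccessProb P (n k) (m k) (q k) (B k)

/-! ### The LWE-based noisy trapdoor claw-free functions -/

/-- Bounded by a polynomial. -/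
def PolyBounded (f : ℕ → ℕ) : Prop := ∃ p : Polynomial ℕ, ∀ᶠ k : ℕ in atTop, f k ≤ p.eval k

/-- Eventually larger than every polynomial. -/
def SuperPoly (f : ℕ → ℝ) : Prop := ∀ d : ℕ, ∀ᶠ k : ℕ in atTop, (k : ℝ) ^ d ≤ f k

/-- Negligible functions of `λ`. -/
def Negl (f : ℕ → ℝ) : Prop :=
  (∀ k, 0 ≤ f k) ∧ SuperpolynomialDecay atTop (fun k : ℕ => (k : ℝ)) f

/-- The parameters of the LWE-based family, as functions of `λ`.  The bound `BP` is an integer, so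
its defining quotient is rounded down. -/
structure NTCFParams (CT : ℝ) (n m q BL BV BP : ℕ → ℕ) : Prop where
  n_pos : ∀ k, 1 ≤ n k
  m_pos : ∀ k, 1 ≤ m k
  n_poly : PolyBounded n
  m_poly : PolyBounded m
  m_large : ∃ c : ℝ, 0 < c ∧ ∀ᶠ k in atTop, c * (n k * Real.logb 2 (q k)) ≤ m k
  BL_pos : ∀ k, 1 ≤ BL k
  BL_lt_BV : ∀ k, BL k < BV k
  BV_lt_BP : ∀ k, BV k < BP k
  BP_eq : ∀ k, BP k = ⌊(q k : ℝ) / (2 * CT * √(m k * n k * Real.logb 2 (q k)))⌋₊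
  BV_div_BL : SuperPoly fun k => (BV k : ℝ) / BL k
  BP_div_BV : SuperPoly fun k => (BP k : ℝ) / BV k

/-- The density `f'_{k,b}(x)` on `ℤ_q^m` for the key `k = (A, t)`:
`y ↦ D_{ℤ_q^m, B}(y - Ax - b t)`. -/
noncomputable def ntcfDensity {n m q : ℕ} [NeZero q] (B : ℝ)
    (A : Matrix (Fin m) (Fin n) (ZMod q)) (t : Fin m → ZMod q) (b : Bool) (x : Fin n → ZMod q)
    (y : Fin m → ZMod q) : ℝ :=
  gaussVecDensity B (y - A.mulVec x - (if b then t else 0))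

/-- The part of the range superposition
`(2 q^n)^{-1/2} ∑_{b, x, y} √(f'_{k,b}(x)(y)) |b, x⟩ |y⟩` that has `y` in the image register. -/
noncomputable def sampSlice {n m q : ℕ} [NeZero q] (B : ℝ)
    (A : Matrix (Fin m) (Fin n) (ZMod q)) (t : Fin m → ZMod q) (y : Fin m → ZMod q) :
    EuclideanSpace ℂ (Bool × (Fin n → ZMod q)) :=
  WithLp.toLp 2 fun bx => ((√(ntcfDensity B A t bx.1 bx.2 y / (2 * (q : ℝ) ^ n)) : ℝ) : ℂ)

open Classical in
/-- The image register of the range superposition for the key `(A, t)` is measured.  This is the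
probability that the normalized state left in the other two registers is, for some `x`, at
distance at most `ε` from `(|0, x⟩ + |1, x - s⟩) / √2`. -/
noncomputable def sampCosetProb {n m q : ℕ} [NeZero q] (B : ℝ)
    (A : Matrix (Fin m) (Fin n) (ZMod q)) (t : Fin m → ZMod q) (s : Fin n → ZMod q)
    (ε : ℝ) : ℝ :=
  ∑ y : Fin m → ZMod q,
    if ∃ x, ‖((‖sampSlice B A t y‖ : ℂ)⁻¹) • sampSlice B A t y - dcpState (-s) x‖ ≤ ε then
      ‖sampSlice B A t y‖ ^ 2 else 0

/-- The same probability for the key `(A, As + e)`, with `A` uniform and `e` of density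
`D_{ℤ_q^m, BV}`; the range superposition has the width `BP`. -/
noncomputable def lweCosetProb {n m q : ℕ} [NeZero q] (BV BP : ℝ) (s : Fin n → ZMod q)
    (ε : ℝ) : ℝ :=
  ∑ A : Matrix (Fin m) (Fin n) (ZMod q), ∑ e : Fin m → ZMod q,
    ((q : ℝ) ^ (m * n))⁻¹ * gaussVecDensity BV e * sampCosetProb BP A (A.mulVec s + e) s ε

/-! For t = As + e the pair (b, x) is mapped to Ax + bt = A(x + bs) + be. Up to the short vector be
the image depends only on z = x + bs. Hence coarse information on the image that still separates
distinct z leaves exactly the two pairs (0, z) and (1, z - s), which form a coset with secret -s.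
Both claims make this quantitative, with different kinds of coarse information.

Claim 1. The reduction needs no Gaussian superposition. It prepares the uniform superposition over
(b, x) and measures, for each of the m rows, the D leading binary digits of the fractional part of
(Ax + bt)_i / q, with D a constant. The digits are computed from coefficients rounded down to K
binary places, which moves a row by at most one unit (`rowForm_bounds`). A point z is good
(`GoodPoint`) if every coordinate of Az stays away from the boundaries of the 2^D cells of [0, q)
and no other z' has A(z' - z) short. For good z both partners show the same digits and nobody else
does (`isGood_of_goodPoint`), so the measurement leaves a coset state.

Bad points are rare on average over A (`sum_card_not_goodPoint`). For z ≠ 0 the vector Az is uniform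
because q is prime. Closeness to a boundary therefore has probability O(m 2^D B_V / q), which is
negligible since B_P is at most q/(2 C_T). A union bound over z' gives q^n times a power x^m with x
of order 2^{-D}; as m ≥ c n log q, a large constant D makes this at most q^{-n}. Polynomially many
registers are then all good with large probability, the given solver finds -s, and the output is
negated.

To make this a statement about programs, `QProg.wp` turns a run into an expectation over measurement
outcomes, and `Tri` records the share of squared norm that reaches a configuration. All states that
occur before the solver starts are uniform superpositions `uni c Ω`, so they are described by finite
sets of basis states. A digit of a linear form is measured by computing it reversibly, measuring one
qubit and uncomputing, which amounts to a filter on basis states (`measForm_wp`). Residues below q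
are produced by rejection (`attempts_tri`), rows are measured in `rows_tri`, registers are collected
in `registers_tri`. The given solver runs unchanged inside the larger memory because execution
commutes with scaling the vector and adding foreign arrays (`QProg.exec_embed`). Its running time
does not depend on the vector at all (`QProg.exec_merge`), which bounds the time also where the
preparation failed.

Claim 2. Here the coarse information is y, a noisy image of width B_P. If A maps no nonzero z to a
vector with all coordinates at most 3 B_P, the state left by y lives on at most two pairs. If y lies
in the supports of both, the two amplitudes differ by a factor of at most exp(π m B_V / B_P), so the
normalized state is close to the balanced one (`exists_norm_sampSlice_sub_le`). The outcome y misses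
one support only if the noise falls in a boundary shell of width B_V, which has small mass
(`sum_gaussVecDensity_shift`). Averaging over keys (`le_lweCosetProb`) and the growth of the
parameters finish the argument. -/

/-! ### Weakest pre-expectations -/

/-- Write `v` into the classical cell `a[i]`. -/
def wr (σ : Store) (a i v : ℕ) : Store :=
  Function.update σ a (Function.update (σ a) i v)

theorem wr_apply (σ : Store) (a i v b j : ℕ) :
    wr σ a i v b j = if b = a ∧ j = i then v else σ b j := by
  unfold wr
  by_cases hb : b = a
  · subst hb
    by_cases hj : j = i <;> simp [hj]
  · simp [hb]

theorem wr_of_ne (σ : Store) {a b : ℕ} (i v : ℕ) (h : b ≠ a) : wr σ a i v b = σ b := by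
  simp [wr, h]

/-- The expectation of `g` over the branches of a program (not normalized). -/
noncomputable def QProg.wp : QProg → (Store → QVec → ℝ) → Store → QVec → ℝ
  | .skip, g, σ, ψ => g σ ψ
  | .assign a i e, g, σ, ψ => g (wr σ a (i.eval σ) (e.eval σ)) ψ
  | .had a i, g, σ, ψ => g σ (gateH (a, i.eval σ) ψ)
  | .tee a i, g, σ, ψ => g σ (gateT (a, i.eval σ) ψ)
  | .not a i, g, σ, ψ => g σ (gateX (a, i.eval σ) ψ)
  | .cnot a i b j, g, σ, ψ => g σ (gateCX (a, i.eval σ) (b, j.eval σ) ψ)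
  | .ccnot a i b j c k, g, σ, ψ =>
      g σ (gateCCX (a, i.eval σ) (b, j.eval σ) (c, k.eval σ) ψ)
  | .meas a i b j, g, σ, ψ =>
      g (wr σ a (i.eval σ) 0) (projQubit (b, j.eval σ) false ψ) +
        g (wr σ a (i.eval σ) 1) (projQubit (b, j.eval σ) true ψ)
  | .seq p r, g, σ, ψ => p.wp (r.wp g) σ ψ
  | .ite e p r, g, σ, ψ => if e.eval σ ≠ 0 then p.wp g σ ψ else r.wp g σ ψ
  | .rep e p, g, σ, ψ => (p.wp)^[e.eval σ] g σ ψ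

/-- Execution lists branches forwards while `wp` transforms the observable backwards; this equality
lets all later arguments work with `wp` and never with lists of branches. -/
theorem QProg.exec_sum (p : QProg) (g : Store → QVec → ℝ) (β : Branch) :
    ((p.exec β).map fun γ => g γ.store γ.vec).sum = p.wp g β.store β.vec := by
  induction p generalizing g β with
  | skip => simp [exec, wp, Branch.tick]
  | assign => simp [exec, wp, Branch.tick, Branch.write, wr]
  | had => simp [exec, wp, Branch.tick, Branch.apply]
  | tee => simp [exec, wp, Branch.tick, Branch.apply]
  | not => simp [exec, wp, Branch.tick, Branch.apply]
  | cnot => simp [exec, wp, Branch.tick, Branch.apply]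
  | ccnot => simp [exec, wp, Branch.tick, Branch.apply]
  | meas => simp [exec, wp, Branch.tick, Branch.write, wr]
  | seq p r ihp ihr =>
    simp only [exec, wp, List.map_flatMap]
    rw [← ihp]
    generalize p.exec β = L
    induction L with
    | nil => simp
    | cons a L ih => simp [List.flatMap_cons, ih, ihr]
  | ite e p r ihp ihr =>
    simp only [exec, wp]
    split_ifs
    · exact ihp _ _
    · exact ihr _ _
  | rep e p ih =>
    simp only [exec, wp]
    have key : ∀ (k : ℕ) (L : List Branch),
        ((((fun L : List Branch => L.flatMap fun γ => p.exec (γ.tick 1))^[k] L).map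
          fun γ => g γ.store γ.vec).sum) =
        (L.map fun γ => (p.wp)^[k] g γ.store γ.vec).sum := by
      intro k
      induction k with
      | zero => intro L; rfl
      | succ k ihk =>
        intro L
        -- The first pass of the loop is the innermost application on lists of branches, but the
        -- outermost one on expectations.
        rw [Function.iterate_succ_apply, ihk, Function.iterate_succ_apply']
        induction L with
        | nil => simp
        | cons a L ihL =>
          simp only [List.flatMap_cons, List.map_append, List.sum_append, List.map_cons,
            List.sum_cons, ihL]
          rw [ih]
          rfl
    rw [key]
    simp [Branch.tick]

theorem QProg.wp_eq_sum (p : QProg) (g : Store → QVec → ℝ) (σ : Store) (ψ : QVec) :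
    p.wp g σ ψ = ((p.exec ⟨σ, ψ, 0⟩).map fun γ => g γ.store γ.vec).sum :=
  (p.exec_sum g ⟨σ, ψ, 0⟩).symm

theorem QProg.outputProb_eq_wp {n q : ℕ} (p : QProg) (σ : Store) (ψ : QVec)
    (s : Fin n → ZMod q) :
    open Classical in
    p.outputProb σ ψ s =
      p.wp (fun τ φ => if ∀ i : Fin n, τ 0 i = (s i).val then φ.normSq else 0) σ ψ := by
  rw [QProg.wp_eq_sum]
  rfl

theorem QProg.wp_le_of_exec {p : QProg} {g h : Store → QVec → ℝ} {σ : Store} {ψ : QVec}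
    (H : ∀ γ ∈ p.exec ⟨σ, ψ, 0⟩, g γ.store γ.vec ≤ h γ.store γ.vec) :
    p.wp g σ ψ ≤ p.wp h σ ψ := by
  rw [wp_eq_sum, wp_eq_sum]
  exact List.sum_le_sum H

theorem QProg.wp_mono {p : QProg} {g h : Store → QVec → ℝ}
    (H : ∀ σ ψ, g σ ψ ≤ h σ ψ) (σ : Store) (ψ : QVec) :
    p.wp g σ ψ ≤ p.wp h σ ψ :=
  wp_le_of_exec fun _ _ => H _ _

theorem QProg.wp_nonneg {p : QProg} {g : Store → QVec → ℝ}
    (H : ∀ σ ψ, 0 ≤ g σ ψ) (σ : Store) (ψ : QVec) : 0 ≤ p.wp g σ ψ := by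
  rw [wp_eq_sum]
  apply List.sum_nonneg
  simp only [List.mem_map]
  rintro _ ⟨γ, -, rfl⟩
  exact H _ _

theorem QProg.wp_smul (p : QProg) (g : Store → QVec → ℝ) (c : ℝ) (σ : Store) (ψ : QVec) :
    p.wp (fun τ φ => c * g τ φ) σ ψ = c * p.wp g σ ψ := by
  rw [wp_eq_sum, wp_eq_sum, List.sum_map_mul_left]

theorem QProg.wp_add (p : QProg) (g h : Store → QVec → ℝ) (σ : Store) (ψ : QVec) :
    p.wp (fun τ φ => g τ φ + h τ φ) σ ψ = p.wp g σ ψ + p.wp h σ ψ := by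
  simp only [wp_eq_sum]
  exact List.sum_map_add

/-! ### Frame conditions -/

theorem mem_iterate_flatMap {α : Type*} {f : α → List α} {R : α → α → Prop}
    (hrefl : ∀ x, R x x) (hstep : ∀ x y z, R x y → z ∈ f y → R x z) (k : ℕ) (L : List α) :
    ∀ z ∈ (fun L : List α => L.flatMap f)^[k] L, ∃ x ∈ L, R x z := by
  induction k with
  | zero => intro z hz; exact ⟨z, hz, hrefl z⟩
  | succ k ih =>
    intro z hz
    rw [Function.iterate_succ_apply'] at hz
    obtain ⟨y, hy, hzy⟩ := List.mem_flatMap.1 hz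
    obtain ⟨x, hx, hxy⟩ := ih y hy
    exact ⟨x, hx, hstep x y z hxy hzy⟩

/-- All classical arrays that the program writes to satisfy `X`. -/
def QProg.Writes (X : ℕ → Prop) : QProg → Prop
  | .assign a _ _ => X a
  | .meas a _ _ _ => X a
  | .seq p r => p.Writes X ∧ r.Writes X
  | .ite _ p r => p.Writes X ∧ r.Writes X
  | .rep _ p => p.Writes X
  | _ => True

theorem QProg.Writes.mono {X Y : ℕ → Prop} (h : ∀ a, X a → Y a) {p : QProg}
    (hp : p.Writes X) : p.Writes Y := by
  induction p with
  | assign | meas => exact h _ hp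
  | seq p r ihp ihr => exact ⟨ihp hp.1, ihr hp.2⟩
  | ite e p r ihp ihr => exact ⟨ihp hp.1, ihr hp.2⟩
  | rep e p ih => exact ih hp
  | _ => trivial

theorem QProg.Writes.store_eq {X : ℕ → Prop} {p : QProg} (hp : p.Writes X) {β γ : Branch}
    (h : γ ∈ p.exec β) {a : ℕ} (ha : ¬ X a) : γ.store a = β.store a := by
  induction p generalizing β γ with
  | skip | had | tee | not | cnot | ccnot =>
    simp only [exec, List.mem_singleton] at h; subst h; rfl
  | assign b i e =>
    simp only [exec, List.mem_singleton] at h; subst h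
    exact wr_of_ne _ _ _ (fun hh => ha (hh ▸ hp))
  | meas b i c j =>
    simp only [exec, List.mem_map] at h
    obtain ⟨o, -, rfl⟩ := h
    exact wr_of_ne _ _ _ (fun hh => ha (hh ▸ hp))
  | seq p r ihp ihr =>
    simp only [exec, List.mem_flatMap] at h
    obtain ⟨δ, h1, h2⟩ := h
    rw [ihr hp.2 h2, ihp hp.1 h1]
  | ite e p r ihp ihr =>
    simp only [exec] at h
    split_ifs at h
    · rw [ihp hp.1 h]; rfl
    · rw [ihr hp.2 h]; rfl
  | rep e p ih =>
    simp only [exec] at h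
    obtain ⟨x, hx, hr⟩ := mem_iterate_flatMap (f := fun γ => p.exec (γ.tick 1))
      (R := fun x z : Branch => z.store a = x.store a)
      (fun _ => rfl) (fun x y z h1 h2 => (ih hp h2).trans h1) _ _ γ h
    simp only [List.mem_singleton] at hx
    subst hx; exact hr

open Classical in
theorem QProg.Writes.wp_eq {X : ℕ → Prop} {p : QProg} (hp : p.Writes X)
    (g : Store → QVec → ℝ) (σ : Store) (ψ : QVec) :
    p.wp g σ ψ = p.wp (fun τ φ => if ∀ a, ¬ X a → τ a = σ a then g τ φ else 0) σ ψ := by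
  rw [wp_eq_sum, wp_eq_sum]
  congr 1
  apply List.map_congr_left
  intro γ hγ
  rw [if_pos fun a ha => hp.store_eq hγ ha]

/-! ### Deterministic runs -/

/-- Started in `(σ, ψ)`, the program ends in `(σ', ψ')` with certainty. -/
def Det (p : QProg) (σ : Store) (ψ : QVec) (σ' : Store) (ψ' : QVec) : Prop :=
  ∀ g : Store → QVec → ℝ, p.wp g σ ψ = g σ' ψ'

theorem Det.seq {p r : QProg} {σ σ' σ'' : Store} {ψ ψ' ψ'' : QVec} (h : Det p σ ψ σ' ψ')
    (h' : Det r σ' ψ' σ'' ψ'') : Det (.seq p r) σ ψ σ'' ψ'' := fun g =>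
  (h (r.wp g)).trans (h' g)

theorem Det.frame {p : QProg} {σ σ' : Store} {ψ ψ' : QVec} (h : Det p σ ψ σ' ψ')
    {X : ℕ → Prop} (hp : p.Writes X) {a : ℕ} (ha : ¬ X a) : σ' a = σ a := by
  classical
  -- The constant observable 1 suffices: a changed array would turn its expectation into 0.
  have h1 := hp.wp_eq (fun _ _ => 1) σ ψ
  rw [h, h] at h1
  by_contra hne
  rw [if_neg (fun hh => hne (hh a ha))] at h1
  norm_num at h1

/-- The program takes every configuration with `P` to one with `Q`, with certainty. -/
def Hoare (P : Store → QVec → Prop) (p : QProg) (Q : Store → QVec → Prop) : Prop :=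
  ∀ σ ψ, P σ ψ → ∃ σ' ψ', Det p σ ψ σ' ψ' ∧ Q σ' ψ'

theorem Hoare.rep {p : QProg} {e : QExpr} (I : ℕ → Store → QVec → Prop) (k : ℕ)
    (h : ∀ i < k, Hoare (I i) p (I (i + 1))) :
    Hoare (fun σ ψ => I 0 σ ψ ∧ e.eval σ = k) (.rep e p) (I k) := by
  have key : ∀ j i, i + j = k → ∀ σ ψ, I i σ ψ →
      ∃ σ' ψ', (∀ g, (p.wp)^[j] g σ ψ = g σ' ψ') ∧ I k σ' ψ' := by
    intro j
    induction j with
    | zero => intro i hi σ ψ hI; exact ⟨σ, ψ, fun g => rfl, by rwa [← hi]⟩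
    | succ j ih =>
      intro i hi σ ψ hI
      obtain ⟨σ', ψ', hd, hI'⟩ := h i (by omega) σ ψ hI
      obtain ⟨σ'', ψ'', hd', hI''⟩ := ih (i + 1) (by omega) σ' ψ' hI'
      exact ⟨σ'', ψ'', fun g => by rw [Function.iterate_succ_apply', hd, hd'], hI''⟩
  rintro σ ψ ⟨h0, he⟩
  obtain ⟨σ', ψ', hd, hI⟩ := key k 0 (by omega) σ ψ h0
  exact ⟨σ', ψ', fun g => by simp only [QProg.wp, he]; exact hd g, hI⟩

/-! ### Quantitative triples -/

open Classical in
/-- Squared norm on the configurations with `I`. -/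
noncomputable def msr (I : Store → QVec → Prop) : Store → QVec → ℝ :=
  fun σ ψ => if I σ ψ then ψ.normSq else 0

theorem QVec.normSq_nonneg (ψ : QVec) : 0 ≤ ψ.normSq :=
  Finset.sum_nonneg fun _ _ => by positivity

theorem msr_nonneg (I : Store → QVec → Prop) (σ : Store) (ψ : QVec) : 0 ≤ msr I σ ψ := by
  unfold msr; split_ifs
  · exact ψ.normSq_nonneg
  · exact le_rfl

theorem msr_of {I : Store → QVec → Prop} {σ : Store} {ψ : QVec} (h : I σ ψ) :
    msr I σ ψ = ψ.normSq := if_pos h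

/-- From `I`, the program reaches `J` with probability at least `κ`. -/
def Tri (κ : ℝ) (I : Store → QVec → Prop) (p : QProg) (J : Store → QVec → Prop) : Prop :=
  ∀ σ ψ, I σ ψ → κ * ψ.normSq ≤ p.wp (msr J) σ ψ

theorem Tri.le_wp {κ : ℝ} {I J : Store → QVec → Prop} {p : QProg} (h : Tri κ I p J)
    (σ : Store) (ψ : QVec) : κ * msr I σ ψ ≤ p.wp (msr J) σ ψ := by
  by_cases hI : I σ ψ
  · rw [msr_of hI]; exact h σ ψ hI
  · rw [msr, if_neg hI, mul_zero]; exact QProg.wp_nonneg (msr_nonneg J) _ _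

/-- Branches are not renormalized, so each bound is relative to the incoming squared norm and the
factors multiply. -/
theorem Tri.seq {κ κ' : ℝ} {I J K : Store → QVec → Prop} {p r : QProg} (hκ : 0 ≤ κ')
    (h : Tri κ I p J) (h' : Tri κ' J r K) : Tri (κ * κ') I (.seq p r) K := by
  intro σ ψ hI
  calc κ * κ' * ψ.normSq = κ' * (κ * ψ.normSq) := by ring
    _ ≤ κ' * p.wp (msr J) σ ψ := mul_le_mul_of_nonneg_left (h σ ψ hI) hκ
    _ = p.wp (fun τ φ => κ' * msr J τ φ) σ ψ := (QProg.wp_smul ..).symm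
    _ ≤ p.wp (r.wp (msr K)) σ ψ := QProg.wp_mono h'.le_wp _ _

theorem Tri.conseq {κ : ℝ} {I J I' J' : Store → QVec → Prop} {p : QProg} (h : Tri κ I p J)
    (hI : ∀ σ ψ, I' σ ψ → I σ ψ) (hJ : ∀ σ ψ, J σ ψ → J' σ ψ) : Tri κ I' p J' := by
  intro σ ψ h'
  refine (h σ ψ (hI _ _ h')).trans (QProg.wp_mono (fun τ φ => ?_) _ _)
  by_cases hj : J τ φ
  · rw [msr_of hj, msr_of (hJ _ _ hj)]
  · rw [msr, if_neg hj]; exact msr_nonneg _ _ _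

theorem Tri.rep {κ : ℝ} (hκ : 0 ≤ κ) {p : QProg} {e : QExpr} (I : ℕ → Store → QVec → Prop)
    (k : ℕ) (h : ∀ i < k, Tri κ (I i) p (I (i + 1))) :
    Tri (κ ^ k) (fun σ ψ => I 0 σ ψ ∧ e.eval σ = k) (.rep e p) (I k) := by
  have key : ∀ j i, i + j = k → ∀ σ ψ, κ ^ j * msr (I i) σ ψ ≤ (p.wp)^[j] (msr (I k)) σ ψ := by
    intro j
    induction j with
    | zero => intro i hi σ ψ; simp [← hi]
    | succ j ih =>
      intro i hi σ ψ
      rw [Function.iterate_succ_apply']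
      calc κ ^ (j + 1) * msr (I i) σ ψ = κ ^ j * (κ * msr (I i) σ ψ) := by ring
        _ ≤ κ ^ j * p.wp (msr (I (i + 1))) σ ψ :=
          mul_le_mul_of_nonneg_left ((h i (by omega)).le_wp _ _) (by positivity)
        _ = p.wp (fun τ φ => κ ^ j * msr (I (i + 1)) τ φ) σ ψ := (QProg.wp_smul ..).symm
        _ ≤ _ := QProg.wp_mono (ih (i + 1) (by omega)) _ _
  rintro σ ψ ⟨h0, he⟩
  have := key k 0 (by omega) σ ψ
  rw [msr_of h0] at this
  simpa only [QProg.wp, he] using this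

/-- The frame rule: unwritten arrays keep their contents. -/
theorem Tri.frame {κ : ℝ} {I J : Store → QVec → Prop} {p : QProg} {X : ℕ → Prop}
    (hp : p.Writes X) (σ₀ : Store) (h : Tri κ (fun σ ψ => I σ ψ ∧ ∀ a, ¬ X a → σ a = σ₀ a) p J) :
    Tri κ (fun σ ψ => I σ ψ ∧ ∀ a, ¬ X a → σ a = σ₀ a) p
      (fun σ ψ => J σ ψ ∧ ∀ a, ¬ X a → σ a = σ₀ a) := by
  intro σ ψ hI
  refine (h σ ψ hI).trans ?_
  apply QProg.wp_le_of_exec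
  intro γ hγ
  by_cases hj : J γ.store γ.vec
  · rw [msr_of hj, msr_of]
    exact ⟨hj, fun a ha => (hp.store_eq hγ ha).trans (hI.2 a ha)⟩
  · rw [msr, if_neg hj]; exact msr_nonneg _ _ _

/-! ### Running times -/

/-- The expression reads only arrays with `C`. -/
def QExpr.Reads (C : ℕ → Prop) : QExpr → Prop
  | .lit _ => True
  | .get a i => C a ∧ i.Reads C
  | .add e f => e.Reads C ∧ f.Reads C
  | .sub e f => e.Reads C ∧ f.Reads C
  | .half e => e.Reads C
  | .len e => e.Reads C

theorem QExpr.Reads.eval_eq {C : ℕ → Prop} {e : QExpr} (he : e.Reads C) {σ τ : Store}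
    (h : ∀ a, C a → σ a = τ a) : e.eval σ = e.eval τ := by
  induction e with
  | lit => rfl
  | get a i ih => simp only [eval, ih he.2, h a he.1]
  | add e f ihe ihf => simp only [eval, ihe he.1, ihf he.2]
  | sub e f ihe ihf => simp only [eval, ihe he.1, ihf he.2]
  | half e ih => simp only [eval, ih he]
  | len e ih => simp only [eval, ih he]

/-- Loop counts are read from arrays with `C`, and these are never written. -/
def QProg.Stable (C : ℕ → Prop) : QProg → Prop
  | .assign a _ _ => ¬ C a
  | .meas a _ _ _ => ¬ C a
  | .seq p r => p.Stable C ∧ r.Stable C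
  | .ite _ p r => p.Stable C ∧ r.Stable C
  | .rep e p => e.Reads C ∧ p.Stable C
  | _ => True

theorem QProg.Stable.writes {C : ℕ → Prop} {p : QProg} (h : p.Stable C) :
    p.Writes fun a => ¬ C a := by
  induction p with
  | assign | meas => exact h
  | seq p r ihp ihr => exact ⟨ihp h.1, ihr h.2⟩
  | ite e p r ihp ihr => exact ⟨ihp h.1, ihr h.2⟩
  | rep e p ih => exact ih h.2
  | _ => trivial

/-- All loop counts are at most `B`. -/
def QProg.LoopsLe (σ : Store) (B : ℕ) : QProg → Prop
  | .seq p r => p.LoopsLe σ B ∧ r.LoopsLe σ B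
  | .ite _ p r => p.LoopsLe σ B ∧ r.LoopsLe σ B
  | .rep e p => e.eval σ ≤ B ∧ p.LoopsLe σ B
  | _ => True

/-- Size of the text, the coefficient in the bound for the running time. -/
def QProg.weight : QProg → ℕ
  | .skip => 1
  | .assign _ i e => i.size + e.size + 1
  | .had _ i => i.size + 1
  | .tee _ i => i.size + 1
  | .not _ i => i.size + 1
  | .cnot _ i _ j => i.size + j.size + 1
  | .ccnot _ i _ j _ k => i.size + j.size + k.size + 1
  | .meas _ i _ j => i.size + j.size + 1
  | .seq p r => p.weight + r.weight
  | .ite e p r => e.size + 1 + p.weight + r.weight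
  | .rep e p => e.size + 1 + (p.weight + 1)

/-- Nesting depth of the loops. -/
def QProg.depth : QProg → ℕ
  | .seq p r => max p.depth r.depth
  | .ite _ p r => max p.depth r.depth
  | .rep _ p => p.depth + 1
  | _ => 0

/-- Loop counts are read from arrays that are never written, so they keep their initial values
throughout the run; each level of nesting costs one factor `B + 1`. -/
theorem QProg.time_le {C : ℕ → Prop} {p : QProg} (hp : p.Stable C) {σ : Store} {B : ℕ}
    (hB : p.LoopsLe σ B) {β γ : Branch} (hβ : ∀ a, C a → β.store a = σ a) (h : γ ∈ p.exec β) :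
    γ.time ≤ β.time + p.weight * (B + 1) ^ p.depth := by
  induction p generalizing β γ with
  | skip | assign | had | tee | not | cnot | ccnot =>
    simp only [exec, List.mem_singleton] at h; subst h
    simp [Branch.tick, Branch.write, Branch.apply, weight, depth]
  | meas b i c j =>
    simp only [exec, List.mem_map] at h
    obtain ⟨o, -, rfl⟩ := h
    simp [Branch.tick, Branch.write, weight, depth]
  | seq p r ihp ihr =>
    simp only [exec, List.mem_flatMap] at h
    obtain ⟨δ, h1, h2⟩ := h
    have t1 := ihp hp.1 hB.1 hβ h1
    have t2 := ihr hp.2 hB.2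
      (fun a ha => (hp.1.writes.store_eq h1 (not_not.2 ha)).trans (hβ a ha)) h2
    have e1 : (B + 1) ^ p.depth ≤ (B + 1) ^ (max p.depth r.depth) :=
      Nat.pow_le_pow_right (by omega) (le_max_left _ _)
    have e2 : (B + 1) ^ r.depth ≤ (B + 1) ^ (max p.depth r.depth) :=
      Nat.pow_le_pow_right (by omega) (le_max_right _ _)
    have e3 := Nat.mul_le_mul_left p.weight e1
    have e4 := Nat.mul_le_mul_left r.weight e2
    simp only [weight, depth, add_mul]
    omega
  | ite e p r ihp ihr =>
    simp only [exec] at h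
    have e1 : (B + 1) ^ p.depth ≤ (B + 1) ^ (max p.depth r.depth) :=
      Nat.pow_le_pow_right (by omega) (le_max_left _ _)
    have e2 : (B + 1) ^ r.depth ≤ (B + 1) ^ (max p.depth r.depth) :=
      Nat.pow_le_pow_right (by omega) (le_max_right _ _)
    have e3 := Nat.mul_le_mul_left p.weight e1
    have e4 := Nat.mul_le_mul_left r.weight e2
    have e5 : (e.size + 1) * 1 ≤ (e.size + 1) * (B + 1) ^ (max p.depth r.depth) :=
      Nat.mul_le_mul_left _ (Nat.one_le_pow _ _ (by omega))
    simp only [weight, depth, add_mul _ _ ((B + 1) ^ (max p.depth r.depth))] at e5 ⊢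
    split_ifs at h
    · have := ihp hp.1 hB.1 (β := β.tick (e.size + 1)) hβ h
      simp only [Branch.tick] at this
      omega
    · have := ihr hp.2 hB.2 (β := β.tick (e.size + 1)) hβ h
      simp only [Branch.tick] at this
      omega
  | rep e p ih =>
    simp only [exec] at h
    have he : e.eval β.store ≤ B := by
      rw [hp.1.eval_eq hβ]; exact hB.1
    have key : ∀ k, ∀ δ ∈ (fun L : List Branch => L.flatMap fun γ => p.exec (γ.tick 1))^[k]
        [β.tick (e.size + 1)], (∀ a, C a → δ.store a = σ a) ∧
        δ.time ≤ β.time + (e.size + 1) + k * (1 + p.weight * (B + 1) ^ p.depth) := by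
      intro k
      induction k with
      | zero =>
        intro δ hδ
        simp only [Function.iterate_zero, id, List.mem_singleton] at hδ
        subst hδ
        exact ⟨hβ, by simp [Branch.tick]⟩
      | succ k ihk =>
        intro δ hδ
        rw [Function.iterate_succ_apply'] at hδ
        obtain ⟨ε, hε, hδε⟩ := List.mem_flatMap.1 hδ
        obtain ⟨h1, h2⟩ := ihk ε hε
        refine ⟨fun a ha => (hp.2.writes.store_eq hδε (not_not.2 ha)).trans (h1 a ha), ?_⟩
        have := ih hp.2 hB.2 (β := ε.tick 1) h1 hδε
        simp only [Branch.tick] at this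
        rw [add_mul k 1]
        omega
    have h1 := (key _ γ h).2
    have h2 : e.eval β.store * (1 + p.weight * (B + 1) ^ p.depth) ≤
        B * (1 + p.weight * (B + 1) ^ p.depth) := Nat.mul_le_mul_right _ he
    have h3 : 1 ≤ (B + 1) ^ p.depth := Nat.one_le_pow _ _ (by omega)
    simp only [weight, depth]
    have h4 : B + (e.size + 1) + B * (p.weight * (B + 1) ^ p.depth) ≤
        (e.size + 1 + (p.weight + 1)) * (B + 1) ^ (p.depth + 1) := by
      rw [pow_succ]
      generalize (B + 1) ^ p.depth = Z at *
      have : B + (e.size + 1) + B * (p.weight * Z) ≤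
          B * Z + (e.size + 1) * Z + B * (p.weight * Z) := by
        gcongr
        · exact Nat.le_mul_of_pos_right _ h3
        · exact Nat.le_mul_of_pos_right _ h3
      nlinarith [Nat.zero_le (e.size * Z * B), Nat.zero_le (Z * B), Nat.zero_le (p.weight * Z)]
    rw [mul_add B, mul_one] at h2
    omega

/-! ### Simulation inside a larger memory -/

/-- The arrays below `M` of `σ` together with the other arrays of `τ`. -/
def merge (M : ℕ) (τ σ : Store) : Store := fun a => if a < M then σ a else τ a

/-- All arrays that occur in the program are below `M`. -/
def QProg.Below (M : ℕ) : QProg → Prop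
  | .skip => True
  | .assign a i e => a < M ∧ i.Reads (· < M) ∧ e.Reads (· < M)
  | .had _ i => i.Reads (· < M)
  | .tee _ i => i.Reads (· < M)
  | .not _ i => i.Reads (· < M)
  | .cnot _ i _ j => i.Reads (· < M) ∧ j.Reads (· < M)
  | .ccnot _ i _ j _ k => i.Reads (· < M) ∧ j.Reads (· < M) ∧ k.Reads (· < M)
  | .meas a i _ j => a < M ∧ i.Reads (· < M) ∧ j.Reads (· < M)
  | .seq p r => p.Below M ∧ r.Below M
  | .ite e p r => e.Reads (· < M) ∧ p.Below M ∧ r.Below M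
  | .rep e p => e.Reads (· < M) ∧ p.Below M

theorem QExpr.exists_reads (e : QExpr) : ∃ M, ∀ M' ≥ M, e.Reads (· < M') := by
  induction e with
  | lit => exact ⟨0, fun _ _ => trivial⟩
  | get a i ih =>
    obtain ⟨M, h⟩ := ih
    exact ⟨max M (a + 1), fun M' hM => ⟨by simp at hM; omega, h M' (by simp at hM; omega)⟩⟩
  | add e f ihe ihf | sub e f ihe ihf =>
    obtain ⟨M, h⟩ := ihe
    obtain ⟨M1, h1⟩ := ihf
    exact ⟨max M M1, fun M' hM => ⟨h M' (by simp at hM; omega), h1 M' (by simp at hM; omega)⟩⟩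
  | half e ih | len e ih => exact ih

theorem QProg.exists_below (p : QProg) : ∃ M, ∀ M' ≥ M, p.Below M' := by
  induction p with
  | skip => exact ⟨0, fun _ _ => trivial⟩
  | had _ i | tee _ i | not _ i => exact i.exists_reads
  | assign a i e =>
    obtain ⟨M, h⟩ := i.exists_reads
    obtain ⟨M1, h1⟩ := e.exists_reads
    exact ⟨M + M1 + a + 1, fun M' hM => ⟨by omega, h M' (by omega), h1 M' (by omega)⟩⟩
  | meas a i _ e =>
    obtain ⟨M, h⟩ := i.exists_reads
    obtain ⟨M1, h1⟩ := e.exists_reads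
    exact ⟨M + M1 + a + 1, fun M' hM => ⟨by omega, h M' (by omega), h1 M' (by omega)⟩⟩
  | cnot _ i _ e =>
    obtain ⟨M, h⟩ := i.exists_reads
    obtain ⟨M1, h1⟩ := e.exists_reads
    exact ⟨M + M1, fun M' hM => ⟨h M' (by omega), h1 M' (by omega)⟩⟩
  | ccnot _ i _ e _ f =>
    obtain ⟨M, h⟩ := i.exists_reads
    obtain ⟨M1, h1⟩ := e.exists_reads
    obtain ⟨M2, h2⟩ := f.exists_reads
    exact ⟨M + M1 + M2, fun M' hM => ⟨h M' (by omega), h1 M' (by omega), h2 M' (by omega)⟩⟩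
  | seq p r ihp ihr =>
    obtain ⟨M, h⟩ := ihp
    obtain ⟨M1, h1⟩ := ihr
    exact ⟨M + M1, fun M' hM => ⟨h M' (by omega), h1 M' (by omega)⟩⟩
  | ite e p r ihp ihr =>
    obtain ⟨M, h⟩ := ihp
    obtain ⟨M1, h1⟩ := ihr
    obtain ⟨M2, h2⟩ := e.exists_reads
    exact ⟨M + M1 + M2, fun M' hM => ⟨h2 M' (by omega), h M' (by omega), h1 M' (by omega)⟩⟩
  | rep e p ih =>
    obtain ⟨M, h⟩ := ih
    obtain ⟨M2, h2⟩ := e.exists_reads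
    exact ⟨M + M2, fun M' hM => ⟨h2 M' (by omega), h M' (by omega)⟩⟩

theorem QExpr.eval_merge {M : ℕ} {e : QExpr} (h : e.Reads (· < M)) (τ σ : Store) :
    e.eval (merge M τ σ) = e.eval σ :=
  h.eval_eq fun a ha => by simp only [merge, if_pos ha]

theorem merge_wr {M a : ℕ} (h : a < M) (τ σ : Store) (i v : ℕ) :
    wr (merge M τ σ) a i v = merge M τ (wr σ a i v) := by
  funext b j
  simp only [wr_apply, merge]
  by_cases hb : b < M
  · simp [hb, wr_apply]
  · have : b ≠ a := by omega
    simp [hb, this]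

/-- The branch in a larger memory, with a scaled vector and a shifted clock. -/
noncomputable def Branch.embed (M : ℕ) (τ : Store) (c : ℂ) (t : ℕ) (β : Branch) : Branch :=
  ⟨merge M τ β.store, c • β.vec, β.time + t⟩

theorem projQubit_smul (a : Qubit) (b : Bool) (c : ℂ) (ψ : QVec) :
    projQubit a b (c • ψ) = c • projQubit a b ψ := by
  unfold projQubit
  exact Finsupp.filter_smul

/-- Gates and projections are linear, and every address or loop count is read from arrays below `M`.
Hence foreign arrays, a scalar in front of the vector and an offset of the clock pass unchanged
through every instruction. This is what allows a given program to run as a subroutine on an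
unnormalized branch. -/
theorem QProg.exec_embed {M : ℕ} {p : QProg} (hp : p.Below M) (τ : Store) (c : ℂ) (t : ℕ)
    (β : Branch) : p.exec (β.embed M τ c t) = (p.exec β).map (Branch.embed M τ c t) := by
  have tick : ∀ (δ : Branch) u, (δ.embed M τ c t).tick u = (δ.tick u).embed M τ c t := by
    intro δ u; simp only [Branch.tick, Branch.embed]; congr 1; omega
  induction p generalizing β with
  | skip => simp [exec, tick]
  | assign a i e =>
    simp only [exec, List.map_singleton, ← tick]
    simp only [Branch.embed, Branch.write, QExpr.eval_merge hp.2.1, QExpr.eval_merge hp.2.2]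
    have := merge_wr hp.1 τ β.store (i.eval β.store) (e.eval β.store)
    unfold wr at this
    rw [this]
  | had a i | tee a i | not a i =>
    simp only [exec, List.map_singleton, ← tick]
    simp only [Branch.embed, Branch.apply, QExpr.eval_merge hp, map_smul]
  | cnot a i b j =>
    simp only [exec, List.map_singleton, ← tick]
    simp only [Branch.embed, Branch.apply, QExpr.eval_merge hp.1, QExpr.eval_merge hp.2, map_smul]
  | ccnot a i b j d k =>
    simp only [exec, List.map_singleton, ← tick]
    simp only [Branch.embed, Branch.apply, QExpr.eval_merge hp.1, QExpr.eval_merge hp.2.1,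
      QExpr.eval_merge hp.2.2, map_smul]
  | meas a i b j =>
    simp only [exec, List.map_cons, List.map_nil, ← tick]
    simp only [Branch.embed, Branch.write, QExpr.eval_merge hp.2.1, QExpr.eval_merge hp.2.2,
      projQubit_smul]
    have := merge_wr hp.1 τ β.store (i.eval β.store)
    unfold wr at this
    rw [this, this]
  | seq p r ihp ihr =>
    simp only [exec, ihp hp.1, List.flatMap_map, List.map_flatMap]
    congr 1
    funext γ
    exact ihr hp.2 γ
  | ite e p r ihp ihr =>
    simp only [exec]
    have : e.eval (β.embed M τ c t).store = e.eval β.store := QExpr.eval_merge hp.1 _ _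
    rw [this, tick]
    split_ifs
    · exact ihp hp.2.1 _
    · exact ihr hp.2.2 _
  | rep e p ih =>
    simp only [exec]
    have : e.eval (β.embed M τ c t).store = e.eval β.store := QExpr.eval_merge hp.1 _ _
    rw [this, tick]
    generalize e.eval β.store = k
    have key : ∀ L : List Branch,
        (fun L : List Branch => L.flatMap fun γ => p.exec (γ.tick 1))^[k]
          (L.map (Branch.embed M τ c t)) =
        ((fun L : List Branch => L.flatMap fun γ => p.exec (γ.tick 1))^[k] L).map
          (Branch.embed M τ c t) := by
      induction k with
      | zero => intro L; rfl
      | succ k ihk =>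
        intro L
        rw [Function.iterate_succ_apply, Function.iterate_succ_apply, ← ihk]
        congr 1
        simp only [List.flatMap_map, List.map_flatMap, tick]
        congr 1
        funext γ
        exact ih hp.2 _
    exact key [β.tick (e.size + 1)]

/-! ### Gates that permute the basis states -/

/-- Action of the Toffoli gate on basis states. -/
def ccx (c d a : Qubit) (S : Ket) : Ket :=
  if (c ≠ a ∧ d ≠ a) ∧ (c ∈ S ∧ d ∈ S) then symmDiff S {a} else S

theorem mem_symmDiff_singleton {S : Ket} {a x : Qubit} :
    x ∈ symmDiff S {a} ↔ if x = a then x ∉ S else x ∈ S := by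
  rw [Finset.mem_symmDiff, Finset.mem_singleton]
  by_cases h : x = a <;> simp [h]

theorem mem_ccx {c d a x : Qubit} {S : Ket} :
    x ∈ ccx c d a S ↔
      if x = a ∧ c ≠ a ∧ d ≠ a ∧ c ∈ S ∧ d ∈ S then x ∉ S else x ∈ S := by
  unfold ccx
  split_ifs with h1 h2 h2
  · rw [mem_symmDiff_singleton, if_pos h2.1]
  · rw [mem_symmDiff_singleton, if_neg (fun h => h2 ⟨h, h1.1.1, h1.1.2, h1.2.1, h1.2.2⟩)]
  · exact absurd ⟨⟨h2.2.1, h2.2.2.1⟩, h2.2.2.2⟩ h1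
  · rfl

theorem ccx_involutive (c d a : Qubit) : Function.Involutive (ccx c d a) := by
  intro S
  ext x
  simp only [mem_ccx]
  by_cases hc : c = a <;> by_cases hd : d = a <;> by_cases hx : x = a <;> by_cases h1 : c ∈ S <;>
    by_cases h2 : d ∈ S <;> simp [hc, hd, hx, h1, h2]

theorem symmDiff_singleton_involutive (a : Qubit) :
    Function.Involutive fun S : Ket => symmDiff S {a} := fun _ =>
  symmDiff_symmDiff_cancel_right _ _

theorem linearCombination_single (f : Ket → Ket) (ψ : QVec) :
    Finsupp.linearCombination ℂ (fun S => Finsupp.single (f S) (1 : ℂ)) ψ = ψ.mapDomain f := by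
  rw [Finsupp.linearCombination_apply, Finsupp.mapDomain]
  congr 1
  funext S c
  simp

theorem gateX_eq (a : Qubit) (ψ : QVec) :
    gateX a ψ = ψ.mapDomain fun S => symmDiff S {a} := linearCombination_single _ _

theorem gateCCX_eq (c d a : Qubit) (ψ : QVec) : gateCCX c d a ψ = ψ.mapDomain (ccx c d a) :=
  linearCombination_single _ _

/-- A controlled NOT is a Toffoli gate with equal controls, so a single family of permutations
covers both. -/
theorem gateCX_eq (c a : Qubit) (ψ : QVec) : gateCX c a ψ = ψ.mapDomain (ccx c c a) := by
  refine Eq.trans ?_ (linearCombination_single _ _)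
  unfold gateCX ccx
  congr 2
  funext S
  by_cases h : c ≠ a ∧ c ∈ S
  · rw [if_pos h, if_pos ⟨⟨h.1, h.1⟩, h.2, h.2⟩]
  · rw [if_neg h, if_neg fun hh => h ⟨hh.1.1, hh.2.1⟩]

/-- Measuring after a permutation of the basis is measuring the pulled-back predicate before it;
once the permutation is undone, only a filter remains. -/
theorem filter_mapDomain {f : Ket → Ket} (hf : Function.Injective f) (p : Ket → Prop)
    [DecidablePred p] (ψ : QVec) :
    (ψ.mapDomain f).filter p = (ψ.filter fun S => p (f S)).mapDomain f := by
  ext S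
  by_cases hS : S ∈ Set.range f
  · obtain ⟨T, rfl⟩ := hS
    rw [Finsupp.mapDomain_apply hf]
    by_cases hp : p (f T)
    · rw [Finsupp.filter_apply_pos _ _ hp, Finsupp.mapDomain_apply hf,
        Finsupp.filter_apply_pos (fun S => p (f S)) _ hp]
    · rw [Finsupp.filter_apply_neg _ _ hp, Finsupp.filter_apply_neg (fun S => p (f S)) _ hp]
  · rw [Finsupp.mapDomain_of_notMem_range _ _ hS, Finsupp.filter_apply,
      Finsupp.mapDomain_of_notMem_range _ _ hS, ite_self]

theorem QVec.normSq_eq_sum {ψ : QVec} {s : Finset Ket} (h : ψ.support ⊆ s) :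
    ψ.normSq = ∑ S ∈ s, ‖ψ S‖ ^ 2 :=
  Finsupp.sum_of_support_subset _ h _ (by simp)

theorem QVec.normSq_mapDomain {f : Ket → Ket} (hf : Function.Injective f) (ψ : QVec) :
    QVec.normSq (ψ.mapDomain f) = ψ.normSq := by
  unfold QVec.normSq
  exact Finsupp.sum_mapDomain_index_inj hf

theorem QVec.normSq_filter_add (p : Ket → Prop) [DecidablePred p] (ψ : QVec) :
    QVec.normSq (ψ.filter p) + QVec.normSq (ψ.filter fun S => ¬ p S) = ψ.normSq := by
  rw [normSq_eq_sum (s := ψ.support) (by rw [Finsupp.support_filter]; exact Finset.filter_subset ..),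
    normSq_eq_sum (s := ψ.support) (by rw [Finsupp.support_filter]; exact Finset.filter_subset ..),
    normSq_eq_sum (s := ψ.support) subset_rfl, ← Finset.sum_add_distrib]
  refine Finset.sum_congr rfl fun S _ => ?_
  by_cases h : p S <;> simp [h]

theorem QVec.normSq_smul (c : ℂ) (ψ : QVec) : QVec.normSq (c • ψ) = ‖c‖ ^ 2 * ψ.normSq := by
  rw [normSq_eq_sum (s := ψ.support) Finsupp.support_smul,
    normSq_eq_sum (s := ψ.support) subset_rfl, Finset.mul_sum]
  refine Finset.sum_congr rfl fun S _ => ?_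
  simp [mul_pow]

theorem projQubit_normSq (a : Qubit) (ψ : QVec) :
    (projQubit a false ψ).normSq + (projQubit a true ψ).normSq = ψ.normSq := by
  rw [← QVec.normSq_filter_add (fun S => a ∉ S) ψ]
  unfold projQubit
  congr 2 <;> · ext S; simp [Finsupp.filter_apply]

/-- The program applies no gates `H` and `T`. -/
def QProg.Perm : QProg → Prop
  | .had _ _ => False
  | .tee _ _ => False
  | .seq p r => p.Perm ∧ r.Perm
  | .ite _ p r => p.Perm ∧ r.Perm
  | .rep _ p => p.Perm
  | _ => True

/-- Permutation gates and measurements conserve the total squared norm. The Hadamard gate is treated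
separately, and only on qubits that are still 0. -/
theorem QProg.Perm.wp_normSq {p : QProg} (hp : p.Perm) (σ : Store) (ψ : QVec) :
    p.wp (fun _ φ => φ.normSq) σ ψ = ψ.normSq := by
  induction p generalizing σ ψ with
  | skip | assign => rfl
  | had | tee => exact hp.elim
  | not a i =>
    simp only [wp, gateX_eq]
    exact QVec.normSq_mapDomain (symmDiff_singleton_involutive _).injective ψ
  | cnot =>
    simp only [wp, gateCX_eq]
    exact QVec.normSq_mapDomain (ccx_involutive _ _ _).injective ψ
  | ccnot =>
    simp only [wp, gateCCX_eq]
    exact QVec.normSq_mapDomain (ccx_involutive _ _ _).injective ψ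
  | meas => exact projQubit_normSq _ ψ
  | seq p r ihp ihr =>
    simp only [wp]
    have : r.wp (fun _ φ => QVec.normSq φ) = fun _ φ => φ.normSq := by
      funext τ φ; exact ihr hp.2 τ φ
    rw [this, ihp hp.1]
  | ite e p r ihp ihr =>
    simp only [wp]
    split_ifs
    · exact ihp hp.1 _ _
    · exact ihr hp.2 _ _
  | rep e p ih =>
    simp only [wp]
    have : ∀ k, (p.wp)^[k] (fun _ φ => QVec.normSq φ) = fun _ φ => φ.normSq := by
      intro k
      induction k with
      | zero => rfl
      | succ k ihk =>
        rw [Function.iterate_succ_apply', ihk]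
        funext τ φ; exact ih hp τ φ
    rw [this]

theorem Det.normSq {p : QProg} (hp : p.Perm) {σ σ' : Store} {ψ ψ' : QVec}
    (h : Det p σ ψ σ' ψ') : ψ'.normSq = ψ.normSq := by
  have h1 := hp.wp_normSq σ ψ
  rw [h] at h1
  exact h1

/-! ### Uniform superpositions -/

/-- The superposition of the basis states in `Ω`, with all amplitudes equal to `c`. -/
noncomputable def uni (c : ℂ) (Ω : Finset Ket) : QVec := ∑ S ∈ Ω, Finsupp.single S c

theorem uni_apply (c : ℂ) (Ω : Finset Ket) (S : Ket) : uni c Ω S = if S ∈ Ω then c else 0 := by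
  unfold uni
  rw [Finsupp.finsetSum_apply]
  simp [Finsupp.single_apply]

theorem smul_uni (d c : ℂ) (Ω : Finset Ket) : d • uni c Ω = uni (d * c) Ω := by
  ext S
  rw [Finsupp.smul_apply, uni_apply, uni_apply]
  split_ifs <;> simp

theorem uni_support (c : ℂ) (Ω : Finset Ket) : (uni c Ω).support ⊆ Ω := by
  intro S hS
  by_contra h
  rw [Finsupp.mem_support_iff, uni_apply, if_neg h] at hS
  exact hS rfl

theorem normSq_uni (c : ℂ) (Ω : Finset Ket) : (uni c Ω).normSq = ‖c‖ ^ 2 * Ω.card := by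
  rw [QVec.normSq_eq_sum (uni_support c Ω), Finset.sum_congr rfl
    (g := fun _ => ‖c‖ ^ 2) fun S hS => by rw [uni_apply, if_pos hS]]
  rw [Finset.sum_const, nsmul_eq_mul, mul_comm]

theorem filter_uni (c : ℂ) (Ω : Finset Ket) (p : Ket → Prop) [DecidablePred p] :
    (uni c Ω).filter p = uni c (Ω.filter p) := by
  ext S
  by_cases h : p S <;> simp [uni_apply, h]

theorem mapDomain_uni (c : ℂ) (Ω : Finset Ket) {f : Ket → Ket} (hf : Function.Injective f) :
    (uni c Ω).mapDomain f = uni c (Ω.image f) := by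
  unfold uni
  rw [Finset.sum_image hf.injOn, Finsupp.mapDomain_finsetSum]
  simp

theorem uni_empty (c : ℂ) : uni c ∅ = 0 := by simp [uni]

theorem uni_zero (Ω : Finset Ket) : uni 0 Ω = 0 := by simp [uni]

/-- On a qubit that is 0 in all basis states the Hadamard gate produces no signs and no
interference, so the superposition stays uniform. -/
theorem gateH_uni (c : ℂ) (Ω : Finset Ket) (a : Qubit) (h : ∀ S ∈ Ω, a ∉ S) :
    gateH a (uni c Ω) = uni (((√2 : ℝ) : ℂ)⁻¹ * c) (Ω ∪ Ω.image (insert a)) := by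
  have hd : Disjoint Ω (Ω.image (insert a)) := by
    rw [Finset.disjoint_right]
    intro S hS
    obtain ⟨T, -, rfl⟩ := Finset.mem_image.1 hS
    exact fun h1 => h _ h1 (Finset.mem_insert_self _ _)
  have hinj : Set.InjOn (insert a : Ket → Ket) Ω := by
    intro S hS T hT hST
    rw [← Finset.erase_insert (h S hS), ← Finset.erase_insert (h T hT)]
    exact congrArg (fun X => Finset.erase X a) hST
  unfold uni
  rw [Finset.sum_union hd, Finset.sum_image hinj, ← Finset.sum_add_distrib, map_sum]
  refine Finset.sum_congr rfl fun S hS => ?_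
  unfold gateH
  rw [Finsupp.linearCombination_single, Finset.erase_eq_of_notMem (h S hS), if_neg (h S hS)]
  simp [smul_add, mul_comm]

theorem normSq_gateH_uni (c : ℂ) (Ω : Finset Ket) (a : Qubit) (h : ∀ S ∈ Ω, a ∉ S) :
    (gateH a (uni c Ω)).normSq = (uni c Ω).normSq := by
  have hd : Disjoint Ω (Ω.image (insert a)) := by
    rw [Finset.disjoint_right]
    intro S hS
    obtain ⟨T, -, rfl⟩ := Finset.mem_image.1 hS
    exact fun h1 => h _ h1 (Finset.mem_insert_self _ _)
  have hinj : Set.InjOn (insert a : Ket → Ket) Ω := by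
    intro S hS T hT hST
    rw [← Finset.erase_insert (h S hS), ← Finset.erase_insert (h T hT)]
    exact congrArg (fun X => Finset.erase X a) hST
  rw [gateH_uni c Ω a h, normSq_uni, normSq_uni, Finset.card_union_of_disjoint hd,
    Finset.card_image_of_injOn hinj, norm_mul, mul_pow, norm_inv, Complex.norm_real,
    Real.norm_of_nonneg (Real.sqrt_nonneg 2), inv_pow, Real.sq_sqrt (by norm_num)]
  push_cast
  ring

/-! ### Products of sets of basis states -/

/-- The unions of a basis state in `Ω` and one in `Y`. -/
def prodSet (Ω Y : Finset Ket) : Finset Ket := Finset.image₂ (· ∪ ·) Ω Y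

theorem mem_prodSet {Ω Y : Finset Ket} {S : Ket} :
    S ∈ prodSet Ω Y ↔ ∃ A ∈ Ω, ∃ B ∈ Y, A ∪ B = S := by
  simp [prodSet, Finset.mem_image₂]

theorem prodSet_singleton_empty (Ω : Finset Ket) : prodSet Ω {∅} = Ω := by
  ext S; simp [mem_prodSet]

theorem prodSet_empty (Ω : Finset Ket) : prodSet Ω ∅ = ∅ := by simp [prodSet]

theorem prodSet_assoc (Ω Y Z : Finset Ket) : prodSet (prodSet Ω Y) Z = prodSet Ω (prodSet Y Z) := by
  unfold prodSet
  exact Finset.image₂_assoc fun _ _ _ => Finset.union_assoc _ _ _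

/-- `X` decides to which factor a qubit belongs, so a union determines both parts. Cardinalities of
product sets are multiplicative for this reason. -/
theorem union_inj_of_sep {X : Qubit → Prop} {A A' B B' : Ket} (hA : ∀ a ∈ A, ¬ X a)
    (hA' : ∀ a ∈ A', ¬ X a) (hB : ∀ a ∈ B, X a) (hB' : ∀ a ∈ B', X a) (h : A ∪ B = A' ∪ B') :
    A = A' ∧ B = B' := by
  have key : ∀ x, x ∈ A ∨ x ∈ B ↔ x ∈ A' ∨ x ∈ B' := fun x => by
    rw [← Finset.mem_union, h, Finset.mem_union]
  constructor
  · ext x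
    have := key x; have := hA x; have := hA' x; have := hB x; have := hB' x
    tauto
  · ext x
    have := key x; have := hA x; have := hA' x; have := hB x; have := hB' x
    tauto

theorem card_prodSet {X : Qubit → Prop} {Ω Y : Finset Ket} (hΩ : ∀ S ∈ Ω, ∀ a ∈ S, ¬ X a)
    (hY : ∀ S ∈ Y, ∀ a ∈ S, X a) : (prodSet Ω Y).card = Ω.card * Y.card := by
  rw [prodSet, Finset.card_image₂_iff]
  rintro ⟨A, B⟩ h ⟨A', B'⟩ h' heq
  simp only [Set.mem_prod, Finset.mem_coe] at h h'
  obtain ⟨h1, h2⟩ := union_inj_of_sep (hΩ A h.1) (hΩ A' h'.1) (hY B h.2) (hY B' h'.2) heq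
  rw [h1, h2]

theorem filter_prodSet {Ω Y : Finset Ket} (p p' : Ket → Prop) [DecidablePred p]
    [DecidablePred p'] (h : ∀ A ∈ Ω, ∀ B ∈ Y, (p (A ∪ B) ↔ p' B)) :
    (prodSet Ω Y).filter p = prodSet Ω (Y.filter p') := by
  ext S
  simp only [Finset.mem_filter, mem_prodSet]
  constructor
  · rintro ⟨⟨A, hA, B, hB, rfl⟩, hp⟩
    exact ⟨A, hA, B, ⟨hB, (h A hA B hB).1 hp⟩, rfl⟩
  · rintro ⟨A, hA, B, ⟨hB, hp⟩, rfl⟩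
    exact ⟨⟨A, hA, B, hB, rfl⟩, (h A hA B hB).2 hp⟩

/-! ### Binary numbers in the work array -/

/-- The binary digits of `v`, in the work qubits from `base` on. -/
def bits (base v : ℕ) : Ket :=
  ((Finset.range v.size).filter fun k => v.testBit k = true).image fun k => ((2, base + k) : Qubit)

theorem testBit_lt_size {v k : ℕ} (h : v.testBit k = true) : k < v.size := by
  by_contra hk
  push Not at hk
  rw [Nat.testBit_lt_two_pow ((Nat.lt_size_self v).trans_le (Nat.pow_le_pow_right (by norm_num) hk))] at h
  exact Bool.false_ne_true h

theorem mem_bits {base v : ℕ} {x : Qubit} :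
    x ∈ bits base v ↔ x.1 = 2 ∧ base ≤ x.2 ∧ v.testBit (x.2 - base) = true := by
  unfold bits
  simp only [Finset.mem_image, Finset.mem_filter, Finset.mem_range]
  constructor
  · rintro ⟨k, ⟨-, h⟩, rfl⟩
    simpa using h
  · rintro ⟨h1, h2, h3⟩
    refine ⟨x.2 - base, ⟨testBit_lt_size h3, h3⟩, ?_⟩
    ext <;> simp [h1, h2]

theorem mem_bits_add {base v k : ℕ} : ((2, base + k) : Qubit) ∈ bits base v ↔ v.testBit k = true := by
  simp [mem_bits]

theorem lt_of_mem_bits {base v L : ℕ} (hv : v < 2 ^ L) {x : Qubit} (hx : x ∈ bits base v) :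
    x.1 = 2 ∧ base ≤ x.2 ∧ x.2 < base + L := by
  obtain ⟨h1, h2, h3⟩ := mem_bits.1 hx
  refine ⟨h1, h2, ?_⟩
  by_contra h
  rw [Nat.testBit_lt_two_pow (hv.trans_le (Nat.pow_le_pow_right (by norm_num) (by omega)))] at h3
  exact Bool.false_ne_true h3

theorem bits_injective (base : ℕ) : Function.Injective (bits base) := by
  intro v w h
  apply Nat.eq_of_testBit_eq
  intro k
  have h1 : v.testBit k = true ↔ w.testBit k = true := by
    rw [← mem_bits_add (base := base), h, mem_bits_add]
  exact Bool.eq_iff_iff.2 h1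

theorem bits_zero (base : ℕ) : bits base 0 = ∅ := by
  ext x; simp [mem_bits]

theorem bits_add_two_pow (base : ℕ) {v k : ℕ} (hv : v < 2 ^ k) :
    bits base (v + 2 ^ k) = insert (2, base + k) (bits base v) := by
  ext ⟨a, p⟩
  simp only [mem_bits, Finset.mem_insert, Prod.mk.injEq]
  rw [add_comm v]
  constructor
  · rintro ⟨h1, h2, h3⟩
    by_cases hp : p - base = k
    · left; omega
    · right
      refine ⟨h1, h2, ?_⟩
      rcases lt_or_gt_of_ne hp with hlt | hgt
      · rwa [Nat.testBit_two_pow_add_gt hlt] at h3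
      · exfalso
        rw [Nat.testBit_lt_two_pow] at h3
        · exact Bool.false_ne_true h3
        · calc 2 ^ k + v < 2 ^ k + 2 ^ k := by omega
            _ = 2 ^ (k + 1) := by rw [pow_succ]; omega
            _ ≤ _ := Nat.pow_le_pow_right (by norm_num) hgt
  · rintro (⟨h1, h2⟩ | ⟨h1, h2, h3⟩)
    · refine ⟨h1, by omega, ?_⟩
      have : p - base = k := by omega
      rw [this, Nat.testBit_two_pow_add_eq, Nat.testBit_lt_two_pow hv]
      rfl
    · refine ⟨h1, h2, ?_⟩
      have hlt : p - base < k := by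
        by_contra hk
        rw [Nat.testBit_lt_two_pow (hv.trans_le (Nat.pow_le_pow_right (by norm_num) (by omega)))] at h3
        exact Bool.false_ne_true h3
      rwa [Nat.testBit_two_pow_add_gt hlt]

/-- The encodings of the numbers in a set. -/
def nums (base : ℕ) (s : Finset ℕ) : Finset Ket := s.image (bits base)

theorem card_nums (base : ℕ) (s : Finset ℕ) : (nums base s).card = s.card :=
  Finset.card_image_of_injective _ (bits_injective base)

theorem nums_two_pow_succ (base k : ℕ) :
    nums base (Finset.range (2 ^ (k + 1))) =
      nums base (Finset.range (2 ^ k)) ∪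
        (nums base (Finset.range (2 ^ k))).image (insert (2, base + k)) := by
  ext S
  simp only [nums, Finset.mem_union, Finset.mem_image, Finset.mem_range, exists_exists_and_eq_and]
  constructor
  · rintro ⟨v, hv, rfl⟩
    by_cases h : v < 2 ^ k
    · exact .inl ⟨v, h, rfl⟩
    · refine .inr ⟨v - 2 ^ k, ?_, ?_⟩
      · rw [pow_succ] at hv; omega
      · rw [← bits_add_two_pow]
        · congr 1; omega
        · rw [pow_succ] at hv; omega
  · rintro (⟨v, hv, rfl⟩ | ⟨v, hv, rfl⟩)
    · exact ⟨v, by rw [pow_succ]; omega, rfl⟩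
    · exact ⟨v + 2 ^ k, by rw [pow_succ]; omega, bits_add_two_pow base hv⟩

/-- The numbers below 2^k together with a free digit `k` are the numbers below 2^(k+1): one Hadamard
gate doubles the range. -/
theorem gateH_prodSet (c : ℂ) (Ω : Finset Ket) (base k : ℕ) (h : ∀ S ∈ Ω, (2, base + k) ∉ S) :
    gateH (2, base + k) (uni c (prodSet Ω (nums base (Finset.range (2 ^ k))))) =
      uni (((√2 : ℝ) : ℂ)⁻¹ * c) (prodSet Ω (nums base (Finset.range (2 ^ (k + 1))))) ∧
    (gateH (2, base + k) (uni c (prodSet Ω (nums base (Finset.range (2 ^ k)))))).normSq =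
      (uni c (prodSet Ω (nums base (Finset.range (2 ^ k))))).normSq := by
  have hfree : ∀ S ∈ prodSet Ω (nums base (Finset.range (2 ^ k))), ((2, base + k) : Qubit) ∉ S := by
    intro S hS
    obtain ⟨A, hA, B, hB, rfl⟩ := mem_prodSet.1 hS
    simp only [nums, Finset.mem_image, Finset.mem_range] at hB
    obtain ⟨v, hv, rfl⟩ := hB
    rw [Finset.mem_union, not_or]
    refine ⟨h A hA, fun hx => ?_⟩
    have := (lt_of_mem_bits hv hx).2.2
    simp at this
  refine ⟨?_, normSq_gateH_uni c _ _ hfree⟩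
  rw [gateH_uni c _ _ hfree]
  congr 1
  rw [nums_two_pow_succ]
  ext S
  simp only [Finset.mem_union, mem_prodSet, Finset.mem_image]
  constructor
  · rintro (⟨A, hA, B, hB, rfl⟩ | ⟨_, ⟨A, hA, B, hB, rfl⟩, rfl⟩)
    · exact ⟨A, hA, B, .inl hB, rfl⟩
    · exact ⟨A, hA, _, .inr ⟨B, hB, rfl⟩, Finset.union_insert _ _ _⟩
  · rintro ⟨A, hA, B, (hB | ⟨B, hB, rfl⟩), rfl⟩
    · exact .inl ⟨A, hA, B, hB, rfl⟩
    · exact .inr ⟨_, ⟨A, hA, B, hB, rfl⟩, (Finset.union_insert _ _ _).symm⟩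

/-! ### Reversible circuits for linear forms -/

/-- A Toffoli gate on the work array: two controls and the target.  With equal controls it is a
controlled NOT, and with three equal qubits the identity. -/
abbrev Gate := ℕ × ℕ × ℕ

def Gate.act (g : Gate) : Ket → Ket := ccx (2, g.1) (2, g.2.1) (2, g.2.2)

def runG (G : List Gate) (S : Ket) : Ket := G.foldl (fun T g => g.act T) S

theorem runG_append (G H : List Gate) (S : Ket) : runG (G ++ H) S = runG H (runG G S) :=
  List.foldl_append

/-- Every gate is an involution, so the reversed list uncomputes. -/
theorem runG_reverse (G : List Gate) (S : Ket) : runG G.reverse (runG G S) = S := by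
  induction G generalizing S with
  | nil => rfl
  | cons g G ih =>
    rw [List.reverse_cons, runG_append]
    change g.act (runG G.reverse (runG G (g.act S))) = S
    rw [ih]
    exact ccx_involutive _ _ _ S

theorem runG_injective (G : List Gate) : Function.Injective (runG G) :=
  Function.LeftInverse.injective (runG_reverse G)

/-- The value of a work qubit. -/
def ind (S : Ket) (p : ℕ) : ℕ := if ((2, p) : Qubit) ∈ S then 1 else 0

/-- The number in the `w` work qubits from `R` on. -/
def accVal (R w : ℕ) (S : Ket) : ℕ := ∑ i ∈ Finset.range w, ind S (R + i) * 2 ^ i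

/-- The basis states agree off the work qubits from `R` on. -/
def Keeps (R : ℕ) (S T : Ket) : Prop := ∀ x : Qubit, x.1 ≠ 2 ∨ x.2 < R → (x ∈ T ↔ x ∈ S)

theorem Keeps.trans {R : ℕ} {S T U : Ket} (h : Keeps R S T) (h' : Keeps R T U) : Keeps R S U :=
  fun x hx => (h' x hx).trans (h x hx)

theorem Keeps.ind {R : ℕ} {S T : Ket} (h : Keeps R S T) {p : ℕ} (hp : p < R) :
    ind T p = ind S p := by
  unfold _root_.ind
  simp only [h (2, p) (.inr hp)]

/-- Half adders that propagate the carry `f` into the qubits from `l` on. -/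
def ripple (l f s : ℕ) : List Gate :=
  (List.range s).flatMap fun i => [(l + i, f + i, f + i + 1), (f + i, f + i, l + i)]

theorem ripple_succ (l f s : ℕ) :
    ripple l f (s + 1) = ripple l f s ++ [(l + s, f + s, f + s + 1), (f + s, f + s, l + s)] := by
  simp [ripple, List.range_succ]

/-- Changing one digit changes the number by the difference of that digit times its weight; the
equation is written without subtraction. -/
theorem accVal_eq_of_single {R w j : ℕ} (hj : j < w) {S T : Ket}
    (h : ∀ i, i ≠ j → i < w → ind T (R + i) = ind S (R + i)) :
    accVal R w T + ind S (R + j) * 2 ^ j = accVal R w S + ind T (R + j) * 2 ^ j := by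
  unfold accVal
  rw [← Finset.sum_erase_add _ _ (Finset.mem_range.2 hj),
    ← Finset.sum_erase_add (Finset.range w) _ (Finset.mem_range.2 hj)]
  have : ∑ i ∈ (Finset.range w).erase j, ind T (R + i) * 2 ^ i =
      ∑ i ∈ (Finset.range w).erase j, ind S (R + i) * 2 ^ i := by
    refine Finset.sum_congr rfl fun i hi => ?_
    rw [Finset.mem_erase, Finset.mem_range] at hi
    rw [h i hi.1 hi.2]
  rw [this]
  ring

/-- A half adder leaves the sum digit in the accumulator and puts the new carry into a fresh qubit,
which preserves the weighted sum of digit and carry. Spent carries stay behind as garbage above the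
accumulator; running the circuit backwards removes them later. -/
theorem ripple_spec {R w f i₀ : ℕ} (hf : R + w ≤ f) (S : Ket)
    (hS : ∀ p, f < p → ((2, p) : Qubit) ∉ S) (s : ℕ) (hs : i₀ + s ≤ w) :
    Keeps R S (runG (ripple (R + i₀) f s) S) ∧
    (∀ p, f + s < p → ((2, p) : Qubit) ∉ runG (ripple (R + i₀) f s) S) ∧
    accVal R w (runG (ripple (R + i₀) f s) S) +
      ind (runG (ripple (R + i₀) f s) S) (f + s) * 2 ^ (i₀ + s) =
      accVal R w S + ind S f * 2 ^ i₀ := by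
  induction s with
  | zero => exact ⟨fun x _ => Iff.rfl, by simpa [ripple, runG] using hS, by simp [ripple, runG]⟩
  | succ s ih =>
    obtain ⟨h1, h2, h3⟩ := ih (by omega)
    rw [ripple_succ, runG_append]
    generalize runG (ripple (R + i₀) f s) S = T at *
    set U := runG [(R + i₀ + s, f + s, f + s + 1), (f + s, f + s, R + i₀ + s)] T with hU
    have hmem : ∀ x : Qubit, x ∈ U ↔
        if x = (2, R + i₀ + s) then (¬ (x ∈ T ↔ (2, f + s) ∈ T))
        else if x = (2, f + s + 1) then ((2, R + i₀ + s) ∈ T ∧ (2, f + s) ∈ T) else x ∈ T := by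
      intro x
      have hn : ((2, f + s + 1) : Qubit) ∉ T := h2 _ (by omega)
      simp only [hU, runG, List.foldl_cons, List.foldl_nil, Gate.act, mem_ccx]
      have e1 : ((2, f + s) : Qubit) ≠ (2, f + s + 1) := by simp
      have e2 : ((2, R + i₀ + s) : Qubit) ≠ (2, f + s + 1) := by simp; omega
      have e3 : ((2, f + s) : Qubit) ≠ (2, R + i₀ + s) := by simp; omega
      by_cases hx1 : x = (2, R + i₀ + s)
      · subst hx1
        simp only [e1, e2, e3, ne_eq, not_false_eq_true, false_and, if_false, true_and, if_true]
        by_cases hc : ((2, f + s) : Qubit) ∈ T <;> simp [hc]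
      · by_cases hx2 : x = (2, f + s + 1)
        · subst hx2
          simp [e1, e2, e2.symm, hn]
        · simp [hx1, hx2]
    refine ⟨h1.trans fun x hx => ?_, fun p hp => ?_, ?_⟩
    · rw [hmem, if_neg, if_neg]
      · rintro rfl; simp at hx; omega
      · rintro rfl; simp at hx; omega
    · rw [hmem, if_neg (by simp; omega), if_neg (by simp; omega)]
      exact h2 p (by omega)
    · have h4 := accVal_eq_of_single (R := R) (w := w) (j := i₀ + s) (by omega) (S := T) (T := U)
        (fun i hi hiw => by
          unfold ind
          congr 1
          rw [hmem, if_neg (by simp; omega), if_neg (by simp; omega)])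
      have h5 : ind U (R + (i₀ + s)) + 2 * ind U (f + s + 1) =
          ind T (R + (i₀ + s)) + ind T (f + s) := by
        have e1 := hmem (2, R + (i₀ + s))
        have e2 := hmem (2, f + s + 1)
        rw [if_pos (by simp; omega)] at e1
        rw [if_neg (by simp; omega), if_pos rfl] at e2
        rw [add_assoc R] at e2
        unfold ind
        simp only [e1, e2]
        by_cases hc : ((2, f + s) : Qubit) ∈ T <;>
          by_cases hd : ((2, R + (i₀ + s)) : Qubit) ∈ T <;> simp [hc, hd]
      have e6 : 2 ^ (i₀ + (s + 1)) = 2 * 2 ^ (i₀ + s) := by rw [← add_assoc, pow_succ]; ring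
      rw [e6]
      rw [← add_assoc f s 1]
      generalize 2 ^ (i₀ + s) = Z at *
      have h7 : ind U (R + (i₀ + s)) * Z + ind U (f + s + 1) * (2 * Z) =
          ind T (R + (i₀ + s)) * Z + ind T (f + s) * Z := by
        calc _ = (ind U (R + (i₀ + s)) + 2 * ind U (f + s + 1)) * Z := by ring
          _ = _ := by rw [h5]; ring
      omega

/-- Copy the qubit `p` to the fresh qubit `f` if `b`. -/
def loadGate (b : Bool) (p f : ℕ) : Gate := if b then (p, p, f) else (f, f, f)

theorem loadGate_spec {b : Bool} {p f : ℕ} (hpf : p ≠ f) (S : Ket) (hS : ((2, f) : Qubit) ∉ S) :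
    (∀ x, x ≠ (2, f) → (x ∈ (loadGate b p f).act S ↔ x ∈ S)) ∧
    ind ((loadGate b p f).act S) f = b.toNat * ind S p := by
  cases b with
  | false =>
    have : (loadGate false p f).act S = S := by
      ext x; simp [loadGate, Gate.act, mem_ccx]
    rw [this]
    exact ⟨fun _ _ => Iff.rfl, by simp [ind, hS]⟩
  | true =>
    have e : ∀ x, x ∈ (loadGate true p f).act S ↔
        if x = (2, f) ∧ ((2, p) : Qubit) ∈ S then x ∉ S else x ∈ S := by
      intro x
      simp [loadGate, Gate.act, mem_ccx, hpf]
    refine ⟨fun x hx => by rw [e, if_neg fun h => hx h.1], ?_⟩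
    unfold ind
    simp only [e]
    by_cases h : ((2, p) : Qubit) ∈ S <;> simp [h, hS]

/-- Add the number formed by the lowest `s` digits of `v` to the accumulator, controlled by `p`. -/
def addGates (K R p v f s : ℕ) : List Gate :=
  (List.range s).flatMap fun i =>
    loadGate (v.testBit i) p (f + i * (K + 1)) :: ripple (R + i) (f + i * (K + 1)) K

theorem addGates_succ (K R p v f s : ℕ) :
    addGates K R p v f (s + 1) = addGates K R p v f s ++
      (loadGate (v.testBit s) p (f + s * (K + 1)) :: ripple (R + s) (f + s * (K + 1)) K) := by
  simp [addGates, List.range_succ]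

theorem Keeps.of_single {R f : ℕ} (hf : R ≤ f) {S T : Ket}
    (h : ∀ x, x ≠ (2, f) → (x ∈ T ↔ x ∈ S)) : Keeps R S T := fun x hx =>
  h x (by rintro rfl; simp at hx; omega)

/-- For each digit of `v` the control is copied into a fresh carry qubit, which is then rippled
upwards from the position of that digit through `K` places. A carry that is left over has weight at
least 2^K and vanishes in the congruence. The accumulator has `2 * K` digits so that a ripple
starting below `K` does not run out of it. -/
theorem addGates_spec {K R p v f : ℕ} (hf : R + 2 * K ≤ f) (hp : p < R) (S : Ket)
    (hS : ∀ p, f ≤ p → ((2, p) : Qubit) ∉ S) (s : ℕ) (hs : s ≤ K) :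
    Keeps R S (runG (addGates K R p v f s) S) ∧
    (∀ x, f + s * (K + 1) ≤ x → ((2, x) : Qubit) ∉ runG (addGates K R p v f s) S) ∧
    accVal R (2 * K) (runG (addGates K R p v f s) S) ≡
      accVal R (2 * K) S + ind S p * (v % 2 ^ s) [MOD 2 ^ K] := by
  induction s with
  | zero =>
    exact ⟨fun x _ => Iff.rfl, by simpa [addGates, runG] using hS, by
      simp [addGates, runG, Nat.mod_one, Nat.ModEq.refl]⟩
  | succ s ih =>
    obtain ⟨h1, h2, h3⟩ := ih (by omega)
    rw [addGates_succ, runG_append]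
    generalize runG (addGates K R p v f s) S = T at *
    have hff : f ≤ f + s * (K + 1) := Nat.le_add_right _ _
    generalize hfs : f + s * (K + 1) = f' at *
    have hfs' : f + (s + 1) * (K + 1) = f' + K + 1 := by rw [← hfs]; ring
    obtain ⟨h4, h5⟩ := loadGate_spec (b := v.testBit s) (p := p) (f := f') (by omega) T
      (h2 _ le_rfl)
    change Keeps R S (runG (ripple (R + s) f' K) ((loadGate (v.testBit s) p f').act T)) ∧ _
    have hrun : runG (loadGate (v.testBit s) p f' :: ripple (R + s) f' K) T =
      runG (ripple (R + s) f' K) ((loadGate (v.testBit s) p f').act T) := rfl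
    rw [hrun]
    generalize (loadGate (v.testBit s) p f').act T = U at *
    obtain ⟨h6, h7, h8⟩ := ripple_spec (R := R) (w := 2 * K) (f := f') (i₀ := s) (by omega) U
      (fun p hp => by rw [h4 _ (by simp; omega)]; exact h2 p (by omega)) K (by omega)
    refine ⟨(h1.trans (Keeps.of_single (by omega) h4)).trans h6, fun x hx => h7 x (by omega), ?_⟩
    have h9 : accVal R (2 * K) U = accVal R (2 * K) T := by
      unfold accVal ind
      refine Finset.sum_congr rfl fun i hi => ?_
      rw [Finset.mem_range] at hi
      simp only [h4 (2, R + i) (by simp; omega)]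
    have h10 : accVal R (2 * K) (runG (ripple (R + s) f' K) U) ≡
        accVal R (2 * K) U + ind U f' * 2 ^ s [MOD 2 ^ K] := by
      rw [← h8, pow_add]
      unfold Nat.ModEq
      rw [mul_comm (2 ^ s), ← mul_assoc, mul_comm _ (2 ^ K), mul_assoc, Nat.add_mul_mod_self_left]
    refine h10.trans ?_
    rw [h9, h5, h1.ind hp]
    refine (Nat.ModEq.add_right _ h3).trans ?_
    rw [Nat.mod_pow_succ, ← Nat.toNat_testBit]
    have : accVal R (2 * K) S + ind S p * (v % 2 ^ s) + (v.testBit s).toNat * ind S p * 2 ^ s =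
      accVal R (2 * K) S + ind S p * (v % 2 ^ s + 2 ^ s * (v.testBit s).toNat) := by ring
    rw [this]

/-- Compute the linear form with coefficients `W` in the first `n` qubits. -/
def formGates (K R : ℕ) (W : ℕ → ℕ) (n : ℕ) : List Gate :=
  (List.range n).flatMap fun p => addGates K R p (W p) (R + 2 * K + p * (K * (K + 1))) K

theorem formGates_succ (K R : ℕ) (W : ℕ → ℕ) (n : ℕ) :
    formGates K R W (n + 1) = formGates K R W n ++
      addGates K R n (W n) (R + 2 * K + n * (K * (K + 1))) K := by
  simp [formGates, List.range_succ]

/-- Each input qubit gets its own block of `K * (K + 1)` fresh carry qubits, and overflow is always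
a multiple of 2^K. So the digits below `K` of the linear form are exact, whatever the size of its
coefficients. -/
theorem formGates_spec {K R : ℕ} {W : ℕ → ℕ} (S : Ket)
    (hS : ∀ p, R ≤ p → ((2, p) : Qubit) ∉ S) (n : ℕ) (hn : n ≤ R) :
    Keeps R S (runG (formGates K R W n) S) ∧
    (∀ p, R + 2 * K + n * (K * (K + 1)) ≤ p → ((2, p) : Qubit) ∉ runG (formGates K R W n) S) ∧
    accVal R (2 * K) (runG (formGates K R W n) S) ≡
      ∑ p ∈ Finset.range n, ind S p * W p [MOD 2 ^ K] := by
  induction n with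
  | zero =>
    refine ⟨fun x _ => Iff.rfl, fun p hp => ?_, ?_⟩
    · simp only [formGates, runG, List.range_zero, List.flatMap_nil, List.foldl_nil]
      exact hS p (by omega)
    · simp only [formGates, runG, List.range_zero, List.flatMap_nil, List.foldl_nil,
        Finset.range_zero, Finset.sum_empty]
      have : accVal R (2 * K) S = 0 := by
        unfold accVal ind
        refine Finset.sum_eq_zero fun i _ => ?_
        rw [if_neg (hS _ (by omega)), zero_mul]
      rw [this]
  | succ n ih =>
    obtain ⟨h1, h2, h3⟩ := ih (by omega)
    rw [formGates_succ, runG_append, Finset.sum_range_succ]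
    generalize runG (formGates K R W n) S = T at *
    have hff : R + 2 * K ≤ R + 2 * K + n * (K * (K + 1)) := Nat.le_add_right _ _
    have hfs' : R + 2 * K + (n + 1) * (K * (K + 1)) =
      R + 2 * K + n * (K * (K + 1)) + K * (K + 1) := by ring
    rw [hfs']
    generalize R + 2 * K + n * (K * (K + 1)) = f' at *
    obtain ⟨h4, h5, h6⟩ := addGates_spec (v := W n) hff (by omega : n < R) T h2 K le_rfl
    refine ⟨h1.trans h4, h5, h6.trans ?_⟩
    rw [h1.ind (by omega)]
    refine (Nat.ModEq.add_right _ h3).trans (Nat.ModEq.add_left _ (Nat.ModEq.mul_left _ ?_))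
    exact Nat.mod_modEq _ _

theorem accVal_testBit {R w : ℕ} (S : Ket) {t : ℕ} (ht : t < w) :
    (accVal R w S).testBit t = true ↔ ((2, R + t) : Qubit) ∈ S := by
  have hlt : ∀ w, accVal R w S < 2 ^ w := by
    intro w
    induction w with
    | zero => simp [accVal]
    | succ w ih =>
      have h1 : ind S (R + w) ≤ 1 := by unfold ind; split_ifs <;> omega
      have h2 : accVal R (w + 1) S = accVal R w S + ind S (R + w) * 2 ^ w := by
        simp [accVal, Finset.sum_range_succ]
      rw [h2, pow_succ]
      nlinarith
  have hbit : ∀ w, t < w → (accVal R w S).testBit t = decide (((2, R + t) : Qubit) ∈ S) := by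
    intro w
    induction w with
    | zero => intro h; omega
    | succ w ih =>
      intro h
      have h2 : accVal R (w + 1) S = accVal R w S + ind S (R + w) * 2 ^ w := by
        simp [accVal, Finset.sum_range_succ]
      rw [h2]
      by_cases htw : t = w
      · subst htw
        unfold ind
        by_cases hm : ((2, R + t) : Qubit) ∈ S
        · rw [if_pos hm, one_mul, add_comm, Nat.testBit_two_pow_add_eq,
            Nat.testBit_lt_two_pow (hlt t)]
          simp [hm]
        · rw [if_neg hm, zero_mul, add_zero, Nat.testBit_lt_two_pow (hlt t)]
          simp [hm]
      · rw [← ih (by omega)]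
        unfold ind
        split_ifs
        · rw [one_mul, add_comm, Nat.testBit_two_pow_add_gt (by omega)]
        · rw [zero_mul, add_zero]
  rw [hbit w ht, decide_eq_true_iff]

theorem Nat.ModEq.testBit_eq {a b K t : ℕ} (h : a ≡ b [MOD 2 ^ K]) (ht : t < K) :
    a.testBit t = b.testBit t := by
  have h1 := Nat.testBit_mod_two_pow a K t
  have h2 := Nat.testBit_mod_two_pow b K t
  rw [show a % 2 ^ K = b % 2 ^ K from h, h2] at h1
  simpa [ht] using h1.symm

theorem formGates_testBit {K R : ℕ} {W : ℕ → ℕ} (S : Ket)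
    (hS : ∀ p, R ≤ p → ((2, p) : Qubit) ∉ S) {t : ℕ} (ht : t < K) :
    ((2, R + t) : Qubit) ∈ runG (formGates K R W R) S ↔
      (∑ p ∈ Finset.range R, ind S p * W p).testBit t = true := by
  rw [← (formGates_spec S hS R le_rfl).2.2.testBit_eq ht, accVal_testBit _ (by omega)]

theorem ripple_length (l f s : ℕ) : (ripple l f s).length = 2 * s := by
  simp [ripple, List.length_flatMap, mul_comm]

theorem addGates_length (K R p v f s : ℕ) :
    (addGates K R p v f s).length = s * (1 + 2 * K) := by
  simp [addGates, List.length_flatMap, ripple_length, add_comm]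

theorem formGates_length (K R : ℕ) (W : ℕ → ℕ) (n : ℕ) :
    (formGates K R W n).length = n * (K * (1 + 2 * K)) := by
  simp [formGates, List.length_flatMap, addGates_length]

/-! ### Classical runs -/

/-- The program takes the store `σ` to `σ'` and leaves the state vector alone. -/
def CDet (p : QProg) (σ σ' : Store) : Prop := ∀ ψ, Det p σ ψ σ' ψ

theorem CDet.seq {p r : QProg} {σ σ' σ'' : Store} (h : CDet p σ σ') (h' : CDet r σ' σ'') :
    CDet (.seq p r) σ σ'' := fun ψ => (h ψ).seq (h' ψ)

theorem CDet.frame {p : QProg} {σ σ' : Store} (h : CDet p σ σ') {X : ℕ → Prop}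
    (hp : p.Writes X) {a : ℕ} (ha : ¬ X a) : σ' a = σ a := (h 0).frame hp ha

theorem CDet.ite_true {e : QExpr} {p r : QProg} {σ σ' : Store} (he : e.eval σ ≠ 0)
    (h : CDet p σ σ') : CDet (.ite e p r) σ σ' := fun ψ g => by
  simp only [QProg.wp, if_pos he]; exact h ψ g

theorem CDet.ite_false {e : QExpr} {p r : QProg} {σ σ' : Store} (he : e.eval σ = 0)
    (h : CDet r σ σ') : CDet (.ite e p r) σ σ' := fun ψ g => by
  simp only [QProg.wp, ne_eq, he, not_true, if_false]; exact h ψ g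

theorem CDet.rep {p : QProg} {e : QExpr} (I : ℕ → Store → Prop) (k : ℕ)
    (h : ∀ i < k, ∀ σ, I i σ → ∃ σ', CDet p σ σ' ∧ I (i + 1) σ') {σ : Store} (h0 : I 0 σ)
    (he : e.eval σ = k) : ∃ σ', CDet (.rep e p) σ σ' ∧ I k σ' := by
  have key : ∀ j i, i + j = k → ∀ σ, I i σ →
      ∃ σ', (∀ ψ g, (p.wp)^[j] g σ ψ = g σ' ψ) ∧ I k σ' := by
    intro j
    induction j with
    | zero => intro i hi σ hI; exact ⟨σ, fun ψ g => rfl, by rwa [← hi]⟩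
    | succ j ih =>
      intro i hi σ hI
      obtain ⟨σ', hd, hI'⟩ := h i (by omega) σ hI
      obtain ⟨σ'', hd', hI''⟩ := ih (i + 1) (by omega) σ' hI'
      exact ⟨σ'', fun ψ g => by rw [Function.iterate_succ_apply', hd, hd'], hI''⟩
  obtain ⟨σ', hd, hI⟩ := key k 0 (by omega) σ h0
  exact ⟨σ', fun ψ g => by simp only [QProg.wp, he]; exact hd ψ g, hI⟩

/-- The content of the cell `a[0]`, used as a scalar variable. -/
def var (a : ℕ) : QExpr := .get a (.lit 0)

/-- Assignment to a scalar variable. -/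
def setv (a : ℕ) (e : QExpr) : QProg := .assign a (.lit 0) e

/-- Increment a scalar variable. -/
def incr (a : ℕ) : QProg := setv a (.add (var a) (.lit 1))

/-- Sequential composition. -/
def QProg.block : List QProg → QProg
  | [] => .skip
  | p :: l => .seq p (block l)

theorem CDet.nil (σ : Store) : CDet (.block []) σ σ := fun _ _ => rfl

theorem CDet.cons {p : QProg} {l : List QProg} {σ σ' σ'' : Store} (h : CDet p σ σ')
    (h' : CDet (.block l) σ' σ'') : CDet (.block (p :: l)) σ σ'' := CDet.seq h h'

theorem CDet.assign (a : ℕ) (i e : QExpr) (σ : Store) :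
    CDet (.assign a i e) σ (wr σ a (i.eval σ) (e.eval σ)) := fun _ _ => rfl

theorem CDet.setv (a : ℕ) (e : QExpr) (σ : Store) :
    CDet (setv a e) σ (wr σ a 0 (e.eval σ)) := fun _ _ => rfl

theorem CDet.incr (a : ℕ) (σ : Store) : CDet (incr a) σ (wr σ a 0 (σ a 0 + 1)) := fun _ _ => rfl

/-! ### Writing the circuit of a linear form into the classical memory

Private arrays are numbered from `M` on.  Constants of the computation:
`M`: n, `M+1`: m, `M+2`: q, `M+3`: the bit length `L` of the modulus, `M+4`: `n * L`,
`M+5`: `n * L + 1`, `M+6`: the precision `K`, `M+7`: `K + 1`, `M+8`: number of registers,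
`M+9`: number of attempts, `M+10`: number of gates, `M+11`: the matrix, `M+12`: the vector,
`M+13`: first carry qubit, `M+14`: coefficient of the comparison with `q`.
The other names are variables: `M+20`: coefficients of the linear form, `M+21`, `M+22`, `M+23`:
the gates, `M+24`: their number, `M+31`: outcome of a measurement, `M+37`: digit to be measured. -/

/-- Append a gate to the list. -/
def emit (M : ℕ) (e₁ e₂ e₃ : QExpr) : QProg := .block
  [.assign (M + 21) (var (M + 24)) e₁, .assign (M + 22) (var (M + 24)) e₂,
    .assign (M + 23) (var (M + 24)) e₃, incr (M + 24)]

def gateAt (M : ℕ) (σ : Store) (i : ℕ) : Gate := (σ (M + 21) i, σ (M + 22) i, σ (M + 23) i)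

/-- The list of gates in the memory is `Gs`. -/
def Buf (M : ℕ) (σ : Store) (Gs : List Gate) : Prop :=
  Gs = (List.range (σ (M + 24) 0)).map (gateAt M σ)

theorem Buf.congr {M : ℕ} {σ τ : Store} {Gs : List Gate} (h : Buf M σ Gs)
    (hs : ∀ a, M + 21 ≤ a → a ≤ M + 24 → τ a = σ a) : Buf M τ Gs := by
  unfold Buf gateAt at *
  rw [hs _ (by omega) (by omega), hs _ (by omega) (by omega), hs (M + 23) (by omega) (by omega),
    hs (M + 24) (by omega) (by omega)]
  exact h

/-- The second and third expressions are evaluated after other fields have been written and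
therefore must not read the gate buffer; the first is evaluated before any write and needs no such
condition. -/
theorem emit_spec {M : ℕ} {a b c : QExpr} (hb : b.Reads (M + 24 < ·))
    (hc : c.Reads (M + 24 < ·)) {σ : Store} {Gs : List Gate} (h : Buf M σ Gs) :
    ∃ σ', CDet (emit M a b c) σ σ' ∧ Buf M σ' (Gs ++ [(a.eval σ, b.eval σ, c.eval σ)]) ∧
      ∀ x, M + 24 < x → σ' x = σ x := by
  refine ⟨_, .cons (.assign _ _ _ _) (.cons (.assign _ _ _ _) (.cons (.assign _ _ _ _)
    (.cons (.incr _ _) (.nil _)))), ?_, ?_⟩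
  · set σ₁ := wr σ (M + 21) ((var (M + 24)).eval σ) (a.eval σ) with h1
    set σ₂ := wr σ₁ (M + 22) ((var (M + 24)).eval σ₁) (b.eval σ₁) with h2
    set σ₃ := wr σ₂ (M + 23) ((var (M + 24)).eval σ₂) (c.eval σ₂) with h3
    have hb' : b.eval σ₁ = b.eval σ := hb.eval_eq fun x hx => wr_of_ne _ _ _ (by omega)
    have hc' : c.eval σ₂ = c.eval σ := hc.eval_eq fun x hx => by
      rw [h2, wr_of_ne _ _ _ (by omega), h1, wr_of_ne _ _ _ (by omega)]
    have hg : σ₃ (M + 24) 0 = σ (M + 24) 0 := by simp [h3, h2, h1, wr_apply]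
    unfold Buf at *
    rw [wr_apply, if_pos ⟨rfl, rfl⟩, hg, List.range_succ, List.map_append, h]
    congr 1
    · apply List.map_congr_left
      intro i hi
      rw [List.mem_range] at hi
      have : i ≠ σ (M + 24) 0 := by omega
      simp [gateAt, h3, h2, h1, wr_apply, QExpr.eval, var, this]
    · simp only [List.map_singleton, gateAt, List.cons.injEq, and_true]
      rw [← hb', ← hc']
      simp [h3, h2, h1, wr_apply, QExpr.eval, var]
  · intro x hx
    rw [wr_of_ne _ _ _ (by omega), wr_of_ne _ _ _ (by omega), wr_of_ne _ _ _ (by omega),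
      wr_of_ne _ _ _ (by omega)]

/-- `M+25` is the current carry qubit, `M+29` the accumulator qubit to which it is added. -/
def rippleStep (M : ℕ) : QProg := .block
  [emit M (var (M + 29)) (var (M + 25)) (.add (var (M + 25)) (.lit 1)),
    emit M (var (M + 25)) (var (M + 25)) (var (M + 29)), incr (M + 25), incr (M + 29)]

/-- `M+26` is the control qubit, `M+27` holds the digits of the coefficient still to be processed,
`M+28` the accumulator qubit at which the next one enters. The condition is the parity of `M+27`,
expressed by truncated subtraction and halving. -/
def addStep (M : ℕ) : QProg := .block
  [.ite (.sub (var (M + 27)) (.add (.half (var (M + 27))) (.half (var (M + 27)))))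
      (emit M (var (M + 26)) (var (M + 26)) (var (M + 25)))
      (emit M (var (M + 25)) (var (M + 25)) (var (M + 25))),
    setv (M + 29) (var (M + 28)),
    .rep (var (M + 7)) (rippleStep M),
    incr (M + 25), setv (M + 27) (.half (var (M + 27))), incr (M + 28)]

def formStep (M : ℕ) : QProg := .block
  [setv (M + 27) (.get (M + 20) (var (M + 26))), setv (M + 28) (var (M + 5)),
    .rep (var (M + 7)) (addStep M), incr (M + 26)]

/-- Write the gates that compute the linear form with the coefficients `(M+20)[p]`. -/
def build (M : ℕ) : QProg := .block
  [setv (M + 24) (.lit 0), setv (M + 25) (var (M + 13)), setv (M + 26) (.lit 0),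
    .rep (var (M + 5)) (formStep M)]

theorem rippleStep_spec {M : ℕ} {σ : Store} {Gs : List Gate} {l f : ℕ} (h : Buf M σ Gs)
    (hf : σ (M + 25) 0 = f) (hl : σ (M + 29) 0 = l) :
    ∃ σ', CDet (rippleStep M) σ σ' ∧ Buf M σ' (Gs ++ [(l, f, f + 1), (f, f, l)]) ∧
      σ' (M + 25) 0 = f + 1 ∧ σ' (M + 29) 0 = l + 1 := by
  obtain ⟨σ₁, d1, b1, e1⟩ := emit_spec (a := var (M + 29)) (b := var (M + 25))
    (c := .add (var (M + 25)) (.lit 1)) (by simp [QExpr.Reads, var]) (by simp [QExpr.Reads, var]) h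
  obtain ⟨σ₂, d2, b2, e2⟩ := emit_spec (a := var (M + 25)) (b := var (M + 25))
    (c := var (M + 29)) (by simp [QExpr.Reads, var]) (by simp [QExpr.Reads, var]) b1
  have e25 : σ₂ (M + 25) 0 = f := by rw [e2 _ (by omega), e1 _ (by omega), hf]
  have e29 : σ₂ (M + 29) 0 = l := by rw [e2 _ (by omega), e1 _ (by omega), hl]
  refine ⟨_, .cons d1 (.cons d2 (.cons (.incr _ _) (.cons (.incr _ _) (.nil _)))), ?_, ?_, ?_⟩
  · refine Buf.congr (σ := σ₂) ?_ fun a h1 h2 => ?_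
    · convert b2 using 1
      simp [QExpr.eval, var, e1, hf, hl]
    · rw [wr_of_ne _ _ _ (by omega), wr_of_ne _ _ _ (by omega)]
  · simp [wr_apply, e25]
  · simp [wr_apply, e29]

theorem rippleLoop_spec {M : ℕ} {σ : Store} {Gs : List Gate} {l f K : ℕ} (h : Buf M σ Gs)
    (hf : σ (M + 25) 0 = f) (hl : σ (M + 29) 0 = l) (hK : σ (M + 7) 0 = K) :
    ∃ σ', CDet (.rep (var (M + 7)) (rippleStep M)) σ σ' ∧ Buf M σ' (Gs ++ ripple l f K) ∧
      σ' (M + 25) 0 = f + K ∧ σ' (M + 29) 0 = l + K := by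
  refine CDet.rep (fun i τ => Buf M τ (Gs ++ ripple l f i) ∧ τ (M + 25) 0 = f + i ∧
    τ (M + 29) 0 = l + i) K (fun i _ τ hτ => ?_) ⟨by simpa [ripple] using h, hf, hl⟩ hK
  obtain ⟨σ', d, h1, h2, h3⟩ := rippleStep_spec hτ.1 hτ.2.1 hτ.2.2
  refine ⟨σ', d, ?_, h2, h3⟩
  rw [ripple_succ, ← List.append_assoc]
  exact h1

theorem addStep_writes (M : ℕ) : (addStep M).Writes fun a => M + 21 ≤ a ∧ a ≤ M + 29 := by
  simp [addStep, QProg.block, QProg.Writes, emit, setv, incr, rippleStep]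

theorem addStep_spec {M : ℕ} {σ : Store} {Gs : List Gate} {l f p v K : ℕ} (h : Buf M σ Gs)
    (hf : σ (M + 25) 0 = f) (hp : σ (M + 26) 0 = p) (hv : σ (M + 27) 0 = v)
    (hl : σ (M + 28) 0 = l) (hK : σ (M + 7) 0 = K) :
    ∃ σ', CDet (addStep M) σ σ' ∧
      Buf M σ' (Gs ++ (loadGate (v.testBit 0) p f :: ripple l f K)) ∧
      σ' (M + 25) 0 = f + (K + 1) ∧ σ' (M + 26) 0 = p ∧ σ' (M + 27) 0 = v / 2 ∧
      σ' (M + 28) 0 = l + 1 := by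
  have h1 : ∃ σ₁, CDet (.ite (.sub (var (M + 27)) (.add (.half (var (M + 27))) (.half (var (M + 27)))))
      (emit M (var (M + 26)) (var (M + 26)) (var (M + 25)))
      (emit M (var (M + 25)) (var (M + 25)) (var (M + 25)))) σ σ₁ ∧
      Buf M σ₁ (Gs ++ [loadGate (v.testBit 0) p f]) ∧ ∀ x, M + 24 < x → σ₁ x = σ x := by
    have hodd : (QExpr.sub (var (M + 27)) (.add (.half (var (M + 27)))
        (.half (var (M + 27))))).eval σ = v % 2 := by
      simp only [QExpr.eval, var, hv]; omega
    rcases Nat.mod_two_eq_zero_or_one v with h0 | h0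
    · obtain ⟨σ', d, b, e⟩ := emit_spec (a := var (M + 25)) (b := var (M + 25))
        (c := var (M + 25)) (by simp [QExpr.Reads, var]) (by simp [QExpr.Reads, var]) h
      refine ⟨σ', .ite_false (by rw [hodd, h0]) d, ?_, e⟩
      simpa [loadGate, Nat.testBit_zero, h0, QExpr.eval, var, hf] using b
    · obtain ⟨σ', d, b, e⟩ := emit_spec (a := var (M + 26)) (b := var (M + 26))
        (c := var (M + 25)) (by simp [QExpr.Reads, var]) (by simp [QExpr.Reads, var]) h
      refine ⟨σ', .ite_true (by rw [hodd, h0]; norm_num) d, ?_, e⟩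
      simpa [loadGate, Nat.testBit_zero, h0, QExpr.eval, var, hf, hp] using b
  obtain ⟨σ₁, d1, b1, e1⟩ := h1
  have d2 := CDet.setv (M + 29) (var (M + 28)) σ₁
  set σ₂ := wr σ₁ (M + 29) 0 ((var (M + 28)).eval σ₁) with h2
  obtain ⟨σ₃, d3, b3, f3, a3⟩ := rippleLoop_spec (M := M) (σ := σ₂)
    (Gs := Gs ++ [loadGate (v.testBit 0) p f]) (l := l) (f := f) (K := K)
    (b1.congr fun a _ _ => by rw [h2, wr_of_ne _ _ _ (by omega)])
    (by simp [h2, wr_apply, e1, hf]) (by simp [h2, wr_apply, QExpr.eval, var, e1, hl])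
    (by
      have := d1.frame (a := M + 7) (X := fun a => M + 21 ≤ a) (by
        simp [QProg.block, QProg.Writes, emit, setv, incr]) (by omega)
      simp [h2, wr_apply, this, hK])
  have fr : ∀ x, (x = M + 26 ∨ x = M + 27 ∨ x = M + 28) → σ₃ x = σ x := by
    intro x hx
    rw [d3.frame (X := fun a => a ≤ M + 25 ∨ a = M + 29) (by
        simp [QProg.block, QProg.Writes, emit, setv, incr, rippleStep]) (by omega),
      h2, wr_of_ne _ _ _ (by omega), e1 _ (by omega)]
  refine ⟨_, .cons d1 (.cons d2 (.cons d3 (.cons (.incr _ _) (.cons (.setv _ _ _) (.cons (.incr _ _)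
    (.nil _)))))), ?_, ?_, ?_, ?_, ?_⟩
  · refine Buf.congr (σ := σ₃) (by simpa using b3) fun a _ _ => ?_
    rw [wr_of_ne _ _ _ (by omega), wr_of_ne _ _ _ (by omega), wr_of_ne _ _ _ (by omega)]
  · simp [wr_apply, f3]; ring
  · simp [wr_apply, fr, hp]
  · simp [wr_apply, QExpr.eval, var, fr, hv]
  · simp [wr_apply, fr, hl]

theorem addLoop_spec {M : ℕ} {σ : Store} {Gs : List Gate} {R f p v K : ℕ} (h : Buf M σ Gs)
    (hf : σ (M + 25) 0 = f) (hp : σ (M + 26) 0 = p) (hv : σ (M + 27) 0 = v)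
    (hl : σ (M + 28) 0 = R) (hK : σ (M + 7) 0 = K) :
    ∃ σ', CDet (.rep (var (M + 7)) (addStep M)) σ σ' ∧
      Buf M σ' (Gs ++ addGates K R p v f K) ∧
      σ' (M + 25) 0 = f + K * (K + 1) ∧ σ' (M + 26) 0 = p := by
  have hrep := CDet.rep (p := addStep M) (e := var (M + 7))
    (fun i τ => Buf M τ (Gs ++ addGates K R p v f i) ∧ τ (M + 25) 0 = f + i * (K + 1) ∧
      τ (M + 26) 0 = p ∧ τ (M + 27) 0 = v / 2 ^ i ∧ τ (M + 28) 0 = R + i ∧ τ (M + 7) 0 = K) K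
    (fun i _ τ hτ => ?_) (σ := σ) ⟨by simpa [addGates] using h, by simpa using hf, hp,
      by simpa using hv, hl, hK⟩ hK
  · obtain ⟨σ', d, h1, h2, h3, -⟩ := hrep
    exact ⟨σ', d, h1, h2, h3⟩
  · obtain ⟨t1, t2, t3, t4, t5, t6⟩ := hτ
    obtain ⟨σ', d, h1, h2, h3, h4, h5⟩ := addStep_spec t1 t2 t3 t4 t5 t6
    refine ⟨σ', d, ?_, by rw [h2]; ring, h3, ?_, h5, ?_⟩
    · rw [addGates_succ, ← List.append_assoc]
      rw [Nat.testBit_div_two_pow, zero_add] at h1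
      exact h1
    · rw [h4, Nat.div_div_eq_div_mul, pow_succ]
    · rw [d.frame (addStep_writes M) (by omega), t6]

theorem build_spec {M : ℕ} {σ : Store} {R K : ℕ} (hR : σ (M + 5) 0 = R) (hK : σ (M + 7) 0 = K)
    (hC : σ (M + 13) 0 = R + 2 * K) :
    ∃ σ', CDet (build M) σ σ' ∧ Buf M σ' (formGates K R (σ (M + 20)) R) := by
  set σ₁ := wr (wr (wr σ (M + 24) 0 0) (M + 25) 0 (R + 2 * K)) (M + 26) 0 0 with h1
  have agree : ∀ a, a ≤ M + 20 → σ₁ a = σ a := fun a ha => by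
    rw [h1, wr_of_ne _ _ _ (by omega), wr_of_ne _ _ _ (by omega), wr_of_ne _ _ _ (by omega)]
  have wform : (formStep M).Writes fun a => M + 21 ≤ a := by
    simp [formStep, addStep, QProg.block, QProg.Writes, emit, setv, incr, rippleStep]
  have hrep := CDet.rep (p := formStep M) (e := var (M + 5))
    (fun i τ => Buf M τ (formGates K R (σ (M + 20)) i) ∧
      τ (M + 25) 0 = R + 2 * K + i * (K * (K + 1)) ∧ τ (M + 26) 0 = i ∧
      ∀ a, a ≤ M + 20 → τ a = σ a) R
    (fun i _ τ hτ => ?_) (σ := σ₁) ⟨by simp [Buf, formGates, h1, wr_apply],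
      by simp [h1, wr_apply], by simp [h1, wr_apply], agree⟩
      (by simp [QExpr.eval, var, agree, hR])
  · obtain ⟨σ₂, d2, b2, -⟩ := hrep
    refine ⟨σ₂, ?_, b2⟩
    refine .cons (.setv _ _ _) (.cons (.setv _ _ _) (.cons (.setv _ _ _) (.cons ?_ (.nil _))))
    simpa [QExpr.eval, var, wr_apply, hC] using d2
  · obtain ⟨t1, t2, t3, t4⟩ := hτ
    have d1 := CDet.setv (M + 27) (.get (M + 20) (var (M + 26))) τ
    set τ₁ := wr τ (M + 27) 0 _ with e1
    have d2 := CDet.setv (M + 28) (var (M + 5)) τ₁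
    set τ₂ := wr τ₁ (M + 28) 0 _ with e2
    have r5 : τ (M + 5) 0 = R := by rw [t4 _ (by omega), hR]
    have r7 : τ (M + 7) 0 = K := by rw [t4 _ (by omega), hK]
    have r20 : τ (M + 20) = σ (M + 20) := t4 _ (by omega)
    obtain ⟨τ₃, d3, b3, f3, p3⟩ := addLoop_spec (M := M) (σ := τ₂)
      (Gs := formGates K R (σ (M + 20)) i) (R := R) (f := R + 2 * K + i * (K * (K + 1))) (p := i)
      (v := σ (M + 20) i) (K := K)
      (t1.congr fun a _ _ => by rw [e2, wr_of_ne _ _ _ (by omega), e1, wr_of_ne _ _ _ (by omega)])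
      (by simp [e2, e1, wr_apply, t2]) (by simp [e2, e1, wr_apply, t3])
      (by simp [e2, e1, wr_apply, QExpr.eval, var, t3, r20])
      (by simp [e2, e1, wr_apply, QExpr.eval, var, r5])
      (by simp [e2, e1, wr_apply, r7])
    have hd : CDet (formStep M) τ _ := .cons d1 (.cons d2 (.cons d3 (.cons (.incr _ _) (.nil _))))
    refine ⟨_, hd, ?_, ?_, ?_, ?_⟩
    · rw [formGates_succ]
      exact b3.congr fun a _ _ => wr_of_ne _ _ _ (by omega)
    · simp [wr_apply, f3]; ring
    · simp [wr_apply, p3]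
    · intro a ha
      rw [hd.frame wform (by omega), t4 a ha]

/-! ### Measuring a digit of a linear form -/

def applyGate (M : ℕ) : QProg :=
  .ccnot 2 (.get (M + 21) (var (M + 30))) 2 (.get (M + 22) (var (M + 30)))
    2 (.get (M + 23) (var (M + 30)))

/-- Measure the binary digit `(M+37)[0]` of the linear form with the coefficients `(M+20)[p]` in
the work qubits. -/
def measForm (M : ℕ) : QProg := .block
  [build M, setv (M + 30) (.lit 0),
    .rep (var (M + 10)) (.block [applyGate M, incr (M + 30)]),
    .meas (M + 31) (.lit 0) 2 (.add (var (M + 5)) (var (M + 37))),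
    .rep (var (M + 10)) (.block [setv (M + 30) (.sub (var (M + 30)) (.lit 1)), applyGate M])]

theorem runG_range_succ (h : ℕ → Gate) (k : ℕ) (S : Ket) :
    runG ((List.range (k + 1)).map h) S = (h k).act (runG ((List.range k).map h) S) := by
  rw [List.range_succ, List.map_append, runG_append]; rfl

theorem applyGate_det (M : ℕ) (σ : Store) (ψ : QVec) :
    Det (applyGate M) σ ψ σ (ψ.mapDomain (gateAt M σ (σ (M + 30) 0)).act) := by
  intro g
  simp only [applyGate, QProg.wp, gateCCX_eq]
  rfl

theorem forward_spec {M : ℕ} {σ : Store} {G : ℕ} (hG : σ (M + 10) 0 = G) (h0 : σ (M + 30) 0 = 0)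
    (ψ : QVec) : ∃ σ', Det (.rep (var (M + 10)) (.block [applyGate M, incr (M + 30)])) σ ψ σ'
      (ψ.mapDomain (runG ((List.range G).map (gateAt M σ)))) ∧ σ' (M + 30) 0 = G := by
  have hrep := Hoare.rep (e := var (M + 10))
    (p := .block [applyGate M, incr (M + 30)])
    (fun i τ φ => (∀ a, a ≠ M + 30 → τ a = σ a) ∧ τ (M + 30) 0 = i ∧
      φ = ψ.mapDomain (runG ((List.range i).map (gateAt M σ)))) G ?_ σ ψ
    ⟨⟨fun _ _ => rfl, h0, by exact Finsupp.mapDomain_id.symm⟩, hG⟩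
  · obtain ⟨σ', ψ', d, h1, h2, rfl⟩ := hrep
    exact ⟨σ', d, h2⟩
  · rintro i - τ φ ⟨h1, h2, rfl⟩
    refine ⟨_, _, (applyGate_det M τ _).seq ((CDet.cons (.incr _ _) (.nil _)) _), ?_, ?_, ?_⟩
    · intro a ha; rw [wr_of_ne _ _ _ ha, h1 a ha]
    · simp [wr_apply, h2]
    · rw [← Finsupp.mapDomain_comp]
      congr 1
      funext S
      rw [runG_range_succ, h2]
      have : gateAt M τ i = gateAt M σ i := by
        unfold gateAt
        rw [h1 _ (by omega), h1 _ (by omega), h1 _ (by omega)]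
      rw [this]
      rfl

/-- The counter starts at the number of gates and is decremented before each use, so the gates are
undone from the last to the first. -/
theorem backward_spec {M : ℕ} {σ : Store} {G : ℕ} (hG : σ (M + 10) 0 = G) (h0 : σ (M + 30) 0 = G)
    (ψ : QVec) : ∃ σ', Det (.rep (var (M + 10))
      (.block [setv (M + 30) (.sub (var (M + 30)) (.lit 1)), applyGate M])) σ
      (ψ.mapDomain (runG ((List.range G).map (gateAt M σ)))) σ' ψ := by
  have hrep := Hoare.rep (e := var (M + 10))
    (p := .block [setv (M + 30) (.sub (var (M + 30)) (.lit 1)), applyGate M])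
    (fun i τ φ => (∀ a, a ≠ M + 30 → τ a = σ a) ∧ τ (M + 30) 0 = G - i ∧
      φ = ψ.mapDomain (runG ((List.range (G - i)).map (gateAt M σ)))) G ?_ σ
    (ψ.mapDomain (runG ((List.range G).map (gateAt M σ))))
    ⟨⟨fun _ _ => rfl, h0, by simp⟩, hG⟩
  · obtain ⟨σ', ψ', d, h1, h2, h3⟩ := hrep
    refine ⟨σ', ?_⟩
    simp only [Nat.sub_self, List.range_zero, List.map_nil] at h3
    have : (runG [] : Ket → Ket) = id := rfl
    rw [this, Finsupp.mapDomain_id] at h3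
    rwa [h3] at d
  · rintro i hi τ φ ⟨h1, h2, rfl⟩
    refine ⟨_, _, (CDet.setv (M + 30) _ τ _).seq ((applyGate_det M _ _).seq (CDet.nil _ _)),
      ?_, ?_, ?_⟩
    · intro a ha; rw [wr_of_ne _ _ _ ha, h1 a ha]
    · simp [wr_apply, QExpr.eval, var, h2]; omega
    · rw [← Finsupp.mapDomain_comp]
      congr 1
      funext S
      obtain ⟨j, hj⟩ : ∃ j, G - i = j + 1 := ⟨G - i - 1, by omega⟩
      have hj' : G - (i + 1) = j := by omega
      rw [hj, hj']
      have hget : ∀ v, gateAt M (wr τ (M + 30) 0 v) = gateAt M σ := by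
        intro v
        funext x
        unfold gateAt
        rw [wr_of_ne _ _ _ (by omega), wr_of_ne _ _ _ (by omega), wr_of_ne _ _ _ (by omega),
          h1 _ (by omega), h1 _ (by omega), h1 _ (by omega)]
      simp only [Function.comp_apply, runG_range_succ, hget, wr_apply]
      simp only [QExpr.eval, var, h2, hj, Nat.add_sub_cancel, and_self, if_true]
      exact ccx_involutive _ _ _ _

theorem measForm_writes (M : ℕ) : (measForm M).Writes fun a => M + 21 ≤ a ∧ a ≤ M + 31 := by
  simp [measForm, build, applyGate, formStep, addStep, QProg.block, QProg.Writes, emit, setv, incr,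
    rippleStep]

/-- Compute, measure, uncompute: the circuit permutes basis states, so projecting in the middle and
then undoing it is the same as filtering by the digit of the form. All carries are cleared on the
way back, and the only other trace is the classical outcome. -/
theorem measForm_wp {M : ℕ} {σ : Store} {R K t : ℕ} (hR : σ (M + 5) 0 = R)
    (hK : σ (M + 7) 0 = K) (hC : σ (M + 13) 0 = R + 2 * K)
    (hG : σ (M + 10) 0 = R * (K * (1 + 2 * K))) (ht : σ (M + 37) 0 = t) (htK : t < K)
    {ψ : QVec} (hψ : ∀ S ∈ ψ.support, ∀ p, R ≤ p → ((2, p) : Qubit) ∉ S) :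
    ∃ σ' : Bool → Store, (∀ g, (measForm M).wp g σ ψ =
        g (σ' false) (ψ.filter fun S =>
          (∑ p ∈ Finset.range R, ind S p * σ (M + 20) p).testBit t = false) +
        g (σ' true) (ψ.filter fun S =>
          (∑ p ∈ Finset.range R, ind S p * σ (M + 20) p).testBit t = true)) ∧
      (∀ o, σ' o (M + 31) 0 = o.toNat) ∧
      ∀ o a, a < M + 21 ∨ M + 31 < a → σ' o a = σ a := by
  obtain ⟨σ₁, d1, b1⟩ := build_spec hR hK hC
  have fr1 : ∀ a, a < M + 21 ∨ M + 29 < a → σ₁ a = σ a := fun a ha =>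
    d1.frame (X := fun a => M + 21 ≤ a ∧ a ≤ M + 29) (by
      simp [build, formStep, addStep, QProg.block, QProg.Writes, emit, setv, incr,
        rippleStep]) (by omega)
  have hlen : σ₁ (M + 24) 0 = R * (K * (1 + 2 * K)) := by
    have := congrArg List.length b1
    rw [formGates_length, List.length_map, List.length_range] at this
    exact this.symm
  unfold Buf at b1
  rw [hlen] at b1
  set G := R * (K * (1 + 2 * K)) with hGdef
  set Gs := formGates K R (σ (M + 20)) R with hGs
  set σ₂ := wr σ₁ (M + 30) 0 0 with h2
  have hgate : gateAt M σ₂ = gateAt M σ₁ := by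
    funext x
    unfold gateAt
    rw [h2, wr_of_ne _ _ _ (by omega), wr_of_ne _ _ _ (by omega), wr_of_ne _ _ _ (by omega)]
  obtain ⟨σ₃, d3, c3⟩ := forward_spec (M := M) (σ := σ₂) (G := G)
    (by rw [h2, wr_of_ne _ _ _ (by omega), fr1 _ (by omega), hG]) (by simp [h2, wr_apply]) ψ
  rw [hgate, ← b1] at d3
  have fr3 : ∀ a, a ≠ M + 30 → σ₃ a = σ₁ a := fun a ha => by
    rw [d3.frame (X := fun a => a = M + 30) (by
      simp [applyGate, QProg.block, QProg.Writes, setv, incr]) ha, h2, wr_of_ne _ _ _ ha]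
  have hd : Det (.block [build M, setv (M + 30) (.lit 0),
      .rep (var (M + 10)) (.block [applyGate M, incr (M + 30)])]) σ ψ σ₃ (ψ.mapDomain (runG Gs)) :=
    (d1 _).seq ((CDet.setv _ _ _ _).seq (d3.seq (CDet.nil _ _)))
  let σ₄ : Bool → Store := fun o => wr σ₃ (M + 31) 0 o.toNat
  have hback : ∀ (o : Bool) (φ : QVec), ∃ σ', Det (.rep (var (M + 10))
      (.block [setv (M + 30) (.sub (var (M + 30)) (.lit 1)), applyGate M])) (σ₄ o)
      (φ.mapDomain (runG Gs)) σ' φ := by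
    intro o φ
    obtain ⟨σ', d⟩ := backward_spec (M := M) (σ := σ₄ o) (G := G)
      (by simp only [σ₄]; rw [wr_of_ne _ _ _ (by omega), fr3 _ (by omega), fr1 _ (by omega), hG])
      (by simp only [σ₄]; rw [wr_of_ne _ _ _ (by omega), c3]) φ
    have : gateAt M (σ₄ o) = gateAt M σ₁ := by
      funext x
      unfold gateAt
      simp only [σ₄]
      rw [wr_of_ne _ _ _ (by omega), wr_of_ne _ _ _ (by omega), wr_of_ne _ _ _ (by omega),
        fr3 _ (by omega), fr3 _ (by omega), fr3 _ (by omega)]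
    rw [this, ← b1] at d
    exact ⟨σ', d⟩
  -- Basis states in the support have clear qubits from `R` on, which the circuit needs; elsewhere
  -- both sides have coefficient 0.
  have hproj : ∀ o : Bool, projQubit (2, R + t) o (ψ.mapDomain (runG Gs)) =
      (ψ.filter fun S => (∑ p ∈ Finset.range R, ind S p * σ (M + 20) p).testBit t =
        o).mapDomain (runG Gs) := by
    intro o
    unfold projQubit
    rw [filter_mapDomain (runG_injective Gs)]
    congr 1
    apply Finsupp.ext
    intro S
    by_cases hS : S ∈ ψ.support
    · have hb := formGates_testBit (W := σ (M + 20)) S (hψ S hS) htK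
      simp only [Finsupp.filter_apply, hGs, hb]
      cases o <;> simp
    · rw [Finsupp.notMem_support_iff] at hS
      simp [Finsupp.filter_apply, hS]
  choose back hbackd using hback
  let φ : Bool → QVec := fun o => ψ.filter fun S =>
    (∑ p ∈ Finset.range R, ind S p * σ (M + 20) p).testBit t = o
  refine ⟨fun o => back o (φ o), fun g => ?_, fun o => ?_, fun o a ha => ?_⟩
  · have e1 : (measForm M).wp g σ ψ = (QProg.block [build M, setv (M + 30) (.lit 0),
        .rep (var (M + 10)) (.block [applyGate M, incr (M + 30)])]).wp
        (QProg.wp (.block [.meas (M + 31) (.lit 0) 2 (.add (var (M + 5)) (var (M + 37))),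
          .rep (var (M + 10)) (.block [setv (M + 30) (.sub (var (M + 30)) (.lit 1)),
            applyGate M])]) g) σ ψ := rfl
    have e2 : (QExpr.add (var (M + 5)) (var (M + 37))).eval σ₃ = R + t := by
      simp only [QExpr.eval, var]
      rw [fr3 _ (by omega), fr1 _ (by omega), fr3 _ (by omega), fr1 _ (by omega), hR, ht]
    rw [e1, hd]
    simp only [QProg.block]
    change QProg.wp _ _ _ _ + QProg.wp _ _ _ _ = _
    rw [e2, hproj, hproj]
    congr 1
    · exact ((hbackd false (φ false)).seq (CDet.nil _ _)) g
    · exact ((hbackd true (φ true)).seq (CDet.nil _ _)) g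
  · change back o (φ o) _ _ = _
    rw [(hbackd o (φ o)).frame (X := fun a => a = M + 30) (by
      simp [applyGate, QProg.block, QProg.Writes, setv]) (by omega)]
    simp [σ₄, wr_apply]
  · change back o (φ o) _ = _
    rw [(hbackd o (φ o)).frame (X := fun a => a = M + 30) (by
      simp [applyGate, QProg.block, QProg.Writes, setv]) (by omega)]
    simp only [σ₄]
    rw [wr_of_ne _ _ _ (by omega), fr3 _ (by omega), fr1 _ (by omega)]

/-! ### Preparing a uniform superposition over the residues -/

theorem CDet.tri {p : QProg} {I J : Store → QVec → Prop}
    (h : ∀ σ ψ, I σ ψ → ∃ σ', CDet p σ σ' ∧ J σ' ψ) : Tri 1 I p J := by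
  intro σ ψ hI
  obtain ⟨σ', d, hJ⟩ := h σ ψ hI
  rw [d, msr_of hJ, one_mul]

theorem sum_testBit (v L : ℕ) :
    ∑ k ∈ Finset.range L, (v.testBit k).toNat * 2 ^ k = v % 2 ^ L := by
  induction L with
  | zero => simp [Nat.mod_one]
  | succ L ih =>
    rw [Finset.sum_range_succ, ih, Nat.mod_pow_succ, ← Nat.toNat_testBit, mul_comm]

theorem ind_eq_testBit {S A : Ket} {base v k : ℕ} (hS : S = A ∪ bits base v)
    (hA : ((2, base + k) : Qubit) ∉ A) : ind S (base + k) = (v.testBit k).toNat := by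
  unfold ind
  subst hS
  simp only [Finset.mem_union, hA, mem_bits_add, false_or]
  cases v.testBit k <;> rfl

theorem sum_block {R base L : ℕ} (h : base + L ≤ R) {f g : ℕ → ℕ}
    (hf : ∀ p < R, f p = if base ≤ p ∧ p < base + L then g (p - base) else 0) :
    ∑ p ∈ Finset.range R, f p = ∑ k ∈ Finset.range L, g k := by
  have h1 : ∑ k ∈ Finset.range L, g k = ∑ p ∈ (Finset.range L).image (base + ·), g (p - base) := by
    rw [Finset.sum_image (fun a _ b _ h => Nat.add_left_cancel h)]
    simp
  rw [h1]
  symm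
  have hsub : (Finset.range L).image (base + ·) ⊆ Finset.range R := by
    intro x hx
    simp only [Finset.mem_image, Finset.mem_range] at hx ⊢
    omega
  rw [← Finset.sum_subset hsub (f := f)]
  · refine Finset.sum_congr rfl fun p hp => ?_
    simp only [Finset.mem_image, Finset.mem_range] at hp
    rw [hf p (by omega), if_pos (by omega)]
  · intro p hp hp'
    simp only [Finset.mem_image, Finset.mem_range, not_exists, not_and] at hp hp'
    rw [hf p hp, if_neg]
    rintro ⟨h2, h3⟩
    exact hp' (p - base) (by omega) (by omega)

theorem form_block {R base L al v : ℕ} (h : base + L ≤ R) {W : ℕ → ℕ}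
    (hW : ∀ p < R, W p = if base ≤ p ∧ p < base + L then al * 2 ^ (p - base) else 0)
    (hv : v < 2 ^ L) {A : Ket} (hA : ∀ p, base ≤ p → ((2, p) : Qubit) ∉ A) :
    ∑ p ∈ Finset.range R, ind (A ∪ bits base v) p * W p = v * al := by
  rw [sum_block h (f := fun p => ind (A ∪ bits base v) p * W p)
    (g := fun k => al * ((v.testBit k).toNat * 2 ^ k))]
  · rw [← Finset.mul_sum, sum_testBit, Nat.mod_eq_of_lt hv, mul_comm]
  · intro p hp
    rw [hW p hp]
    split_ifs with hb
    · obtain ⟨k, rfl⟩ : ∃ k, p = base + k := ⟨p - base, by omega⟩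
      rw [ind_eq_testBit rfl (hA _ (by omega))]
      simp only [Nat.add_sub_cancel_left]
      ring
    · rfl

/-- Comparison by multiplication. With a = ⌊2^K / q⌋ ≥ q one has (q - 1)(a + 1) < 2^K < q(a + 1), so
v(a + 1) reaches 2^K exactly when q ≤ v. Since v ≤ 2(q - 1), it stays below 2^(K+1), and digit `K`
alone decides. Thus the comparison with `q` is a digit of a linear form, like the row measurements.
-/
theorem testBit_scaled {q L K v : ℕ} (hL : 2 ^ L < 2 * q) (hK : q * q ≤ 2 ^ K)
    (hv : v < 2 ^ L) : (v * (2 ^ K / q + 1)).testBit K = true ↔ q ≤ v := by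
  have hq : 0 < q := by
    have := Nat.pos_of_ne_zero (two_pow_pos' L)
    omega
  set a := 2 ^ K / q with ha
  have h1 : q * a ≤ 2 ^ K := Nat.mul_div_le _ _
  have h2 : 2 ^ K < q * (a + 1) := Nat.lt_mul_div_succ _ hq
  have h3 : q ≤ a := by rw [ha, Nat.le_div_iff_mul_le hq]; exact hK
  obtain ⟨q', rfl⟩ : ∃ q', q = q' + 1 := ⟨q - 1, by omega⟩
  have h4 : q' * (a + 1) < 2 ^ K := by nlinarith
  have h5 : v * (a + 1) ≤ (2 * q') * (a + 1) := Nat.mul_le_mul_right _ (by omega)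
  rw [Nat.testBit_eq_decide_div_mod_eq, decide_eq_true_iff]
  constructor
  · intro h
    by_contra hlt
    push Not at hlt
    have h6 : v * (a + 1) ≤ q' * (a + 1) := Nat.mul_le_mul_right _ (by omega)
    rw [Nat.div_eq_of_lt (by omega)] at h
    omega
  · intro h
    have h6 : (q' + 1) * (a + 1) ≤ v * (a + 1) := Nat.mul_le_mul_right _ h
    have : v * (a + 1) / 2 ^ K = 1 := by
      apply Nat.div_eq_of_lt_le
      · omega
      · rw [mul_assoc] at h5; omega
    rw [this]
where
  two_pow_pos' (L : ℕ) : 2 ^ L ≠ 0 := by positivity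

def hadBlock (M : ℕ) : QProg := .block
  [setv (M + 34) (var (M + 33)),
    .rep (var (M + 3)) (.block [.had 2 (var (M + 34)), incr (M + 34)])]

/-- Measure a block of qubits and set it to zero. -/
def resetBlock (M : ℕ) : QProg := .block
  [setv (M + 34) (var (M + 33)),
    .rep (var (M + 3)) (.block [.meas (M + 31) (.lit 0) 2 (var (M + 34)),
      .ite (var (M + 31)) (.not 2 (var (M + 34))) .skip, incr (M + 34)])]

/-- One attempt to prepare a uniform superposition over the numbers below `q`; the flag is set in
case of success. -/
def attempt (M : ℕ) : QProg := .ite (var (M + 32)) .skip (.block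
  [hadBlock M, setv (M + 37) (var (M + 6)), measForm M,
    .ite (var (M + 31)) (resetBlock M) (setv (M + 32) (.lit 1))])

theorem hadBlock_spec {M : ℕ} {σ : Store} {base L : ℕ} (hb : σ (M + 33) 0 = base)
    (hL : σ (M + 3) 0 = L) {Ω : Finset Ket}
    (hΩ : ∀ S ∈ Ω, ∀ p, base ≤ p → ((2, p) : Qubit) ∉ S) (c : ℂ) :
    ∃ σ' c', Det (hadBlock M) σ (uni c Ω) σ'
        (uni c' (prodSet Ω (nums base (Finset.range (2 ^ L))))) ∧
      (uni c' (prodSet Ω (nums base (Finset.range (2 ^ L))))).normSq = (uni c Ω).normSq := by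
  have hrep := Hoare.rep (e := var (M + 3))
    (p := .block [.had 2 (var (M + 34)), incr (M + 34)])
    (fun i τ φ => τ (M + 34) 0 = base + i ∧
      ∃ c', φ = uni c' (prodSet Ω (nums base (Finset.range (2 ^ i)))) ∧
        φ.normSq = (uni c Ω).normSq) L ?_ (wr σ (M + 34) 0 base) (uni c Ω)
    ⟨⟨by simp [wr_apply], c, by
      have : nums base (Finset.range (2 ^ 0)) = {∅} := by simp [nums, bits_zero]
      rw [this, prodSet_singleton_empty], rfl⟩, by
      simp [QExpr.eval, var, wr_apply, hL]⟩
  · obtain ⟨σ', ψ', d, -, c', rfl, h3⟩ := hrep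
    refine ⟨σ', c', ?_, h3⟩
    have h1 := CDet.setv (M + 34) (var (M + 33)) σ
    simp only [QExpr.eval, var, hb] at h1
    exact (h1 _).seq (d.seq (CDet.nil _ _))
  · rintro i hi τ φ ⟨h1, c', rfl, h2⟩
    obtain ⟨e1, e2⟩ := gateH_prodSet c' Ω base i fun S hS => hΩ S hS _ (by omega)
    refine ⟨wr τ (M + 34) 0 (base + i + 1), _, fun g => ?_, ?_, _, e1, ?_⟩
    · simp only [QProg.block, QProg.wp, incr, setv, QExpr.eval, var, h1]
    · simp [wr_apply]; ring
    · rw [e2, h2]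

theorem resetStep_wp (M : ℕ) (σ : Store) (ψ : QVec) (g : Store → QVec → ℝ) :
    (QProg.block [.meas (M + 31) (.lit 0) 2 (var (M + 34)),
      .ite (var (M + 31)) (.not 2 (var (M + 34))) .skip, incr (M + 34)]).wp g σ ψ =
    g (wr (wr σ (M + 31) 0 0) (M + 34) 0 (σ (M + 34) 0 + 1))
      (projQubit (2, σ (M + 34) 0) false ψ) +
    g (wr (wr σ (M + 31) 0 1) (M + 34) 0 (σ (M + 34) 0 + 1))
      (gateX (2, σ (M + 34) 0) (projQubit (2, σ (M + 34) 0) true ψ)) := by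
  simp [QProg.block, QProg.wp, incr, setv, QExpr.eval, var, wr_apply]

/-- Measuring a qubit splits `Y` into the strings with and without it, and after the correcting flip
neither part contains it. The squared norms of the two outcomes add up to the whole, so no weight is
lost. -/
theorem resetBlock_tri {M : ℕ} {base L : ℕ} {σ₀ : Store} (hb : σ₀ (M + 33) 0 = base)
    (hL : σ₀ (M + 3) 0 = L) {Ω : Finset Ket}
    (hΩ : ∀ S ∈ Ω, ∀ p, base ≤ p → ((2, p) : Qubit) ∉ S) :
    Tri 1 (fun σ ψ => σ = σ₀ ∧ ∃ c Y, ψ = uni c (prodSet Ω Y) ∧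
        ∀ B ∈ Y, ∀ x ∈ B, x.1 = 2 ∧ base ≤ x.2 ∧ x.2 < base + L) (resetBlock M)
      (fun _ ψ => ∃ c, ψ = uni c Ω) := by
  let J : ℕ → Store → QVec → Prop := fun i τ φ => τ (M + 34) 0 = base + i ∧
    ∃ c Y, φ = uni c (prodSet Ω Y) ∧
      ∀ B ∈ Y, ∀ x ∈ B, x.1 = 2 ∧ base + i ≤ x.2 ∧ x.2 < base + L
  have hrep := Tri.rep (κ := 1) zero_le_one (e := var (M + 3))
    (p := .block [.meas (M + 31) (.lit 0) 2 (var (M + 34)),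
      .ite (var (M + 31)) (.not 2 (var (M + 34))) .skip, incr (M + 34)]) J L ?_
  · rw [one_pow] at hrep
    have h1 : Tri 1 (fun σ ψ => σ = σ₀ ∧ ∃ c Y, ψ = uni c (prodSet Ω Y) ∧
        ∀ B ∈ Y, ∀ x ∈ B, x.1 = 2 ∧ base ≤ x.2 ∧ x.2 < base + L)
        (setv (M + 34) (var (M + 33)))
        (fun σ ψ => J 0 σ ψ ∧ (var (M + 3)).eval σ = L) := by
      apply CDet.tri
      rintro σ ψ ⟨rfl, c, Y, h2, h3⟩
      refine ⟨_, CDet.setv _ _ _, ⟨?_, c, Y, h2, h3⟩, ?_⟩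
      · simp [wr_apply, QExpr.eval, var, hb]
      · simp [wr_apply, QExpr.eval, var, hL]
    have h2 : Tri 1 (J L) (.block []) (fun _ ψ => ∃ c, ψ = uni c Ω) := by
      apply CDet.tri
      rintro σ ψ ⟨-, c, Y, rfl, h3⟩
      refine ⟨σ, CDet.nil σ, ?_⟩
      have hY : Y ⊆ {∅} := by
        intro B hB
        rw [Finset.mem_singleton, Finset.eq_empty_iff_forall_notMem]
        intro x hx
        have := h3 B hB x hx
        omega
      rcases Finset.subset_singleton_iff.1 hY with rfl | rfl
      -- Outcomes of probability zero are branches too; there `Y` is empty and the zero vector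
      -- counts as `Ω` with amplitude 0.
      · exact ⟨0, by rw [prodSet_empty, uni_empty, uni_zero]⟩
      · exact ⟨c, by rw [prodSet_singleton_empty]⟩
    have := h1.seq (by norm_num) (hrep.seq zero_le_one h2)
    simpa [resetBlock, QProg.block] using this
  · rintro i hi τ φ ⟨h1, c, Y, rfl, h3⟩
    have hp : ∀ o : Bool, projQubit (2, base + i) o (uni c (prodSet Ω Y)) =
        uni c (prodSet Ω (Y.filter fun B => ((2, base + i) : Qubit) ∈ B ↔ o = true)) := by
      intro o
      unfold projQubit
      rw [filter_uni, filter_prodSet _ (fun B => ((2, base + i) : Qubit) ∈ B ↔ o = true)]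
      intro A hA B _
      have := hΩ A hA (base + i) (by omega)
      simp [this]
    have hX : gateX (2, base + i) (projQubit (2, base + i) true (uni c (prodSet Ω Y))) =
        uni c (prodSet Ω ((Y.filter fun B => ((2, base + i) : Qubit) ∈ B ↔ true = true).image
          fun B => B.erase (2, base + i))) := by
      rw [hp, gateX_eq, mapDomain_uni _ _ (symmDiff_singleton_involutive _).injective]
      congr 1
      ext S
      simp only [Finset.mem_image, mem_prodSet]
      have hkey : ∀ A ∈ Ω, ∀ B, ((2, base + i) : Qubit) ∈ B →
          symmDiff (A ∪ B) {((2, base + i) : Qubit)} = A ∪ B.erase (2, base + i) := by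
        intro A hA B hB
        have hn := hΩ A hA (base + i) (by omega)
        ext x
        rw [mem_symmDiff_singleton]
        by_cases hx : x = (2, base + i)
        · subst hx; simp [hB, hn]
        · simp [hx]
      constructor
      · rintro ⟨_, ⟨A, hA, B, hB, rfl⟩, rfl⟩
        refine ⟨A, hA, _, ⟨B, hB, rfl⟩, (hkey A hA B ?_).symm⟩
        simpa using (Finset.mem_filter.1 hB).2
      · rintro ⟨A, hA, _, ⟨B, hB, rfl⟩, rfl⟩
        refine ⟨_, ⟨A, hA, B, hB, rfl⟩, hkey A hA B ?_⟩
        simpa using (Finset.mem_filter.1 hB).2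
    rw [resetStep_wp, h1, msr_of, msr_of, one_mul, gateX_eq,
      QVec.normSq_mapDomain (symmDiff_singleton_involutive _).injective, projQubit_normSq]
    · refine ⟨by simp [wr_apply]; ring, c, _, hX, ?_⟩
      intro B hB x hx
      obtain ⟨B', hB', rfl⟩ := Finset.mem_image.1 hB
      rw [Finset.mem_erase] at hx
      have h4 := h3 B' (Finset.mem_filter.1 hB').1 x hx.2
      refine ⟨h4.1, ?_, h4.2.2⟩
      have : x.2 ≠ base + i := fun h => hx.1 (Prod.ext h4.1 h)
      omega
    · refine ⟨by simp [wr_apply]; ring, c, _, hp false, ?_⟩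
      intro B hB x hx
      rw [Finset.mem_filter] at hB
      have h4 := h3 B hB.1 x hx
      refine ⟨h4.1, ?_, h4.2.2⟩
      have : x.2 ≠ base + i := by
        intro h
        have hxe : x = (2, base + i) := Prod.ext h4.1 h
        have := hB.2
        simp only [Bool.false_eq_true, iff_false] at this
        exact this (hxe ▸ hx)
      omega

/-- Values of the private constants. -/
structure Consts (M : ℕ) (σ : Store) (n m q L K r T : ℕ) : Prop where
  hn : σ M 0 = n
  hm : σ (M + 1) 0 = m
  hq : σ (M + 2) 0 = q
  hL : σ (M + 3) 0 = L
  hN : σ (M + 4) 0 = n * L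
  hR : σ (M + 5) 0 = n * L + 1
  hK : σ (M + 6) 0 = K
  hK1 : σ (M + 7) 0 = K + 1
  hr : σ (M + 8) 0 = r
  hT : σ (M + 9) 0 = T
  hG : σ (M + 10) 0 = (n * L + 1) * ((K + 1) * (1 + 2 * (K + 1)))
  hC : σ (M + 13) 0 = n * L + 1 + 2 * (K + 1)
  hal : σ (M + 14) 0 = 2 ^ K / q + 1

theorem Consts.congr {M : ℕ} {σ τ : Store} {n m q L K r T : ℕ} (h : Consts M σ n m q L K r T)
    (hs : ∀ a, a < M + 20 → τ a = σ a) : Consts M τ n m q L K r T := by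
  constructor
  all_goals rw [hs _ (by omega)]
  exacts [h.hn, h.hm, h.hq, h.hL, h.hN, h.hR, h.hK, h.hK1, h.hr, h.hT, h.hG, h.hC, h.hal]

theorem Consts.measForm_wp {M : ℕ} {σ : Store} {n m q L K r T t : ℕ}
    (h : Consts M σ n m q L K r T) (ht : σ (M + 37) 0 = t) (htK : t ≤ K)
    {ψ : QVec} (hψ : ∀ S ∈ ψ.support, ∀ p, n * L + 1 ≤ p → ((2, p) : Qubit) ∉ S) :
    ∃ σ' : Bool → Store, (∀ g, (measForm M).wp g σ ψ =
        g (σ' false) (ψ.filter fun S =>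
          (∑ p ∈ Finset.range (n * L + 1), ind S p * σ (M + 20) p).testBit t = false) +
        g (σ' true) (ψ.filter fun S =>
          (∑ p ∈ Finset.range (n * L + 1), ind S p * σ (M + 20) p).testBit t = true)) ∧
      (∀ o, σ' o (M + 31) 0 = o.toNat) ∧
      ∀ o a, a < M + 21 ∨ M + 31 < a → σ' o a = σ a :=
  _root_.measForm_wp h.hR h.hK1 h.hC h.hG ht (by omega) hψ

/-! ### Rejection sampling of a residue below `q` -/

section Attempt

variable {M : ℕ} {σ₀ : Store} {n m q L K r T base : ℕ} {Ω : Finset Ket}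

/-- No success yet. -/
def Pending (M : ℕ) (σ₀ : Store) (Ω : Finset Ket) : Store → QVec → Prop := fun σ ψ =>
  (∀ a, a < M + 21 ∨ a = M + 33 → σ a = σ₀ a) ∧ σ (M + 32) 0 = 0 ∧ ∃ c, ψ = uni c Ω

/-- Success. -/
def Ready (M q base : ℕ) (σ₀ : Store) (Ω : Finset Ket) : Store → QVec → Prop := fun σ ψ =>
  (∀ a, a < M + 21 ∨ a = M + 33 → σ a = σ₀ a) ∧ σ (M + 32) 0 = 1 ∧
    ∃ c, ψ = uni c (prodSet Ω (nums base (Finset.range q)))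

/-- Two estimates are needed for the iteration: success takes at least half of the squared norm, and
success together with a clean return to the initial state takes all of it. -/
theorem attempt_spec (hc : Consts M σ₀ n m q L K r T) (hb : σ₀ (M + 33) 0 = base)
    (hbase : base + L ≤ n * L + 1) (hLq : q ≤ 2 ^ L) (hL : 2 ^ L < 2 * q) (hK : q * q ≤ 2 ^ K)
    (hW : ∀ p < n * L + 1, σ₀ (M + 20) p =
      if base ≤ p ∧ p < base + L then (2 ^ K / q + 1) * 2 ^ (p - base) else 0)
    (hΩ : ∀ S ∈ Ω, ∀ p, base ≤ p → ((2, p) : Qubit) ∉ S) {σ : Store} {ψ : QVec}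
    (h : Pending M σ₀ Ω σ ψ) :
    ψ.normSq / 2 ≤ (attempt M).wp (msr (Ready M q base σ₀ Ω)) σ ψ ∧
    ψ.normSq ≤ (attempt M).wp (fun τ φ => msr (Ready M q base σ₀ Ω) τ φ +
      msr (Pending M σ₀ Ω) τ φ) σ ψ := by
  obtain ⟨hfr, hdone, c, rfl⟩ := h
  obtain ⟨σ₁, c₁, d1, hn1⟩ := hadBlock_spec (M := M) (σ := σ) (base := base) (L := L)
    (by rw [hfr _ (.inr rfl), hb]) (by rw [hfr _ (.inl (by omega)), hc.hL]) hΩ c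
  have fr1 : ∀ a, a ≠ M + 34 → σ₁ a = σ a := fun a ha =>
    d1.frame (X := fun a => a = M + 34)
      (by simp [hadBlock, QProg.block, QProg.Writes, setv, incr]) ha
  set Y := nums base (Finset.range (2 ^ L)) with hY
  set σ₂ := wr σ₁ (M + 37) 0 K with h2
  have fr2 : ∀ a, a < M + 21 ∨ a = M + 33 → σ₂ a = σ₀ a := fun a ha => by
    rw [h2, wr_of_ne _ _ _ (by omega), fr1 _ (by omega), hfr _ ha]
  have hc2 : Consts M σ₂ n m q L K r T := hc.congr fun a ha => fr2 a (.inl (by omega))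
  have hmemY : ∀ B ∈ Y, ∃ v < 2 ^ L, B = bits base v := by
    intro B hB
    simp only [hY, nums, Finset.mem_image, Finset.mem_range] at hB
    obtain ⟨v, hv, rfl⟩ := hB
    exact ⟨v, hv, rfl⟩
  have hsupp : ∀ S ∈ (uni c₁ (prodSet Ω Y)).support, ∀ p, n * L + 1 ≤ p →
      ((2, p) : Qubit) ∉ S := by
    intro S hS p hp hx
    obtain ⟨A, hA, B, hB, rfl⟩ := mem_prodSet.1 (uni_support _ _ hS)
    obtain ⟨v, hv, rfl⟩ := hmemY B hB
    rcases Finset.mem_union.1 hx with hx | hx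
    · exact hΩ A hA p (by omega) hx
    · have := lt_of_mem_bits hv hx
      simp at this
      omega
  obtain ⟨σ₃, hwp, ho, fr3⟩ := hc2.measForm_wp (t := K) (by simp [h2, wr_apply]) le_rfl hsupp
  have hform : ∀ o : Bool, (uni c₁ (prodSet Ω Y)).filter (fun S =>
      (∑ p ∈ Finset.range (n * L + 1), ind S p * σ₂ (M + 20) p).testBit K = o) =
      uni c₁ (prodSet Ω (nums base ((Finset.range (2 ^ L)).filter fun v => (q ≤ v ↔ o = true)))) := by
    intro o
    rw [filter_uni]
    congr 1
    ext S
    simp only [Finset.mem_filter, mem_prodSet, nums, hY, Finset.mem_image, Finset.mem_range]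
    have key : ∀ A ∈ Ω, ∀ v < 2 ^ L,
        ((∑ p ∈ Finset.range (n * L + 1), ind (A ∪ bits base v) p * σ₂ (M + 20) p).testBit K = o ↔
          (q ≤ v ↔ o = true)) := by
      intro A hA v hv
      rw [fr2 _ (.inl (by omega)), form_block hbase hW hv (hΩ A hA)]
      have := testBit_scaled hL hK hv
      rw [← this]
      cases o <;> simp
    constructor
    · rintro ⟨⟨A, hA, _, ⟨v, hv, rfl⟩, rfl⟩, hs⟩
      exact ⟨A, hA, _, ⟨v, ⟨hv, (key A hA v hv).1 hs⟩, rfl⟩, rfl⟩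
    · rintro ⟨A, hA, _, ⟨v, ⟨hv, hs⟩, rfl⟩, rfl⟩
      exact ⟨⟨A, hA, _, ⟨v, hv, rfl⟩, rfl⟩, (key A hA v hv).2 hs⟩
  have hlow : (Finset.range (2 ^ L)).filter (fun v => (q ≤ v ↔ false = true)) = Finset.range q := by
    ext v; simp; omega
  have hsplit : (uni c₁ (prodSet Ω Y)).normSq =
      (uni c₁ (prodSet Ω (nums base (Finset.range q)))).normSq +
      (uni c₁ (prodSet Ω (nums base ((Finset.range (2 ^ L)).filter fun v =>
        (q ≤ v ↔ true = true))))).normSq := by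
    rw [← hform true, ← hlow, ← hform false, ← QVec.normSq_filter_add (fun S =>
      (∑ p ∈ Finset.range (n * L + 1), ind S p * σ₂ (M + 20) p).testBit K = false)]
    congr 2
    apply Finsupp.ext
    intro S
    simp [Finsupp.filter_apply]
  -- Of the 2^L < 2q equally weighted strings, the `q` smallest are accepted.
  have hhalf : (uni c₁ (prodSet Ω Y)).normSq / 2 ≤
      (uni c₁ (prodSet Ω (nums base (Finset.range q)))).normSq := by
    have hsep : ∀ S ∈ Ω, ∀ a ∈ S, ¬ (a.1 = 2 ∧ base ≤ a.2) := by
      rintro S hS ⟨x, p⟩ ha ⟨h1, h2⟩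
      simp only at h1 h2
      subst h1
      exact hΩ S hS p h2 ha
    have hsep' : ∀ s : Finset ℕ, ∀ S ∈ nums base s, ∀ a ∈ S, (a.1 = 2 ∧ base ≤ a.2) := by
      intro s S hS a ha
      obtain ⟨v, -, rfl⟩ := Finset.mem_image.1 hS
      have := mem_bits.1 ha
      exact ⟨this.1, this.2.1⟩
    rw [normSq_uni, normSq_uni, card_prodSet hsep (hsep' _), card_prodSet hsep (hsep' _),
      card_nums, card_nums, Finset.card_range, Finset.card_range]
    have : ((2 : ℝ) ^ L) ≤ 2 * q := by exact_mod_cast hL.le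
    push_cast
    have h0 : 0 ≤ ‖c₁‖ ^ 2 * (Ω.card : ℝ) := by positivity
    nlinarith [mul_le_mul_of_nonneg_left this h0]
  have hfin : ∀ g : Store → QVec → ℝ, (attempt M).wp g σ (uni c Ω) =
      g (wr (σ₃ false) (M + 32) 0 1) (uni c₁ (prodSet Ω (nums base (Finset.range q)))) +
      (resetBlock M).wp g (σ₃ true) (uni c₁ (prodSet Ω (nums base
        ((Finset.range (2 ^ L)).filter fun v => (q ≤ v ↔ true = true))))) := by
    intro g
    have hK' : (var (M + 6)).eval σ₁ = K := by
      simp only [QExpr.eval, var]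
      rw [fr1 _ (by omega), hfr _ (.inl (by omega)), hc.hK]
    simp only [attempt, QProg.block, QProg.wp]
    rw [if_neg (by simp [QExpr.eval, var, hdone]), d1]
    simp only [setv, QProg.wp, hK', QExpr.eval]
    rw [← h2, hwp, hform, hform, hlow]
    simp [var, QExpr.eval, ho]
  have hready : Ready M q base σ₀ Ω (wr (σ₃ false) (M + 32) 0 1)
      (uni c₁ (prodSet Ω (nums base (Finset.range q)))) :=
    ⟨fun a ha => by rw [wr_of_ne _ _ _ (by omega), fr3 _ _ (by omega), fr2 a ha],
      by simp [wr_apply], c₁, rfl⟩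
  have hreset := Tri.frame (p := resetBlock M) (X := fun a => a = M + 31 ∨ a = M + 34)
    (by simp [resetBlock, QProg.block, QProg.Writes, setv, incr]) (σ₃ true)
    ((resetBlock_tri (M := M) (σ₀ := σ₃ true) (base := base) (L := L) (Ω := Ω)
      (by rw [fr3 _ _ (by omega), fr2 _ (.inr rfl), hb])
      (by rw [fr3 _ _ (by omega), fr2 _ (.inl (by omega)), hc.hL]) hΩ).conseq
      (fun σ ψ h => h.1) (fun σ ψ h => h)) (σ₃ true) (uni c₁ (prodSet Ω (nums base
        ((Finset.range (2 ^ L)).filter fun v => (q ≤ v ↔ true = true)))))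
      ⟨⟨rfl, c₁, _, rfl, fun B hB x hx => by
        simp only [nums, Finset.mem_image, Finset.mem_filter, Finset.mem_range] at hB
        obtain ⟨v, hv, rfl⟩ := hB
        exact lt_of_mem_bits hv.1 hx⟩, fun _ _ => rfl⟩
  rw [one_mul] at hreset
  have hpend : (resetBlock M).wp (msr fun τ φ => (∃ c, φ = uni c Ω) ∧
      ∀ a, ¬ (a = M + 31 ∨ a = M + 34) → τ a = σ₃ true a) (σ₃ true) (uni c₁ (prodSet Ω (nums base
        ((Finset.range (2 ^ L)).filter fun v => (q ≤ v ↔ true = true))))) ≤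
      (resetBlock M).wp (msr (Pending M σ₀ Ω)) (σ₃ true) (uni c₁ (prodSet Ω (nums base
        ((Finset.range (2 ^ L)).filter fun v => (q ≤ v ↔ true = true))))) := by
    apply QProg.wp_mono
    intro τ φ
    by_cases hI : (∃ c, φ = uni c Ω) ∧ ∀ a, ¬ (a = M + 31 ∨ a = M + 34) → τ a = σ₃ true a
    · rw [msr_of hI, msr_of]
      refine ⟨fun a ha => ?_, ?_, hI.1⟩
      · rw [hI.2 a (by omega), fr3 _ _ (by omega), fr2 a ha]
      · rw [hI.2 _ (by omega), fr3 _ _ (by omega), h2, wr_of_ne _ _ _ (by omega),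
          fr1 _ (by omega), hdone]
    · rw [msr, if_neg hI]; exact msr_nonneg _ _ _
  constructor
  · rw [hfin, msr_of hready, ← hn1]
    have := QProg.wp_nonneg (p := resetBlock M) (msr_nonneg (Ready M q base σ₀ Ω)) (σ₃ true)
      (uni c₁ (prodSet Ω (nums base
        ((Finset.range (2 ^ L)).filter fun v => (q ≤ v ↔ true = true)))))
    exact le_add_of_le_of_nonneg hhalf this
  · rw [hfin, msr_of hready, QProg.wp_add, ← hn1, hsplit]
    have h1 := QProg.wp_nonneg (p := resetBlock M) (msr_nonneg (Ready M q base σ₀ Ω)) (σ₃ true)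
      (uni c₁ (prodSet Ω (nums base
        ((Finset.range (2 ^ L)).filter fun v => (q ≤ v ↔ true = true)))))
    have h2 := msr_nonneg (Pending M σ₀ Ω) (wr (σ₃ false) (M + 32) 0 1)
      (uni c₁ (prodSet Ω (nums base (Finset.range q))))
    linarith

theorem attempts_tri (hc : Consts M σ₀ n m q L K r T) (hb : σ₀ (M + 33) 0 = base)
    (hbase : base + L ≤ n * L + 1) (hLq : q ≤ 2 ^ L) (hL : 2 ^ L < 2 * q) (hK : q * q ≤ 2 ^ K)
    (hW : ∀ p < n * L + 1, σ₀ (M + 20) p =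
      if base ≤ p ∧ p < base + L then (2 ^ K / q + 1) * 2 ^ (p - base) else 0)
    (hΩ : ∀ S ∈ Ω, ∀ p, base ≤ p → ((2, p) : Qubit) ∉ S) :
    Tri (1 - (1 / 2) ^ T) (Pending M σ₀ Ω) (.rep (var (M + 9)) (attempt M))
      (Ready M q base σ₀ Ω) := by
  -- With `j` attempts to go, a pending state is worth 1 - 2^(-j) of its squared norm. For the
  -- induction step the two estimates of `attempt_spec` are combined with the weights 2^(-j) and 1 -
  -- 2^(-j).
  have key : ∀ j σ ψ, msr (Ready M q base σ₀ Ω) σ ψ +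
      (1 - (1 / 2) ^ j) * msr (Pending M σ₀ Ω) σ ψ ≤
      ((attempt M).wp)^[j] (msr (Ready M q base σ₀ Ω)) σ ψ := by
    intro j
    induction j with
    | zero => intro σ ψ; simp
    | succ j ih =>
      intro σ ψ
      rw [Function.iterate_succ_apply']
      refine le_trans ?_ (QProg.wp_mono ih σ ψ)
      have hpos : (0 : ℝ) < (1 / 2) ^ j := by positivity
      have hle : ((1 : ℝ) / 2) ^ j ≤ 1 := pow_le_one₀ (by norm_num) (by norm_num)
      by_cases hP : Pending M σ₀ Ω σ ψ
      · have hR : ¬ Ready M q base σ₀ Ω σ ψ := fun hR => by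
          have h1 := hR.2.1; rw [hP.2.1] at h1; exact zero_ne_one h1
        obtain ⟨h1, h2⟩ := attempt_spec hc hb hbase hLq hL hK hW hΩ hP
        have h3 : (fun τ φ => msr (Ready M q base σ₀ Ω) τ φ +
            (1 - (1 / 2) ^ j) * msr (Pending M σ₀ Ω) τ φ) =
            fun τ φ => (1 / 2) ^ j * msr (Ready M q base σ₀ Ω) τ φ + (1 - (1 / 2) ^ j) *
              (msr (Ready M q base σ₀ Ω) τ φ + msr (Pending M σ₀ Ω) τ φ) := by
          funext τ φ; ring
        rw [h3, QProg.wp_add, QProg.wp_smul, QProg.wp_smul, msr_of hP, msr, if_neg hR, pow_succ]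
        have h4 := mul_le_mul_of_nonneg_left h1 hpos.le
        have h5 := mul_le_mul_of_nonneg_left h2 (sub_nonneg.2 hle)
        linarith
      · have h1 : msr (Pending M σ₀ Ω) σ ψ = 0 := by rw [msr, if_neg hP]
        rw [h1, mul_zero, add_zero]
        by_cases hR : Ready M q base σ₀ Ω σ ψ
        · simp only [attempt, QProg.wp]
          rw [if_pos (by simp [QExpr.eval, var, hR.2.1]), h1, mul_zero, add_zero]
        · rw [msr, if_neg hR]
          apply QProg.wp_nonneg
          intro τ φ
          have := msr_nonneg (Ready M q base σ₀ Ω) τ φ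
          have := mul_nonneg (sub_nonneg.2 hle) (msr_nonneg (Pending M σ₀ Ω) τ φ)
          linarith
  intro σ ψ hP
  have hT : (var (M + 9)).eval σ = T := by
    simp only [QExpr.eval, var]
    rw [hP.1 _ (.inl (by omega)), hc.hT]
  simp only [QProg.wp, hT]
  have h1 := key T σ ψ
  rw [msr_of hP] at h1
  have := msr_nonneg (Ready M q base σ₀ Ω) σ ψ
  linarith

end Attempt

/-- Coefficients of the comparison of a block of qubits with `q`. -/
def fillBlock (M : ℕ) : QProg := .block
  [setv (M + 26) (.lit 0),
    .rep (var (M + 5)) (.block [.assign (M + 20) (var (M + 26)) (.lit 0), incr (M + 26)]),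
    setv (M + 26) (var (M + 33)), setv (M + 27) (var (M + 14)),
    .rep (var (M + 3)) (.block [.assign (M + 20) (var (M + 26)) (var (M + 27)),
      setv (M + 27) (.add (var (M + 27)) (var (M + 27))), incr (M + 26)])]

/-- Store `w, 2w, 4w, …` in the array of coefficients. -/
theorem doubling_spec {M : ℕ} {σ : Store} {L p w : ℕ} (hL : σ (M + 3) 0 = L)
    (hp : σ (M + 26) 0 = p) (hw : σ (M + 27) 0 = w) :
    ∃ σ', CDet (.rep (var (M + 3)) (.block [.assign (M + 20) (var (M + 26)) (var (M + 27)),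
      setv (M + 27) (.add (var (M + 27)) (var (M + 27))), incr (M + 26)])) σ σ' ∧
      σ' (M + 26) 0 = p + L ∧
      ∀ i, σ' (M + 20) i = if p ≤ i ∧ i < p + L then w * 2 ^ (i - p) else σ (M + 20) i := by
  have hrep := CDet.rep (p := .block [.assign (M + 20) (var (M + 26)) (var (M + 27)),
      setv (M + 27) (.add (var (M + 27)) (var (M + 27))), incr (M + 26)]) (e := var (M + 3))
    (fun k τ => τ (M + 26) 0 = p + k ∧ τ (M + 27) 0 = w * 2 ^ k ∧
      ∀ i, τ (M + 20) i = if p ≤ i ∧ i < p + k then w * 2 ^ (i - p) else σ (M + 20) i) L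
    (fun k _ τ hτ => ?_) (σ := σ) ⟨hp, by simpa using hw, fun i => by
      rw [if_neg (by omega)]⟩ hL
  · obtain ⟨σ', d, h1, -, h2⟩ := hrep
    exact ⟨σ', d, h1, h2⟩
  · obtain ⟨h1, h2, h3⟩ := hτ
    refine ⟨_, .cons (.assign _ _ _ _) (.cons (.setv _ _ _) (.cons (.incr _ _) (.nil _))),
      ?_, ?_, ?_⟩
    · simp [wr_apply, h1]; ring
    · simp [wr_apply, QExpr.eval, var, h2]; ring
    · intro i
      simp only [wr_apply, QExpr.eval, var, h1, h2, h3]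
      by_cases hi : i = p + k
      · subst hi
        simp
      · have e : (p ≤ i ∧ i < p + (k + 1)) ↔ (p ≤ i ∧ i < p + k) := by omega
        simp [hi, e]

theorem fillBlock_spec {M : ℕ} {σ : Store} {n m q L K r T base : ℕ}
    (hc : Consts M σ n m q L K r T) (hb : σ (M + 33) 0 = base) :
    ∃ σ', CDet (fillBlock M) σ σ' ∧ ∀ p < n * L + 1, σ' (M + 20) p =
      if base ≤ p ∧ p < base + L then (2 ^ K / q + 1) * 2 ^ (p - base) else 0 := by
  have hrep := CDet.rep (p := .block [.assign (M + 20) (var (M + 26)) (.lit 0), incr (M + 26)])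
    (e := var (M + 5)) (fun k τ => τ (M + 26) 0 = k ∧ ∀ i < k, τ (M + 20) i = 0) (n * L + 1)
    (fun k _ τ hτ => ?_) (σ := wr σ (M + 26) 0 0) ⟨by simp [wr_apply], fun i hi => by omega⟩
    (by simp [QExpr.eval, var, wr_apply, hc.hR])
  · obtain ⟨σ₁, d1, -, h1⟩ := hrep
    have fr1 : ∀ a, a ≠ M + 20 → a ≠ M + 26 → σ₁ a = σ a := fun a h2 h3 => by
      rw [d1.frame (X := fun a => a = M + 20 ∨ a = M + 26)
        (by simp [QProg.block, QProg.Writes, setv, incr]) (by omega), wr_of_ne _ _ _ h3]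
    set σ₂ := wr σ₁ (M + 26) 0 ((var (M + 33)).eval σ₁) with e2
    set σ₃ := wr σ₂ (M + 27) 0 ((var (M + 14)).eval σ₂) with e3
    obtain ⟨σ₄, d4, -, h4⟩ := doubling_spec (M := M) (σ := σ₃) (L := L) (p := base)
      (w := 2 ^ K / q + 1) (by simp [e3, e2, wr_apply, fr1, hc.hL])
      (by simp [e3, e2, wr_apply, fr1, QExpr.eval, var, hb])
      (by simp [e3, e2, wr_apply, fr1, QExpr.eval, var, hc.hal])
    refine ⟨σ₄, .cons (.setv _ _ _) (.cons d1 (.cons (.setv _ _ _) (.cons (.setv _ _ _)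
      (.cons d4 (.nil _))))), fun p hp => ?_⟩
    rw [h4]
    have : σ₃ (M + 20) p = 0 := by simp [e3, e2, wr_apply, h1 p hp]
    rw [this]
  · obtain ⟨h1, h2⟩ := hτ
    refine ⟨_, .cons (.assign _ _ _ _) (.cons (.incr _ _) (.nil _)), ?_, ?_⟩
    · simp [wr_apply, h1]
    · intro i hi
      simp only [wr_apply, QExpr.eval, var, h1]
      by_cases hik : i = k
      · simp [hik]
      · simp [hik, h2 i (by omega)]

/-- Prepare a coordinate. -/
def coord (M : ℕ) : QProg := .block
  [fillBlock M, setv (M + 32) (.lit 0), .rep (var (M + 9)) (attempt M),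
    setv (M + 33) (.add (var (M + 33)) (var (M + 3)))]

theorem coord_writes (M : ℕ) : (coord M).Writes fun a => M + 20 ≤ a ∧ a ≤ M + 37 := by
  have h : (measForm M).Writes fun a => M + 20 ≤ a ∧ a ≤ M + 37 :=
    (measForm_writes M).mono fun a ha => by omega
  simp [coord, fillBlock, attempt, hadBlock, resetBlock, QProg.block, QProg.Writes, setv, incr, h]

theorem coord_tri {M : ℕ} {σ₀ : Store} {n m q L K r T base : ℕ} {Ω : Finset Ket}
    (hc : Consts M σ₀ n m q L K r T)
    (hbase : base + L ≤ n * L + 1) (hLq : q ≤ 2 ^ L) (hL : 2 ^ L < 2 * q) (hK : q * q ≤ 2 ^ K)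
    (hΩ : ∀ S ∈ Ω, ∀ p, base ≤ p → ((2, p) : Qubit) ∉ S) :
    Tri (1 - (1 / 2) ^ T)
      (fun σ ψ => (∀ a < M + 20, σ a = σ₀ a) ∧ σ (M + 33) 0 = base ∧ ∃ c, ψ = uni c Ω) (coord M)
      (fun σ ψ => (∀ a < M + 20, σ a = σ₀ a) ∧ σ (M + 33) 0 = base + L ∧
        ∃ c, ψ = uni c (prodSet Ω (nums base (Finset.range q)))) := by
  rintro σ ψ ⟨hfr, hb, c, rfl⟩
  have hcσ := hc.congr hfr
  obtain ⟨σ₁, d1, h1⟩ := fillBlock_spec hcσ hb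
  have fr1 : ∀ a, (a < M + 20 ∨ a = M + 33) → σ₁ a = σ a := fun a ha =>
    d1.frame (X := fun a => a = M + 20 ∨ a = M + 26 ∨ a = M + 27)
      (by simp [fillBlock, QProg.block, QProg.Writes, setv, incr]) (by omega)
  set σ₂ := wr σ₁ (M + 32) 0 0 with e2
  have fr2 : ∀ a, a ≠ M + 32 → σ₂ a = σ₁ a := fun a ha => wr_of_ne _ _ _ ha
  have hc2 : Consts M σ₂ n m q L K r T := hcσ.congr fun a ha => by
    rw [fr2 _ (by omega), fr1 _ (by omega)]
  have hb2 : σ₂ (M + 33) 0 = base := by rw [fr2 _ (by omega), fr1 _ (by omega), hb]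
  have hT := attempts_tri (σ₀ := σ₂) hc2 hb2 hbase hLq hL hK
    (fun p hp => by rw [fr2 _ (by omega)]; exact h1 p hp) hΩ σ₂ (uni c Ω)
    ⟨fun _ _ => rfl, by simp [e2, wr_apply], c, rfl⟩
  refine hT.trans ?_
  have hw : ∀ g, (coord M).wp g σ (uni c Ω) = (QProg.rep (var (M + 9)) (attempt M)).wp
      (fun τ φ => g (wr τ (M + 33) 0 (τ (M + 33) 0 + τ (M + 3) 0)) φ) σ₂ (uni c Ω) := by
    intro g
    simp only [coord, QProg.block]
    change (fillBlock M).wp _ _ _ = _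
    rw [d1]
    rfl
  rw [hw]
  apply QProg.wp_mono
  intro τ φ
  by_cases hR : Ready M q base σ₂ Ω τ φ
  · rw [msr_of hR, msr_of]
    refine ⟨fun a ha => ?_, ?_, hR.2.2⟩
    · rw [wr_of_ne _ _ _ (by omega), hR.1 a (by omega), fr2 _ (by omega), fr1 _ (by omega),
        hfr a ha]
    · simp [wr_apply, hR.1 (M + 33) (.inr rfl), hb2, hR.1 (M + 3) (.inl (by omega)), hc2.hL]
  · rw [msr, if_neg hR]; exact msr_nonneg _ _ _

/-! ### Registers in the work array and in the input arrays of the solver -/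

section Registers

variable {n q : ℕ}

/-- The first `i` coordinates of `x` in the work array. -/
def partialKet (L i : ℕ) (x : Fin n → ZMod q) : Ket :=
  (Finset.univ.filter fun j : Fin n => (j : ℕ) < i).biUnion fun j => bits (1 + j * L) (x j).val

theorem mem_partialKet {L i : ℕ} {x : Fin n → ZMod q} {a : Qubit} :
    a ∈ partialKet L i x ↔ ∃ j : Fin n, (j : ℕ) < i ∧ a ∈ bits (1 + j * L) (x j).val := by
  simp [partialKet]

theorem partialKet_zero (L : ℕ) (x : Fin n → ZMod q) : partialKet L 0 x = ∅ := by
  simp [partialKet]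

theorem partialKet_succ (L : ℕ) (i : Fin n) (x : Fin n → ZMod q) :
    partialKet L (i + 1) x = partialKet L i x ∪ bits (1 + i * L) (x i).val := by
  ext a
  rw [Finset.mem_union, mem_partialKet, mem_partialKet]
  constructor
  · rintro ⟨j, hj, h⟩
    rcases Nat.lt_succ_iff_lt_or_eq.1 hj with h1 | h1
    · exact .inl ⟨j, h1, h⟩
    · rw [Fin.ext h1] at h; exact .inr h
  · rintro (⟨j, hj, h⟩ | h)
    · exact ⟨j, by omega, h⟩
    · exact ⟨i, by omega, h⟩

theorem of_mem_partialKet [NeZero q] {L i : ℕ} (hL : q ≤ 2 ^ L) {x : Fin n → ZMod q} {a : Qubit}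
    (h : a ∈ partialKet L i x) : a.1 = 2 ∧ 1 ≤ a.2 ∧ a.2 < 1 + i * L := by
  obtain ⟨j, hj, h⟩ := mem_partialKet.1 h
  obtain ⟨h1, h2, h3⟩ := lt_of_mem_bits ((ZMod.val_lt (x j)).trans_le hL) h
  refine ⟨h1, by omega, ?_⟩
  have : (j + 1 : ℕ) * L ≤ i * L := Nat.mul_le_mul_right _ hj
  rw [add_mul] at this
  omega

/-- All contents of the first `i` coordinates. -/
def partialKets (n q L i : ℕ) [NeZero q] : Finset Ket :=
  (Finset.univ : Finset (Fin n → ZMod q)).image (partialKet L i)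

theorem partialKets_zero (n q L : ℕ) [NeZero q] : partialKets n q L 0 = {∅} := by
  ext S
  simp [partialKets, partialKet_zero, eq_comm]

theorem partialKets_succ [NeZero q] (L : ℕ) (i : Fin n) :
    partialKets n q L (i + 1) =
      prodSet (partialKets n q L i) (nums (1 + i * L) (Finset.range q)) := by
  ext S
  simp only [partialKets, mem_prodSet, nums, Finset.mem_image, Finset.mem_univ, true_and,
    Finset.mem_range]
  constructor
  · rintro ⟨x, rfl⟩
    exact ⟨_, ⟨x, rfl⟩, _, ⟨(x i).val, ZMod.val_lt _, rfl⟩, (partialKet_succ L i x).symm⟩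
  · rintro ⟨_, ⟨x, rfl⟩, _, ⟨v, hv, rfl⟩, rfl⟩
    refine ⟨Function.update x i (v : ZMod q), ?_⟩
    rw [partialKet_succ, Function.update_self, ZMod.val_natCast_of_lt hv]
    congr 1
    unfold partialKet
    refine Finset.biUnion_congr rfl fun j hj => ?_
    simp only [Finset.mem_filter, Finset.mem_univ, true_and] at hj
    rw [Function.update_of_ne]
    rintro rfl
    omega

/-- A register in the work array. -/
def workKet (L : ℕ) (w : Bool × (Fin n → ZMod q)) : Ket :=
  (if w.1 = true then {((2, 0) : Qubit)} else ∅) ∪ partialKet L n w.2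

theorem zero_mem_workKet [NeZero q] {L : ℕ} (hL : q ≤ 2 ^ L) {w : Bool × (Fin n → ZMod q)} :
    ((2, 0) : Qubit) ∈ workKet L w ↔ w.1 = true := by
  have : ((2, 0) : Qubit) ∉ partialKet L n w.2 := fun h => by
    have := of_mem_partialKet hL h
    simp at this
  unfold workKet
  split_ifs with h <;> simp [h, this]

theorem mem_workKet_block [NeZero q] {L : ℕ} (hL : q ≤ 2 ^ L) {w : Bool × (Fin n → ZMod q)}
    (i : Fin n) {k : ℕ} (hk : k < L) :
    ((2, 1 + i * L + k) : Qubit) ∈ workKet L w ↔ (w.2 i).val.testBit k = true := by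
  unfold workKet
  rw [Finset.mem_union, mem_partialKet]
  have h0 : ((2, 1 + i * L + k) : Qubit) ∉ (if w.1 = true then {((2, 0) : Qubit)} else ∅ : Ket) := by
    split_ifs <;> simp
  rw [or_iff_right h0]
  constructor
  · rintro ⟨j, hj, h⟩
    have h1 := lt_of_mem_bits ((ZMod.val_lt (w.2 j)).trans_le hL) h
    have hij : i = j := by
      apply Fin.ext
      simp only at h1
      by_contra hne
      rcases lt_or_gt_of_ne hne with h2 | h2
      · have : (i + 1 : ℕ) * L ≤ j * L := Nat.mul_le_mul_right _ h2
        rw [add_mul] at this; omega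
      · have : (j + 1 : ℕ) * L ≤ i * L := Nat.mul_le_mul_right _ h2
        rw [add_mul] at this; omega
    subst hij
    rwa [mem_bits_add] at h
  · intro h
    exact ⟨i, i.2, mem_bits_add.2 h⟩

theorem of_mem_workKet [NeZero q] {L : ℕ} (hL : q ≤ 2 ^ L) {w : Bool × (Fin n → ZMod q)}
    {a : Qubit} (h : a ∈ workKet L w) : a.1 = 2 ∧ a.2 < n * L + 1 := by
  rcases Finset.mem_union.1 h with h | h
  · split_ifs at h
    · rw [Finset.mem_singleton] at h; subst h; simp
    · simp at h
  · have := of_mem_partialKet hL h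
    exact ⟨this.1, by omega⟩

theorem workKet_injective [NeZero q] {L : ℕ} (hL : q ≤ 2 ^ L) :
    Function.Injective (workKet (n := n) (q := q) L) := by
  intro w w' h
  have h1 : w.1 = w'.1 := by
    rw [Bool.eq_iff_iff, ← zero_mem_workKet hL, h, zero_mem_workKet hL]
  refine Prod.ext h1 (funext fun i => ZMod.val_injective q (Nat.eq_of_testBit_eq fun k => ?_))
  by_cases hk : k < L
  · rw [Bool.eq_iff_iff, ← mem_workKet_block hL i hk, h, mem_workKet_block hL i hk]
  · have : ∀ v : ZMod q, v.val.testBit k = false := fun v =>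
      Nat.testBit_lt_two_pow ((ZMod.val_lt v).trans_le
        (hL.trans (Nat.pow_le_pow_right (by norm_num) (by omega))))
    rw [this, this]

/-- All contents of a register. -/
theorem image_workKet_univ [NeZero q] {L : ℕ} (Ω : Finset Ket) :
    prodSet Ω ((Finset.univ : Finset (Bool × (Fin n → ZMod q))).image (workKet L)) =
      prodSet Ω (partialKets n q L n) ∪
        (prodSet Ω (partialKets n q L n)).image (insert (2, 0)) := by
  ext S
  simp only [Finset.mem_union, mem_prodSet, Finset.mem_image, partialKets, Finset.mem_univ,
    true_and]
  constructor
  · rintro ⟨A, hA, _, ⟨⟨b, x⟩, rfl⟩, rfl⟩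
    cases b with
    | false => exact .inl ⟨A, hA, _, ⟨x, rfl⟩, by simp [workKet]⟩
    | true => exact .inr ⟨_, ⟨A, hA, _, ⟨x, rfl⟩, rfl⟩, by ext; simp [workKet]⟩
  · rintro (⟨A, hA, _, ⟨x, rfl⟩, rfl⟩ | ⟨_, ⟨A, hA, _, ⟨x, rfl⟩, rfl⟩, rfl⟩)
    · exact ⟨A, hA, _, ⟨(false, x), rfl⟩, by simp [workKet]⟩
    · exact ⟨A, hA, _, ⟨(true, x), rfl⟩, by ext; simp [workKet]⟩

/-! ### Moving a qubit -/

/-- Two controlled NOTs, from `a` to `b` and back. -/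
def moveQubit (a b : Qubit) (S : Ket) : Ket := ccx b b a (ccx a a b S)

theorem moveQubit_injective (a b : Qubit) : Function.Injective (moveQubit a b) :=
  (ccx_involutive _ _ _).injective.comp (ccx_involutive _ _ _).injective

/-- The second controlled NOT clears the source because the target, initially 0, has become its
copy. -/
theorem mem_moveQubit {a b : Qubit} (hab : a ≠ b) {S : Ket} (hb : b ∉ S) {x : Qubit} :
    x ∈ moveQubit a b S ↔ (x = b ∧ a ∈ S) ∨ (x ≠ a ∧ x ∈ S) := by
  unfold moveQubit
  simp only [mem_ccx]
  by_cases hxa : x = a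
  · subst hxa
    by_cases hxS : x ∈ S <;> simp [hab, hab.symm, hb, hxS]
  · by_cases hxb : x = b
    · subst hxb
      by_cases haS : a ∈ S <;> simp [hab, hab.symm, hb, haS]
    · simp [hxa, hxb]

/-- Move the flag and the first `k` binary digits of a register. -/
def moveKet (j b : ℕ) : ℕ → Ket → Ket
  | 0, S => moveQubit (2, 0) (0, j) S
  | k + 1, S => moveQubit (2, 1 + k) (1, b + k) (moveKet j b k S)

theorem moveKet_injective (j b k : ℕ) : Function.Injective (moveKet j b k) := by
  induction k with
  | zero => exact moveQubit_injective _ _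
  | succ k ih => exact (moveQubit_injective _ _).comp ih

theorem mem_moveKet {j b : ℕ} {S : Ket} (h0 : ((0, j) : Qubit) ∉ S)
    (h1 : ∀ p, b ≤ p → ((1, p) : Qubit) ∉ S) (k : ℕ) {x : Qubit} :
    x ∈ moveKet j b k S ↔ (x = (0, j) ∧ ((2, 0) : Qubit) ∈ S) ∨
      (∃ i < k, x = (1, b + i) ∧ ((2, 1 + i) : Qubit) ∈ S) ∨
      (x ∈ S ∧ ¬ (x.1 = 2 ∧ x.2 < 1 + k)) := by
  induction k generalizing x with
  | zero =>
    rw [moveKet, mem_moveQubit (by simp) h0]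
    have : x ≠ (2, 0) ↔ ¬ (x.1 = 2 ∧ x.2 < 1 + 0) := by
      rw [ne_eq, Prod.ext_iff]; simp
    rw [this]
    simp [and_comm]
  | succ k ih =>
    rw [moveKet, mem_moveQubit (by simp)]
    · rw [ih, ih]
      have e1 : (((2, 1 + k) : Qubit) = (0, j) ∧ ((2, 0) : Qubit) ∈ S) ↔ False := by simp
      have e2 : (∃ i < k, ((2, 1 + k) : Qubit) = (1, b + i) ∧ ((2, 1 + i) : Qubit) ∈ S) ↔ False := by
        simp
      have e3 : (((2, 1 + k) : Qubit) ∈ S ∧ ¬ (((2, 1 + k) : Qubit).1 = 2 ∧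
          ((2, 1 + k) : Qubit).2 < 1 + k)) ↔ ((2, 1 + k) : Qubit) ∈ S := by simp
      rw [e1, e2, e3, false_or, false_or]
      constructor
      · rintro (⟨rfl, h⟩ | ⟨hx, h | ⟨i, hi, h⟩ | ⟨h, h'⟩⟩)
        · exact .inr (.inl ⟨k, by omega, rfl, h⟩)
        · exact .inl h
        · exact .inr (.inl ⟨i, by omega, h⟩)
        · refine .inr (.inr ⟨h, fun h2 => ?_⟩)
          have : x.2 ≠ 1 + k := fun h3 => hx (Prod.ext h2.1 h3)
          exact h' ⟨h2.1, by omega⟩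
      · rintro (⟨rfl, h⟩ | ⟨i, hi, rfl, h⟩ | ⟨h, h'⟩)
        · exact .inr ⟨by simp, .inl ⟨rfl, h⟩⟩
        · rcases Nat.lt_succ_iff_lt_or_eq.1 hi with h2 | rfl
          · exact .inr ⟨by simp, .inr (.inl ⟨i, h2, rfl, h⟩)⟩
          · exact .inl ⟨rfl, h⟩
        · refine .inr ⟨?_, .inr (.inr ⟨h, fun h2 => h' ⟨h2.1, by omega⟩⟩)⟩
          rintro rfl
          exact h' ⟨rfl, by simp⟩
    · rw [ih]
      rintro (⟨h, -⟩ | ⟨i, hi, h, -⟩ | ⟨h, -⟩)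
      · simp at h
      · simp at h; omega
      · exact h1 _ (by omega) h

/-! ### The input of the solver -/

theorem mem_encodeRegs_zero {r : ℕ} {w : Fin r → Bool × (Fin n → ZMod q)} {p : ℕ} :
    ((0, p) : Qubit) ∈ encodeRegs w ↔ ∃ j : Fin r, (j : ℕ) = p ∧ (w j).1 = true := by
  simp [encodeRegs, and_comm]

theorem mem_encodeRegs_one {r : ℕ} {w : Fin r → Bool × (Fin n → ZMod q)} {p : ℕ} :
    ((1, p) : Qubit) ∈ encodeRegs w ↔ ∃ (j : Fin r) (i : Fin n) (k : Fin (Nat.clog 2 q)),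
      p = (j * n + i) * Nat.clog 2 q + k ∧ ((w j).2 i).val.testBit k = true := by
  unfold encodeRegs
  rw [Finset.mem_union, Finset.mem_image, Finset.mem_image]
  constructor
  · rintro (⟨j, -, h⟩ | ⟨⟨j, i, k⟩, hb, h⟩)
    · simp at h
    · exact ⟨j, i, k, (congrArg Prod.snd h).symm, (Finset.mem_filter.1 hb).2⟩
  · rintro ⟨j, i, k, rfl, hb⟩
    exact .inr ⟨(j, i, k), Finset.mem_filter.2 ⟨Finset.mem_univ _, hb⟩, rfl⟩

theorem fst_of_mem_encodeRegs {r : ℕ} {w : Fin r → Bool × (Fin n → ZMod q)} {x : Qubit}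
    (h : x ∈ encodeRegs w) : x.1 = 0 ∨ x.1 = 1 := by
  rcases Finset.mem_union.1 h with h | h
  · obtain ⟨j, -, rfl⟩ := Finset.mem_image.1 h; exact .inl rfl
  · obtain ⟨j, -, rfl⟩ := Finset.mem_image.1 h; exact .inr rfl

theorem lt_of_mem_encodeRegs_one {r : ℕ} {w : Fin r → Bool × (Fin n → ZMod q)} {p : ℕ}
    (h : ((1, p) : Qubit) ∈ encodeRegs w) : p < r * (n * Nat.clog 2 q) := by
  obtain ⟨j, i, k, rfl, -⟩ := mem_encodeRegs_one.1 h
  have h1 : (j + 1 : ℕ) * (n * Nat.clog 2 q) ≤ r * (n * Nat.clog 2 q) :=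
    Nat.mul_le_mul_right _ j.2
  have h2 : (i + 1 : ℕ) * Nat.clog 2 q ≤ n * Nat.clog 2 q := Nat.mul_le_mul_right _ i.2
  have := k.2
  calc (j * n + i) * Nat.clog 2 q + k < (j * n + i) * Nat.clog 2 q + Nat.clog 2 q := by omega
    _ = j * (n * Nat.clog 2 q) + (i + 1) * Nat.clog 2 q := by ring
    _ ≤ j * (n * Nat.clog 2 q) + n * Nat.clog 2 q := by omega
    _ = (j + 1) * (n * Nat.clog 2 q) := by ring
    _ ≤ _ := h1

theorem two_notMem_encodeRegs {r : ℕ} (w : Fin r → Bool × (Fin n → ZMod q)) (p : ℕ) :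
    ((2, p) : Qubit) ∉ encodeRegs w := fun h => by
  have := fst_of_mem_encodeRegs h; simp at this

/-- In the encoding, register `r` fills array 1 from `r * (n * L)` on in the same order in which the
work array stores the digits from qubit 1 on, so moving with a constant shift appends the register.
-/
theorem moveKet_encodeRegs [NeZero q] {r : ℕ} (w : Fin r → Bool × (Fin n → ZMod q))
    (v : Bool × (Fin n → ZMod q)) :
    moveKet r (r * (n * Nat.clog 2 q)) (n * Nat.clog 2 q)
      (encodeRegs w ∪ workKet (Nat.clog 2 q) v) =
      encodeRegs (Fin.snoc (α := fun _ => Bool × (Fin n → ZMod q)) w v) := by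
  have hL : q ≤ 2 ^ Nat.clog 2 q := Nat.le_pow_clog (by norm_num) q
  have hone := @mem_encodeRegs_one n q
  have hlt := @lt_of_mem_encodeRegs_one n q
  generalize Nat.clog 2 q = L at hL hone hlt ⊢
  ext ⟨a, p⟩
  have hw : ∀ a p, a ≠ 2 → ((a, p) : Qubit) ∉ workKet L v := fun a p ha h =>
    ha (of_mem_workKet hL h).1
  have h2 : ∀ p, ((2, p) : Qubit) ∈ encodeRegs w ∪ workKet L v ↔ ((2, p) : Qubit) ∈ workKet L v :=
    fun p => by rw [Finset.mem_union, or_iff_right (two_notMem_encodeRegs w p)]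
  have ha : ∀ a p, a ≠ 2 → (((a, p) : Qubit) ∈ encodeRegs w ∪ workKet L v ↔
      ((a, p) : Qubit) ∈ encodeRegs w) :=
    fun a p h => by rw [Finset.mem_union, or_iff_left (hw a p h)]
  rw [mem_moveKet]
  · simp only [h2]
    by_cases h0 : a = 0
    · subst h0
      rw [ha 0 p (by norm_num), mem_encodeRegs_zero, mem_encodeRegs_zero, zero_mem_workKet hL]
      constructor
      · rintro (⟨h, hb⟩ | ⟨i, hi, h, -⟩ | ⟨⟨j, hj, hb⟩, -⟩)
        · simp only [Prod.mk.injEq, true_and] at h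
          exact ⟨Fin.last r, by simp [h], by simpa using hb⟩
        · simp at h
        · exact ⟨j.castSucc, by simpa using hj, by simpa using hb⟩
      · rintro ⟨j, hj, hb⟩
        induction j using Fin.lastCases with
        | last => exact .inl ⟨by simp [← hj], by simpa using hb⟩
        | cast j => exact .inr (.inr ⟨⟨j, by simpa using hj, by simpa using hb⟩, by simp⟩)
    · by_cases h1 : a = 1
      · subst h1
        rw [ha 1 p (by norm_num), hone, hone]
        constructor
        · rintro (⟨h, -⟩ | ⟨i, hi, h, hm⟩ | ⟨⟨j, i, k, hp, hb⟩, -⟩)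
          · simp at h
          · simp only [Prod.mk.injEq, true_and] at h
            have hLpos : 0 < L := by
              by_contra hL0
              have : L = 0 := by omega
              rw [this] at hi; simp at hi
            have hi' : i / L < n := by rw [Nat.div_lt_iff_lt_mul hLpos]; exact hi
            have hk : i % L < L := Nat.mod_lt _ hLpos
            have hdm : 1 + i = 1 + (⟨i / L, hi'⟩ : Fin n) * L + i % L := by
              have := Nat.div_add_mod' i L
              simp only; omega
            rw [hdm, mem_workKet_block hL _ hk] at hm
            refine ⟨Fin.last r, ⟨i / L, hi'⟩, ⟨i % L, hk⟩, ?_, by simpa using hm⟩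
            have := Nat.div_add_mod' i L
            simp only [Fin.val_last]
            rw [h, add_mul, mul_assoc]
            omega
          · exact ⟨j.castSucc, i, k, by simpa using hp, by simpa using hb⟩
        · rintro ⟨j, i, k, hp, hb⟩
          induction j using Fin.lastCases with
          | last =>
            refine .inr (.inl ⟨i * L + k, ?_, ?_, ?_⟩)
            · have h3 : (i + 1 : ℕ) * L ≤ n * L := Nat.mul_le_mul_right _ i.2
              have := k.2
              rw [add_mul] at h3; omega
            · rw [hp]; simp only [Fin.val_last, Prod.mk.injEq, true_and]; ring
            · rw [← add_assoc, mem_workKet_block hL _ k.2]; simpa using hb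
          | cast j => exact .inr (.inr ⟨⟨j, i, k, by simpa using hp, by simpa using hb⟩, by simp⟩)
      · have hr : ((a, p) : Qubit) ∉ encodeRegs
            (Fin.snoc (α := fun _ => Bool × (Fin n → ZMod q)) w v) := fun h => by
          have := fst_of_mem_encodeRegs h; simp at this; omega
        refine iff_of_false ?_ hr
        rintro (⟨h, -⟩ | ⟨i, hi, h, hm⟩ | ⟨h, h'⟩)
        · simp at h; omega
        · simp at h; omega
        · rcases Finset.mem_union.1 h with h | h
          · have := fst_of_mem_encodeRegs h; simp at this; omega
          · have := of_mem_workKet hL h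
            simp at this h'; omega
  · rw [ha 0 r (by norm_num), mem_encodeRegs_zero]
    rintro ⟨j, hj, -⟩
    have := j.2; omega
  · intro p hp
    rw [ha 1 p (by norm_num)]
    intro h
    have := hlt h
    omega

/-- The two basis states of a coset state. -/
def cosetPt (s x : Fin n → ZMod q) (b : Bool) : Bool × (Fin n → ZMod q) :=
  (b, if b = true then x + s else x)

/-- The basis states of a product of coset states. -/
def cosetKets (s : Fin n → ZMod q) {r : ℕ} (x : Fin r → Fin n → ZMod q) : Finset Ket :=
  (Finset.univ : Finset (Fin r → Bool)).image fun b => encodeRegs fun j => cosetPt s (x j) (b j)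

theorem encodeRegs_cosetPt_injective (s : Fin n → ZMod q) {r : ℕ} (x : Fin r → Fin n → ZMod q) :
    Function.Injective fun b : Fin r → Bool => encodeRegs fun j => cosetPt s (x j) (b j) := by
  intro b b' h
  funext j
  have key : ∀ b : Fin r → Bool, ((0, (j : ℕ)) : Qubit) ∈
      (encodeRegs fun j => cosetPt s (x j) (b j)) ↔ b j = true := by
    intro b
    rw [mem_encodeRegs_zero]
    constructor
    · rintro ⟨j', hj, h⟩; rw [Fin.ext hj] at h; exact h
    · intro h; exact ⟨j, rfl, h⟩
  rw [Bool.eq_iff_iff, ← key b, ← key b']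
  simp only at h
  rw [h]

theorem dcpState_apply [NeZero q] (s x : Fin n → ZMod q) (w : Bool × (Fin n → ZMod q)) :
    dcpState s x w = if w = cosetPt s x w.1 then (((√2 : ℝ) : ℂ)⁻¹) else 0 := by
  unfold dcpState
  rcases w with ⟨b, y⟩
  cases b <;> simp [cosetPt]

/-- The product of amplitudes vanishes unless each register is at one of its two coset points, and
is otherwise always 2^(-r/2). So the input of the solver is a uniform superposition, and any `uni`
over the same set is a multiple of it. -/
theorem dcpInput_eq [NeZero q] (s : Fin n → ZMod q) {r : ℕ} (x : Fin r → Fin n → ZMod q) :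
    dcpInput s x = uni ((((√2 : ℝ) : ℂ)⁻¹) ^ r) (cosetKets s x) := by
  unfold dcpInput uni cosetKets
  rw [Finset.sum_image (encodeRegs_cosetPt_injective s x).injOn]
  symm
  apply Finset.sum_of_injOn (fun (b : Fin r → Bool) j => cosetPt s (x j) (b j))
  · intro b _ b' _ h
    funext j
    exact congrArg Prod.fst (congrFun h j)
  · intro b _; simp
  · intro w _ hw
    have : ∃ j, w j ≠ cosetPt s (x j) (w j).1 := by
      by_contra hcon
      push Not at hcon
      exact hw ⟨fun j => (w j).1, by simp, funext fun j => (hcon j).symm⟩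
    obtain ⟨j, hj⟩ := this
    rw [Finset.prod_eq_zero (Finset.mem_univ j), Finsupp.single_zero]
    rw [dcpState_apply, if_neg hj]
  · intro b _
    congr 1
    rw [Finset.prod_congr rfl (g := fun _ => (((√2 : ℝ) : ℂ)⁻¹))]
    · simp
    · intro j _
      exact (dcpState_apply _ _ _).trans (if_pos rfl)

theorem normSq_dcpInput [NeZero q] (s : Fin n → ZMod q) {r : ℕ} (x : Fin r → Fin n → ZMod q) :
    (dcpInput s x).normSq = 1 := by
  rw [dcpInput_eq, normSq_uni, cosetKets,
    Finset.card_image_of_injective _ (encodeRegs_cosetPt_injective s x)]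
  simp only [Finset.card_univ, Fintype.card_pi, Fintype.card_bool, Finset.prod_const,
    Fintype.card_fin, norm_pow, norm_inv, Complex.norm_real,
    Real.norm_of_nonneg (Real.sqrt_nonneg 2)]
  rw [inv_pow, inv_pow, ← pow_mul, mul_comm r 2, pow_mul, Real.sq_sqrt (by norm_num)]
  push_cast
  exact inv_mul_cancel₀ (by positivity)

theorem cosetKets_zero (s : Fin n → ZMod q) (x : Fin 0 → Fin n → ZMod q) :
    cosetKets s x = {∅} := by
  have : ∀ w : Fin 0 → Bool × (Fin n → ZMod q), encodeRegs w = ∅ := fun w => by simp [encodeRegs]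
  simp [cosetKets, this]

theorem cosetKets_snoc [NeZero q] (s : Fin n → ZMod q) {r : ℕ} (x : Fin r → Fin n → ZMod q)
    (y : Fin n → ZMod q) :
    (prodSet (cosetKets s x) ((Finset.univ.image (cosetPt s y)).image
      (workKet (Nat.clog 2 q)))).image
        (moveKet r (r * (n * Nat.clog 2 q)) (n * Nat.clog 2 q)) =
      cosetKets s (Fin.snoc (α := fun _ => Fin n → ZMod q) x y) := by
  have key : ∀ (b : Fin r → Bool) (c : Bool),
      (Fin.snoc (α := fun _ => Bool × (Fin n → ZMod q)) (fun j => cosetPt s (x j) (b j))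
        (cosetPt s y c)) =
      fun j => cosetPt s ((Fin.snoc (α := fun _ => Fin n → ZMod q) x y : _) j)
        ((Fin.snoc (α := fun _ => Bool) b c : _) j) := by
    intro b c
    funext j
    induction j using Fin.lastCases with
    | last => simp
    | cast j => simp
  ext S
  simp only [Finset.mem_image, mem_prodSet, cosetKets, Finset.mem_univ, true_and]
  constructor
  · rintro ⟨_, ⟨_, ⟨b, rfl⟩, _, ⟨_, ⟨c, rfl⟩, rfl⟩, rfl⟩, rfl⟩
    refine ⟨Fin.snoc (α := fun _ => Bool) b c, ?_⟩
    rw [moveKet_encodeRegs, key]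
  · rintro ⟨b, rfl⟩
    refine ⟨_, ⟨_, ⟨Fin.init b, rfl⟩, _, ⟨_, ⟨b (Fin.last r), rfl⟩, rfl⟩, rfl⟩, ?_⟩
    rw [moveKet_encodeRegs, key]
    have : (Fin.snoc (α := fun _ => Bool) (Fin.init b) (b (Fin.last r))) = b :=
      Fin.snoc_init_self b
    rw [this]

end Registers

/-! ### Rows of the matrix as linear forms -/

/-- Compute `e * 2 ^ K / q`. -/
def divide (M : ℕ) (e : QExpr) : QProg := .block
  [setv (M + 41) e, setv (M + 40) (.lit 0),
    .rep (var (M + 6)) (.block [setv (M + 41) (.add (var (M + 41)) (var (M + 41))),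
      setv (M + 40) (.add (var (M + 40)) (var (M + 40))),
      .ite (.sub (.add (var (M + 41)) (.lit 1)) (var (M + 2)))
        (.block [setv (M + 41) (.sub (var (M + 41)) (var (M + 2))), incr (M + 40)]) .skip])]

/-- Binary long division: quotient and remainder are doubled, and since the remainder was below `q`,
at most one subtraction of `q` restores this. The added 1 in the test makes truncated subtraction
decide q ≤ remainder rather than the strict inequality. -/
theorem divide_spec {M K q : ℕ} {e : QExpr} {σ : Store} (hK : σ (M + 6) 0 = K)
    (hq : σ (M + 2) 0 = q) (he : e.eval σ < q) :
    ∃ σ', CDet (divide M e) σ σ' ∧ σ' (M + 40) 0 = e.eval σ * 2 ^ K / q ∧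
      ∀ a, a ≠ M + 40 → a ≠ M + 41 → σ' a = σ a := by
  have hq0 : 0 < q := by omega
  set v := e.eval σ with hv
  set σ₁ := wr (wr σ (M + 41) 0 v) (M + 40) 0 0 with h1
  have hrep := CDet.rep (e := var (M + 6)) (p := .block
      [setv (M + 41) (.add (var (M + 41)) (var (M + 41))),
      setv (M + 40) (.add (var (M + 40)) (var (M + 40))),
      .ite (.sub (.add (var (M + 41)) (.lit 1)) (var (M + 2)))
        (.block [setv (M + 41) (.sub (var (M + 41)) (var (M + 2))), incr (M + 40)]) .skip])
    (fun k τ => τ (M + 41) 0 < q ∧ v * 2 ^ k = q * τ (M + 40) 0 + τ (M + 41) 0 ∧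
      ∀ a, a ≠ M + 40 → a ≠ M + 41 → τ a = σ a) K ?_ (σ := σ₁) ?_ ?_
  · obtain ⟨σ', d, h2, h3, h4⟩ := hrep
    refine ⟨σ', .cons (.setv _ _ _) (.cons (.setv _ _ _) (.cons d (.nil _))), ?_, h4⟩
    rw [h3, Nat.mul_add_div hq0, Nat.div_eq_of_lt h2, add_zero]
  · rintro k _ τ ⟨h2, h3, h4⟩
    have hqτ : τ (M + 2) 0 = q := by rw [h4 _ (by omega) (by omega), hq]
    set τ₂ := wr (wr τ (M + 41) 0 ((QExpr.add (var (M + 41)) (var (M + 41))).eval τ)) (M + 40) 0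
      ((QExpr.add (var (M + 40)) (var (M + 40))).eval
        (wr τ (M + 41) 0 ((QExpr.add (var (M + 41)) (var (M + 41))).eval τ))) with e2
    have e41 : τ₂ (M + 41) 0 = τ (M + 41) 0 + τ (M + 41) 0 := by
      simp [e2, wr_apply, QExpr.eval, var]
    have e40 : τ₂ (M + 40) 0 = τ (M + 40) 0 + τ (M + 40) 0 := by
      simp [e2, wr_apply, QExpr.eval, var]
    have eo : ∀ a, a ≠ M + 40 → a ≠ M + 41 → τ₂ a = τ a := fun a ha hb => by
      rw [e2, wr_of_ne _ _ _ ha, wr_of_ne _ _ _ hb]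
    have eq2 : τ₂ (M + 2) 0 = q := by rw [eo _ (by omega) (by omega), hqτ]
    by_cases hc : q ≤ τ₂ (M + 41) 0
    · refine ⟨_, .cons (.setv _ _ _) (.cons (.setv _ _ _) (.cons (.ite_true ?_
        (.cons (.setv _ _ _) (.cons (.incr _ _) (.nil _)))) (.nil _))), ?_, ?_, ?_⟩
      · change τ₂ (M + 41) 0 + 1 - τ₂ (M + 2) 0 ≠ 0
        omega
      · rw [← e2]
        simp only [wr_apply, QExpr.eval, var, eq2, e41]
        simp
        omega
      · rw [← e2]
        simp only [wr_apply, QExpr.eval, var, eq2, e41, e40]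
        simp
        rw [e41] at hc
        rw [pow_succ, ← mul_assoc, h3]
        obtain ⟨z, hz⟩ := Nat.exists_eq_add_of_le hc
        rw [hz, Nat.add_sub_cancel_left]
        have : (q * τ (M + 40) 0 + τ (M + 41) 0) * 2 =
          q * τ (M + 40) 0 + q * τ (M + 40) 0 + (τ (M + 41) 0 + τ (M + 41) 0) := by ring
        rw [this, hz]; ring
      · intro a ha hb
        rw [wr_of_ne _ _ _ ha, wr_of_ne _ _ _ hb, ← e2, eo a ha hb, h4 a ha hb]
    · refine ⟨τ₂, .cons (.setv _ _ _) (.cons (.setv _ _ _) (.cons (.ite_false ?_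
        (CDet.nil _)) (.nil _))), ?_, ?_, ?_⟩
      · change τ₂ (M + 41) 0 + 1 - τ₂ (M + 2) 0 = 0
        omega
      · omega
      · rw [e40, e41, pow_succ, ← mul_assoc, h3]; ring
      · intro a ha hb
        rw [eo a ha hb, h4 a ha hb]
  · refine ⟨by simpa [h1, wr_apply] using he, by simp [h1, wr_apply], fun a ha hb => ?_⟩
    rw [h1, wr_of_ne _ _ _ ha, wr_of_ne _ _ _ hb]
  · simp [h1, wr_apply, QExpr.eval, var, hK]

/-- Coefficients of the linear form of a row. -/
def fillRow (M : ℕ) : QProg := .block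
  [divide M (.get (M + 12) (var (M + 36))), .assign (M + 20) (.lit 0) (var (M + 40)),
    incr (M + 36), setv (M + 26) (.lit 1),
    .rep (var M) (.block [divide M (.get (M + 11) (var (M + 35))), incr (M + 35),
      setv (M + 27) (var (M + 40)),
      .rep (var (M + 3)) (.block [.assign (M + 20) (var (M + 26)) (var (M + 27)),
        setv (M + 27) (.add (var (M + 27)) (var (M + 27))), incr (M + 26)])])]

theorem fillRow_writes (M : ℕ) : (fillRow M).Writes fun a => a = M + 20 ∨ a = M + 26 ∨
    a = M + 27 ∨ a = M + 35 ∨ a = M + 36 ∨ a = M + 40 ∨ a = M + 41 := by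
  simp [fillRow, divide, QProg.block, QProg.Writes, setv, incr]

theorem fillRow_spec {M : ℕ} {σ : Store} {n m q L K r T i : ℕ} (hc : Consts M σ n m q L K r T)
    (hA : ∀ j < n, σ (M + 11) (i * n + j) < q) (hu : σ (M + 12) i < q)
    (h35 : σ (M + 35) 0 = i * n) (h36 : σ (M + 36) 0 = i) :
    ∃ σ', CDet (fillRow M) σ σ' ∧ σ' (M + 35) 0 = (i + 1) * n ∧ σ' (M + 36) 0 = i + 1 ∧
      σ' (M + 20) 0 = σ (M + 12) i * 2 ^ K / q ∧
      ∀ j < n, ∀ k < L, σ' (M + 20) (1 + j * L + k) = σ (M + 11) (i * n + j) * 2 ^ K / q * 2 ^ k := by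
  obtain ⟨σ₁, d1, h1, f1⟩ := divide_spec (e := .get (M + 12) (var (M + 36))) hc.hK hc.hq
    (by simpa [QExpr.eval, var, h36] using hu)
  simp only [QExpr.eval, var, h36] at h1
  set σ₂ := wr σ₁ (M + 20) ((QExpr.lit 0).eval σ₁) ((var (M + 40)).eval σ₁) with e2
  set σ₃ := wr σ₂ (M + 36) 0 (σ₂ (M + 36) 0 + 1) with e3
  set σ₄ := wr σ₃ (M + 26) 0 ((QExpr.lit 1).eval σ₃) with e4
  have f4 : ∀ a < M + 20, σ₄ a = σ a := fun a ha => by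
    rw [e4, wr_of_ne _ _ _ (by omega), e3, wr_of_ne _ _ _ (by omega), e2,
      wr_of_ne _ _ _ (by omega), f1 _ (by omega) (by omega)]
  have hrep := CDet.rep (e := var M) (p := .block
      [divide M (.get (M + 11) (var (M + 35))), incr (M + 35),
      setv (M + 27) (var (M + 40)),
      .rep (var (M + 3)) (.block [.assign (M + 20) (var (M + 26)) (var (M + 27)),
        setv (M + 27) (.add (var (M + 27)) (var (M + 27))), incr (M + 26)])])
    (fun j τ => (∀ a < M + 20, τ a = σ a) ∧ τ (M + 35) 0 = i * n + j ∧ τ (M + 36) 0 = i + 1 ∧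
      τ (M + 26) 0 = 1 + j * L ∧ τ (M + 20) 0 = σ (M + 12) i * 2 ^ K / q ∧
      ∀ j' < j, ∀ k < L, τ (M + 20) (1 + j' * L + k) =
        σ (M + 11) (i * n + j') * 2 ^ K / q * 2 ^ k) n ?_ (σ := σ₄) ?_ ?_
  · obtain ⟨σ', d, -, h2, h3, -, h5, h6⟩ := hrep
    exact ⟨σ', .cons d1 (.cons (.assign _ _ _ _) (.cons (.incr _ _) (.cons (.setv _ _ _)
      (.cons d (.nil _))))), by rw [h2]; ring, h3, h5, h6⟩
  · rintro j hj τ ⟨g1, g2, g3, g4, g5, g6⟩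
    have hcτ := hc.congr g1
    have hev : (QExpr.get (M + 11) (var (M + 35))).eval τ = σ (M + 11) (i * n + j) := by
      simp only [QExpr.eval, var, g2, g1 (M + 11) (by omega)]
    obtain ⟨τ₁, t1, k1, l1⟩ := divide_spec (e := .get (M + 11) (var (M + 35))) hcτ.hK hcτ.hq
      (by rw [hev]; exact hA j hj)
    rw [hev] at k1
    set τ₂ := wr τ₁ (M + 35) 0 (τ₁ (M + 35) 0 + 1) with e2'
    set τ₃ := wr τ₂ (M + 27) 0 ((var (M + 40)).eval τ₂) with e3'
    have l3 : ∀ a, a ≠ M + 35 → a ≠ M + 27 → a ≠ M + 40 → a ≠ M + 41 → τ₃ a = τ a := by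
      intro a h1 h2 h3 h4
      rw [e3', wr_of_ne _ _ _ h2, e2', wr_of_ne _ _ _ h1, l1 _ h3 h4]
    obtain ⟨τ₄, t4, k4, l4⟩ := doubling_spec (M := M) (σ := τ₃) (L := L) (p := 1 + j * L)
      (w := σ (M + 11) (i * n + j) * 2 ^ K / q)
      (by rw [l3 _ (by omega) (by omega) (by omega) (by omega), hcτ.hL])
      (by rw [l3 _ (by omega) (by omega) (by omega) (by omega), g4])
      (by simp [e3', e2', wr_apply, QExpr.eval, var, k1])
    have fr : ∀ a, a ≠ M + 20 → a ≠ M + 26 → a ≠ M + 27 → τ₄ a = τ₃ a := fun a h1 h2 h3 =>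
      t4.frame (X := fun a => a = M + 20 ∨ a = M + 26 ∨ a = M + 27)
        (by simp [QProg.block, QProg.Writes, setv, incr]) (by omega)
    have h20 : τ₃ (M + 20) = τ (M + 20) := l3 _ (by omega) (by omega) (by omega) (by omega)
    refine ⟨τ₄, .cons t1 (.cons (.incr _ _) (.cons (.setv _ _ _) (.cons t4 (.nil _)))),
      ?_, ?_, ?_, ?_, ?_, ?_⟩
    · intro a ha
      rw [fr _ (by omega) (by omega) (by omega), l3 _ (by omega) (by omega) (by omega) (by omega),
        g1 a ha]
    · rw [fr _ (by omega) (by omega) (by omega), e3', wr_of_ne _ _ _ (by omega), e2', wr_apply,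
        if_pos ⟨rfl, rfl⟩, l1 _ (by omega) (by omega), g2]; ring
    · rw [fr _ (by omega) (by omega) (by omega), l3 _ (by omega) (by omega) (by omega) (by omega),
        g3]
    · rw [k4]; ring
    · rw [l4, if_neg (by omega), h20, g5]
    · intro j' hj' k hk
      rw [l4]
      rcases Nat.lt_succ_iff_lt_or_eq.1 hj' with h | rfl
      · have : (j' + 1) * L ≤ j * L := Nat.mul_le_mul_right _ h
        rw [add_mul] at this
        rw [if_neg (by omega), h20, g6 j' h k hk]
      · rw [if_pos (by omega), Nat.add_sub_cancel_left]
  · refine ⟨f4, ?_, ?_, by simp [e4, wr_apply, QExpr.eval], ?_, fun j' h => by omega⟩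
    · rw [e4, wr_of_ne _ _ _ (by omega), e3, wr_of_ne _ _ _ (by omega), e2,
        wr_of_ne _ _ _ (by omega), f1 _ (by omega) (by omega), h35, add_zero]
    · rw [e4, wr_of_ne _ _ _ (by omega), e3, wr_apply, if_pos ⟨rfl, rfl⟩, e2,
        wr_of_ne _ _ _ (by omega), f1 _ (by omega) (by omega), h36]
    · rw [e4, wr_of_ne _ _ _ (by omega), e3, wr_of_ne _ _ _ (by omega), e2]
      simp [wr_apply, QExpr.eval, var, h1]
  · simp only [QExpr.eval, var]
    rw [f4 _ (by omega), hc.hn]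

/-- The linear form of row `i` with coefficients rounded down. -/
def rowForm {n q : ℕ} (K : ℕ) (a u : ℕ → ℕ) (i : ℕ) (w : Bool × (Fin n → ZMod q)) : ℕ :=
  w.1.toNat * (u i * 2 ^ K / q) + ∑ j : Fin n, (a (i * n + j) * 2 ^ K / q) * (w.2 j).val

theorem sum_range_mul_block (f : ℕ → ℕ) (n L : ℕ) :
    ∑ p ∈ Finset.range (n * L), f p =
      ∑ j ∈ Finset.range n, ∑ k ∈ Finset.range L, f (j * L + k) := by
  induction n with
  | zero => simp
  | succ n ih => rw [add_mul, one_mul, Finset.sum_range_add, ih, Finset.sum_range_succ]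

theorem form_workKet {n q L K i : ℕ} [NeZero q] (hL : q ≤ 2 ^ L) {a u W : ℕ → ℕ}
    (h0 : W 0 = u i * 2 ^ K / q)
    (hW : ∀ j < n, ∀ k < L, W (1 + j * L + k) = a (i * n + j) * 2 ^ K / q * 2 ^ k)
    {A : Ket} (hA : ∀ p, ((2, p) : Qubit) ∉ A) (w : Bool × (Fin n → ZMod q)) :
    ∑ p ∈ Finset.range (n * L + 1), ind (A ∪ workKet L w) p * W p = rowForm K a u i w := by
  have hind : ∀ p, ind (A ∪ workKet L w) p = ind (workKet L w) p := fun p => by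
    simp [ind, hA p]
  rw [Finset.sum_range_succ', add_comm, h0, hind, rowForm, sum_range_mul_block, Finset.sum_range]
  congr 1
  · congr 1
    unfold ind
    simp only [zero_mem_workKet hL]
    cases w.1 <;> rfl
  · refine Finset.sum_congr rfl fun j _ => ?_
    have hv : (w.2 j).val % 2 ^ L = (w.2 j).val :=
      Nat.mod_eq_of_lt ((ZMod.val_lt _).trans_le hL)
    rw [← hv, ← sum_testBit, Finset.mul_sum]
    refine Finset.sum_congr rfl fun k hk => ?_
    rw [Finset.mem_range] at hk
    have e : (j : ℕ) * L + k + 1 = 1 + j * L + k := by ring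
    rw [e, hW j j.2 k hk, hind]
    have : ind (workKet L w) (1 + j * L + k) = ((w.2 j).val.testBit k).toNat := by
      unfold ind
      simp only [mem_workKet_block hL j hk]
      cases (w.2 j).val.testBit k <;> rfl
    rw [this]; ring

/-! ### Measuring the rows -/

/-- Expected final value of `F'` at least the initial value of `F`. -/
def Gains (F : Store → QVec → ℝ) (p : QProg) (F' : Store → QVec → ℝ) : Prop :=
  ∀ σ ψ, F σ ψ ≤ p.wp F' σ ψ

theorem Gains.iterate {p : QProg} (F : ℕ → Store → QVec → ℝ) (k : ℕ)
    (h : ∀ i < k, Gains (F i) p (F (i + 1))) (σ : Store) (ψ : QVec) :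
    F 0 σ ψ ≤ (p.wp)^[k] (F k) σ ψ := by
  have key : ∀ j i, i + j = k → ∀ σ ψ, F i σ ψ ≤ (p.wp)^[j] (F k) σ ψ := by
    intro j
    induction j with
    | zero => intro i hi σ ψ; simp [← hi]
    | succ j ih =>
      intro i hi σ ψ
      rw [Function.iterate_succ_apply']
      exact (h i (by omega) σ ψ).trans (QProg.wp_mono (ih (i + 1) (by omega)) σ ψ)
  exact key k 0 (by omega) σ ψ

open Classical in
/-- Weight of the basis states with `G` in the configurations with `I`. -/
noncomputable def msrOn (G : Ket → Prop) (I : Store → QVec → Prop) : Store → QVec → ℝ :=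
  fun σ ψ => if I σ ψ then QVec.normSq (ψ.filter G) else 0

theorem msrOn_nonneg (G : Ket → Prop) (I : Store → QVec → Prop) (σ : Store) (ψ : QVec) :
    0 ≤ msrOn G I σ ψ := by
  unfold msrOn; split_ifs
  · exact QVec.normSq_nonneg _
  · exact le_rfl

open Classical in
theorem msrOn_of {G : Ket → Prop} {I : Store → QVec → Prop} {σ : Store} {ψ : QVec} (h : I σ ψ) :
    msrOn G I σ ψ = QVec.normSq (ψ.filter G) := if_pos h

theorem Gains.of_imp {G : Ket → Prop} {I : Store → QVec → Prop} {F : Store → QVec → ℝ}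
    {p : QProg} (hF : ∀ σ ψ, 0 ≤ F σ ψ)
    (h : ∀ σ ψ, I σ ψ → msrOn G I σ ψ ≤ p.wp F σ ψ) : Gains (msrOn G I) p F := by
  intro σ ψ
  by_cases hI : I σ ψ
  · exact h σ ψ hI
  · rw [msrOn, if_neg hI]; exact QProg.wp_nonneg hF _ _

section Rows

variable {n q : ℕ}

/-- The bits that are measured: leading bits of the fractional part of a row form. -/
def rowBit (K : ℕ) (a u : ℕ → ℕ) (i d : ℕ) (w : Bool × (Fin n → ZMod q)) : Bool :=
  (rowForm K a u i w).testBit (K - (d + 1))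

/-- Agreement on the first `i` rows and on the first `d` bits of row `i`. -/
def SameBits (K D : ℕ) (a u : ℕ → ℕ) (i d : ℕ) (w w' : Bool × (Fin n → ZMod q)) : Prop :=
  (∀ i' < i, ∀ d' < D, rowBit K a u i' d' w = rowBit K a u i' d' w') ∧
    ∀ d' < d, rowBit K a u i d' w = rowBit K a u i d' w'

/-- `w` is only confused with the partner in its coset. -/
def IsGood (K D m : ℕ) (a u : ℕ → ℕ) (s : Fin n → ZMod q) (w : Bool × (Fin n → ZMod q)) : Prop :=
  ∃ x, ∀ w', SameBits K D a u m 0 w w' ↔ ∃ b, cosetPt s x b = w'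

/-- The set is a class of the relation `T`, or empty. -/
def IsClass {α : Type*} (T : α → α → Prop) (s : Finset α) : Prop :=
  ∀ w ∈ s, ∀ w', w' ∈ s ↔ T w w'

/-- Measure the row at which the pointers stand. -/
def row (M D : ℕ) : QProg := .block [fillRow M, setv (M + 37) (var (M + 6)),
  .rep (.lit D) (.block [setv (M + 37) (.sub (var (M + 37)) (.lit 1)), measForm M])]

theorem row_writes (M D : ℕ) : (row M D).Writes fun a =>
    (M + 20 ≤ a ∧ a ≤ M + 37) ∨ a = M + 40 ∨ a = M + 41 := by
  have h1 := (measForm_writes M).mono (Y := fun a =>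
    (M + 20 ≤ a ∧ a ≤ M + 37) ∨ a = M + 40 ∨ a = M + 41) (fun a h => by omega)
  have h2 := (fillRow_writes M).mono (Y := fun a =>
    (M + 20 ≤ a ∧ a ≤ M + 37) ∨ a = M + 40 ∨ a = M + 41) (fun a h => by omega)
  refine ⟨h2, ?_, ⟨?_, h1, trivial⟩, trivial⟩ <;> simp [setv, QProg.Writes]

/-- Configurations after the measurement of `i` rows and `d` bits. -/
def Measured (M L K D i d : ℕ) (σ₀ : Store) [NeZero q] (n : ℕ) (Ω : Finset Ket) :
    Store → QVec → Prop :=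
  fun σ ψ => (∀ a < M + 20, σ a = σ₀ a) ∧
    ∃ (c : ℂ) (𝒮 : Finset (Bool × (Fin n → ZMod q))),
      ψ = uni c (prodSet Ω (𝒮.image (workKet L))) ∧
        IsClass (SameBits K D (σ₀ (M + 11)) (σ₀ (M + 12)) i d) 𝒮

/-- The two outcomes of a digit are complementary filters, so for any fixed set `G` of basis states
the weight on `G` is conserved in expectation. Meanwhile the surviving pairs shrink to those that
agree on all digits measured so far. Conservation replaces any computation of outcome probabilities.
-/
theorem row_gains {M : ℕ} {σ₀ : Store} {m L K r T D : ℕ} [NeZero q] (hc : Consts M σ₀ n m q L K r T)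
    (hL : q ≤ 2 ^ L) {Ω : Finset Ket} (hΩ : ∀ S ∈ Ω, ∀ p, ((2, p) : Qubit) ∉ S)
    {i : ℕ} (hA : ∀ j < n, σ₀ (M + 11) (i * n + j) < q) (hu : σ₀ (M + 12) i < q) (G : Ket → Prop) :
    Gains (msrOn G fun σ ψ => Measured (q := q) M L K D i 0 σ₀ n Ω σ ψ ∧ σ (M + 35) 0 = i * n ∧
        σ (M + 36) 0 = i) (row M D)
      (msrOn G fun σ ψ => Measured (q := q) M L K D (i + 1) 0 σ₀ n Ω σ ψ ∧
        σ (M + 35) 0 = (i + 1) * n ∧ σ (M + 36) 0 = i + 1) := by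
  classical
  apply Gains.of_imp (msrOn_nonneg _ _)
  rintro σ ψ ⟨hM, h35, h36⟩
  have hcσ := hc.congr hM.1
  obtain ⟨σ₁, d1, h1, h2, h3, h4⟩ := fillRow_spec (i := i) hcσ
    (by rw [hM.1 _ (by omega)]; exact hA) (by rw [hM.1 _ (by omega)]; exact hu) h35 h36
  rw [hM.1 (M + 12) (by omega)] at h3
  rw [hM.1 (M + 11) (by omega)] at h4
  have f1 : ∀ a < M + 20, σ₁ a = σ₀ a := fun a ha => by
    rw [d1.frame (fillRow_writes M) (by omega), hM.1 a ha]
  set σ₂ := wr σ₁ (M + 37) 0 K with e2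
  have f2 : ∀ a, a ≠ M + 37 → σ₂ a = σ₁ a := fun a ha => wr_of_ne _ _ _ ha
  let I : ℕ → Store → QVec → Prop := fun d τ φ =>
    (∀ a, a < M + 21 ∨ a = M + 35 ∨ a = M + 36 → τ a = σ₁ a) ∧ τ (M + 37) 0 = K - d ∧
      Measured (q := q) M L K D i d σ₀ n Ω τ φ
  have hstep : ∀ d < D, Gains (msrOn G (I d))
      (.block [setv (M + 37) (.sub (var (M + 37)) (.lit 1)), measForm M]) (msrOn G (I (d + 1))) := by
    intro d hd
    apply Gains.of_imp (msrOn_nonneg _ _)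
    rintro τ φ hI
    rw [msrOn_of hI]
    obtain ⟨g1, g2, g3, c, 𝒮, rfl, hcl⟩ := hI
    set τ₁ := wr τ (M + 37) 0 (K - (d + 1)) with t1
    have hev : (QExpr.sub (var (M + 37)) (.lit 1)).eval τ = K - (d + 1) := by
      simp only [QExpr.eval, var, g2]; omega
    have fτ : ∀ a, a ≠ M + 37 → τ₁ a = τ a := fun a ha => wr_of_ne _ _ _ ha
    have hcτ : Consts M τ₁ n m q L K r T := hc.congr fun a ha => by
      rw [fτ _ (by omega), g3 a ha]
    have hsupp : ∀ S ∈ (uni c (prodSet Ω (𝒮.image (workKet L)))).support, ∀ p, n * L + 1 ≤ p →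
        ((2, p) : Qubit) ∉ S := by
      intro S hS p hp hx
      obtain ⟨A, hA, B, hB, rfl⟩ := mem_prodSet.1 (uni_support _ _ hS)
      obtain ⟨w, -, rfl⟩ := Finset.mem_image.1 hB
      rcases Finset.mem_union.1 hx with hx | hx
      · exact hΩ A hA p hx
      · have := (of_mem_workKet hL hx).2
        simp at this; omega
    obtain ⟨τ', hwp, -, fr⟩ := hcτ.measForm_wp (t := K - (d + 1)) (by simp [t1, wr_apply])
      (by omega) hsupp
    have hform : ∀ o : Bool, (uni c (prodSet Ω (𝒮.image (workKet L)))).filter (fun S =>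
        (∑ p ∈ Finset.range (n * L + 1), ind S p * τ₁ (M + 20) p).testBit (K - (d + 1)) = o) =
        uni c (prodSet Ω ((𝒮.filter fun w =>
          rowBit K (σ₀ (M + 11)) (σ₀ (M + 12)) i d w = o).image (workKet L))) := by
      intro o
      rw [filter_uni]
      congr 1
      have key : ∀ A ∈ Ω, ∀ w, ∑ p ∈ Finset.range (n * L + 1),
          ind (A ∪ workKet L w) p * τ₁ (M + 20) p =
            rowForm (n := n) (q := q) K (σ₀ (M + 11)) (σ₀ (M + 12)) i w := by
        intro A hA w
        rw [fτ _ (by omega), g1 _ (by omega)]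
        exact form_workKet hL h3 h4 (hΩ A hA) w
      ext S
      simp only [Finset.mem_filter, mem_prodSet, Finset.mem_image]
      constructor
      · rintro ⟨⟨A, hA, _, ⟨w, hw, rfl⟩, rfl⟩, hs⟩
        rw [key A hA] at hs
        exact ⟨A, hA, _, ⟨w, ⟨hw, hs⟩, rfl⟩, rfl⟩
      · rintro ⟨A, hA, _, ⟨w, ⟨hw, hs⟩, rfl⟩, rfl⟩
        exact ⟨⟨A, hA, _, ⟨w, hw, rfl⟩, rfl⟩, by rw [key A hA]; exact hs⟩
    have hI' : ∀ o : Bool, I (d + 1) (τ' o) (uni c (prodSet Ω ((𝒮.filter fun w =>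
          rowBit K (σ₀ (M + 11)) (σ₀ (M + 12)) i d w = o).image (workKet L)))) := by
      intro o
      refine ⟨fun a ha => ?_, ?_, fun a ha => ?_, c, _, rfl, ?_⟩
      · rw [fr _ _ (by omega), fτ _ (by omega), g1 _ ha]
      · rw [fr _ _ (by omega)]; simp [t1, wr_apply]
      · rw [fr _ _ (by omega), fτ _ (by omega), g3 _ ha]
      · intro w hw w'
        rw [Finset.mem_filter] at hw
        rw [Finset.mem_filter, hcl w hw.1, SameBits, SameBits]
        constructor
        · rintro ⟨⟨k1, k2⟩, k3⟩
          refine ⟨k1, fun d' hd' => ?_⟩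
          rcases Nat.lt_succ_iff_lt_or_eq.1 hd' with h | rfl
          · exact k2 d' h
          · rw [hw.2, k3]
        · rintro ⟨k1, k2⟩
          exact ⟨⟨k1, fun d' hd' => k2 d' (by omega)⟩, by rw [← k2 d (by omega), hw.2]⟩
    have hgoal : ∀ g : Store → QVec → ℝ,
        (QProg.block [setv (M + 37) (.sub (var (M + 37)) (.lit 1)), measForm M]).wp g τ
          (uni c (prodSet Ω (𝒮.image (workKet L)))) = (measForm M).wp g τ₁
            (uni c (prodSet Ω (𝒮.image (workKet L)))) := by
      intro g
      have := CDet.setv (M + 37) (.sub (var (M + 37)) (.lit 1)) τ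
        (uni c (prodSet Ω (𝒮.image (workKet L))))
      rw [hev] at this
      exact this _
    rw [hgoal, hwp, hform, hform, msrOn_of (hI' false), msrOn_of (hI' true), ← hform, ← hform]
    apply le_of_eq
    rw [← QVec.normSq_filter_add (fun S => (∑ p ∈ Finset.range (n * L + 1),
      ind S p * τ₁ (M + 20) p).testBit (K - (d + 1)) = false)]
    congr 2
    · ext S; simp only [Finsupp.filter_apply]; split_ifs <;> rfl
    · ext S; simp only [Finsupp.filter_apply]; split_ifs <;> simp_all
  have hrep := Gains.iterate (fun d => msrOn G (I d)) D hstep σ₂ ψ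
  have hI0 : I 0 σ₂ ψ := by
    refine ⟨fun a ha => f2 _ (by omega), by simp [e2, wr_apply], fun a ha => ?_, hM.2⟩
    rw [f2 _ (by omega), f1 a ha]
  rw [msrOn_of hI0] at hrep
  rw [msrOn_of ⟨hM, h35, h36⟩]
  refine hrep.trans ?_
  have hwp : ∀ g : Store → QVec → ℝ, (row M D).wp g σ ψ =
      ((QProg.block [setv (M + 37) (.sub (var (M + 37)) (.lit 1)), measForm M]).wp)^[D] g σ₂ ψ := by
    intro g
    have hev : (var (M + 6)).eval σ₁ = K := by
      simp only [QExpr.eval, var]; rw [f1 _ (by omega), hc.hK]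
    have h5 := CDet.setv (M + 37) (var (M + 6)) σ₁ ψ
    rw [hev] at h5
    exact ((d1 ψ).seq h5) _
  rw [hwp]
  have hmono : ∀ (k : ℕ) (g g' : Store → QVec → ℝ), (∀ σ ψ, g σ ψ ≤ g' σ ψ) → ∀ σ ψ,
      ((QProg.block [setv (M + 37) (.sub (var (M + 37)) (.lit 1)), measForm M]).wp)^[k] g σ ψ ≤
      ((QProg.block [setv (M + 37) (.sub (var (M + 37)) (.lit 1)), measForm M]).wp)^[k] g' σ ψ := by
    intro k
    induction k with
    | zero => intro g g' h; exact h
    | succ k ih =>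
      intro g g' h
      simp only [Function.iterate_succ_apply]
      exact ih _ _ (QProg.wp_mono h)
  refine hmono D _ _ (fun τ φ => ?_) _ _
  by_cases hI : I D τ φ
  · rw [msrOn_of hI, msrOn_of]
    obtain ⟨g1, g2, g3, c, 𝒮, rfl, hcl⟩ := hI
    refine ⟨⟨g3, c, 𝒮, rfl, fun w hw w' => ?_⟩, ?_, ?_⟩
    · rw [hcl w hw, SameBits, SameBits]
      constructor
      · rintro ⟨k1, k2⟩
        refine ⟨fun i' hi' => ?_, fun d' hd' => by omega⟩
        rcases Nat.lt_succ_iff_lt_or_eq.1 hi' with h | rfl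
        · exact k1 i' h
        · exact k2
      · rintro ⟨k1, -⟩
        exact ⟨fun i' hi' => k1 i' (by omega), k1 i (by omega)⟩
    · rw [g1 _ (by omega), h1]
    · rw [g1 _ (by omega), h2]
  · rw [msrOn, if_neg hI]; exact msrOn_nonneg _ _ _ _

/-- Measure all rows. -/
def rows (M D : ℕ) : QProg := .block [setv (M + 35) (.lit 0), setv (M + 36) (.lit 0),
  .rep (var (M + 1)) (row M D)]

theorem rows_writes (M D : ℕ) : (rows M D).Writes fun a =>
    (M + 20 ≤ a ∧ a ≤ M + 37) ∨ a = M + 40 ∨ a = M + 41 := by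
  refine ⟨?_, ?_, row_writes M D, trivial⟩ <;> simp [setv, QProg.Writes]

-- The conservation law is applied to the set of good pairs. In the end a surviving class that
-- contains a good pair is exactly a coset, and a class that contains none has weight zero on this
-- set. Hence the initial share of good pairs bounds the probability of ending in a coset state from
-- below.
open Classical in
theorem rows_tri {M : ℕ} {σ₀ : Store} {m L K r T D : ℕ} [NeZero q] (hc : Consts M σ₀ n m q L K r T)
    (hL : q ≤ 2 ^ L) {Ω : Finset Ket} (hΩ : ∀ S ∈ Ω, ∀ p, ((2, p) : Qubit) ∉ S)
    (hA : ∀ p, σ₀ (M + 11) p < q) (hu : ∀ i, σ₀ (M + 12) i < q) (s : Fin n → ZMod q) {κ : ℝ}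
    (hκ : κ * (2 * (q : ℝ) ^ n) ≤ (Finset.univ.filter
      (IsGood K D m (σ₀ (M + 11)) (σ₀ (M + 12)) s)).card) :
    Tri κ (fun σ ψ => (∀ a < M + 20, σ a = σ₀ a) ∧ ∃ c, ψ = uni c (prodSet Ω
        ((Finset.univ : Finset (Bool × (Fin n → ZMod q))).image (workKet L)))) (rows M D)
      (fun σ ψ => (∀ a < M + 20, σ a = σ₀ a) ∧ ∃ c x, ψ = uni c (prodSet Ω
        ((Finset.univ.image (cosetPt s x)).image (workKet L)))) := by
  set good := Finset.univ.filter (IsGood K D m (σ₀ (M + 11)) (σ₀ (M + 12)) s) with hgood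
  obtain ⟨G, hG⟩ : ∃ G : Ket → Prop, ∀ S, G S ↔ S ∈ prodSet Ω (good.image (workKet L)) :=
    ⟨_, fun _ => Iff.rfl⟩
  rintro σ ψ ⟨hfr, c, rfl⟩
  have hsepΩ : ∀ S ∈ Ω, ∀ a ∈ S, ¬ (a.1 = 2) := by
    rintro S hS ⟨x, p⟩ ha h1
    simp only at h1
    subst h1
    exact hΩ S hS p ha
  have hsepW : ∀ t : Finset (Bool × (Fin n → ZMod q)), ∀ S ∈ t.image (workKet L), ∀ a ∈ S,
      a.1 = 2 := by
    intro t S hS a ha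
    obtain ⟨w, -, rfl⟩ := Finset.mem_image.1 hS
    exact (of_mem_workKet hL ha).1
  set σ₁ := wr (wr σ (M + 35) 0 0) (M + 36) 0 0 with e1
  have f1 : ∀ a < M + 20, σ₁ a = σ₀ a := fun a ha => by
    rw [e1, wr_of_ne _ _ _ (by omega), wr_of_ne _ _ _ (by omega), hfr a ha]
  have hgain := Gains.iterate (p := row M D) (fun i => msrOn G fun σ ψ =>
    Measured (q := q) M L K D i 0 σ₀ n Ω σ ψ ∧ σ (M + 35) 0 = i * n ∧ σ (M + 36) 0 = i) m
    (fun i _ => row_gains hc hL hΩ (fun j _ => hA _) (hu i) G) σ₁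
    (uni c (prodSet Ω ((Finset.univ : Finset (Bool × (Fin n → ZMod q))).image (workKet L))))
  rw [msrOn_of ⟨⟨f1, c, Finset.univ, rfl, fun w _ w' => by simp [SameBits]⟩,
    by simp [e1, wr_apply], by simp [e1, wr_apply]⟩] at hgain
  have hfilt : (uni c (prodSet Ω ((Finset.univ : Finset (Bool × (Fin n → ZMod q))).image
      (workKet L)))).filter G = uni c (prodSet Ω (good.image (workKet L))) := by
    rw [filter_uni]
    congr 1
    ext S
    simp only [Finset.mem_filter, hG]
    refine and_iff_right_of_imp fun h => ?_
    obtain ⟨A, hA, B, hB, rfl⟩ := mem_prodSet.1 h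
    exact mem_prodSet.2 ⟨A, hA, B, Finset.image_subset_image (Finset.subset_univ _) hB, rfl⟩
  rw [hfilt, normSq_uni, card_prodSet hsepΩ (hsepW _),
    Finset.card_image_of_injective _ (workKet_injective hL)] at hgain
  have hwp : ∀ g : Store → QVec → ℝ, (rows M D).wp g σ (uni c (prodSet Ω
      ((Finset.univ : Finset (Bool × (Fin n → ZMod q))).image (workKet L)))) =
      ((row M D).wp)^[m] g σ₁ (uni c (prodSet Ω
        ((Finset.univ : Finset (Bool × (Fin n → ZMod q))).image (workKet L)))) := by
    intro g
    have hm : (var (M + 1)).eval σ₁ = m := by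
      simp only [QExpr.eval, var]; rw [f1 _ (by omega), hc.hm]
    change (QProg.rep (var (M + 1)) (row M D)).wp g σ₁ _ = _
    simp only [QProg.wp, hm]
  rw [hwp, normSq_uni, card_prodSet hsepΩ (hsepW _),
    Finset.card_image_of_injective _ (workKet_injective hL)]
  have hcard : (((Finset.univ : Finset (Bool × (Fin n → ZMod q))).card : ℕ) : ℝ) = 2 * (q : ℝ) ^ n := by
    simp [Finset.card_univ, ZMod.card]
  refine le_trans ?_ (hgain.trans ?_)
  · push_cast
    rw [hcard]
    have h0 : 0 ≤ ‖c‖ ^ 2 * (Ω.card : ℝ) := by positivity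
    nlinarith [mul_le_mul_of_nonneg_left hκ h0]
  · have hmono : ∀ (k : ℕ) (g g' : Store → QVec → ℝ), (∀ σ ψ, g σ ψ ≤ g' σ ψ) → ∀ σ ψ,
        ((row M D).wp)^[k] g σ ψ ≤ ((row M D).wp)^[k] g' σ ψ := by
      intro k
      induction k with
      | zero => intro g g' h; exact h
      | succ k ih =>
        intro g g' h
        simp only [Function.iterate_succ_apply]
        exact ih _ _ (QProg.wp_mono h)
    refine hmono m _ _ (fun τ φ => ?_) _ _
    by_cases hI : Measured (q := q) M L K D m 0 σ₀ n Ω τ φ ∧ τ (M + 35) 0 = m * n ∧ τ (M + 36) 0 = m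
    · rw [msrOn_of hI]
      obtain ⟨⟨g1, c', 𝒮, rfl, hcl⟩, -, -⟩ := hI
      by_cases hne : ∃ w ∈ 𝒮, w ∈ good
      · obtain ⟨w, hw, hwg⟩ := hne
        obtain ⟨x, hx⟩ := (Finset.mem_filter.1 hwg).2
        have h𝒮 : 𝒮 = Finset.univ.image (cosetPt s x) := by
          ext w'
          rw [hcl w hw, hx, Finset.mem_image]
          simp only [Finset.mem_univ, true_and]
        rw [msr_of ⟨g1, c', x, by rw [h𝒮]⟩]
        refine le_of_le_of_eq ?_ (QVec.normSq_filter_add G _)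
        exact le_add_of_nonneg_right (QVec.normSq_nonneg _)
      · have : (uni c' (prodSet Ω (𝒮.image (workKet L)))).filter G = 0 := by
          rw [filter_uni]
          have : (prodSet Ω (𝒮.image (workKet L))).filter G = ∅ := by
            rw [Finset.filter_eq_empty_iff]
            intro S hS hGS
            obtain ⟨A, hA, B, hB, rfl⟩ := mem_prodSet.1 hS
            obtain ⟨A', hA', B', hB', heq⟩ := mem_prodSet.1 ((hG _).1 hGS)
            have := (union_inj_of_sep (hsepΩ A' hA') (hsepΩ A hA) (hsepW _ B' hB')
              (hsepW _ B hB) heq).2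
            obtain ⟨w, hw, rfl⟩ := Finset.mem_image.1 hB
            obtain ⟨w', hw', rfl⟩ := Finset.mem_image.1 hB'
            rw [workKet_injective hL this] at hw'
            exact hne ⟨w, hw, hw'⟩
          rw [this, uni_empty]
        rw [this]
        have h0 : QVec.normSq 0 = 0 := by simp [QVec.normSq]
        rw [h0]
        exact msr_nonneg _ _ _
    · rw [msrOn, if_neg hI]; exact msr_nonneg _ _ _

end Rows

/-! ### The registers of the solver -/

section Register

variable {n q : ℕ}

/-- Prepare a coset state in the work array. -/
def prepare (M D : ℕ) : QProg := .block
  [setv (M + 33) (.lit 1), .rep (var M) (coord M), .had 2 (.lit 0), rows M D]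

theorem prepare_writes (M D : ℕ) : (prepare M D).Writes fun a =>
    (M + 20 ≤ a ∧ a ≤ M + 37) ∨ a = M + 40 ∨ a = M + 41 := by
  refine ⟨?_, (coord_writes M).mono fun a h => .inl h, trivial, rows_writes M D, trivial⟩
  simp [setv, QProg.Writes]

open Classical in
theorem prepare_tri {M : ℕ} {σ₀ : Store} {m L K r T D : ℕ} [NeZero q]
    (hc : Consts M σ₀ n m q L K r T) (hLq : q ≤ 2 ^ L) (hL : 2 ^ L < 2 * q) (hK : q * q ≤ 2 ^ K)
    {Ω : Finset Ket} (hΩ : ∀ S ∈ Ω, ∀ p, ((2, p) : Qubit) ∉ S)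
    (hA : ∀ p, σ₀ (M + 11) p < q) (hu : ∀ i, σ₀ (M + 12) i < q) (s : Fin n → ZMod q) {κ : ℝ}
    (hκ0 : 0 ≤ κ) (hκ : κ * (2 * (q : ℝ) ^ n) ≤ (Finset.univ.filter
      (IsGood K D m (σ₀ (M + 11)) (σ₀ (M + 12)) s)).card) :
    Tri ((1 - (1 / 2) ^ T) ^ n * κ)
      (fun σ ψ => (∀ a < M + 20, σ a = σ₀ a) ∧ ∃ c, ψ = uni c Ω) (prepare M D)
      (fun σ ψ => (∀ a < M + 20, σ a = σ₀ a) ∧ ∃ c x, ψ = uni c (prodSet Ω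
        ((Finset.univ.image (cosetPt s x)).image (workKet L)))) := by
  have hT : (0 : ℝ) ≤ 1 - (1 / 2) ^ T :=
    sub_nonneg.2 (pow_le_one₀ (by norm_num) (by norm_num))
  have h1 : Tri 1 (fun σ ψ => (∀ a < M + 20, σ a = σ₀ a) ∧ ∃ c, ψ = uni c Ω)
      (setv (M + 33) (.lit 1)) (fun σ ψ => ((∀ a < M + 20, σ a = σ₀ a) ∧
        σ (M + 33) 0 = 1 + 0 * L ∧ ∃ c, ψ = uni c (prodSet Ω (partialKets n q L 0))) ∧
        (var M).eval σ = n) := by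
    apply CDet.tri
    rintro σ ψ ⟨h1, c, rfl⟩
    refine ⟨_, CDet.setv _ _ _, ⟨fun a ha => by rw [wr_of_ne _ _ _ (by omega), h1 a ha], ?_, c, ?_⟩,
      ?_⟩
    · simp [wr_apply, QExpr.eval]
    · rw [partialKets_zero, prodSet_singleton_empty]
    · simp only [QExpr.eval, var]
      rw [wr_of_ne _ _ _ (by omega), h1 _ (by omega), hc.hn]
  have h2 := Tri.rep (κ := 1 - (1 / 2) ^ T) hT (p := coord M) (e := var M)
    (fun i σ ψ => (∀ a < M + 20, σ a = σ₀ a) ∧ σ (M + 33) 0 = 1 + i * L ∧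
      ∃ c, ψ = uni c (prodSet Ω (partialKets n q L i))) n ?_
  · have h3 : Tri 1 (fun σ ψ => (∀ a < M + 20, σ a = σ₀ a) ∧ σ (M + 33) 0 = 1 + n * L ∧
        ∃ c, ψ = uni c (prodSet Ω (partialKets n q L n))) (.had 2 (.lit 0))
        (fun σ ψ => (∀ a < M + 20, σ a = σ₀ a) ∧ ∃ c, ψ = uni c (prodSet Ω
          ((Finset.univ : Finset (Bool × (Fin n → ZMod q))).image (workKet L)))) := by
      rintro σ ψ ⟨h1, -, c, rfl⟩
      have hfree : ∀ S ∈ prodSet Ω (partialKets n q L n), ((2, 0) : Qubit) ∉ S := by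
        intro S hS hx
        obtain ⟨A, hA, B, hB, rfl⟩ := mem_prodSet.1 hS
        obtain ⟨x, -, rfl⟩ := Finset.mem_image.1 hB
        rcases Finset.mem_union.1 hx with hx | hx
        · exact hΩ A hA _ hx
        · have := (of_mem_partialKet hLq hx).2.1
          simp at this
      simp only [QProg.wp, QExpr.eval]
      rw [one_mul, msr_of, normSq_gateH_uni _ _ _ hfree]
      exact ⟨h1, _, by rw [gateH_uni _ _ _ hfree, image_workKet_univ]⟩
    have h4 := rows_tri (D := D) hc hLq hΩ hA hu s hκ
    have h5 : Tri 1 (fun σ ψ => (∀ a < M + 20, σ a = σ₀ a) ∧ ∃ c x, ψ = uni c (prodSet Ω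
        ((Finset.univ.image (cosetPt s x)).image (workKet L)))) (.block [])
        (fun σ ψ => (∀ a < M + 20, σ a = σ₀ a) ∧ ∃ c x, ψ = uni c (prodSet Ω
        ((Finset.univ.image (cosetPt s x)).image (workKet L)))) :=
      CDet.tri fun σ ψ h => ⟨σ, CDet.nil σ, h⟩
    have := h1.seq (by positivity) (h2.seq (by positivity) (h3.seq (by positivity)
      (h4.seq zero_le_one h5)))
    simpa [prepare, QProg.block] using this
  · intro i hi
    have hb : 1 + i * L + L ≤ n * L + 1 := by
      have : (i + 1) * L ≤ n * L := Nat.mul_le_mul_right _ hi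
      rw [add_mul] at this; omega
    refine (coord_tri (σ₀ := σ₀) (base := 1 + i * L) (Ω := prodSet Ω (partialKets n q L i)) hc hb hLq
      hL hK ?_).conseq (fun σ ψ h => h) ?_
    · intro S hS p hp hx
      obtain ⟨A, hA, B, hB, rfl⟩ := mem_prodSet.1 hS
      obtain ⟨x, -, rfl⟩ := Finset.mem_image.1 hB
      rcases Finset.mem_union.1 hx with hx | hx
      · exact hΩ A hA _ hx
      · have := (of_mem_partialKet hLq hx).2.2
        simp at this; omega
    · rintro σ ψ ⟨k1, k2, c, rfl⟩
      refine ⟨k1, by rw [k2]; ring, c, ?_⟩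
      rw [prodSet_assoc]
      have := partialKets_succ (n := n) (q := q) L ⟨i, hi⟩
      rw [← this]

/-- Move the state from the work array to the next register. -/
def move (M : ℕ) : QProg := .block
  [.cnot 2 (.lit 0) 0 (var (M + 38)), .cnot 0 (var (M + 38)) 2 (.lit 0), setv (M + 34) (.lit 1),
    .rep (var (M + 4)) (.block [.cnot 2 (var (M + 34)) 1 (var (M + 39)),
      .cnot 1 (var (M + 39)) 2 (var (M + 34)), incr (M + 34), incr (M + 39)]),
    incr (M + 38)]

theorem mapDomain_moveQubit (a b : Qubit) (ψ : QVec) :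
    gateCX b a (gateCX a b ψ) = ψ.mapDomain (moveQubit a b) := by
  rw [gateCX_eq, gateCX_eq, ← Finsupp.mapDomain_comp]
  rfl

theorem move_spec {M : ℕ} {σ : Store} {N j b : ℕ} (hN : σ (M + 4) 0 = N) (hj : σ (M + 38) 0 = j)
    (hb : σ (M + 39) 0 = b) (ψ : QVec) :
    ∃ σ', Det (move M) σ ψ σ' (ψ.mapDomain (moveKet j b N)) ∧ σ' (M + 38) 0 = j + 1 ∧
      σ' (M + 39) 0 = b + N ∧ ∀ a < M + 20, σ' a = σ a := by
  have hrep := Hoare.rep (e := var (M + 4)) (p := .block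
      [.cnot 2 (var (M + 34)) 1 (var (M + 39)),
      .cnot 1 (var (M + 39)) 2 (var (M + 34)), incr (M + 34), incr (M + 39)])
    (fun k τ φ => (∀ a, a ≠ M + 34 → a ≠ M + 39 → τ a = σ a) ∧ τ (M + 34) 0 = 1 + k ∧
      τ (M + 39) 0 = b + k ∧ φ = ψ.mapDomain (moveKet j b k)) N ?_
    (wr σ (M + 34) 0 1) (ψ.mapDomain (moveQubit (2, 0) (0, j))) ?_
  · obtain ⟨σ', φ, d, h1, h2, h3, rfl⟩ := hrep
    refine ⟨wr σ' (M + 38) 0 (j + 1), ?_, by simp [wr_apply], ?_, fun a ha => ?_⟩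
    · intro g
      have := d (fun τ φ => g (wr τ (M + 38) 0 (τ (M + 38) 0 + 1)) φ)
      rw [h1 _ (by omega) (by omega), hj] at this
      rw [← this]
      simp only [move, QProg.block, incr, setv]
      rw [← mapDomain_moveQubit]
      simp only [QProg.wp, QExpr.eval, var, hj]
    · rw [wr_of_ne _ _ _ (by omega), h3]
    · rw [wr_of_ne _ _ _ (by omega), h1 _ (by omega) (by omega)]
  · rintro k _ τ φ ⟨h1, h2, h3, rfl⟩
    refine ⟨wr (wr τ (M + 34) 0 (1 + k + 1)) (M + 39) 0 (b + k + 1),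
      (ψ.mapDomain (moveKet j b k)).mapDomain (moveQubit (2, 1 + k) (1, b + k)),
      fun g => ?_, fun a ha hb => ?_, ?_, ?_, ?_⟩
    · rw [← mapDomain_moveQubit]
      simp [QProg.block, incr, setv, QProg.wp, QExpr.eval, var, h2, h3, wr_apply]
    · rw [wr_of_ne _ _ _ hb, wr_of_ne _ _ _ ha, h1 a ha hb]
    · simp [wr_apply]; ring
    · simp [wr_apply]; ring
    · rw [← Finsupp.mapDomain_comp]; rfl
  · refine ⟨⟨fun a ha _ => wr_of_ne _ _ _ ha, by simp [wr_apply], by simp [wr_apply, hb], rfl⟩, ?_⟩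
    simp [QExpr.eval, var, wr_apply, hN]

theorem move_perm (M : ℕ) : (move M).Perm := by
  simp [move, QProg.block, QProg.Perm, setv, incr]

/-- Prepare all registers. -/
def registers (M D : ℕ) : QProg := .block
  [setv (M + 38) (.lit 0), setv (M + 39) (.lit 0),
    .rep (var (M + 8)) (.seq (prepare M D) (move M))]

-- Finished registers live in arrays 0 and 1 and form the factor `Ω` that all preparation steps
-- carry along. After each move the work array is clear again, so the rounds compose and their
-- factors multiply.
open Classical in
theorem registers_tri {M : ℕ} {σ₀ : Store} {m K r T D : ℕ} [NeZero q]
    (hc : Consts M σ₀ n m q (Nat.clog 2 q) K r T) (hq : 1 < q) (hK : q * q ≤ 2 ^ K)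
    (hA : ∀ p, σ₀ (M + 11) p < q) (hu : ∀ i, σ₀ (M + 12) i < q) (s : Fin n → ZMod q) {κ : ℝ}
    (hκ0 : 0 ≤ κ) (hκ : κ * (2 * (q : ℝ) ^ n) ≤ (Finset.univ.filter
      (IsGood K D m (σ₀ (M + 11)) (σ₀ (M + 12)) s)).card) :
    Tri (((1 - (1 / 2) ^ T) ^ n * κ) ^ r)
      (fun σ ψ => (∀ a < M + 20, σ a = σ₀ a) ∧ ψ = Finsupp.single ∅ 1) (registers M D)
      (fun σ ψ => (∀ a < M + 20, σ a = σ₀ a) ∧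
        ∃ (c : ℂ) (x : Fin r → Fin n → ZMod q), ψ = uni c (cosetKets s x)) := by
  have hT : (0 : ℝ) ≤ 1 - (1 / 2) ^ T :=
    sub_nonneg.2 (pow_le_one₀ (by norm_num) (by norm_num))
  have hLq : q ≤ 2 ^ Nat.clog 2 q := Nat.le_pow_clog (by norm_num) q
  have hL : 2 ^ Nat.clog 2 q < 2 * q := by
    have h1 := Nat.pow_pred_clog_lt_self (b := 2) (by norm_num) hq
    have h2 : 0 < Nat.clog 2 q := Nat.clog_pos (by norm_num) hq
    obtain ⟨L', hL'⟩ : ∃ L', Nat.clog 2 q = L' + 1 := ⟨Nat.clog 2 q - 1, by omega⟩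
    rw [hL'] at h1 ⊢
    simp only [Nat.pred_succ] at h1
    rw [pow_succ]; omega
  let I : ℕ → Store → QVec → Prop := fun j σ ψ => (∀ a < M + 20, σ a = σ₀ a) ∧
    σ (M + 38) 0 = j ∧ σ (M + 39) 0 = j * (n * Nat.clog 2 q) ∧
      ∃ (c : ℂ) (x : Fin j → Fin n → ZMod q), ψ = uni c (cosetKets s x)
  have hstep : ∀ j < r, Tri ((1 - (1 / 2) ^ T) ^ n * κ) (I j) (.seq (prepare M D) (move M))
      (I (j + 1)) := by
    rintro j hj σ ψ ⟨h1, h2, h3, c, x, rfl⟩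
    have hfr := Tri.frame (prepare_writes M D) σ
      ((prepare_tri (D := D) hc hLq hL hK (Ω := cosetKets s x) (fun S hS p hx => by
        obtain ⟨b, -, rfl⟩ := Finset.mem_image.1 hS
        exact two_notMem_encodeRegs _ p hx) hA hu s hκ0 hκ).conseq
        (I' := fun τ φ => ((∀ a < M + 20, τ a = σ₀ a) ∧ ∃ c, φ = uni c (cosetKets s x)) ∧
          ∀ a, ¬((M + 20 ≤ a ∧ a ≤ M + 37) ∨ a = M + 40 ∨ a = M + 41) → τ a = σ a)
        (fun _ _ h => h.1) (fun _ _ h => h))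
    refine (hfr σ _ ⟨⟨h1, c, rfl⟩, fun _ _ => rfl⟩).trans ?_
    simp only [QProg.wp]
    apply QProg.wp_mono
    intro τ φ
    by_cases hI : ((∀ a < M + 20, τ a = σ₀ a) ∧ ∃ c y, φ = uni c (prodSet (cosetKets s x)
        ((Finset.univ.image (cosetPt s y)).image (workKet (Nat.clog 2 q))))) ∧
        ∀ a, ¬((M + 20 ≤ a ∧ a ≤ M + 37) ∨ a = M + 40 ∨ a = M + 41) → τ a = σ a
    · rw [msr_of hI]
      obtain ⟨⟨g1, c', y, rfl⟩, g2⟩ := hI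
      obtain ⟨τ', d, k1, k2, k3⟩ := move_spec (M := M) (σ := τ) (N := n * Nat.clog 2 q) (j := j)
        (b := j * (n * Nat.clog 2 q)) (by rw [g1 _ (by omega), hc.hN])
        (by rw [g2 _ (by omega), h2]) (by rw [g2 _ (by omega), h3]) (uni c' (prodSet (cosetKets s x)
          ((Finset.univ.image (cosetPt s y)).image (workKet (Nat.clog 2 q)))))
      rw [d, msr_of, d.normSq (move_perm M)]
      refine ⟨fun a ha => by rw [k3 a ha, g1 a ha], k1, by rw [k2]; ring, c',
        Fin.snoc (α := fun _ => Fin n → ZMod q) x y, ?_⟩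
      rw [mapDomain_uni _ _ (moveKet_injective _ _ _)]
      congr 1
      convert cosetKets_snoc s x y
    · rw [msr, if_neg hI]; exact QProg.wp_nonneg (msr_nonneg _) _ _
  have hrep := Tri.rep (κ := (1 - (1 / 2) ^ T) ^ n * κ) (by positivity)
    (p := .seq (prepare M D) (move M)) (e := var (M + 8)) I r hstep
  have h1 : Tri 1 (fun σ ψ => (∀ a < M + 20, σ a = σ₀ a) ∧ ψ = Finsupp.single ∅ 1)
      (.seq (setv (M + 38) (.lit 0)) (setv (M + 39) (.lit 0)))
      (fun σ ψ => I 0 σ ψ ∧ (var (M + 8)).eval σ = r) := by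
    apply CDet.tri
    rintro σ ψ ⟨h1, rfl⟩
    refine ⟨_, (CDet.setv _ _ _).seq (CDet.setv _ _ _), ⟨fun a ha => ?_, ?_, ?_, 1, Fin.elim0, ?_⟩, ?_⟩
    · rw [wr_of_ne _ _ _ (by omega), wr_of_ne _ _ _ (by omega), h1 a ha]
    · simp [wr_apply, QExpr.eval]
    · simp [wr_apply, QExpr.eval]
    · rw [cosetKets_zero]; simp [uni]
    · simp only [QExpr.eval, var]
      rw [wr_of_ne _ _ _ (by omega), wr_of_ne _ _ _ (by omega), h1 _ (by omega), hc.hr]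
  have h2 : Tri 1 (I r) (.block []) (fun σ ψ => (∀ a < M + 20, σ a = σ₀ a) ∧
        ∃ (c : ℂ) (x : Fin r → Fin n → ZMod q), ψ = uni c (cosetKets s x)) :=
    CDet.tri fun σ ψ h => ⟨σ, CDet.nil σ, h.1, h.2.2.2⟩
  have h3 := h1.seq (by positivity) (hrep.seq zero_le_one h2)
  rw [one_mul, mul_one] at h3
  exact h3

end Register

/-! ### Classical programs with their running times -/

/-- Determinism is stated through expectations; testing with the indicator of a wrong final store
shows that no branch at all can have one, even of probability zero. This is needed for running
times, which concern every branch. -/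
theorem CDet.exec_store {p : QProg} {σ σ' : Store} (h : CDet p σ σ') {β γ : Branch}
    (hβ : β.store = σ) (hγ : γ ∈ p.exec β) : γ.store = σ' := by
  classical
  subst hβ
  have h1 := h β.vec (fun τ _ => if τ = σ' then 0 else 1)
  rw [← p.exec_sum] at h1
  simp only [if_true] at h1
  by_contra hne
  have h2 := List.single_le_sum (l := (p.exec β).map
    fun γ => if γ.store = σ' then (0 : ℝ) else 1) (by
      simp only [List.mem_map]; rintro _ ⟨δ, -, rfl⟩; split_ifs <;> norm_num) 1
    (List.mem_map.2 ⟨γ, hγ, by simp [hne]⟩)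
  linarith

/-- `p` takes `σ` to `σ'` within `weight * (B + 1)` steps. -/
def Runs (B : ℕ) (p : QProg) (σ σ' : Store) : Prop :=
  CDet p σ σ' ∧ ∀ β γ, β.store = σ → γ ∈ p.exec β → γ.time ≤ β.time + p.weight * (B + 1)

theorem Runs.seq {B : ℕ} {p r : QProg} {σ σ' σ'' : Store} (h : Runs B p σ σ') (h' : Runs B r σ' σ'') :
    Runs B (.seq p r) σ σ'' := by
  refine ⟨h.1.seq h'.1, fun β γ hβ hγ => ?_⟩
  simp only [QProg.exec, List.mem_flatMap] at hγ
  obtain ⟨δ, h1, h2⟩ := hγ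
  have t1 := h.2 β δ hβ h1
  have t2 := h'.2 δ γ (h.1.exec_store hβ h1) h2
  simp only [QProg.weight, add_mul] at *
  omega

/-- The initialization computes its own loop counts and so is not `Stable` as a whole. Its pieces
are, and `Runs` glues them by keeping track of the store in between. -/
theorem Runs.of_stable {B : ℕ} {C : ℕ → Prop} {p : QProg} {σ σ' : Store} (h : CDet p σ σ')
    (hp : p.Stable C) (hB : p.LoopsLe σ B) (hd : p.depth ≤ 1) : Runs B p σ σ' := by
  refine ⟨h, fun β γ hβ hγ => ?_⟩
  refine (QProg.time_le hp hB (fun a _ => by rw [hβ]) hγ).trans ?_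
  gcongr
  calc (B + 1) ^ p.depth ≤ (B + 1) ^ 1 := Nat.pow_le_pow_right (by omega) hd
    _ = B + 1 := pow_one _

theorem Runs.assign (B a : ℕ) (i e : QExpr) (σ : Store) :
    Runs B (.assign a i e) σ (wr σ a (i.eval σ) (e.eval σ)) :=
  .of_stable (C := fun _ => False) (.assign _ _ _ _) (by simp [QProg.Stable])
    (by simp [QProg.LoopsLe]) (by simp [QProg.depth])

theorem Runs.setv (B a : ℕ) (e : QExpr) (σ : Store) : Runs B (setv a e) σ (wr σ a 0 (e.eval σ)) :=
  Runs.assign B a (.lit 0) e σ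

theorem Runs.nil (B : ℕ) (σ : Store) : Runs B (.block []) σ σ :=
  .of_stable (C := fun _ => False) (.nil σ) (by simp [QProg.Stable, QProg.block])
    (by simp [QProg.LoopsLe, QProg.block]) (by simp [QProg.depth, QProg.block])

theorem Runs.cons {B : ℕ} {p : QProg} {l : List QProg} {σ σ' σ'' : Store} (h : Runs B p σ σ')
    (h' : Runs B (.block l) σ' σ'') : Runs B (.block (p :: l)) σ σ'' := h.seq h'

theorem wr_wr (σ : Store) (a i v w : ℕ) : wr (wr σ a i v) a i w = wr σ a i w := by
  funext b j
  simp only [wr_apply]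
  split_ifs <;> rfl

/-- `a := b * c`. -/
def mulInto (a b c : ℕ) : QProg :=
  .block [setv a (.lit 0), .rep (var b) (setv a (.add (var a) (var c)))]

theorem Runs.mulInto {B a b c : ℕ} (hab : b ≠ a) (hac : c ≠ a) {σ : Store} (hB : σ b 0 ≤ B) :
    Runs B (mulInto a b c) σ (wr σ a 0 (σ b 0 * σ c 0)) := by
  refine .cons (.setv _ _ _ _) (.cons (.of_stable (C := fun x => x = b) ?_ ?_ ?_ ?_) (.nil _ _))
  · have := CDet.rep (p := _root_.setv a (.add (var a) (var c))) (e := var b)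
      (fun i τ => τ = wr σ a 0 (i * σ c 0)) (σ b 0) (fun i _ τ hτ => ?_)
      (σ := wr σ a 0 ((QExpr.lit 0).eval σ)) (by simp [QExpr.eval])
      (by simp [QExpr.eval, var, wr_apply, hab])
    · obtain ⟨σ', d, rfl⟩ := this
      exact d
    · refine ⟨_, .setv _ _ _, ?_⟩
      rw [hτ, wr_wr]
      simp [QExpr.eval, var, wr_apply, hac]
      ring_nf
  · simpa [QProg.Stable, QExpr.Reads, var, _root_.setv] using hab.symm
  · simpa [QProg.LoopsLe, QExpr.eval, var, _root_.setv, wr_apply, hab] using hB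
  · simp [QProg.depth, _root_.setv]

/-- Move the first cells of an array to another array. -/
def moveArray (src dst cnt ctr : ℕ) : QProg := .block [setv ctr (.lit 0),
  .rep (var cnt) (.block [.assign dst (var ctr) (.get src (var ctr)),
    .assign src (var ctr) (.lit 0), incr ctr])]

theorem Runs.moveArray {B src dst cnt ctr : ℕ} (h1 : src ≠ dst) (h2 : src ≠ ctr) (h3 : dst ≠ ctr)
    (h4 : cnt ≠ src) (h5 : cnt ≠ dst) (h6 : cnt ≠ ctr) {σ : Store} (hB : σ cnt 0 ≤ B) :
    ∃ σ', Runs B (moveArray src dst cnt ctr) σ σ' ∧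
      (∀ i, σ' dst i = if i < σ cnt 0 then σ src i else σ dst i) ∧
      (∀ i, σ' src i = if i < σ cnt 0 then 0 else σ src i) ∧
      ∀ a, a ≠ src → a ≠ dst → a ≠ ctr → σ' a = σ a := by
  have := CDet.rep (p := .block [.assign dst (var ctr) (.get src (var ctr)),
    .assign src (var ctr) (.lit 0), incr ctr]) (e := var cnt)
    (fun k τ => τ ctr 0 = k ∧ (∀ i, τ dst i = if i < k then σ src i else σ dst i) ∧
      (∀ i, τ src i = if i < k then 0 else σ src i) ∧
      ∀ a, a ≠ src → a ≠ dst → a ≠ ctr → τ a = σ a) (σ cnt 0) (fun k _ τ hτ => ?_)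
    (σ := wr σ ctr 0 ((QExpr.lit 0).eval σ)) ?_ ?_
  · obtain ⟨σ', d, -, h⟩ := this
    refine ⟨σ', .cons (.setv _ _ _ _) (.cons (.of_stable (C := fun x => x = cnt) d ?_ ?_ ?_)
      (.nil _ _)), h⟩
    · simp [QProg.Stable, QProg.block, incr, _root_.setv, QExpr.Reads, var, h4.symm, h5.symm,
        h6.symm]
    · simp [QProg.LoopsLe, QProg.block, incr, _root_.setv, QExpr.eval, var, wr_apply, h6, hB]
    · simp [QProg.depth, QProg.block, incr, _root_.setv]
  · obtain ⟨g1, g2, g3, g4⟩ := hτ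
    refine ⟨_, .cons (.assign _ _ _ _) (.cons (.assign _ _ _ _) (.cons (.incr _ _) (.nil _))),
      ?_, ?_, ?_, ?_⟩
    · simp [wr_apply, h2.symm, h3.symm, g1]
    · intro i
      simp only [wr_apply, QExpr.eval, var, g1, g2, g3]
      by_cases hi : i = k
      · subst hi; simp [h1.symm, h3]
      · have : i < k + 1 ↔ i < k := by omega
        simp [h1.symm, h3, hi, this]
    · intro i
      simp only [wr_apply, QExpr.eval, var, g1, g3]
      by_cases hi : i = k
      · subst hi; simp [h2, h3.symm]
      · have : i < k + 1 ↔ i < k := by omega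
        simp [h1, h2, hi, this, h3.symm]
    · intro a ha hb hc
      rw [wr_of_ne _ _ _ hc, wr_of_ne _ _ _ ha, wr_of_ne _ _ _ hb, g4 a ha hb hc]
  · exact ⟨by simp [wr_apply, QExpr.eval], fun i => by simp [wr_apply, h3],
      fun i => by simp [wr_apply, h2], fun a _ _ h => wr_of_ne _ _ _ h⟩
  · simp [QExpr.eval, var, wr_apply, h6]

/-! ### Evaluation of a polynomial -/

/-- Value of the polynomial with the coefficients `l`. -/
def evalList (x : ℕ) : List ℕ → ℕ
  | [] => 0
  | c :: l => x * evalList x l + c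

theorem exists_evalList (p : Polynomial ℕ) : ∃ l, ∀ x, evalList x l = p.eval x := by
  induction p using Polynomial.recOnHorner with
  | M0 => exact ⟨[], fun x => by simp [evalList]⟩
  | MC p a _ _ ih =>
    obtain ⟨l, h⟩ := ih
    cases l with
    | nil => exact ⟨[a], fun x => by simp [evalList, ← h x]⟩
    | cons c l => exact ⟨(c + a) :: l, fun x => by simp [evalList, ← h x]; ring⟩
  | MX p _ ih =>
    obtain ⟨l, h⟩ := ih
    exact ⟨0 :: l, fun x => by simp [evalList, h x]; ring⟩

/-- Horner's scheme: `a := l(x)`, with the auxiliary variable `b`. -/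
def horner (a b x : ℕ) : List ℕ → QProg
  | [] => setv a (.lit 0)
  | c :: l => .seq (horner a b x l) (.block [mulInto b x a, setv a (.add (var b) (.lit c))])

/-- Only `x` serves as a loop count; the growing value of the polynomial is merely added. So the
time depends on the argument and the number of coefficients, not on the value. -/
theorem Runs.horner {B a b x : ℕ} (hab : a ≠ b) (hxa : x ≠ a) (hxb : x ≠ b) (l : List ℕ) {σ : Store}
    (hB : σ x 0 ≤ B) : ∃ σ', Runs B (horner a b x l) σ σ' ∧ σ' a 0 = evalList (σ x 0) l ∧
      ∀ y, y ≠ a → y ≠ b → σ' y = σ y := by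
  induction l with
  | nil => exact ⟨_, .setv _ _ _ _, by simp [wr_apply, QExpr.eval, evalList],
      fun y h _ => wr_of_ne _ _ _ h⟩
  | cons c l ih =>
    obtain ⟨σ₁, d, h1, h2⟩ := ih
    refine ⟨_, d.seq (.cons (.mulInto hxb hab (by rw [h2 x hxa hxb]; exact hB))
      (.cons (.setv _ _ _ _) (.nil _ _))), ?_, ?_⟩
    · simp [wr_apply, QExpr.eval, evalList, var, h1, h2 x hxa hxb]
    · intro y h3 h4
      rw [wr_of_ne _ _ _ h3, wr_of_ne _ _ _ h4, h2 y h3 h4]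

/-! ### Initialization -/

theorem size_pred_eq_clog {q : ℕ} (hq : 0 < q) : (q - 1).size = Nat.clog 2 q := by
  apply le_antisymm
  · rw [Nat.size_le]
    have := Nat.le_pow_clog (b := 2) (by norm_num) q
    omega
  · have h := Nat.lt_size_self (q - 1)
    exact Nat.clog_le_of_le_pow (by omega)

/-- Sizes that are derived from `n`, `m`, `q`. -/
def sizes (M : ℕ) : QProg := .block
  [setv M (.get 0 (.lit 0)), setv (M + 1) (.get 0 (.lit 1)), setv (M + 2) (.get 0 (.lit 2)),
    setv (M + 3) (.len (.sub (var (M + 2)) (.lit 1))),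
    setv (M + 6) (.add (.add (var (M + 3)) (var (M + 3))) (.len (var M))),
    setv (M + 7) (.add (var (M + 6)) (.lit 1)), mulInto (M + 4) M (M + 3),
    setv (M + 5) (.add (var (M + 4)) (.lit 1)),
    setv (M + 13) (.add (var (M + 5)) (.add (var (M + 7)) (var (M + 7)))),
    setv (M + 16) (.add (.lit 1) (.add (var (M + 7)) (var (M + 7)))),
    mulInto (M + 17) (M + 7) (M + 16), mulInto (M + 10) (M + 5) (M + 17),
    mulInto (M + 18) (M + 1) M]

/-- Precision of the fractions. -/
def precision (n q : ℕ) : ℕ := 2 * Nat.clog 2 q + n.size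

theorem Runs.sizes {B M n m q : ℕ} {σ : Store} (hM : 0 < M) (hq : 0 < q) (h0 : σ 0 0 = n)
    (h1 : σ 0 1 = m) (h2 : σ 0 2 = q) (hn : n ≤ B) (hm : m ≤ B) (hK : precision n q + 1 ≤ B)
    (hR : n * Nat.clog 2 q + 1 ≤ B) :
    ∃ σ', Runs B (sizes M) σ σ' ∧ σ' M 0 = n ∧ σ' (M + 1) 0 = m ∧ σ' (M + 2) 0 = q ∧
      σ' (M + 3) 0 = Nat.clog 2 q ∧ σ' (M + 4) 0 = n * Nat.clog 2 q ∧
      σ' (M + 5) 0 = n * Nat.clog 2 q + 1 ∧ σ' (M + 6) 0 = precision n q ∧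
      σ' (M + 7) 0 = precision n q + 1 ∧
      σ' (M + 10) 0 = (n * Nat.clog 2 q + 1) *
        ((precision n q + 1) * (1 + 2 * (precision n q + 1))) ∧
      σ' (M + 13) 0 = n * Nat.clog 2 q + 1 + 2 * (precision n q + 1) ∧ σ' (M + 18) 0 = m * n ∧
      ∀ a, (a < M ∨ a = M + 11 ∨ a = M + 12) → σ' a = σ a := by
  have hM0 : M ≠ 0 := by omega
  have hsz := size_pred_eq_clog hq
  refine ⟨_, .cons (.setv _ _ _ _) (.cons (.setv _ _ _ _) (.cons (.setv _ _ _ _)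
    (.cons (.setv _ _ _ _) (.cons (.setv _ _ _ _) (.cons (.setv _ _ _ _)
    (.cons (.mulInto (by omega) (by omega) ?_) (.cons (.setv _ _ _ _) (.cons (.setv _ _ _ _)
    (.cons (.setv _ _ _ _) (.cons (.mulInto (by omega) (by omega) ?_)
    (.cons (.mulInto (by omega) (by omega) ?_) (.cons (.mulInto (by omega) (by omega) ?_)
    (.nil _ _))))))))))))), ?_⟩
  · simpa [wr_apply, QExpr.eval, h0] using hn
  · simp only [wr_apply, QExpr.eval, var]
    simp [h0, h2, hM0.symm, hsz]
    unfold precision at hK; omega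
  · simp only [wr_apply, QExpr.eval, var]
    simp [h0, h2, hM0.symm, hsz]
    omega
  · simpa [wr_apply, QExpr.eval, var, h1, hM0.symm] using hm
  · refine ⟨?_, ?_, ?_, ?_, ?_, ?_, ?_, ?_, ?_, ?_, ?_, ?_⟩
    all_goals try simp [wr_apply, QExpr.eval, var, h0, h1, h2, hM0.symm, hsz, precision]
    all_goals try ring1
    intro a ha
    repeat rw [wr_of_ne _ _ _ (by omega)]

/-- Initialization of the constants; the inputs are moved to private arrays, and the input of the
solver is put into its place. -/
def setup (M : ℕ) (l : List ℕ) : QProg := .block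
  [sizes M, horner (M + 8) (M + 17) (M + 4) l,
    setv (M + 9) (.add (.add (.len (var (M + 8))) (.len (var M))) (.lit 3)),
    divide M (.lit 1), setv (M + 14) (.add (var (M + 40)) (.lit 1)),
    moveArray 1 (M + 11) (M + 18) (M + 16), moveArray 2 (M + 12) (M + 1) (M + 16),
    .assign 0 (.lit 1) (var (M + 2)), .assign 0 (.lit 2) (.lit 0)]

/-- Number of attempts. -/
def attemptCount (n r : ℕ) : ℕ := r.size + n.size + 3

theorem Runs.setup {B M n m q : ℕ} [NeZero q] (hM : 2 < M) (hq : 1 < q) (l : List ℕ)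
    (A : Matrix (Fin m) (Fin n) (ZMod q)) (t : Fin m → ZMod q)
    (hn : n ≤ B) (hm : m ≤ B) (hK : precision n q + 1 ≤ B) (hR : n * Nat.clog 2 q + 1 ≤ B)
    (hmn : m * n ≤ B) :
    ∃ σ, Runs B (setup M l) (lweStore A t) σ ∧
      Consts M σ n m q (Nat.clog 2 q) (precision n q) (evalList (n * Nat.clog 2 q) l)
        (attemptCount n (evalList (n * Nat.clog 2 q) l)) ∧
      σ (M + 11) = lweStore A t 1 ∧ σ (M + 12) = lweStore A t 2 ∧
      ∀ a < M, σ a = dcpStore n q a := by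
  obtain ⟨σ₁, r1, k0, k1, k2, k3, k4, k5, k6, k7, k10, k13, k18, f1⟩ := Runs.sizes (B := B) (M := M)
    (n := n) (m := m) (q := q) (σ := lweStore A t) (by omega) (by omega) (by simp [lweStore])
    (by simp [lweStore]) (by simp [lweStore]) hn hm hK hR
  obtain ⟨σ₂, r2, k8, f2⟩ := Runs.horner (B := B) (a := M + 8) (b := M + 17) (x := M + 4)
    (by omega) (by omega) (by omega) l (σ := σ₁) (by rw [k4]; omega)
  set σ₃ := wr σ₂ (M + 9) 0 ((QExpr.add (.add (.len (var (M + 8))) (.len (var M))) (.lit 3)).eval σ₂)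
    with e3
  have f3 : ∀ a, a ≠ M + 9 → σ₃ a = σ₂ a := fun a h => wr_of_ne _ _ _ h
  obtain ⟨σ₄, d4, k40, f4⟩ := divide_spec (M := M) (K := precision n q) (q := q) (e := .lit 1)
    (σ := σ₃) (by rw [f3 _ (by omega), f2 _ (by omega) (by omega), k6])
    (by rw [f3 _ (by omega), f2 _ (by omega) (by omega), k2]) hq
  have r4 : Runs B (divide M (.lit 1)) σ₃ σ₄ := by
    refine .of_stable (C := fun a => a = M + 6) d4 ?_ ?_ ?_
    · simp [divide, QProg.block, QProg.Stable, _root_.setv, incr, QExpr.Reads, var]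
    · simp [divide, QProg.block, QProg.LoopsLe, _root_.setv, incr, QExpr.eval, var]
      rw [f3 _ (by omega), f2 _ (by omega) (by omega), k6]; omega
    · simp [divide, QProg.block, QProg.depth, _root_.setv, incr]
  set σ₅ := wr σ₄ (M + 14) 0 ((QExpr.add (var (M + 40)) (.lit 1)).eval σ₄) with e5
  have f5 : ∀ a, a ≠ M + 14 → σ₅ a = σ₄ a := fun a h => wr_of_ne _ _ _ h
  have g5 : ∀ a, a ≠ M + 8 → a ≠ M + 17 → a ≠ M + 9 → a ≠ M + 40 → a ≠ M + 41 → a ≠ M + 14 →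
      σ₅ a = σ₁ a := fun a h1 h2 h3 h4 h5 h6 => by
    rw [f5 a h6, f4 a h4 h5, f3 a h3, f2 a h1 h2]
  obtain ⟨σ₆, r6, c6, z6, f6⟩ := Runs.moveArray (B := B) (src := 1) (dst := M + 11) (cnt := M + 18)
    (ctr := M + 16) (by omega) (by omega) (by omega) (by omega) (by omega) (by omega) (σ := σ₅)
    (by rw [g5 _ (by omega) (by omega) (by omega) (by omega) (by omega) (by omega), k18]; exact hmn)
  obtain ⟨σ₇, r7, c7, z7, f7⟩ := Runs.moveArray (B := B) (src := 2) (dst := M + 12) (cnt := M + 1)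
    (ctr := M + 16) (by omega) (by omega) (by omega) (by omega) (by omega) (by omega) (σ := σ₆)
    (by rw [f6 _ (by omega) (by omega) (by omega),
      g5 _ (by omega) (by omega) (by omega) (by omega) (by omega) (by omega), k1]; exact hm)
  set σ₈ := wr σ₇ 0 ((QExpr.lit 1).eval σ₇) ((var (M + 2)).eval σ₇) with e8
  set σ₉ := wr σ₈ 0 ((QExpr.lit 2).eval σ₈) ((QExpr.lit 0).eval σ₈) with e9
  have f9 : ∀ a, a ≠ 0 → σ₉ a = σ₇ a := fun a h => by
    rw [e9, wr_of_ne _ _ _ h, e8, wr_of_ne _ _ _ h]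
  have g9 : ∀ a, 2 < a → a ≠ M + 8 → a ≠ M + 17 → a ≠ M + 9 → a ≠ M + 40 → a ≠ M + 41 →
      a ≠ M + 14 → a ≠ M + 16 → a ≠ M + 11 → a ≠ M + 12 → σ₉ a = σ₁ a :=
    fun a h0 h1 h2 h3 h4 h5 h6 h7 h8 h9 => by
      rw [f9 a (by omega), f7 a (by omega) h9 h7, f6 a (by omega) h8 h7, g5 a h1 h2 h3 h4 h5 h6]
  have e18 : σ₅ (M + 18) 0 = m * n := by
    rw [g5 _ (by omega) (by omega) (by omega) (by omega) (by omega) (by omega), k18]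
  have e1 : σ₆ (M + 1) 0 = m := by
    rw [f6 _ (by omega) (by omega) (by omega),
      g5 _ (by omega) (by omega) (by omega) (by omega) (by omega) (by omega), k1]
  have i1 : σ₅ 1 = lweStore A t 1 := by
    rw [g5 _ (by omega) (by omega) (by omega) (by omega) (by omega) (by omega), f1 _ (by omega)]
  have i2 : σ₆ 2 = lweStore A t 2 := by
    rw [f6 _ (by omega) (by omega) (by omega),
      g5 _ (by omega) (by omega) (by omega) (by omega) (by omega) (by omega), f1 _ (by omega)]
  have i11 : σ₅ (M + 11) = fun _ => 0 := by
    rw [g5 _ (by omega) (by omega) (by omega) (by omega) (by omega) (by omega), f1 _ (by omega)]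
    funext i
    simp [lweStore]
  have i12 : σ₆ (M + 12) = fun _ => 0 := by
    rw [f6 _ (by omega) (by omega) (by omega),
      g5 _ (by omega) (by omega) (by omega) (by omega) (by omega) (by omega), f1 _ (by omega)]
    funext i
    simp [lweStore]
  -- Beyond the length of the input the cells are 0 already, so moving finitely many cells transfers
  -- and clears the whole array.
  have big1 : ∀ i, ¬ i < m * n → lweStore A t 1 i = 0 := fun i hi => by
    simp [lweStore, hi]
  have big2 : ∀ i, ¬ i < m → lweStore A t 2 i = 0 := fun i hi => by
    simp [lweStore, hi]
  refine ⟨σ₉, .cons r1 (.cons r2 (.cons (.setv _ _ _ _) (.cons r4 (.cons (.setv _ _ _ _) (.cons r6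
    (.cons r7 (.cons (.assign _ _ _ _ _) (.cons (.assign _ _ _ _ _) (.nil _ _))))))))), ?_, ?_, ?_,
    ?_⟩
  · have l8 : σ₉ (M + 8) 0 = evalList (n * Nat.clog 2 q) l := by
      rw [f9 _ (by omega), f7 _ (by omega) (by omega) (by omega), f6 _ (by omega) (by omega)
        (by omega), f5 _ (by omega), f4 _ (by omega) (by omega), f3 _ (by omega), k8, k4]
    constructor
    · rw [g9 _ (by omega) (by omega) (by omega) (by omega) (by omega) (by omega) (by omega)
        (by omega) (by omega) (by omega), k0]
    · rw [g9 _ (by omega) (by omega) (by omega) (by omega) (by omega) (by omega) (by omega)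
        (by omega) (by omega) (by omega), k1]
    · rw [g9 _ (by omega) (by omega) (by omega) (by omega) (by omega) (by omega) (by omega)
        (by omega) (by omega) (by omega), k2]
    · rw [g9 _ (by omega) (by omega) (by omega) (by omega) (by omega) (by omega) (by omega)
        (by omega) (by omega) (by omega), k3]
    · rw [g9 _ (by omega) (by omega) (by omega) (by omega) (by omega) (by omega) (by omega)
        (by omega) (by omega) (by omega), k4]
    · rw [g9 _ (by omega) (by omega) (by omega) (by omega) (by omega) (by omega) (by omega)
        (by omega) (by omega) (by omega), k5]
    · rw [g9 _ (by omega) (by omega) (by omega) (by omega) (by omega) (by omega) (by omega)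
        (by omega) (by omega) (by omega), k6]
    · rw [g9 _ (by omega) (by omega) (by omega) (by omega) (by omega) (by omega) (by omega)
        (by omega) (by omega) (by omega), k7]
    · exact l8
    · rw [f9 _ (by omega), f7 _ (by omega) (by omega) (by omega), f6 _ (by omega) (by omega)
        (by omega), f5 _ (by omega), f4 _ (by omega) (by omega), e3]
      simp only [wr_apply, QExpr.eval, var, k8, k4, f2 M (by omega) (by omega), k0]
      simp [attemptCount]
    · rw [g9 _ (by omega) (by omega) (by omega) (by omega) (by omega) (by omega) (by omega)
        (by omega) (by omega) (by omega), k10]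
    · rw [g9 _ (by omega) (by omega) (by omega) (by omega) (by omega) (by omega) (by omega)
        (by omega) (by omega) (by omega), k13]
    · rw [f9 _ (by omega), f7 _ (by omega) (by omega) (by omega), f6 _ (by omega) (by omega)
        (by omega), e5]
      simp [wr_apply, QExpr.eval, var, k40]
  · rw [f9 _ (by omega), f7 _ (by omega) (by omega) (by omega)]
    funext i
    rw [c6, e18, i1, i11]
    split_ifs with h
    · rfl
    · rw [big1 i h]
  · rw [f9 _ (by omega)]
    funext i
    rw [c7, e1, i2, i12]
    split_ifs with h
    · rfl
    · rw [big2 i h]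
  · intro a ha
    by_cases h0 : a = 0
    · subst h0
      funext i
      have hz : σ₇ 0 = lweStore A t 0 := by
        rw [f7 _ (by omega) (by omega) (by omega), f6 _ (by omega) (by omega) (by omega),
          g5 _ (by omega) (by omega) (by omega) (by omega) (by omega) (by omega), f1 _ (by omega)]
      have h2 : σ₇ (M + 2) 0 = q := by
        rw [f7 _ (by omega) (by omega) (by omega), f6 _ (by omega) (by omega) (by omega),
          g5 _ (by omega) (by omega) (by omega) (by omega) (by omega) (by omega), k2]
      rw [e9, e8]
      simp only [wr_apply, QExpr.eval, var, h2, hz, true_and]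
      unfold dcpStore lweStore
      simp only [true_and, if_true]
      split_ifs <;> first | rfl | omega
    · rw [f9 a h0]
      funext i
      by_cases h1 : a = 1
      · subst h1
        rw [f7 _ (by omega) (by omega) (by omega), z6, e18, i1]
        have hd : dcpStore n q 1 i = 0 := by simp [dcpStore]
        rw [hd]
        split_ifs with h
        · rfl
        · exact big1 i h
      · by_cases h2 : a = 2
        · subst h2
          rw [z7, e1, i2]
          have hd : dcpStore n q 2 i = 0 := by simp [dcpStore]
          rw [hd]
          split_ifs with h
          · rfl
          · exact big2 i h
        · rw [f7 _ (by omega) (by omega) (by omega), f6 _ (by omega) (by omega) (by omega),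
            g5 _ (by omega) (by omega) (by omega) (by omega) (by omega) (by omega),
            f1 _ (by omega)]
          simp [dcpStore, lweStore, h0, h1, h2]

/-- Negate the output. -/
def negate (M : ℕ) : QProg := .block [setv (M + 34) (.lit 0),
  .rep (var M) (.block [.ite (.get 0 (var (M + 34)))
    (.assign 0 (var (M + 34)) (.sub (var (M + 2)) (.get 0 (var (M + 34))))) .skip,
    incr (M + 34)])]

theorem Runs.negate {B M n q : ℕ} (hM : 0 < M) {σ : Store} (hn : σ M 0 = n) (hq : σ (M + 2) 0 = q)
    (hB : n ≤ B) : ∃ σ', Runs B (negate M) σ σ' ∧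
      ∀ i < n, σ' 0 i = if σ 0 i = 0 then 0 else q - σ 0 i := by
  have := CDet.rep (p := .block [.ite (.get 0 (var (M + 34)))
    (.assign 0 (var (M + 34)) (.sub (var (M + 2)) (.get 0 (var (M + 34))))) .skip,
    incr (M + 34)]) (e := var M) (fun k τ => τ (M + 34) 0 = k ∧ τ (M + 2) 0 = q ∧
      ∀ i, τ 0 i = if i < k then (if σ 0 i = 0 then 0 else q - σ 0 i) else σ 0 i) n
      (fun k _ τ hτ => ?_) (σ := wr σ (M + 34) 0 0) ?_ ?_
  · obtain ⟨σ', d, -, -, h⟩ := this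
    refine ⟨σ', .cons (.setv _ _ _ _) (.cons (.of_stable (C := fun x => x = M) d ?_ ?_ ?_)
      (.nil _ _)), fun i hi => by rw [h, if_pos hi]⟩
    · simp [QProg.Stable, QProg.block, incr, _root_.setv, QExpr.Reads, var]; omega
    · simp [QProg.LoopsLe, QProg.block, incr, _root_.setv, QExpr.eval, var, wr_apply, hn, hB]
    · simp [QProg.depth, QProg.block, incr, _root_.setv]
  · obtain ⟨g1, g2, g3⟩ := hτ
    have e1 : (QExpr.get 0 (var (M + 34))).eval τ = σ 0 k := by
      simp [QExpr.eval, var, g1, g3]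
    have hM0 : M ≠ 0 := by omega
    by_cases h : σ 0 k = 0
    · refine ⟨_, .cons (.ite_false (by rw [e1, h]) (fun _ _ => rfl)) (.cons (.incr _ _) (.nil _)),
        by simp [wr_apply, g1], by simp [wr_apply, g2], fun i => ?_⟩
      rw [wr_of_ne _ _ _ (by omega), g3]
      by_cases hi : i = k
      · subst hi; simp [h]
      · have : i < k + 1 ↔ i < k := by omega
        simp [this]
    · refine ⟨_, .cons (.ite_true (by rwa [e1]) (.assign _ _ _ _)) (.cons (.incr _ _) (.nil _)),
        by simp [wr_apply, g1], by simp [wr_apply, g2], fun i => ?_⟩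
      rw [wr_of_ne _ _ _ (by omega)]
      simp only [wr_apply, QExpr.eval, var, g1, g2, g3]
      by_cases hi : i = k
      · subst hi; simp [h]
      · have : i < k + 1 ↔ i < k := by omega
        simp [hi, this]
  · exact ⟨by simp [wr_apply], by simp [wr_apply, hq], fun i => by
      rw [wr_of_ne _ _ _ (by omega)]; simp⟩
  · simp [QExpr.eval, var, wr_apply, hn]

/-! ### The algorithm for learning with errors -/

/-- Both outcomes of every measurement are branches whatever their probability, so stores and times
do not depend on the vector. Scaling by 0 identifies the runs on any two vectors. Hence a time bound
known for one input vector holds for all. -/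
theorem QProg.exec_merge {M : ℕ} {P : QProg} (hP : P.Below M) {τ σ : Store} {ψ : QVec} {t : ℕ}
    {γ : Branch} (h : γ ∈ P.exec ⟨merge M τ σ, ψ, t⟩) (ψ' : QVec) :
    ∃ δ ∈ P.exec ⟨σ, ψ', 0⟩, γ.time = δ.time + t ∧ γ.store = merge M τ δ.store := by
  have h1 := QProg.exec_embed hP τ 1 t ⟨σ, ψ, 0⟩
  have e1 : Branch.embed M τ 1 t ⟨σ, ψ, 0⟩ = ⟨merge M τ σ, ψ, t⟩ := by simp [Branch.embed]
  rw [e1] at h1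
  rw [h1] at h
  obtain ⟨δ, hδ, rfl⟩ := List.mem_map.1 h
  have h2 := QProg.exec_embed hP τ 0 0 ⟨σ, ψ, 0⟩
  have h3 := QProg.exec_embed hP τ 0 0 ⟨σ, ψ', 0⟩
  have e2 : Branch.embed M τ 0 0 ⟨σ, ψ, 0⟩ = Branch.embed M τ 0 0 ⟨σ, ψ', 0⟩ := by
    simp [Branch.embed]
  rw [e2] at h2
  have h4 : δ.embed M τ 0 0 ∈ (P.exec ⟨σ, ψ', 0⟩).map (Branch.embed M τ 0 0) := by
    rw [← h3, h2]; exact List.mem_map.2 ⟨δ, hδ, rfl⟩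
  obtain ⟨ε, hε, he⟩ := List.mem_map.1 h4
  simp only [Branch.embed, Branch.mk.injEq] at he
  exact ⟨ε, hε, by simp only [Branch.embed]; omega, he.1.symm⟩

/-- The algorithm: `P` is run on coset states that are prepared from the samples. -/
def solver (P : QProg) (M D : ℕ) (l : List ℕ) : QProg := .block
  [setup M l, registers M D, P, negate M]

theorem registers_stable (M D : ℕ) : (registers M D).Stable (· < M + 20) := by
  simp [registers, prepare, coord, fillBlock, attempt, hadBlock, resetBlock, measForm, build,
    formStep, addStep, rippleStep, applyGate, emit, rows, row, fillRow, divide, move, QProg.block,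
    QProg.Stable, QExpr.Reads, setv, incr, var]

/-- A bound for all loop counts. -/
def loopBound (D n m q r : ℕ) : ℕ :=
  D + n + m + m * n + (n * Nat.clog 2 q + 1) + (precision n q + 1) + r + attemptCount n r +
    (n * Nat.clog 2 q + 1) * ((precision n q + 1) * (1 + 2 * (precision n q + 1))) + Nat.clog 2 q

theorem registers_loopsLe {M D n m q r : ℕ} {σ : Store} (hc : Consts M σ n m q (Nat.clog 2 q)
    (precision n q) r (attemptCount n r)) : (registers M D).LoopsLe σ (loopBound D n m q r) := by
  have h1 : n ≤ loopBound D n m q r := by unfold loopBound; omega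
  have h2 : m ≤ loopBound D n m q r := by unfold loopBound; omega
  have h3 : Nat.clog 2 q ≤ loopBound D n m q r := by unfold loopBound; omega
  have h4 : n * Nat.clog 2 q ≤ loopBound D n m q r := by unfold loopBound; omega
  have h5 : n * Nat.clog 2 q + 1 ≤ loopBound D n m q r := by unfold loopBound; omega
  have h6 : precision n q ≤ loopBound D n m q r := by unfold loopBound; omega
  have h7 : precision n q + 1 ≤ loopBound D n m q r := by unfold loopBound; omega
  have h8 : r ≤ loopBound D n m q r := by unfold loopBound; omega
  have h9 : attemptCount n r ≤ loopBound D n m q r := by unfold loopBound; omega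
  have h10 : (n * Nat.clog 2 q + 1) * ((precision n q + 1) * (1 + 2 * (precision n q + 1))) ≤
    loopBound D n m q r := by unfold loopBound; omega
  have h11 : D ≤ loopBound D n m q r := by unfold loopBound; omega
  simp only [registers, prepare, coord, fillBlock, attempt, hadBlock, resetBlock, measForm, build,
    formStep, addStep, rippleStep, applyGate, emit, rows, row, fillRow, divide, move, QProg.block,
    QProg.LoopsLe, QExpr.eval, setv, incr, var, hc.hn, hc.hm, hc.hL, hc.hN, hc.hR, hc.hK, hc.hK1,
    hc.hr, hc.hT, hc.hG]
  simp only [h1, h2, h3, h4, h5, h6, h7, h8, h9, h10, h11, and_self]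

section Solver

variable {P : QProg} {M D n m q r : ℕ} [NeZero q] {l : List ℕ}

/-- The bound must also hold on branches where the preparation failed and `P` is run on a vector
that is no tensor product of coset states; `QProg.exec_merge` transfers the bound from a genuine
input. -/
theorem solver_haltsWithin (hM : 2 < M) (hP : P.Below M) (hq : 1 < q)
    (hr : evalList (n * Nat.clog 2 q) l = r) {tP : ℕ}
    {s : Fin n → ZMod q} {x : Fin r → Fin n → ZMod q}
    (hT : P.HaltsWithin (dcpStore n q) (dcpInput s x) tP)
    (A : Matrix (Fin m) (Fin n) (ZMod q)) (t : Fin m → ZMod q) (ψ : QVec) :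
    (solver P M D l).HaltsWithin (lweStore A t) ψ
      (((setup M l).weight + (negate M).weight) *
        (loopBound D n m q r + 1) +
      (registers M D).weight *
        (loopBound D n m q r + 1) ^ (registers M D).depth + tP + 1) := by
  obtain ⟨B, hB⟩ : ∃ B, B = loopBound D n m q r := ⟨_, rfl⟩
  obtain ⟨σ, hrun, hc, hA, hu, hd⟩ := Runs.setup (B := B) hM hq l A t
    (by rw [hB]; unfold loopBound; omega) (by rw [hB]; unfold loopBound; omega)
    (by rw [hB]; unfold loopBound; omega) (by rw [hB]; unfold loopBound; omega)
    (by rw [hB]; unfold loopBound; omega)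
  rw [hr] at hc
  intro β hβ
  simp only [solver, QProg.block, QProg.exec, List.mem_flatMap, List.mem_singleton] at hβ
  obtain ⟨β₁, hβ₁, β₂, hβ₂, β₃, hβ₃, β₄, hβ₄, rfl⟩ := hβ
  have t1 := hrun.2 _ _ rfl hβ₁
  have s1 := hrun.1.exec_store rfl hβ₁
  have t2 := QProg.time_le (registers_stable M D) (registers_loopsLe hc) (fun a _ => by rw [s1]) hβ₂
  rw [← hB] at t2 ⊢
  have s2 : ∀ a < M + 20, β₂.store a = σ a := fun a ha => by
    rw [(registers_stable M D).writes.store_eq hβ₂ (not_not.2 ha), s1]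
  have e2 : β₂ = ⟨merge M β₂.store (dcpStore n q), β₂.vec, β₂.time⟩ := by
    have : β₂.store = merge M β₂.store (dcpStore n q) := by
      funext a
      unfold merge
      split_ifs with h
      · rw [s2 a (by omega), hd a h]
      · rfl
    rw [← this]
  rw [e2] at hβ₃
  obtain ⟨δ, hδ, t3, s3⟩ := QProg.exec_merge hP hβ₃ (dcpInput s x)
  have t3' := hT δ hδ
  have s3' : ∀ a, M ≤ a → a < M + 20 → β₃.store a = σ a := fun a h1 h2 => by
    rw [s3, ← s2 a h2]
    simp [merge, not_lt.2 h1]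
  obtain ⟨σ', hneg, -⟩ := Runs.negate (B := B) (M := M) (n := n) (q := q) (by omega) (σ := β₃.store)
    (by rw [s3' _ (by omega) (by omega), hc.hn]) (by rw [s3' _ (by omega) (by omega), hc.hq])
    (by rw [hB]; unfold loopBound; omega)
  have t4 := hneg.2 _ _ rfl hβ₄
  simp only [Branch.tick] at *
  rw [add_mul]
  omega

theorem lweStore_one_lt (A : Matrix (Fin m) (Fin n) (ZMod q)) (t : Fin m → ZMod q) (p : ℕ) :
    lweStore A t 1 p < q := by
  by_cases h : p < m * n
  · simp [lweStore, h, ZMod.val_lt]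
  · simp [lweStore, h, Nat.pos_of_neZero]

theorem lweStore_two_lt (A : Matrix (Fin m) (Fin n) (ZMod q)) (t : Fin m → ZMod q) (p : ℕ) :
    lweStore A t 2 p < q := by
  by_cases h : p < m
  · simp [lweStore, h, ZMod.val_lt]
  · simp [lweStore, h, Nat.pos_of_neZero]

-- Where the preparation succeeds, the vector is a multiple of a genuine input with secret -s and
-- the arrays below `M` are exactly the classical input. By linearity `P` contributes its success
-- probability times the squared norm of that branch, and negating residues turns -s into s.
open Classical in
theorem le_outputProb_solver (hM : 2 < M) (hP : P.Below M) (hq : 1 < q)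
    (hr : evalList (n * Nat.clog 2 q) l = r) {s : Fin n → ZMod q}
    {p₀ : ℝ} (hp₀ : 0 ≤ p₀) (hout : ∀ x : Fin r → Fin n → ZMod q,
      p₀ ≤ P.outputProb (dcpStore n q) (dcpInput (-s) x) (-s))
    (A : Matrix (Fin m) (Fin n) (ZMod q)) (t : Fin m → ZMod q) {κ : ℝ} (hκ0 : 0 ≤ κ)
    (hκ : κ * (2 * (q : ℝ) ^ n) ≤ (Finset.univ.filter
      (IsGood (precision n q) D m (lweStore A t 1) (lweStore A t 2) (-s))).card) :
    ((1 - (1 / 2) ^ attemptCount n r) ^ n * κ) ^ r * p₀ ≤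
    (solver P M D l).outputProb (lweStore A t) (Finsupp.single ∅ 1) s := by
  obtain ⟨B, hB⟩ : ∃ B, B = loopBound D n m q r := ⟨_, rfl⟩
  obtain ⟨σ, hrun, hc, hA, hu, hd⟩ := Runs.setup (B := B) hM hq l A t
    (by rw [hB]; unfold loopBound; omega) (by rw [hB]; unfold loopBound; omega)
    (by rw [hB]; unfold loopBound; omega) (by rw [hB]; unfold loopBound; omega)
    (by rw [hB]; unfold loopBound; omega)
  rw [hr] at hc
  have hK : q * q ≤ 2 ^ precision n q := by
    have h1 := Nat.le_pow_clog (b := 2) (by norm_num) q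
    calc q * q ≤ 2 ^ Nat.clog 2 q * 2 ^ Nat.clog 2 q := Nat.mul_le_mul h1 h1
      _ = 2 ^ (2 * Nat.clog 2 q) := by ring
      _ ≤ _ := Nat.pow_le_pow_right (by norm_num) (Nat.le_add_right _ _)
  have hreg := registers_tri (D := D) hc hq hK
    (fun p => by rw [hA]; exact lweStore_one_lt A t p) (fun p => by rw [hu]; exact lweStore_two_lt A t p)
    (-s) hκ0 (by rw [hA, hu]; exact hκ) σ (Finsupp.single ∅ 1) ⟨fun _ _ => rfl, rfl⟩
  have hone : QVec.normSq (Finsupp.single ∅ 1) = 1 := by simp [QVec.normSq]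
  rw [hone, mul_one] at hreg
  rw [QProg.outputProb_eq_wp]
  set out : Store → QVec → ℝ := fun τ φ => if ∀ i : Fin n, τ 0 i = (s i).val then φ.normSq else 0
    with hout'
  have h0 : (solver P M D l).wp out (lweStore A t) (Finsupp.single ∅ 1) =
      (registers M D).wp (P.wp ((negate M).wp out)) σ (Finsupp.single ∅ 1) :=
    hrun.1 _ _
  rw [h0, mul_comm]
  refine (mul_le_mul_of_nonneg_left hreg hp₀).trans ?_
  rw [← QProg.wp_smul]
  apply QProg.wp_mono
  intro τ φ
  have hnn : 0 ≤ P.wp ((negate M).wp out) τ φ := by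
    refine QProg.wp_nonneg (QProg.wp_nonneg fun τ φ => ?_) _ _
    simp only [hout']; split_ifs
    · exact QVec.normSq_nonneg _
    · exact le_rfl
  by_cases hJ : (∀ a < M + 20, τ a = σ a) ∧
      ∃ (c : ℂ) (x : Fin r → Fin n → ZMod q), φ = uni c (cosetKets (-s) x)
  swap
  · rw [msr, if_neg hJ, mul_zero]; exact hnn
  rw [msr_of hJ]
  obtain ⟨hτ, c, x, rfl⟩ := hJ
  have h2 : (((√2 : ℝ) : ℂ)⁻¹) ^ r ≠ 0 := by
    apply pow_ne_zero
    simp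
  obtain ⟨d, hdφ⟩ : ∃ d : ℂ, uni c (cosetKets (-s) x) = d • dcpInput (-s) x := by
    refine ⟨c / (((√2 : ℝ) : ℂ)⁻¹) ^ r, ?_⟩
    rw [dcpInput_eq, smul_uni, div_mul_cancel₀ _ h2]
  rw [hdφ, QVec.normSq_smul, normSq_dcpInput, mul_one]
  have hmerge : τ = merge M τ (dcpStore n q) := by
    funext a
    unfold merge
    split_ifs with h
    · rw [hτ a (by omega), hd a h]
    · rfl
  have hemb := QProg.exec_embed hP τ d 0 ⟨dcpStore n q, dcpInput (-s) x, 0⟩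
  have e1 : Branch.embed M τ d 0 ⟨dcpStore n q, dcpInput (-s) x, 0⟩ =
      ⟨τ, d • dcpInput (-s) x, 0⟩ := by
    simp only [Branch.embed]
    rw [← hmerge]
  rw [e1] at hemb
  rw [QProg.wp_eq_sum, hemb, List.map_map]
  calc p₀ * ‖d‖ ^ 2 ≤ ‖d‖ ^ 2 * P.outputProb (dcpStore n q) (dcpInput (-s) x) (-s) := by
        rw [mul_comm]
        exact mul_le_mul_of_nonneg_left (hout x) (by positivity)
    _ ≤ _ := by
        unfold QProg.outputProb
        rw [← List.sum_map_mul_left]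
        apply List.sum_le_sum
        intro δ _
        simp only [Function.comp_apply]
        have hst : ∀ a, M ≤ a → a < M + 20 → (δ.embed M τ d 0).store a = σ a := fun a h1 h2 => by
          rw [← hτ a h2]
          simp [Branch.embed, merge, not_lt.2 h1]
        obtain ⟨σ', hneg, hσ'⟩ := Runs.negate (B := B) (M := M) (n := n) (q := q) (by omega)
          (σ := (δ.embed M τ d 0).store)
          (by rw [hst _ (by omega) (by omega), hc.hn]) (by rw [hst _ (by omega) (by omega), hc.hq])
          (by rw [hB]; unfold loopBound; omega)
        rw [hneg.1]
        have hvec : (δ.embed M τ d 0).vec = d • δ.vec := rfl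
        have hst0 : (δ.embed M τ d 0).store 0 = δ.store 0 := by
          simp [Branch.embed, merge]; omega
        simp only [hout', hvec]
        split_ifs with h1 h3 h3
        · rw [QVec.normSq_smul]
        · exfalso
          apply h3
          intro i
          rw [hσ' i i.2, hst0, h1 i, Pi.neg_apply, ZMod.neg_val]
          by_cases hsi : s i = 0
          · simp [hsi]
          · have h4 : (s i).val ≠ 0 := by simpa [ZMod.val_eq_zero] using hsi
            have h5 := ZMod.val_lt (s i)
            rw [if_neg hsi, if_neg (by omega)]
            omega
        · rw [mul_zero]; exact QVec.normSq_nonneg _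
        · rw [mul_zero]

end Solver

/-! ### Leading bits of a row form -/

section Bits

variable {n q : ℕ}

/-- The digits at the positions K - 1, …, K - D form the index of the cell, among 2^D, in which the
fractional part of the form divided by 2^K lies. -/
theorem rowBit_agree_iff {K D : ℕ} (hD : D ≤ K) {a u : ℕ → ℕ} {i : ℕ}
    {w w' : Bool × (Fin n → ZMod q)} :
    (∀ d < D, rowBit K a u i d w = rowBit K a u i d w') ↔
      rowForm K a u i w / 2 ^ (K - D) % 2 ^ D = rowForm K a u i w' / 2 ^ (K - D) % 2 ^ D := by
  unfold rowBit
  constructor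
  · intro h
    apply Nat.eq_of_testBit_eq
    intro j
    simp only [Nat.testBit_mod_two_pow, Nat.testBit_div_two_pow]
    by_cases hj : j < D
    · have := h (D - 1 - j) (by omega)
      have e : K - (D - 1 - j + 1) = K - D + j := by omega
      rw [e] at this
      simp [hj, add_comm j, this]
    · simp [hj]
  · intro h d hd
    have := congrArg (fun x => Nat.testBit x (D - 1 - d)) h
    simp only [Nat.testBit_mod_two_pow, Nat.testBit_div_two_pow] at this
    have e : D - 1 - d + (K - D) = K - (d + 1) := by omega
    rw [e] at this
    have h1 : D - 1 - d < D := by omega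
    simpa [h1] using this

/-- The exact value of a row. -/
def rowVal (a u : ℕ → ℕ) (i : ℕ) (w : Bool × (Fin n → ZMod q)) : ℕ :=
  w.1.toNat * u i + ∑ j : Fin n, a (i * n + j) * (w.2 j).val

/-- Rounding down a coefficient and multiplying back by `q` loses at most `q`, times a factor of at
most 1 for the bit and at most q - 1 for a coordinate. The total q + nq(q - 1) is at most nq², hence
at most 2^K. So the rounded row equals the exact one up to one unit downwards. -/
theorem rowForm_bounds [NeZero q] (hn : 1 ≤ n) {K : ℕ} (hK : q * (n * q) ≤ 2 ^ K) (a u : ℕ → ℕ)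
    (i : ℕ) (w : Bool × (Fin n → ZMod q)) :
    q * rowForm K a u i w ≤ 2 ^ K * rowVal a u i w ∧
      2 ^ K * rowVal a u i w ≤ q * rowForm K a u i w + 2 ^ K := by
  have hq : 0 < q := Nat.pos_of_neZero q
  have hfl : ∀ v x : ℕ, q * (v * 2 ^ K / q * x) ≤ 2 ^ K * (v * x) ∧
      2 ^ K * (v * x) ≤ q * (v * 2 ^ K / q * x) + q * x := by
    intro v x
    have h1 : q * (v * 2 ^ K / q) ≤ v * 2 ^ K := Nat.mul_div_le _ _
    have h2 : v * 2 ^ K ≤ q * (v * 2 ^ K / q) + q := by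
      have := Nat.lt_mul_div_succ (v * 2 ^ K) hq
      rw [mul_add, mul_one] at this; omega
    have h3 := Nat.mul_le_mul_right x h1
    have h4 := Nat.mul_le_mul_right x h2
    rw [add_mul] at h4
    constructor
    · calc _ = q * (v * 2 ^ K / q) * x := by ring
        _ ≤ v * 2 ^ K * x := h3
        _ = _ := by ring
    · calc _ = v * 2 ^ K * x := by ring
        _ ≤ _ := h4
        _ = _ := by ring
  unfold rowForm rowVal
  have hb := hfl (u i) w.1.toNat
  rw [mul_comm _ w.1.toNat, mul_comm (u i) w.1.toNat] at hb
  rw [mul_add, mul_add, Finset.mul_sum, Finset.mul_sum]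
  constructor
  · exact add_le_add hb.1 (Finset.sum_le_sum fun j _ => (hfl _ _).1)
  · have h1 : ∑ j : Fin n, 2 ^ K * (a (i * n + j) * (w.2 j).val) ≤
        ∑ j : Fin n, q * (a (i * n + j) * 2 ^ K / q * (w.2 j).val) + n * (q * (q - 1)) := by
      calc _ ≤ ∑ j : Fin n, (q * (a (i * n + j) * 2 ^ K / q * (w.2 j).val) + q * (q - 1)) := by
            refine Finset.sum_le_sum fun j _ => ((hfl _ _).2).trans ?_
            have := ZMod.val_lt (w.2 j)
            gcongr
            omega
        _ = _ := by rw [Finset.sum_add_distrib]; simp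
    have h2 : q * w.1.toNat ≤ q := by
      cases w.1 <;> simp
    have h3 : q + n * (q * (q - 1)) ≤ 2 ^ K := by
      refine le_trans ?_ hK
      obtain ⟨q', rfl⟩ : ∃ q', q = q' + 1 := ⟨q - 1, by omega⟩
      simp only [Nat.add_sub_cancel]
      nlinarith [Nat.mul_le_mul_right (q' + 1) hn]
    have := hb.2
    omega

/-- In terms of the exact value, the cell index read off the rounded form lies between the one of V
- 1 and the one of V. -/
theorem block_bounds {K D F V : ℕ} (hD : D ≤ K) (h1 : q * F ≤ 2 ^ K * V)
    (h2 : 2 ^ K * V ≤ q * F + 2 ^ K) (hq : 0 < q) :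
    q * (F / 2 ^ (K - D)) ≤ 2 ^ D * V ∧ 2 ^ D * V < q * (F / 2 ^ (K - D) + 1) + 2 ^ D := by
  obtain ⟨E, rfl⟩ := Nat.exists_eq_add_of_le hD
  rw [Nat.add_sub_cancel_left]
  have hE : 0 < 2 ^ E := by positivity
  have h3 : 2 ^ E * (F / 2 ^ E) ≤ F := Nat.mul_div_le _ _
  have h4 : F < 2 ^ E * (F / 2 ^ E + 1) := Nat.lt_mul_div_succ _ hE
  set β := F / 2 ^ E
  rw [pow_add] at h1 h2
  constructor
  · apply Nat.le_of_mul_le_mul_left _ hE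
    nlinarith [Nat.mul_le_mul_left q h3]
  · apply Nat.lt_of_mul_lt_mul_left (a := 2 ^ E)
    nlinarith [Nat.mul_lt_mul_of_pos_left h4 hq]

/-- All numbers near `y` are in the same of `2 ^ D` blocks of equal length. -/
def InCell (q D B y : ℕ) : Prop :=
  B + 1 ≤ y ∧ y + B < q ∧ 2 ^ D * (y - (B + 1)) / q = 2 ^ D * (y + B) / q

theorem InCell.div_eq {D B y : ℕ} (h : InCell q D B y) {v : ℕ} (h1 : y ≤ v + (B + 1)) (h2 : v ≤ y + B) :
    2 ^ D * v / q = 2 ^ D * y / q := by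
  obtain ⟨g1, g2, g3⟩ := h
  have e : ∀ v, y ≤ v + (B + 1) → v ≤ y + B → 2 ^ D * v / q = 2 ^ D * (y + B) / q := fun v h1 h2 =>
    le_antisymm (Nat.div_le_div_right (Nat.mul_le_mul_left _ h2))
      (g3 ▸ Nat.div_le_div_right (Nat.mul_le_mul_left _ (by omega)))
  rw [e v h1 h2, e y (by omega) (by omega)]

/-- The index read off the rounded form may be that of v - 1 instead of v. Both lie in the cell of
`y`, because the interior of a cell keeps one additional unit of distance on the lower side. -/
theorem InCell.block_eq {D B y V k v β : ℕ} (h : InCell q D B y) (hV : V = q * k + v)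
    (h1 : y ≤ v + B) (h2 : v ≤ y + B) (hβ : q * β ≤ 2 ^ D * V)
    (hβ' : 2 ^ D * V < q * (β + 1) + 2 ^ D) (hq : 0 < q) : β % 2 ^ D = 2 ^ D * y / q := by
  have hy := h.1
  have hyq := h.2.1
  have e1 := h.div_eq (v := v) (by omega) h2
  have e2 := h.div_eq (v := v - 1) (by omega) (by omega)
  set c := 2 ^ D * y / q with hc
  have hcD : c < 2 ^ D := by
    rw [hc, Nat.div_lt_iff_lt_mul hq]
    exact Nat.mul_lt_mul_of_pos_left (by omega) (by positivity)
  have h3 : 2 ^ D * v < q * (c + 1) := by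
    rw [← e1]; exact Nat.lt_mul_div_succ _ hq
  have h4 : q * c ≤ 2 ^ D * (v - 1) := by
    rw [← e2]; exact Nat.mul_div_le _ _
  obtain ⟨v', rfl⟩ : ∃ v', v = v' + 1 := ⟨v - 1, by omega⟩
  rw [Nat.add_sub_cancel] at h4
  subst hV
  have h5 : β < 2 ^ D * k + c + 1 := by
    apply Nat.lt_of_mul_lt_mul_left (a := q)
    nlinarith
  have h6 : 2 ^ D * k + c < β + 1 := by
    apply Nat.lt_of_mul_lt_mul_left (a := q)
    nlinarith
  have : β = c + 2 ^ D * k := by omega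
  rw [this, Nat.add_mul_mod_self_left, Nat.mod_eq_of_lt hcD]

/-- Conversely, equal indices confine V to the length of a cell around y modulo q, up to one unit of
rounding. -/
theorem near_of_block_eq {D y V β : ℕ} (hβ : q * β ≤ 2 ^ D * V)
    (hβ' : 2 ^ D * V < q * (β + 1) + 2 ^ D) (hq : 0 < q) (h : β % 2 ^ D = 2 ^ D * y / q) :
    ∃ τ : ℤ, |τ| ≤ (q / 2 ^ D : ℕ) + 1 ∧ ((V : ℤ) : ZMod q) = ((y + τ : ℤ) : ZMod q) := by
  have hD : (0 : ℤ) < 2 ^ D := by positivity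
  have h1 : q * (2 ^ D * y / q) ≤ 2 ^ D * y := Nat.mul_div_le _ _
  have h2 : 2 ^ D * y < q * (2 ^ D * y / q + 1) := Nat.lt_mul_div_succ _ hq
  rw [← h] at h1 h2
  have h3 := Nat.div_add_mod β (2 ^ D)
  set k := β / 2 ^ D
  set c := β % 2 ^ D
  rw [← h3] at hβ hβ'
  have h4 : q < 2 ^ D * (q / 2 ^ D + 1) := Nat.lt_mul_div_succ _ (by positivity)
  set g := q / 2 ^ D
  zify at hβ hβ' h1 h2 h4
  refine ⟨V - q * k - y, ?_, ?_⟩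
  · rw [abs_le]
    constructor
    · by_contra hcon
      push Not at hcon
      have : (V : ℤ) - q * k - y ≤ -((g : ℤ) + 1) - 1 := by linarith [Int.add_one_le_of_lt hcon]
      have := mul_le_mul_of_nonneg_left this hD.le
      nlinarith
    · by_contra hcon
      push Not at hcon
      have : (g : ℤ) + 1 + 1 ≤ (V : ℤ) - q * k - y := Int.add_one_le_of_lt hcon
      have := mul_le_mul_of_nonneg_left this hD.le
      nlinarith
  · push_cast
    simp

/-- Residues of absolute value at most `W`. -/
def Near (q W : ℕ) (τ : ZMod q) : Prop := ∃ k : ℤ, |k| ≤ W ∧ (k : ZMod q) = τ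

/-- The image of `z` is in the interior of a cell, and no other image is close. -/
def GoodPoint {m : ℕ} (D B : ℕ) (A : Matrix (Fin m) (Fin n) (ZMod q)) (z : Fin n → ZMod q) : Prop :=
  (∀ i, InCell q D B (A.mulVec z i).val) ∧
    ∀ z', (∀ i, Near q (q / 2 ^ D + 1 + B) (A.mulVec (z' - z) i)) → z' = z

theorem lweStore_two {m : ℕ} [NeZero q] (A : Matrix (Fin m) (Fin n) (ZMod q)) (t : Fin m → ZMod q)
    (i : Fin m) : lweStore A t 2 i = (t i).val := by
  simp [lweStore]

theorem lweStore_one {m : ℕ} [NeZero q] (A : Matrix (Fin m) (Fin n) (ZMod q)) (t : Fin m → ZMod q)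
    (i : Fin m) (j : Fin n) : lweStore A t 1 (i * n + j) = (A i j).val := by
  have h : (i : ℕ) * n + j < m * n := by
    have : ((i : ℕ) + 1) * n ≤ m * n := Nat.mul_le_mul_right _ i.2
    have := j.2
    rw [add_mul] at *; omega
  have e : finProdFinEquiv.symm ⟨(i : ℕ) * n + j, h⟩ = (i, j) := by
    rw [Equiv.symm_apply_eq]
    ext
    simp [finProdFinEquiv]; ring
  simp [lweStore, h, e]

/-- Modulo q a row sees the pair (b, x) only through x + bs, apart from the error term; the two
partners of a coset are indistinguishable up to noise. -/
theorem rowVal_cast {m : ℕ} [NeZero q] (A : Matrix (Fin m) (Fin n) (ZMod q)) (s : Fin n → ZMod q)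
    (e : Fin m → ZMod q) (i : Fin m) (b : Bool) (x : Fin n → ZMod q) :
    ((rowVal (lweStore A (A.mulVec s + e) 1) (lweStore A (A.mulVec s + e) 2) i (b, x) : ℕ) : ZMod q) =
      A.mulVec (x + if b then s else 0) i + if b then e i else 0 := by
  unfold rowVal
  simp only [lweStore_two, lweStore_one]
  push_cast
  simp only [ZMod.natCast_val, ZMod.cast_id', id]
  have : ∑ j, A i j * x j = A.mulVec x i := rfl
  rw [this, Matrix.mulVec_add]
  cases b <;> simp; ring

/-- With z = x + bs the partners (0, z) and (1, z - s) have row values Az and Az + e, which lie in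
the same interior cells and thus show the same digits. A pair with these digits belongs to some z'
with A(z' - z) short, hence to z itself. The coset has offset z and secret -s, which explains the
sign. -/
theorem isGood_of_goodPoint {m D K B : ℕ} [NeZero q] (hn : 1 ≤ n) (hD : D ≤ K)
    (hK : q * (n * q) ≤ 2 ^ K) (A : Matrix (Fin m) (Fin n) (ZMod q)) (s : Fin n → ZMod q)
    {e : Fin m → ZMod q} (he : ∀ i, |((e i).valMinAbs : ℤ)| ≤ B) {b : Bool} {x : Fin n → ZMod q}
    (h : GoodPoint D B A (x + if b then s else 0)) :
    IsGood K D m (lweStore A (A.mulVec s + e) 1) (lweStore A (A.mulVec s + e) 2) (-s) (b, x) := by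
  have hq : 0 < q := Nat.pos_of_neZero q
  set z := x + if b then s else 0 with hz
  set a := lweStore A (A.mulVec s + e) 1 with ha
  set u := lweStore A (A.mulVec s + e) 2 with hu
  have hbd : ∀ (i : ℕ) (w : Bool × (Fin n → ZMod q)), _ := fun i w =>
    block_bounds hD (rowForm_bounds hn hK a u i w).1 (rowForm_bounds hn hK a u i w).2 hq
  have hsame : ∀ (b' : Bool) (x' : Fin n → ZMod q), (x' + if b' then s else 0) = z → ∀ i : Fin m,
      rowForm K a u i (b', x') / 2 ^ (K - D) % 2 ^ D = 2 ^ D * (A.mulVec z i).val / q := by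
    intro b' x' hz' i
    set y := (A.mulVec z i).val with hy
    have hI := h.1 i
    rw [← hy] at hI
    obtain ⟨h1, h2⟩ := hbd i (b', x')
    set V := rowVal a u i (b', x') with hV
    obtain ⟨ε, hε, hVε⟩ : ∃ ε : ℤ, |ε| ≤ B ∧ ((V : ℕ) : ZMod q) = ((y + ε : ℤ) : ZMod q) := by
      refine ⟨if b' then (e i).valMinAbs else 0, ?_, ?_⟩
      · split_ifs
        · exact he i
        · simp
      · rw [hV, ha, hu, rowVal_cast, hz', hy]
        push_cast
        split_ifs <;> simp
    rw [abs_le] at hε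
    have hI1 := hI.1
    have hI2 := hI.2.1
    -- Being interior keeps y more than the error bound away from both ends of [0, q), so adding the
    -- error does not wrap around.
    have hmod : ((V % q : ℕ) : ℤ) = y + ε := by
      rw [← Int.cast_natCast, ZMod.intCast_eq_intCast_iff'] at hVε
      rw [Int.emod_eq_of_lt (a := (y + ε : ℤ)) (by omega) (by omega)] at hVε
      push_cast
      exact hVε
    exact hI.block_eq (k := V / q) (v := V % q) (Nat.div_add_mod V q).symm (by omega) (by omega)
      h1 h2 hq
  refine ⟨z, fun w' => ?_⟩
  obtain ⟨b', x'⟩ := w'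
  have hiff : (∃ b₁, cosetPt (-s) z b₁ = (b', x')) ↔ (x' + if b' then s else 0) = z := by
    constructor
    · rintro ⟨b₁, h1⟩
      simp only [cosetPt, Prod.mk.injEq] at h1
      obtain ⟨rfl, rfl⟩ := h1
      cases b₁ <;> simp
    · intro h1
      refine ⟨b', ?_⟩
      rw [← h1]
      cases b' <;> simp [cosetPt]
  rw [hiff]
  constructor
  · rintro ⟨h1, -⟩
    apply h.2
    intro i
    have h2 := (rowBit_agree_iff hD).1 (h1 i i.2)
    rw [hsame b x rfl i] at h2
    obtain ⟨h3, h4⟩ := hbd i (b', x')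
    obtain ⟨τ, hτ, hVτ⟩ := near_of_block_eq h3 h4 hq h2.symm
    refine ⟨τ - (if b' then (e i).valMinAbs else 0), ?_, ?_⟩
    · have h5 : |(if b' then (e i).valMinAbs else 0 : ℤ)| ≤ B := by
        split_ifs
        · exact he i
        · simp
      have := abs_sub τ (if b' then (e i).valMinAbs else 0)
      push_cast
      push_cast at hτ
      linarith
    · rw [Int.cast_natCast, ha, hu, rowVal_cast] at hVτ
      rw [Matrix.mulVec_sub, Pi.sub_apply]
      push_cast at hVτ ⊢
      simp only [ZMod.natCast_val, ZMod.cast_id', id] at hVτ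
      have h6 : ((if b' then (e i).valMinAbs else 0 : ℤ) : ZMod q) = if b' then e i else 0 := by
        split_ifs <;> simp
      push_cast at h6
      rw [h6]
      linear_combination -hVτ
  · intro h1
    refine ⟨fun i hi => (rowBit_agree_iff hD).2 ?_, fun d hd => by omega⟩
    have := hsame b x rfl ⟨i, hi⟩
    have := hsame b' x' h1 ⟨i, hi⟩
    simp only at *
    omega

-- Each good point z yields the two distinct good pairs (0, z) and (1, z - s).
open Classical in
theorem card_isGood {m D K B : ℕ} [NeZero q] (hn : 1 ≤ n) (hD : D ≤ K)
    (hK : q * (n * q) ≤ 2 ^ K) (A : Matrix (Fin m) (Fin n) (ZMod q)) (s : Fin n → ZMod q)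
    {e : Fin m → ZMod q} (he : ∀ i, |((e i).valMinAbs : ℤ)| ≤ B) :
    2 * (Finset.univ.filter (GoodPoint D B A)).card ≤ (Finset.univ.filter (IsGood K D m
      (lweStore A (A.mulVec s + e) 1) (lweStore A (A.mulVec s + e) 2) (-s))).card := by
  have h2 : (2 : ℕ) = (Finset.univ : Finset Bool).card := by simp
  rw [h2, ← Finset.card_product]
  refine Finset.card_le_card_of_injOn
    (fun p => (p.1, p.2 - if p.1 then s else 0)) ?_ ?_
  · rintro ⟨b, z⟩ hz
    simp only [Finset.coe_product, Set.mem_prod, Finset.mem_coe, Finset.mem_univ, true_and,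
      Finset.mem_filter] at hz
    simp only [Finset.coe_filter, Finset.mem_univ, true_and, Set.mem_ofPred_eq]
    exact isGood_of_goodPoint hn hD hK A s he (by simpa using hz)
  · rintro ⟨b, z⟩ _ ⟨b', z'⟩ _ h
    simp only [Prod.mk.injEq] at h
    obtain ⟨rfl, h⟩ := h
    simpa using h

end Bits

/-! ### Uniform matrices -/

section Counting

variable {n m q : ℕ}

/-- The fibres of a surjective homomorphism are equally large, so it carries the uniform
distribution to the uniform distribution. -/
theorem card_comp_mul_card {G H : Type*} [AddCommGroup G] [AddCommGroup H] [Fintype G] [Fintype H]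
    (f : G →+ H) (hf : Function.Surjective f) (P : H → Prop) [DecidablePred P]
    [DecidablePred fun g => P (f g)] :
    (Finset.univ.filter fun g => P (f g)).card * Fintype.card H =
      (Finset.univ.filter P).card * Fintype.card G := by
  classical
  have hfib : ∀ h : H, (Finset.univ.filter fun g => f g = h).card =
      (Finset.univ.filter fun g => f g = 0).card := fun h =>
    AddMonoidHom.card_fiber_eq_of_mem_range f (hf h) (hf 0)
  have hsum : ∀ (Q : H → Prop) [DecidablePred Q] [DecidablePred fun g => Q (f g)], (Finset.univ.filter fun g => Q (f g)).card =
      (Finset.univ.filter Q).card * (Finset.univ.filter fun g => f g = 0).card := by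
    intro Q _ _
    rw [Finset.card_eq_sum_card_fiberwise (f := f) (t := Finset.univ.filter Q)
      (by intro g hg; simpa using hg), ← smul_eq_mul, ← Finset.sum_const]
    refine Finset.sum_congr rfl fun h hh => ?_
    rw [← hfib h]
    congr 1
    ext g
    simp only [Finset.mem_filter, Finset.mem_univ, true_and] at hh ⊢
    exact ⟨fun h1 => h1.2, fun h1 => ⟨h1 ▸ hh, h1⟩⟩
  have h1 := hsum fun _ => True
  simp only [Finset.filter_true, Finset.card_univ] at h1
  rw [hsum P, h1]
  ring

theorem card_matrix_zmod [NeZero q] :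
    Fintype.card (Matrix (Fin m) (Fin n) (ZMod q)) = q ^ (m * n) := by
  have : Fintype.card (Fin m → Fin n → ZMod q) = q ^ (m * n) := by
    simp [ZMod.card, ← pow_mul, mul_comm]
  exact this

/-- A nonzero coordinate of z is invertible since q is prime, and one column of the matrix can then
be chosen freely to hit any vector. -/
theorem mulVec_surjective [Fact q.Prime] {z : Fin n → ZMod q} (hz : z ≠ 0) :
    Function.Surjective fun A : Matrix (Fin m) (Fin n) (ZMod q) => A.mulVec z := by
  intro v
  obtain ⟨j, hj⟩ := Function.ne_iff.1 hz
  refine ⟨fun i l => if l = j then v i * (z j)⁻¹ else 0, ?_⟩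
  ext i
  simp only [Matrix.mulVec, dotProduct, ite_mul, zero_mul, Finset.sum_ite_eq', Finset.mem_univ,
    if_true]
  exact inv_mul_cancel_right₀ hj _

theorem card_mulVec_filter [Fact q.Prime] {z : Fin n → ZMod q} (hz : z ≠ 0)
    (P : (Fin m → ZMod q) → Prop) [DecidablePred P]
    [DecidablePred fun A : Matrix (Fin m) (Fin n) (ZMod q) => P (A.mulVec z)] :
    ((Finset.univ.filter fun A : Matrix (Fin m) (Fin n) (ZMod q) => P (A.mulVec z)).card : ℝ) =
      (q : ℝ) ^ (m * n) * ((Finset.univ.filter P).card / (q : ℝ) ^ m) := by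
  have hq : (q : ℝ) ≠ 0 := by exact_mod_cast (Fact.out : q.Prime).ne_zero
  have := card_comp_mul_card (AddMonoidHom.mk' (fun A : Matrix (Fin m) (Fin n) (ZMod q) => A.mulVec z)
    fun A B => Matrix.add_mulVec A B z) (mulVec_surjective hz) P
  rw [card_matrix_zmod] at this
  simp only [AddMonoidHom.mk'_apply, Fintype.card_fun, ZMod.card, Fintype.card_fin] at this
  have h2 := congrArg (Nat.cast (R := ℝ)) this
  push_cast at h2
  field_simp
  rw [h2]; ring

theorem card_mulVec_apply_filter [Fact q.Prime] {z : Fin n → ZMod q} (hz : z ≠ 0) (i : Fin m)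
    (P : ZMod q → Prop) [DecidablePred P]
    [DecidablePred fun A : Matrix (Fin m) (Fin n) (ZMod q) => P (A.mulVec z i)] :
    ((Finset.univ.filter fun A : Matrix (Fin m) (Fin n) (ZMod q) => P (A.mulVec z i)).card : ℝ) =
      (q : ℝ) ^ (m * n) * ((Finset.univ.filter P).card / q) := by
  have hq : (q : ℝ) ≠ 0 := by exact_mod_cast (Fact.out : q.Prime).ne_zero
  have := card_comp_mul_card (AddMonoidHom.mk'
    (fun A : Matrix (Fin m) (Fin n) (ZMod q) => A.mulVec z i)
    fun A B => by simp [Matrix.add_mulVec])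
    ((Function.surjective_eval i).comp (mulVec_surjective hz)) P
  rw [card_matrix_zmod] at this
  simp only [AddMonoidHom.mk'_apply, ZMod.card] at this
  have h2 := congrArg (Nat.cast (R := ℝ)) this
  push_cast at h2
  field_simp
  rw [h2]; ring

open Classical in
theorem card_near [NeZero q] (W : ℕ) : (Finset.univ.filter (Near q W)).card ≤ 2 * W + 1 := by
  calc _ ≤ ((Finset.Icc (-(W : ℤ)) W).image (Int.cast : ℤ → ZMod q)).card := by
        refine Finset.card_le_card fun τ hτ => ?_
        obtain ⟨k, hk, rfl⟩ := (Finset.mem_filter.1 hτ).2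
        exact Finset.mem_image_of_mem _ (Finset.mem_Icc.2 (abs_le.1 hk))
    _ ≤ (Finset.Icc (-(W : ℤ)) W).card := Finset.card_image_le
    _ = _ := by rw [Int.card_Icc]; omega

open Classical in
theorem card_near_mulVec [Fact q.Prime] {z : Fin n → ZMod q} (hz : z ≠ 0) (W : ℕ) :
    ((Finset.univ.filter fun A : Matrix (Fin m) (Fin n) (ZMod q) =>
      ∀ i, Near q W (A.mulVec z i)).card : ℝ) ≤ (q : ℝ) ^ (m * n) * ((2 * W + 1) / q) ^ m := by
  rw [card_mulVec_filter hz fun v => ∀ i, Near q W (v i), div_pow]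
  have e : (Finset.univ.filter fun v : Fin m → ZMod q => ∀ i, Near q W (v i)) =
      Fintype.piFinset fun _ => Finset.univ.filter (Near q W) := by
    ext v; simp
  rw [e, Fintype.card_piFinset]
  have := card_near (q := q) W
  simp only [Finset.prod_const, Finset.card_univ, Fintype.card_fin]
  push_cast
  gcongr
  exact_mod_cast this

-- A residue that is not interior lies in a window of length 2B + 2 around one of the 2^D + 1 cell
-- boundaries, the two ends of [0, q) included.
open Classical in
theorem card_not_inCell [NeZero q] (D B : ℕ) :
    (Finset.univ.filter fun τ : ZMod q => ¬ InCell q D B τ.val).card ≤ (2 ^ D + 1) * (2 * B + 2) := by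
  have hq : 0 < q := Nat.pos_of_neZero q
  have hD : 0 < 2 ^ D := by positivity
  calc _ ≤ ((Finset.range (2 ^ D + 1)).biUnion fun c =>
        Finset.Ico (q * c / 2 ^ D) (q * c / 2 ^ D + (2 * B + 2))).card := by
        -- The shift by `B` lets each window start at its boundary, so no subtraction of natural
        -- numbers is needed.
        refine Finset.card_le_card_of_injOn (fun τ => τ.val + B) ?_ ?_
        · intro τ hτ
          simp only [Finset.coe_filter, Finset.mem_univ, true_and, Set.mem_ofPred_eq] at hτ
          have hy := ZMod.val_lt τ
          simp only [Finset.coe_biUnion, Finset.mem_coe, Finset.mem_range, Set.mem_iUnion,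
            Finset.coe_Ico, Set.mem_Ico]
          set y := τ.val
          by_cases h1 : B + 1 ≤ y
          · by_cases h2 : y + B < q
            · have h3 : ¬ 2 ^ D * (y - (B + 1)) / q = 2 ^ D * (y + B) / q :=
                fun h3 => hτ ⟨h1, h2, h3⟩
              have h4 : 2 ^ D * (y - (B + 1)) / q < 2 ^ D * (y + B) / q :=
                lt_of_le_of_ne (Nat.div_le_div_right (Nat.mul_le_mul_left _ (by omega))) h3
              have h5 : q * (2 ^ D * (y + B) / q) ≤ 2 ^ D * (y + B) := Nat.mul_div_le _ _
              have h6 : 2 ^ D * (y - (B + 1)) < q * (2 ^ D * (y + B) / q) := by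
                have := Nat.lt_mul_div_succ (2 ^ D * (y - (B + 1))) hq
                exact this.trans_le (Nat.mul_le_mul_left _ h4)
              set c := 2 ^ D * (y + B) / q with hc
              refine ⟨c, ?_, ?_, ?_⟩
              · have : c < 2 ^ D := by
                  rw [hc, Nat.div_lt_iff_lt_mul hq]
                  exact Nat.mul_lt_mul_of_pos_left h2 hD
                omega
              · rw [Nat.div_le_iff_le_mul_add_pred hD]; omega
              · have h7 : y - (B + 1) ≤ q * c / 2 ^ D := by
                  rw [Nat.le_div_iff_mul_le hD, mul_comm]; exact h6.le
                omega
            · refine ⟨2 ^ D, by omega, ?_, ?_⟩ <;> rw [Nat.mul_div_cancel _ hD] <;> omega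
          · refine ⟨0, by omega, ?_, ?_⟩ <;> simp; omega
        · intro τ _ τ' _ h
          exact ZMod.val_injective q (by simpa using h)
    _ ≤ ∑ c ∈ Finset.range (2 ^ D + 1), (2 * B + 2) := by
        refine Finset.card_biUnion_le.trans (Finset.sum_le_sum fun c _ => ?_)
        simp
    _ = _ := by simp

-- Double counting: instead of bad points for each matrix, bad matrices are counted for each point.
-- There the image is uniform, and a union bound over rows treats the cells and one over z' the
-- collisions.
open Classical in
theorem sum_card_not_goodPoint [Fact q.Prime] (D B : ℕ) :
    ∑ A : Matrix (Fin m) (Fin n) (ZMod q),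
      ((Finset.univ.filter fun z => ¬ GoodPoint D B A z).card : ℝ) ≤
    (q : ℝ) ^ (m * n) * (1 + q ^ n * (m * ((2 ^ D + 1) * (2 * B + 2) / q)) +
      q ^ n * (q ^ n * ((2 * (q / 2 ^ D + 1 + B : ℕ) + 1) / q) ^ m)) := by
  set W := q / 2 ^ D + 1 + B with hW
  have hcardA : (Fintype.card (Matrix (Fin m) (Fin n) (ZMod q)) : ℝ) = (q : ℝ) ^ (m * n) := by
    rw [card_matrix_zmod]; simp
  have hcardz : (Fintype.card (Fin n → ZMod q) : ℝ) = (q : ℝ) ^ n := by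
    simp [ZMod.card]
  have hswap : ∑ A : Matrix (Fin m) (Fin n) (ZMod q),
      ((Finset.univ.filter fun z => ¬ GoodPoint D B A z).card : ℝ) =
      ∑ z : Fin n → ZMod q, ((Finset.univ.filter fun A : Matrix (Fin m) (Fin n) (ZMod q) =>
        ¬ GoodPoint D B A z).card : ℝ) := by
    simp only [Finset.card_filter, Nat.cast_sum]
    exact Finset.sum_comm
  -- The point z = 0 is exceptional: its image is 0 for every matrix and never interior. It produces
  -- the summand 1 of the final bound.
  have hcell : ∀ z : Fin n → ZMod q, ((Finset.univ.filter
      fun A : Matrix (Fin m) (Fin n) (ZMod q) => ∃ i, ¬ InCell q D B (A.mulVec z i).val).card : ℝ) ≤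
      (if z = 0 then (q : ℝ) ^ (m * n) else 0) +
        (q : ℝ) ^ (m * n) * (m * ((2 ^ D + 1) * (2 * B + 2) / q)) := by
    intro z
    by_cases hz : z = 0
    · rw [if_pos hz, ← hcardA]
      refine le_add_of_le_of_nonneg ?_ (by positivity)
      exact_mod_cast Finset.card_le_univ _
    · rw [if_neg hz, zero_add]
      have h1 : (Finset.univ.filter fun A : Matrix (Fin m) (Fin n) (ZMod q) =>
          ∃ i, ¬ InCell q D B (A.mulVec z i).val) = Finset.univ.biUnion fun i =>
          Finset.univ.filter fun A : Matrix (Fin m) (Fin n) (ZMod q) =>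
            ¬ InCell q D B (A.mulVec z i).val := by
        ext A; simp
      rw [h1]
      calc _ ≤ ∑ i : Fin m, ((Finset.univ.filter fun A : Matrix (Fin m) (Fin n) (ZMod q) =>
            ¬ InCell q D B (A.mulVec z i).val).card : ℝ) := by
            exact_mod_cast Finset.card_biUnion_le
        _ ≤ ∑ i : Fin m, (q : ℝ) ^ (m * n) * ((2 ^ D + 1) * (2 * B + 2) / q) := by
            refine Finset.sum_le_sum fun i _ => ?_
            rw [card_mulVec_apply_filter hz i fun τ => ¬ InCell q D B τ.val]
            have := card_not_inCell (q := q) D B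
            gcongr
            exact_mod_cast this
        _ = _ := by simp; ring
  have hnear : ∀ z : Fin n → ZMod q, ((Finset.univ.filter
      fun A : Matrix (Fin m) (Fin n) (ZMod q) =>
        ∃ z', z' ≠ z ∧ ∀ i, Near q W (A.mulVec (z' - z) i)).card : ℝ) ≤
      (q : ℝ) ^ n * ((q : ℝ) ^ (m * n) * ((2 * W + 1) / q) ^ m) := by
    intro z
    have h1 : (Finset.univ.filter fun A : Matrix (Fin m) (Fin n) (ZMod q) =>
          ∃ z', z' ≠ z ∧ ∀ i, Near q W (A.mulVec (z' - z) i)) =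
        (Finset.univ.filter (· ≠ z)).biUnion fun z' =>
          Finset.univ.filter fun A : Matrix (Fin m) (Fin n) (ZMod q) =>
            ∀ i, Near q W (A.mulVec (z' - z) i) := by
      ext A; simp
    rw [h1]
    calc _ ≤ ∑ z' ∈ Finset.univ.filter (· ≠ z),
          ((Finset.univ.filter fun A : Matrix (Fin m) (Fin n) (ZMod q) =>
            ∀ i, Near q W (A.mulVec (z' - z) i)).card : ℝ) := by
          exact_mod_cast Finset.card_biUnion_le
      _ ≤ ∑ z' ∈ Finset.univ.filter (· ≠ z), (q : ℝ) ^ (m * n) * ((2 * W + 1) / q) ^ m := by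
          refine Finset.sum_le_sum fun z' hz' => ?_
          exact card_near_mulVec (sub_ne_zero.2 (Finset.mem_filter.1 hz').2) W
      _ ≤ _ := by
          rw [Finset.sum_const, nsmul_eq_mul, ← hcardz]
          gcongr
          exact Finset.card_le_univ _
  rw [hswap]
  calc _ ≤ ∑ z : Fin n → ZMod q, (((if z = 0 then (q : ℝ) ^ (m * n) else 0) +
        (q : ℝ) ^ (m * n) * (m * ((2 ^ D + 1) * (2 * B + 2) / q))) +
        (q : ℝ) ^ n * ((q : ℝ) ^ (m * n) * ((2 * W + 1) / q) ^ m)) := by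
        refine Finset.sum_le_sum fun z _ => le_trans ?_ (add_le_add (hcell z) (hnear z))
        norm_cast
        refine (Finset.card_le_card fun A hA => ?_).trans (Finset.card_union_le _ _)
        simp only [Finset.mem_filter, Finset.mem_univ, true_and, Finset.mem_union] at hA ⊢
        by_contra hcon
        push Not at hcon
        refine hA ⟨hcon.1, fun z' hz' => ?_⟩
        by_contra hne
        obtain ⟨i, hi⟩ := hcon.2 z' hne
        exact hi (hz' i)
    _ = _ := by
        rw [Finset.sum_add_distrib, Finset.sum_add_distrib, Finset.sum_ite_eq' Finset.univ 0]
        simp only [Finset.mem_univ, if_true, Finset.sum_const, Finset.card_univ, nsmul_eq_mul, hcardz]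
        ring

end Counting

/-! ### Truncated Gaussian weights -/

section Gauss

variable {m q : ℕ} [NeZero q] {B : ℝ}

theorem gaussNorm_pos (hB : 0 ≤ B) : 0 < ∑ z : ZMod q with |(z.valMinAbs : ℝ)| ≤ B,
    Real.exp (-Real.pi * (z.valMinAbs : ℝ) ^ 2 / B ^ 2) :=
  Finset.sum_pos (fun _ _ => Real.exp_pos _) ⟨0, by simpa using hB⟩

theorem gaussDensity_nonneg (x : ZMod q) : 0 ≤ gaussDensity q B x := by
  unfold gaussDensity
  split_ifs
  · exact div_nonneg (Real.exp_pos _).le (Finset.sum_nonneg fun _ _ => (Real.exp_pos _).le)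
  · exact le_rfl

theorem sum_gaussDensity (hB : 0 ≤ B) : ∑ x : ZMod q, gaussDensity q B x = 1 := by
  unfold gaussDensity
  rw [← Finset.sum_filter, ← Finset.sum_div, div_self (gaussNorm_pos hB).ne']

theorem gaussVecDensity_nonneg (e : Fin m → ZMod q) : 0 ≤ gaussVecDensity B e :=
  Finset.prod_nonneg fun _ _ => gaussDensity_nonneg _

theorem sum_gaussVecDensity (hB : 0 ≤ B) : ∑ e : Fin m → ZMod q, gaussVecDensity B e = 1 := by
  unfold gaussVecDensity
  rw [← Fintype.piFinset_univ, ← Finset.prod_univ_sum]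
  simp [sum_gaussDensity hB]

theorem abs_le_of_gaussDensity_ne_zero {x : ZMod q} (h : gaussDensity q B x ≠ 0) :
    |(x.valMinAbs : ℝ)| ≤ B := by
  unfold gaussDensity at h
  by_contra hc
  exact h (if_neg hc)

theorem abs_le_of_gaussVecDensity_ne_zero {e : Fin m → ZMod q} (h : gaussVecDensity B e ≠ 0)
    (i : Fin m) : |((e i).valMinAbs : ℝ)| ≤ B :=
  abs_le_of_gaussDensity_ne_zero (Finset.prod_ne_zero_iff.1 h i (Finset.mem_univ i))

end Gauss

/-! ### The success probability of the reduction -/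

section Success

variable {n m q : ℕ}

/-- This fixes the precision: it must absorb the rounding errors of all coefficients of a row. -/
theorem le_two_pow_precision : q * (n * q) ≤ 2 ^ precision n q := by
  have h1 : q ≤ 2 ^ Nat.clog 2 q := Nat.le_pow_clog (by norm_num) q
  have h2 : n ≤ 2 ^ n.size := (Nat.lt_size_self n).le
  calc q * (n * q) ≤ 2 ^ Nat.clog 2 q * (2 ^ n.size * 2 ^ Nat.clog 2 q) := by gcongr
    _ = _ := by unfold precision; rw [← pow_add, ← pow_add]; congr 1; ring

/-- Bernoulli's inequality, once for the coordinates and once for the registers. The number of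
attempts T satisfies 8rn ≤ 2^T, so all failures of rejection sampling together cost at most 1/8. -/
theorem le_pow_attempts (n r : ℕ) {κ : ℝ} (h0 : 0 ≤ κ) (h1 : κ ≤ 1) :
    7 / 8 - r * (1 - κ) ≤ ((1 - (1 / 2 : ℝ) ^ attemptCount n r) ^ n * κ) ^ r := by
  set T := attemptCount n r with hT
  have hp0 : (0 : ℝ) ≤ 1 - (1 / 2) ^ T := sub_nonneg.2 (pow_le_one₀ (by norm_num) (by norm_num))
  have hb : 1 - n * (1 / 2 : ℝ) ^ T ≤ (1 - (1 / 2 : ℝ) ^ T) ^ n := by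
    have := one_add_mul_le_pow (a := -(1 / 2 : ℝ) ^ T) (by linarith) n
    rw [← sub_eq_add_neg] at this
    linarith
  have hle : (1 - (1 / 2 : ℝ) ^ T) ^ n ≤ 1 := pow_le_one₀ hp0 (by
    have : (0 : ℝ) ≤ (1 / 2) ^ T := by positivity
    linarith)
  set a := (1 - (1 / 2 : ℝ) ^ T) ^ n
  have ha : 0 ≤ a := pow_nonneg hp0 n
  have hrn : (r : ℝ) * (n * (1 / 2 : ℝ) ^ T) ≤ 1 / 8 := by
    have h2 : r * n * 8 ≤ 2 ^ T := by
      calc r * n * 8 ≤ 2 ^ r.size * 2 ^ n.size * 2 ^ 3 :=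
            Nat.mul_le_mul (Nat.mul_le_mul (Nat.lt_size_self r).le (Nat.lt_size_self n).le) (by norm_num)
        _ = _ := by rw [← pow_add, ← pow_add, hT, attemptCount]
    have h3 : (r : ℝ) * n * 8 ≤ 2 ^ T := by exact_mod_cast h2
    rw [one_div, inv_pow, ← mul_assoc, mul_inv_le_iff₀ (by positivity)]
    linarith
  have hbern := one_add_mul_le_pow (a := a * κ - 1) (by nlinarith [mul_nonneg ha h0]) r
  rw [add_sub_cancel] at hbern
  refine le_trans ?_ hbern
  have h4 : 1 - a * κ ≤ n * (1 / 2 : ℝ) ^ T + (1 - κ) := by nlinarith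
  have h5 := mul_le_mul_of_nonneg_left h4 (Nat.cast_nonneg (α := ℝ) r)
  nlinarith

-- The lower bound 7/8 - r(1 - κ) is linear in the share κ of good points. Averaging over matrices
-- therefore only needs the mean of 1 - κ, which is what the double counting controls. With rδ ≤ 3/8
-- half of `p₀` remains.
open Classical in
theorem le_lweSuccessProb [Fact q.Prime] {P : QProg} {M D B r : ℕ} {l : List ℕ} (hn : 1 ≤ n)
    (hD : D ≤ precision n q) (hM : 2 < M) (hP : P.Below M) (hr : evalList (n * Nat.clog 2 q) l = r)
    {p₀ : ℝ} (hp₀ : 0 ≤ p₀) (hout : ∀ (s : Fin n → ZMod q) (x : Fin r → Fin n → ZMod q),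
      p₀ ≤ P.outputProb (dcpStore n q) (dcpInput s x) s) {δ : ℝ}
    (hδ : ∑ A : Matrix (Fin m) (Fin n) (ZMod q),
      ((Finset.univ.filter fun z => ¬ GoodPoint D B A z).card : ℝ) ≤ q ^ (m * n) * (q ^ n * δ))
    (hrδ : r * δ ≤ 3 / 8) :
    p₀ / 2 ≤ lweSuccessProb (solver P M D l) n m q B := by
  have hq : 1 < q := (Fact.out : q.Prime).one_lt
  have hq0 : (0 : ℝ) < q := by exact_mod_cast hq.pos
  set κ : Matrix (Fin m) (Fin n) (ZMod q) → ℝ := fun A =>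
    (Finset.univ.filter (GoodPoint D B A)).card / (q : ℝ) ^ n with hκ
  have hcomp : ∀ A : Matrix (Fin m) (Fin n) (ZMod q),
      1 - κ A = (Finset.univ.filter fun z => ¬ GoodPoint D B A z).card / (q : ℝ) ^ n := by
    intro A
    have h1 := Finset.card_filter_add_card_filter_not (s := Finset.univ) (GoodPoint D B A)
    have h2 : (Finset.univ : Finset (Fin n → ZMod q)).card = q ^ n := by simp [ZMod.card]
    rw [h2] at h1
    have h3 := congrArg (Nat.cast (R := ℝ)) h1
    push_cast at h3
    rw [hκ, eq_div_iff (by positivity), sub_mul, div_mul_cancel₀ _ (by positivity)]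
    linarith
  have hκ0 : ∀ A, 0 ≤ κ A := fun A => by positivity
  have hκ1 : ∀ A, κ A ≤ 1 := fun A => by
    have : 0 ≤ 1 - κ A := by rw [hcomp]; positivity
    linarith
  have hmain : ∀ (A : Matrix (Fin m) (Fin n) (ZMod q)) (s : Fin n → ZMod q) (e : Fin m → ZMod q),
      gaussVecDensity (B : ℝ) e * (p₀ * (7 / 8 - r * (1 - κ A))) ≤ gaussVecDensity (B : ℝ) e *
        (solver P M D l).outputProb (lweStore A (A.mulVec s + e)) (Finsupp.single ∅ 1) s := by
    intro A s e
    by_cases he : gaussVecDensity (B : ℝ) e = 0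
    · simp [he]
    refine mul_le_mul_of_nonneg_left ?_ (gaussVecDensity_nonneg e)
    have he' : ∀ i, |((e i).valMinAbs : ℤ)| ≤ B := fun i => by
      exact_mod_cast abs_le_of_gaussVecDensity_ne_zero he i
    have hcard := card_isGood hn hD le_two_pow_precision A s he'
    refine le_trans ?_ (le_outputProb_solver hM hP hq hr hp₀ (fun x => hout (-s) x) A _ (hκ0 A) ?_)
    · rw [mul_comm p₀]
      exact mul_le_mul_of_nonneg_right (le_pow_attempts n r (hκ0 A) (hκ1 A)) hp₀
    · have : κ A * (2 * q ^ n) = 2 * ((Finset.univ.filter (GoodPoint D B A)).card : ℝ) := by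
        simp only [hκ]; field_simp
      rw [this]
      exact_mod_cast hcard
  unfold lweSuccessProb
  calc p₀ / 2 ≤ p₀ * (7 / 8 - r * δ) := by nlinarith
    _ ≤ ∑ A : Matrix (Fin m) (Fin n) (ZMod q),
        ((q : ℝ) ^ (m * n))⁻¹ * (p₀ * (7 / 8 - r * (1 - κ A))) := by
        have h1 : ∑ A : Matrix (Fin m) (Fin n) (ZMod q), ((q : ℝ) ^ (m * n))⁻¹ * (1 - κ A) ≤ δ := by
          simp only [hcomp]
          rw [← Finset.mul_sum, ← Finset.sum_div, inv_mul_le_iff₀ (by positivity),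
            div_le_iff₀ (by positivity)]
          linarith
        have h2 : ∑ A : Matrix (Fin m) (Fin n) (ZMod q), ((q : ℝ) ^ (m * n))⁻¹ = 1 := by
          rw [Finset.sum_const, Finset.card_univ, card_matrix_zmod, nsmul_eq_mul]
          push_cast
          exact mul_inv_cancel₀ (by positivity)
        have h3 : ∑ A : Matrix (Fin m) (Fin n) (ZMod q),
            ((q : ℝ) ^ (m * n))⁻¹ * (p₀ * (7 / 8 - r * (1 - κ A))) = p₀ * (7 / 8 *
              ∑ A : Matrix (Fin m) (Fin n) (ZMod q), ((q : ℝ) ^ (m * n))⁻¹) -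
            p₀ * r * ∑ A : Matrix (Fin m) (Fin n) (ZMod q), ((q : ℝ) ^ (m * n))⁻¹ * (1 - κ A) := by
          simp only [Finset.mul_sum, ← Finset.sum_sub_distrib]
          exact Finset.sum_congr rfl fun A _ => by ring
        rw [h3, h2]
        have := mul_le_mul_of_nonneg_left h1 (mul_nonneg hp₀ (Nat.cast_nonneg (α := ℝ) r))
        linarith
    _ = ∑ A : Matrix (Fin m) (Fin n) (ZMod q), ∑ s : Fin n → ZMod q, ∑ e : Fin m → ZMod q,
        ((q : ℝ) ^ (m * n))⁻¹ * ((q : ℝ) ^ n)⁻¹ *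
          (gaussVecDensity (B : ℝ) e * (p₀ * (7 / 8 - r * (1 - κ A)))) := by
        refine Finset.sum_congr rfl fun A _ => ?_
        simp only [← Finset.mul_sum, ← Finset.sum_mul, sum_gaussVecDensity (Nat.cast_nonneg B),
          Finset.sum_const, Finset.card_univ, nsmul_eq_mul]
        simp only [Fintype.card_fun, ZMod.card, Fintype.card_fin]
        push_cast
        field_simp
    _ ≤ _ := by
        refine Finset.sum_le_sum fun A _ => Finset.sum_le_sum fun s _ => Finset.sum_le_sum fun e _ => ?_
        rw [mul_assoc _ (gaussVecDensity (B : ℝ) e)]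
        exact mul_le_mul_of_nonneg_left (hmain A s e) (by positivity)

end Success

/-! ### Polynomial and superpolynomial growth -/

section Growth

theorem polynomial_eval_mono (p : Polynomial ℕ) : Monotone fun x => p.eval x := by
  intro x y hxy
  simp only [Polynomial.eval_eq_sum_range]
  exact Finset.sum_le_sum fun i _ => Nat.mul_le_mul_left _ (Nat.pow_le_pow_left hxy i)

variable {f g : ℕ → ℕ}

theorem PolyBounded.mono (hg : PolyBounded g) (h : ∀ᶠ k in atTop, f k ≤ g k) : PolyBounded f := by
  obtain ⟨p, hp⟩ := hg
  exact ⟨p, by filter_upwards [h, hp] with k h1 h2 using h1.trans h2⟩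

theorem PolyBounded.of_le (hg : PolyBounded g) (h : ∀ k, f k ≤ g k) : PolyBounded f :=
  hg.mono (Eventually.of_forall h)

theorem PolyBounded.eval (hg : PolyBounded g) (p : Polynomial ℕ) :
    PolyBounded fun k => p.eval (g k) := by
  obtain ⟨b, hb⟩ := hg
  refine ⟨p.comp b, ?_⟩
  filter_upwards [hb] with k hk
  rw [Polynomial.eval_comp]
  exact polynomial_eval_mono p hk

theorem PolyBounded.add (hf : PolyBounded f) (hg : PolyBounded g) :
    PolyBounded fun k => f k + g k := by
  obtain ⟨p, hp⟩ := hf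
  obtain ⟨b, hb⟩ := hg
  refine ⟨p + b, ?_⟩
  filter_upwards [hp, hb] with k h1 h2
  rw [Polynomial.eval_add]; exact add_le_add h1 h2

theorem PolyBounded.mul (hf : PolyBounded f) (hg : PolyBounded g) :
    PolyBounded fun k => f k * g k := by
  obtain ⟨p, hp⟩ := hf
  obtain ⟨b, hb⟩ := hg
  refine ⟨p * b, ?_⟩
  filter_upwards [hp, hb] with k h1 h2
  rw [Polynomial.eval_mul]; exact Nat.mul_le_mul h1 h2

theorem PolyBounded.const (c : ℕ) : PolyBounded fun _ => c :=
  ⟨Polynomial.C c, Eventually.of_forall fun k => by simp⟩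

theorem PolyBounded.pow (hf : PolyBounded f) (d : ℕ) : PolyBounded fun k => f k ^ d := by
  obtain ⟨p, hp⟩ := hf
  refine ⟨p ^ d, ?_⟩
  filter_upwards [hp] with k h1
  rw [Polynomial.eval_pow]; exact Nat.pow_le_pow_left h1 d

theorem PolyBounded.le_pow (hf : PolyBounded f) : ∃ d, ∀ᶠ k in atTop, f k ≤ k ^ d := by
  obtain ⟨p, hp⟩ := hf
  -- The spare degree absorbs the sum p(1) of the coefficients.
  refine ⟨p.natDegree + 1, ?_⟩
  filter_upwards [hp, eventually_ge_atTop (p.eval 1), eventually_ge_atTop 1] with k h1 h2 h3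
  refine h1.trans ?_
  calc p.eval k ≤ p.eval 1 * k ^ p.natDegree := by
        rw [Polynomial.eval_eq_sum_range, Polynomial.eval_eq_sum_range, Finset.sum_mul]
        refine Finset.sum_le_sum fun i hi => ?_
        rw [one_pow, mul_one]
        exact Nat.mul_le_mul_left _ (Nat.pow_le_pow_right h3 (by simpa [Nat.lt_succ_iff] using hi))
    _ ≤ k * k ^ p.natDegree := Nat.mul_le_mul_right _ h2
    _ = _ := by ring

theorem negl_of_le {u : ℕ → ℝ} {h : ℕ → ℝ} (C : ℝ) (hg : PolyBounded g) (hh : SuperPoly h)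
    (hu : ∀ k, 0 ≤ u k) (hle : ∀ᶠ k in atTop, u k ≤ C * (g k / h k)) : Negl u := by
  refine ⟨hu, fun d => ?_⟩
  obtain ⟨e, he⟩ := hg.le_pow
  have hlim : Tendsto (fun k : ℕ => |C| * (k : ℝ)⁻¹) atTop (𝓝 0) := by
    simpa using (tendsto_inv_atTop_zero.comp tendsto_natCast_atTop_atTop).const_mul |C|
  refine tendsto_of_tendsto_of_tendsto_of_le_of_le' tendsto_const_nhds hlim
    (Eventually.of_forall fun k => mul_nonneg (by positivity) (hu k)) ?_
  -- The exponent d + e covers the power from the definition and the polynomial numerator; the one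
  -- extra power makes the quotient tend to 0.
  filter_upwards [hle, he, hh (d + e + 1), eventually_ge_atTop 1] with k h1 h2 h3 h4
  have hk : (0 : ℝ) < k := by exact_mod_cast h4
  have hh0 : 0 < h k := lt_of_lt_of_le (by positivity) h3
  have h5 : (g k : ℝ) ≤ (k : ℝ) ^ e := by exact_mod_cast h2
  calc (k : ℝ) ^ d * u k ≤ (k : ℝ) ^ d * (|C| * (k ^ e / k ^ (d + e + 1))) := by
        gcongr
        refine h1.trans ?_
        calc _ ≤ |C| * (g k / h k) := by gcongr; exact le_abs_self C
          _ ≤ _ := by gcongr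
    _ = |C| * (k : ℝ)⁻¹ := by
        field_simp
        ring

theorem Negl.tendsto {u : ℕ → ℝ} (hu : Negl u) : Tendsto u atTop (𝓝 0) := by
  simpa using hu.2 0

end Growth

/-! ### Sizes of the parameters -/

section Params

variable {CT : ℝ} {n m q BL BV BP : ℕ → ℕ}

/-- Since Lm ≥ Lc n log₂ q ≥ 2n log₂ q, the power 2^(-Lm) is at most q^(-2n). This beats a union
bound over all pairs of points of ℤ_q^n. -/
theorem pow_le_of_sample_bound {x c : ℝ} {L n m q : ℕ} (hq : 1 < q) (hx : 0 ≤ x) (hxL : x ≤ (1 / 2) ^ L)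
    (hc : 2 ≤ L * c) (hm : c * (n * Real.logb 2 q) ≤ m) : x ^ m ≤ 1 / ((q : ℝ) ^ n * (q : ℝ) ^ n) := by
  have hq0 : (0 : ℝ) < q := by exact_mod_cast (by omega : 0 < q)
  have hlog : 0 ≤ Real.logb 2 q := Real.logb_nonneg (by norm_num) (by exact_mod_cast hq.le)
  have h1 : (q : ℝ) ^ n * (q : ℝ) ^ n ≤ 2 ^ (L * m) := by
    have e : (q : ℝ) ^ n * (q : ℝ) ^ n = (2 : ℝ) ^ (Real.logb 2 q * (2 * n)) := by
      rw [Real.rpow_mul (by norm_num), Real.rpow_logb (by norm_num) (by norm_num) hq0, ← pow_add,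
        ← Real.rpow_natCast]
      push_cast; ring_nf
    rw [e, ← Real.rpow_natCast]
    apply Real.rpow_le_rpow_of_exponent_le (by norm_num)
    push_cast
    have h2 : 2 * (n * Real.logb 2 q) ≤ L * c * (n * Real.logb 2 q) :=
      mul_le_mul_of_nonneg_right hc (by positivity)
    have h3 := mul_le_mul_of_nonneg_left hm (Nat.cast_nonneg (α := ℝ) L)
    linarith
  calc x ^ m ≤ ((1 / 2) ^ L) ^ m := pow_le_pow_left₀ hx hxL m
    _ = 1 / 2 ^ (L * m) := by rw [← pow_mul, one_div_pow]
    _ ≤ _ := one_div_le_one_div_of_le (by positivity) h1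

namespace NTCFParams

theorem BV_pos (h : NTCFParams CT n m q BL BV BP) (k : ℕ) : 1 ≤ BV k :=
  (h.BL_pos k).trans (h.BL_lt_BV k).le

theorem BP_pos (h : NTCFParams CT n m q BL BV BP) (k : ℕ) : 1 ≤ BP k :=
  (h.BV_pos k).trans (h.BV_lt_BP k).le

theorem negl_mul (h : NTCFParams CT n m q BL BV BP) {g : ℕ → ℕ} (hg : PolyBounded g) :
    Negl fun k => g k * ((BV k : ℝ) / BP k) := by
  refine negl_of_le 1 hg h.BP_div_BV (fun k => by positivity) (Eventually.of_forall fun k => ?_)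
  rw [one_mul, div_div_eq_mul_div, mul_div_assoc]

variable [hq : ∀ k, Fact (q k).Prime]

theorem one_lt_q (k : ℕ) : 1 < q k := (hq k).out.one_lt

theorem one_le_logb (k : ℕ) : 1 ≤ Real.logb 2 (q k) := by
  rw [Real.le_logb_iff_rpow_le (by norm_num) (by exact_mod_cast (one_lt_q k).le.trans_lt' zero_lt_one)]
  simpa using (hq k).out.two_le

theorem BP_mul_le (hCT : 0 < CT) (h : NTCFParams CT n m q BL BV BP) (k : ℕ) :
    (BP k : ℝ) * (2 * CT * √(m k * n k * Real.logb 2 (q k))) ≤ q k := by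
  have h1 := one_le_logb (q := q) k
  have hm : (1 : ℝ) ≤ m k := by exact_mod_cast h.m_pos k
  have hn : (1 : ℝ) ≤ n k := by exact_mod_cast h.n_pos k
  rw [← le_div_iff₀ (by positivity), h.BP_eq]
  exact Nat.floor_le (by positivity)

theorem logb_le (h : NTCFParams CT n m q BL BV BP) (k : ℕ) :
    Real.logb 2 (q k) ≤ m k * n k * Real.logb 2 (q k) := by
  have h1 := one_le_logb (q := q) k
  have hm : (1 : ℝ) ≤ m k := by exact_mod_cast h.m_pos k
  have hn : (1 : ℝ) ≤ n k := by exact_mod_cast h.n_pos k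
  have := one_le_mul_of_one_le_of_one_le hm hn
  nlinarith

theorem BP_le (hCT : 0 < CT) (h : NTCFParams CT n m q BL BV BP) (k : ℕ) :
    (BP k : ℝ) * (2 * CT) ≤ q k := by
  refine le_trans ?_ (h.BP_mul_le hCT k)
  have : 1 ≤ √(m k * n k * Real.logb 2 (q k)) :=
    Real.one_le_sqrt.2 ((one_le_logb k).trans (h.logb_le k))
  have : 2 * CT ≤ 2 * CT * √(m k * n k * Real.logb 2 (q k)) := le_mul_of_one_le_right (by linarith) this
  gcongr

theorem tendsto_q (hCT : 0 < CT) (h : NTCFParams CT n m q BL BV BP) :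
    Tendsto (fun k => (q k : ℝ)) atTop atTop := by
  have h1 : Tendsto (fun k : ℕ => 2 * CT * (k : ℝ)) atTop atTop :=
    tendsto_natCast_atTop_atTop.const_mul_atTop (by linarith)
  refine tendsto_atTop_mono' _ ?_ h1
  filter_upwards [h.BP_div_BV 1] with k hk
  rw [pow_one] at hk
  refine le_trans ?_ (h.BP_le hCT k)
  rw [mul_comm]
  have hV : (1 : ℝ) ≤ BV k := by exact_mod_cast h.BV_pos k
  have : (BP k : ℝ) / BV k ≤ BP k := div_le_self (by positivity) hV
  have := hk.trans this
  gcongr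

theorem BV_div_q_le (hCT : 0 < CT) (h : NTCFParams CT n m q BL BV BP) (k : ℕ) :
    (BV k : ℝ) / q k ≤ 1 / (2 * CT) * (BV k / BP k) := by
  have hP : (1 : ℝ) ≤ BP k := by exact_mod_cast h.BP_pos k
  calc (BV k : ℝ) / q k ≤ BV k / (BP k * (2 * CT)) := by
        gcongr
        exact h.BP_le hCT k
    _ = _ := by field_simp

theorem tendsto_BV_div_q (hCT : 0 < CT) (h : NTCFParams CT n m q BL BV BP) :
    Tendsto (fun k => (BV k : ℝ) / q k) atTop (𝓝 0) := by
  have h1 := ((h.negl_mul (PolyBounded.const 1)).tendsto).const_mul (1 / (2 * CT))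
  simp only [Nat.cast_one, one_mul, mul_zero] at h1
  exact tendsto_of_tendsto_of_tendsto_of_le_of_le tendsto_const_nhds h1
    (fun k => by positivity) (h.BV_div_q_le hCT)

theorem tendsto_logb (hCT : 0 < CT) (h : NTCFParams CT n m q BL BV BP) :
    Tendsto (fun k => Real.logb 2 (q k)) atTop atTop :=
  (Real.tendsto_logb_atTop (by norm_num)).comp (h.tendsto_q hCT)

/-- The square root in the definition of B_P matters here: it tends to infinity with log q, whereas
C_T alone would only give a bound by a constant, possibly a large one. -/
theorem tendsto_BP_div_q (hCT : 0 < CT) (h : NTCFParams CT n m q BL BV BP) :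
    Tendsto (fun k => (BP k : ℝ) / q k) atTop (𝓝 0) := by
  have h1 : Tendsto (fun k => (2 * CT * √(Real.logb 2 (q k)))⁻¹) atTop (𝓝 0) :=
    tendsto_inv_atTop_zero.comp
      ((Real.tendsto_sqrt_atTop.comp (h.tendsto_logb hCT)).const_mul_atTop (by linarith))
  refine tendsto_of_tendsto_of_tendsto_of_le_of_le tendsto_const_nhds h1
    (fun k => by positivity) fun k => ?_
  have h2 := one_le_logb (q := q) k
  have hq0 : (0 : ℝ) < q k := by exact_mod_cast (one_lt_q (q := q) k).le.trans_lt' zero_lt_one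
  rw [div_le_iff₀ hq0, inv_mul_eq_div, le_div_iff₀ (by positivity)]
  refine le_trans ?_ (h.BP_mul_le hCT k)
  gcongr
  exact h.logb_le k

/-- The lower bound on the number of samples, read backwards: log q is at most a constant times m,
and m is polynomially bounded. -/
theorem clog_polyBounded (h : NTCFParams CT n m q BL BV BP) :
    PolyBounded fun k => Nat.clog 2 (q k) := by
  obtain ⟨c, hc, hm⟩ := h.m_large
  refine PolyBounded.mono (((PolyBounded.const ⌈c⁻¹⌉₊).mul h.m_poly).add (PolyBounded.const 1)) ?_
  filter_upwards [hm] with k hk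
  have h1 := one_le_logb (q := q) k
  have hn : (1 : ℝ) ≤ n k := by exact_mod_cast h.n_pos k
  have h2 : Real.logb 2 (q k) ≤ (⌈c⁻¹⌉₊ * m k : ℕ) := by
    push_cast
    calc Real.logb 2 (q k) ≤ n k * Real.logb 2 (q k) := le_mul_of_one_le_left (by linarith) hn
      _ ≤ c⁻¹ * m k := by rw [inv_mul_eq_div, le_div_iff₀ hc]; linarith
      _ ≤ _ := by gcongr; exact Nat.le_ceil _
  apply Nat.clog_le_of_le_pow
  have hq0 : (0 : ℝ) < q k := by exact_mod_cast (one_lt_q (q := q) k).le.trans_lt' zero_lt_one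
  rw [Real.logb_le_iff_le_rpow (by norm_num) hq0, Real.rpow_natCast] at h2
  have h3 : q k ≤ 2 ^ (⌈c⁻¹⌉₊ * m k) := by exact_mod_cast h2
  exact h3.trans (Nat.pow_le_pow_right (by norm_num) (by omega))

end NTCFParams

end Params

/-! ### Solving LWE with a solver for the dihedral coset problem -/

namespace NTCFParams

variable {CT : ℝ} {n m q BL BV BP : ℕ → ℕ}

theorem loopBound_polyBounded {D : ℕ} {r : ℕ → ℕ} (hn : PolyBounded n) (hm : PolyBounded m)
    (hq : PolyBounded fun k => Nat.clog 2 (q k)) (hr : PolyBounded r) :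
    PolyBounded fun k => loopBound D (n k) (m k) (q k) (r k) := by
  have hsize : ∀ {f : ℕ → ℕ}, PolyBounded f → PolyBounded fun k => (f k).size := fun hf =>
    hf.of_le fun k => Nat.size_le.2 Nat.lt_two_pow_self
  have hc := PolyBounded.const
  have hp : PolyBounded fun k => precision (n k) (q k) := ((hc 2).mul hq).add (hsize hn)
  have ht : PolyBounded fun k => attemptCount (n k) (r k) := ((hsize hr).add (hsize hn)).add (hc 3)
  have hN := (hn.mul hq).add (hc 1)
  have hp1 := hp.add (hc 1)
  exact ((((((((((hc D).add hn).add hm).add (hm.mul hn)).add hN).add hp1).add hr).add ht).add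
    (hN.mul (hp1.mul ((hc 1).add ((hc 2).mul hp1))))).add hq)

variable [hq : ∀ k, Fact (q k).Prime]

-- A constant number of digits per row suffices, because m is of order at least n log q. All three
-- sources of bad points, namely the origin, the cell boundaries and the collisions, are then at
-- most q^n times a constant multiple of m B_V / q.
open Classical in
theorem sum_card_not_goodPoint_le (hCT : 0 < CT) (h : NTCFParams CT n m q BL BV BP) :
    ∃ D C : ℕ, ∀ᶠ k in atTop, D ≤ precision (n k) (q k) ∧
      ∑ A : Matrix (Fin (m k)) (Fin (n k)) (ZMod (q k)),
        ((Finset.univ.filter fun z => ¬ GoodPoint D (BV k) A z).card : ℝ) ≤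
      (q k : ℝ) ^ (m k * n k) *
        ((q k : ℝ) ^ n k * ((C * m k : ℕ) * ((BV k : ℝ) / BP k))) := by
  obtain ⟨c, hc, hm⟩ := h.m_large
  obtain ⟨L, hL⟩ : ∃ L : ℕ, 2 ≤ L * c := by
    obtain ⟨L, hL⟩ := exists_nat_ge (2 / c)
    exact ⟨L, (div_le_iff₀ hc).1 hL⟩
  -- The window for collisions has about 2q/2^D residues plus a multiple of B_V; the two additional
  -- digits bring its share of ℤ_q below 2^(-L).
  set D := L + 2 with hD
  set C := ⌈((2 : ℝ) ^ D * 4 + 6) * (1 / (2 * CT))⌉₊ with hC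
  have hlim := h.tendsto_BV_div_q hCT
  refine ⟨D, C, ?_⟩
  have hev : ∀ᶠ k in atTop, (BV k : ℝ) / q k ≤ (1 / 2) ^ D / 4 :=
    hlim.eventually_le_const (by positivity)
  filter_upwards [hm, hev] with k h1 h2
  have hqk := one_lt_q (q := q) k
  have hq0 : (0 : ℝ) < q k := by exact_mod_cast hqk.le.trans_lt' zero_lt_one
  have hV : (1 : ℝ) ≤ BV k := by exact_mod_cast h.BV_pos k
  have hm1 : (1 : ℝ) ≤ m k := by exact_mod_cast h.m_pos k
  have hDq : (2 : ℝ) ^ D * 4 ≤ q k := by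
    rw [div_le_iff₀ hq0, one_div_pow] at h2
    have h3 := hV.trans h2
    have h4 := mul_le_mul_of_nonneg_left h3 (show (0 : ℝ) ≤ 2 ^ D * 4 by positivity)
    calc _ = (2 : ℝ) ^ D * 4 * 1 := by ring
      _ ≤ _ := h4
      _ = _ := by field_simp
  constructor
  · have h3 : 2 ^ D < q k := by
      have : (2 : ℝ) ^ D < q k := by
        have : (0 : ℝ) < 2 ^ D := by positivity
        linarith
      exact_mod_cast this
    have h4 : D < Nat.clog 2 (q k) := by
      by_contra hcon
      push Not at hcon
      have := (Nat.le_pow_clog (b := 2) (by norm_num) (q k)).trans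
        (Nat.pow_le_pow_right (by norm_num) hcon)
      omega
    unfold precision; omega
  · refine (sum_card_not_goodPoint D (BV k)).trans (mul_le_mul_of_nonneg_left ?_ (by positivity))
    have hW : (2 * ((q k / 2 ^ D + 1 + BV k : ℕ) : ℝ) + 1) / q k ≤ (1 / 2) ^ L := by
      have h3 : ((q k / 2 ^ D : ℕ) : ℝ) ≤ q k * (1 / 2) ^ D := by
        refine Nat.cast_div_le.trans (le_of_eq ?_)
        push_cast
        rw [one_div_pow]; ring
      have h4 : (1 / 2 : ℝ) ^ L = 4 * (1 / 2) ^ D := by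
        rw [hD, pow_add]; ring
      rw [div_le_iff₀ hq0, h4]
      rw [div_le_iff₀ hq0] at h2
      push_cast
      have : 0 ≤ (1 / 2 : ℝ) ^ D * q k := by positivity
      nlinarith
    have hpow := pow_le_of_sample_bound hqk (by positivity) hW hL h1
    set x := (2 * ((q k / 2 ^ D + 1 + BV k : ℕ) : ℝ) + 1) / q k
    have hQ : (q k : ℝ) ≤ (q k : ℝ) ^ n k :=
      le_self_pow₀ (by exact_mod_cast hqk.le) (by have := h.n_pos k; omega)
    set Q := (q k : ℝ) ^ n k with hQd
    have hQ0 : 0 < Q := by positivity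
    have h5 : Q * (Q * x ^ m k) ≤ 1 := by
      rw [le_div_iff₀ (by positivity)] at hpow
      linarith
    -- The origin and the collisions contribute at most 1 each; as Q ≥ q and B_V ≥ 1, this is
    -- absorbed into the boundary term.
    have h6 : (1 : ℝ) ≤ Q * (m k * (BV k / q k)) := by
      have : (1 : ℝ) / q k ≤ m k * (BV k / q k) := by
        calc (1 : ℝ) / q k ≤ BV k / q k := by gcongr
          _ ≤ _ := le_mul_of_one_le_left (by positivity) hm1
      calc (1 : ℝ) = q k * (1 / q k) := by field_simp
        _ ≤ _ := by gcongr
    have h7 : (m k : ℝ) * ((2 ^ D + 1) * (2 * BV k + 2) / q k) ≤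
        (2 ^ D + 1) * 4 * (m k * (BV k / q k)) := by
      calc _ ≤ (m k : ℝ) * ((2 ^ D + 1) * (4 * BV k) / q k) := by
            gcongr; linarith
        _ = _ := by ring
    have h8 : (m k : ℝ) * (BV k / q k) ≤ m k * (1 / (2 * CT) * (BV k / BP k)) := by
      gcongr; exact h.BV_div_q_le hCT k
    calc 1 + Q * ((m k : ℝ) * ((2 ^ D + 1) * (2 * BV k + 2) / q k)) + Q * (Q * x ^ m k)
        ≤ Q * (m k * (BV k / q k)) + Q * ((2 ^ D + 1) * 4 * (m k * (BV k / q k))) +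
          Q * (m k * (BV k / q k)) := by
          exact add_le_add (add_le_add h6 (mul_le_mul_of_nonneg_left h7 hQ0.le)) (h5.trans h6)
      _ = Q * ((2 ^ D * 4 + 6) * (m k * (BV k / q k))) := by ring
      _ ≤ Q * ((2 ^ D * 4 + 6) * (m k * (1 / (2 * CT) * (BV k / BP k)))) := by gcongr
      _ = Q * (((2 ^ D * 4 + 6) * (1 / (2 * CT))) * m k * (BV k / BP k)) := by ring
      _ ≤ _ := by
          push_cast
          gcongr
          exact Nat.le_ceil _

theorem efficientlySolvesLWE (hCT : 0 < CT) (h : NTCFParams CT n m q BL BV BP)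
    (hdcp : EfficientlySolvesDCP n q) : EfficientlySolvesLWE n m q fun k => (BV k : ℝ) := by
  classical
  obtain ⟨P, regs, time, loss, hev⟩ := hdcp
  obtain ⟨D, C, hgood⟩ := h.sum_card_not_goodPoint_le hCT
  obtain ⟨M₀, hM₀⟩ := P.exists_below
  obtain ⟨l, hl⟩ := exists_evalList regs
  -- Private arrays start above everything `P` mentions and above the arrays 0, 1, 2 that hold the
  -- input.
  set M := max M₀ 3 with hMd
  have hP : P.Below M := hM₀ M (le_max_left _ _)
  have hM : 2 < M := lt_of_lt_of_le (by norm_num) (le_max_right _ _)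
  have hN : PolyBounded fun k => n k * Nat.clog 2 (q k) := h.n_poly.mul h.clog_polyBounded
  have hr := hN.eval regs
  have hloop := loopBound_polyBounded (D := D) h.n_poly h.m_poly h.clog_polyBounded hr
  have hc := PolyBounded.const
  have hloop1 := hloop.add (hc 1)
  obtain ⟨time', htime⟩ := ((((hc ((setup M l).weight + (negate M).weight)).mul hloop1).add
    ((hc (registers M D).weight).mul (hloop1.pow (registers M D).depth))).add (hN.eval time)).add (hc 1)
  obtain ⟨loss', hloss⟩ := (hc 2).mul (hN.eval loss)
  have hsmall := (h.negl_mul (hr.mul ((hc C).mul h.m_poly))).tendsto.eventually_le_const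
    (show (0 : ℝ) < 3 / 8 by norm_num)
  refine ⟨solver P M D l, time', loss', ?_⟩
  filter_upwards [hev, hgood, htime, hloss, hsmall] with k h1 h2 h3 h4 h5
  have hqk := one_lt_q (q := q) k
  constructor
  · intro A t
    -- For the time bound any genuine input of `P` will do, so secret and offsets are taken to be 0.
    have := solver_haltsWithin (D := D) hM hP hqk (hl _) (h1 0 0).1 A t (Finsupp.single ∅ 1)
    exact fun β hβ => (this β hβ).trans h3
  · set N := n k * Nat.clog 2 (q k)
    have hpos : 0 < loss.eval N := by
      by_contra hcon
      have h0 : loss.eval N = 0 := by omega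
      have := (h1 0 0).2
      rw [h0] at this
      norm_num at this
    have hpos' : (0 : ℝ) < (loss.eval N : ℕ) := by exact_mod_cast hpos
    have := le_lweSuccessProb (m := m k) (B := BV k) (h.n_pos k) h2.1 hM hP (hl N)
      (p₀ := 1 / (loss.eval N : ℕ)) (by positivity)
      (fun s x => (div_le_iff₀' hpos').2 (h1 s x).2) h2.2 (by
        refine le_trans (le_of_eq ?_) h5
        push_cast; ring)
    calc (1 : ℝ) = (2 * (loss.eval N : ℕ)) * (1 / (loss.eval N : ℕ) / 2) := by field_simp
      _ ≤ (loss'.eval k : ℕ) * (1 / (loss.eval N : ℕ) / 2) := by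
          gcongr
          exact_mod_cast h4
      _ ≤ _ := by gcongr

end NTCFParams

/-! ### Truncated Gaussians and small shifts -/

section Shift

variable {m q : ℕ} [NeZero q] {P V : ℕ}

theorem valMinAbs_add_of_lt {x e : ZMod q} (hx : |x.valMinAbs| ≤ P) (he : |e.valMinAbs| ≤ V)
    (h : 2 * (P + V) < q) : (x + e).valMinAbs = x.valMinAbs + e.valMinAbs := by
  rw [ZMod.valMinAbs_spec]
  rw [abs_le] at hx he
  refine ⟨by simp, ?_, ?_⟩ <;> omega

theorem gaussDensity_of_le {x : ZMod q} (hx : |x.valMinAbs| ≤ P) :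
    gaussDensity q (P : ℝ) x = Real.exp (-Real.pi * (x.valMinAbs : ℝ) ^ 2 / (P : ℝ) ^ 2) /
      ∑ z : ZMod q with |(z.valMinAbs : ℝ)| ≤ (P : ℝ),
        Real.exp (-Real.pi * (z.valMinAbs : ℝ) ^ 2 / (P : ℝ) ^ 2) := by
  unfold gaussDensity
  rw [if_pos (by exact_mod_cast hx)]

theorem gaussDensity_pos {x : ZMod q} (hx : |x.valMinAbs| ≤ P) : 0 < gaussDensity q (P : ℝ) x := by
  rw [gaussDensity_of_le hx]
  exact div_pos (Real.exp_pos _) (gaussNorm_pos (Nat.cast_nonneg P))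

/-- The exponents differ by π(a² - b²)/P², and |a² - b²| = |a - b||a + b| ≤ 2VP inside the support.
-/
theorem gaussDensity_le_exp_mul (hP : 1 ≤ P) {x y : ZMod q} (hx : |x.valMinAbs| ≤ P)
    (hy : |y.valMinAbs| ≤ P) (h : |y.valMinAbs - x.valMinAbs| ≤ V) :
    gaussDensity q (P : ℝ) y ≤ Real.exp (2 * Real.pi * (V / P)) * gaussDensity q (P : ℝ) x := by
  rw [gaussDensity_of_le hx, gaussDensity_of_le hy, mul_div_assoc', ← Real.exp_add]
  refine div_le_div_of_nonneg_right (Real.exp_le_exp.2 ?_) (gaussNorm_pos (Nat.cast_nonneg P)).le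
  have hP0 : (0 : ℝ) < P := by exact_mod_cast hP
  have hx' : |(x.valMinAbs : ℝ)| ≤ P := by exact_mod_cast hx
  have hy' : |(y.valMinAbs : ℝ)| ≤ P := by exact_mod_cast hy
  have h' : |(y.valMinAbs : ℝ) - x.valMinAbs| ≤ V := by exact_mod_cast h
  set a := (x.valMinAbs : ℝ)
  set b := (y.valMinAbs : ℝ)
  have key : a ^ 2 - b ^ 2 ≤ 2 * V * P := by
    have h1 : |a + b| ≤ 2 * P := (abs_add_le a b).trans (by linarith)
    calc a ^ 2 - b ^ 2 ≤ |a ^ 2 - b ^ 2| := le_abs_self _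
      _ = |b - a| * |a + b| := by rw [← abs_mul, ← abs_neg]; congr 1; ring
      _ ≤ V * (2 * P) := mul_le_mul h' h1 (abs_nonneg _) (Nat.cast_nonneg V)
      _ = _ := by ring
  have e1 : 2 * Real.pi * ((V : ℝ) / P) + -Real.pi * a ^ 2 / (P : ℝ) ^ 2 - -Real.pi * b ^ 2 / (P : ℝ) ^ 2 =
      Real.pi * (2 * V * P - (a ^ 2 - b ^ 2)) / (P : ℝ) ^ 2 := by
    field_simp
    ring
  have : 0 ≤ Real.pi * (2 * V * P - (a ^ 2 - b ^ 2)) / (P : ℝ) ^ 2 :=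
    div_nonneg (mul_nonneg Real.pi_pos.le (by linarith)) (by positivity)
  linarith

theorem gaussVecDensity_pos {x : Fin m → ZMod q} (hx : ∀ i, |(x i).valMinAbs| ≤ P) :
    0 < gaussVecDensity (P : ℝ) x :=
  Finset.prod_pos fun i _ => gaussDensity_pos (hx i)

theorem gaussVecDensity_le_exp_mul (hP : 1 ≤ P) {x y : Fin m → ZMod q}
    (hx : ∀ i, |(x i).valMinAbs| ≤ P) (hy : ∀ i, |(y i).valMinAbs| ≤ P)
    (h : ∀ i, |(y i).valMinAbs - (x i).valMinAbs| ≤ V) :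
    gaussVecDensity (P : ℝ) y ≤
      Real.exp (2 * (Real.pi * (m * (V / P)))) * gaussVecDensity (P : ℝ) x := by
  unfold gaussVecDensity
  calc _ ≤ ∏ i, Real.exp (2 * Real.pi * (V / P)) * gaussDensity q (P : ℝ) (x i) :=
        Finset.prod_le_prod (fun i _ => gaussDensity_nonneg _)
          fun i _ => gaussDensity_le_exp_mul hP (hx i) (hy i) (h i)
    _ = _ := by
        rw [Finset.prod_mul_distrib, Finset.prod_const, ← Real.exp_nat_mul]
        simp only [Finset.card_univ, Fintype.card_fin]
        congr 2
        ring

/-- At least P residues lie in the support, and each has weight at least e^(-π). This bounds the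
density by e^π / P. -/
theorem le_gaussNorm (hP : 1 ≤ P) (hq : 2 * P < q) :
    (P : ℝ) * Real.exp (-Real.pi) ≤ ∑ z : ZMod q with |(z.valMinAbs : ℝ)| ≤ (P : ℝ),
        Real.exp (-Real.pi * (z.valMinAbs : ℝ) ^ 2 / (P : ℝ) ^ 2) := by
  have hP0 : (0 : ℝ) < P := by exact_mod_cast hP
  have hval : ∀ j ∈ Finset.range P, ((j : ℕ) : ZMod q).valMinAbs = j := by
    intro j hj
    rw [Finset.mem_range] at hj
    exact ZMod.valMinAbs_natCast_of_le_half (by omega)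
  have hcard : P ≤ (Finset.univ.filter fun z : ZMod q => |(z.valMinAbs : ℝ)| ≤ (P : ℝ)).card := by
    calc P = (Finset.range P).card := by simp
      _ ≤ _ := by
        refine Finset.card_le_card_of_injOn (fun j => ((j : ℕ) : ZMod q)) ?_ ?_
        · intro j hj
          have h1 := hval j hj
          simp only [Finset.coe_range, Set.mem_Iio] at hj
          simp only [Finset.coe_filter, Finset.mem_univ, true_and, Set.mem_ofPred_eq, h1]
          simp only [Int.cast_natCast, Nat.abs_cast, Nat.cast_le]
          exact hj.le
        · intro j hj j' hj' h
          have h1 := hval j hj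
          have h2 := hval j' hj'
          simp only at h
          rw [h, h2] at h1
          exact_mod_cast h1.symm
  calc (P : ℝ) * Real.exp (-Real.pi) ≤
      (Finset.univ.filter fun z : ZMod q => |(z.valMinAbs : ℝ)| ≤ (P : ℝ)).card • Real.exp (-Real.pi) := by
        rw [nsmul_eq_mul]; gcongr
    _ ≤ _ := by
        refine Finset.card_nsmul_le_sum _ _ _ fun z hz => Real.exp_le_exp.2 ?_
        have h1 := (Finset.mem_filter.1 hz).2
        have h2 : (z.valMinAbs : ℝ) ^ 2 ≤ (P : ℝ) ^ 2 := sq_le_sq.2 (by simpa using h1)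
        rw [le_div_iff₀ (by positivity)]
        nlinarith [Real.pi_pos]

theorem gaussDensity_le (hP : 1 ≤ P) (hq : 2 * P < q) (x : ZMod q) :
    gaussDensity q (P : ℝ) x ≤ Real.exp Real.pi / P := by
  have hP0 : (0 : ℝ) < P := by exact_mod_cast hP
  unfold gaussDensity
  split_ifs
  · calc _ ≤ 1 / ((P : ℝ) * Real.exp (-Real.pi)) := by
          gcongr
          · rw [Real.exp_le_one_iff, neg_mul, neg_div]
            have := Real.pi_pos
            have : 0 ≤ Real.pi * (x.valMinAbs : ℝ) ^ 2 / (P : ℝ) ^ 2 := by positivity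
            linarith
          · exact le_gaussNorm hP hq
      _ = _ := by rw [Real.exp_neg]; field_simp
  · positivity

theorem card_shell_le (hVP : V ≤ P) :
    (Finset.univ.filter fun x : ZMod q => |x.valMinAbs| ≤ (P : ℤ) ∧ (P : ℤ) < |x.valMinAbs| + V).card ≤
      2 * V := by
  calc _ ≤ (Finset.Ioc ((P : ℤ) - V) P ∪ Finset.Ico (-(P : ℤ)) (-((P : ℤ) - V))).card := by
        refine Finset.card_le_card_of_injOn (fun x => x.valMinAbs) ?_ ?_
        · intro x hx
          simp only [Finset.coe_filter, Finset.mem_univ, true_and, Set.mem_ofPred_eq] at hx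
          simp only [Finset.coe_union, Finset.coe_Ioc, Finset.coe_Ico, Set.mem_union, Set.mem_Ioc,
            Set.mem_Ico]
          rcases abs_cases x.valMinAbs with ⟨h, _⟩ | ⟨h, _⟩ <;> rw [h] at hx <;> omega
        · intro x _ y _ h
          exact ZMod.injective_valMinAbs h
    _ ≤ _ := by
        refine (Finset.card_union_le _ _).trans ?_
        rw [Int.card_Ioc, Int.card_Ico]
        omega

/-- The points that a shift by e pushes out of the support lie in a shell of width V at its ends. It
has at most 2V points, each of density at most e^π / P. -/
theorem sum_gaussDensity_shift (hP : 1 ≤ P) (hVP : V ≤ P) (hq : 2 * P < q) {e : ZMod q}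
    (he : |e.valMinAbs| ≤ V) :
    1 - 2 * V * (Real.exp Real.pi / P) ≤ ∑ x : ZMod q,
      if |x.valMinAbs| ≤ (P : ℤ) ∧ |(x + e).valMinAbs| ≤ (P : ℤ) then gaussDensity q (P : ℝ) x else 0 := by
  rw [← sum_gaussDensity (q := q) (Nat.cast_nonneg P), sub_le_iff_le_add, ← sub_le_iff_le_add',
    ← Finset.sum_sub_distrib]
  calc _ ≤ ∑ x : ZMod q, if |x.valMinAbs| ≤ (P : ℤ) ∧ (P : ℤ) < |x.valMinAbs| + V then
        Real.exp Real.pi / P else 0 := by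
        refine Finset.sum_le_sum fun x _ => ?_
        have hpos : 0 ≤ Real.exp Real.pi / P := by positivity
        by_cases hx : |x.valMinAbs| ≤ (P : ℤ)
        · by_cases hxe : |(x + e).valMinAbs| ≤ (P : ℤ)
          · rw [if_pos ⟨hx, hxe⟩, sub_self]
            split_ifs <;> positivity
          · rw [if_neg (fun h => hxe h.2), if_pos, sub_zero]
            · exact gaussDensity_le hP hq x
            · refine ⟨hx, ?_⟩
              have h1 := ZMod.natAbs_valMinAbs_add_le x e
              push Not at hxe
              have h2 : |(x + e).valMinAbs| ≤ |x.valMinAbs + e.valMinAbs| := by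
                rw [Int.abs_eq_natAbs, Int.abs_eq_natAbs]; exact_mod_cast h1
              have := abs_add_le x.valMinAbs e.valMinAbs
              linarith
        · have h0 : gaussDensity q (P : ℝ) x = 0 := by
            unfold gaussDensity
            exact if_neg fun h => hx (by exact_mod_cast h)
          rw [if_neg (fun h => hx h.1), h0, sub_zero]
          split_ifs <;> positivity
    _ ≤ 2 * V * (Real.exp Real.pi / P) := by
        rw [← Finset.sum_filter, Finset.sum_const, nsmul_eq_mul]
        gcongr
        exact_mod_cast card_shell_le hVP

/-- The sum factors over the coordinates, and Bernoulli's inequality linearizes the product. -/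
theorem sum_gaussVecDensity_shift (hP : 1 ≤ P) (hVP : V ≤ P) (hq : 2 * P < q) {e : Fin m → ZMod q}
    (he : ∀ i, |(e i).valMinAbs| ≤ V) :
    1 - m * (2 * V * (Real.exp Real.pi / P)) ≤ ∑ x : Fin m → ZMod q,
      if (∀ i, |(x i).valMinAbs| ≤ (P : ℤ)) ∧ ∀ i, |((x + e) i).valMinAbs| ≤ (P : ℤ) then
        gaussVecDensity (P : ℝ) x else 0 := by
  set η := 2 * V * (Real.exp Real.pi / P) with hη
  have hη0 : 0 ≤ η := by positivity
  by_cases h1 : η ≤ 1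
  · have hprod : (∑ x : Fin m → ZMod q,
        if (∀ i, |(x i).valMinAbs| ≤ (P : ℤ)) ∧ ∀ i, |((x + e) i).valMinAbs| ≤ (P : ℤ) then
          gaussVecDensity (P : ℝ) x else 0) = ∏ i, ∑ x : ZMod q,
        if |x.valMinAbs| ≤ (P : ℤ) ∧ |(x + e i).valMinAbs| ≤ (P : ℤ) then
          gaussDensity q (P : ℝ) x else 0 := by
      rw [Finset.prod_univ_sum, Fintype.piFinset_univ]
      refine Finset.sum_congr rfl fun x _ => ?_
      rw [Finset.prod_ite_zero]
      simp only [Finset.mem_univ, true_imp_iff, forall_and, Pi.add_apply]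
      rfl
    rw [hprod]
    calc 1 - m * η ≤ (1 - η) ^ m := by
          have := one_add_mul_le_pow (a := -η) (by linarith) m
          rw [← sub_eq_add_neg] at this
          linarith
      _ = ∏ _i : Fin m, (1 - η) := by simp
      _ ≤ _ := Finset.prod_le_prod (fun _ _ => by linarith)
          fun i _ => sum_gaussDensity_shift hP hVP hq (he i)
  -- If the loss per coordinate exceeds 1, the left side is negative, except for m = 0, where both
  -- sides are 1.
  · rcases Nat.eq_zero_or_pos m with rfl | hm
    · simp [gaussVecDensity]
    · have : (1 : ℝ) ≤ m := by exact_mod_cast hm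
      refine le_trans (b := 0) (by nlinarith) (Finset.sum_nonneg fun x _ => ?_)
      split_ifs
      · exact gaussVecDensity_nonneg x
      · exact le_rfl

end Shift

/-! ### States supported on two points -/

section TwoPoints

variable {ι : Type*} [Fintype ι] [DecidableEq ι]

theorem norm_sq_of_support_pair {φ : EuclideanSpace ℂ ι} {p p' : ι} (hp : p ≠ p')
    (h : ∀ i, i ≠ p → i ≠ p' → φ i = 0) : ‖φ‖ ^ 2 = ‖φ p‖ ^ 2 + ‖φ p'‖ ^ 2 := by
  rw [EuclideanSpace.norm_sq_eq, ← Finset.sum_pair (f := fun i => ‖φ i‖ ^ 2) hp]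
  refine (Finset.sum_subset (Finset.subset_univ _) fun i _ hi => ?_).symm
  simp only [Finset.mem_insert, Finset.mem_singleton, not_or] at hi
  simp [h i hi.1 hi.2]

/-- After normalization the amplitudes a, b > 0 satisfy a² + b² = 1 and |a - b| ≤ τ. The squared
distance to the balanced state is 2 - √2(a + b), and (a + b)² = 2 - (a - b)² bounds it by (a - b)².
-/
theorem norm_normalize_sub_le {φ : EuclideanSpace ℂ ι} {p p' : ι} (hp : p ≠ p')
    (h : ∀ i, i ≠ p → i ≠ p' → φ i = 0) {α β : ℝ} (hα : 0 < α) (hβ : 0 < β) (hφ : φ p = (α : ℂ))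
    (hφ' : φ p' = (β : ℂ)) {τ : ℝ} (hτ : 0 ≤ τ) (h1 : α ≤ Real.exp τ * β) (h2 : β ≤ Real.exp τ * α) :
    ‖((‖φ‖ : ℂ)⁻¹) • φ - (((√2 : ℝ) : ℂ)⁻¹) •
      (EuclideanSpace.single p (1 : ℂ) + EuclideanSpace.single p' (1 : ℂ))‖ ≤ τ := by
  set N := ‖φ‖ with hN
  have hNsq : N ^ 2 = α ^ 2 + β ^ 2 := by
    rw [hN, norm_sq_of_support_pair hp h, hφ, hφ']
    simp
  have hN0 : 0 < N := by
    rcases (norm_nonneg φ).lt_or_eq with h0 | h0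
    · exact h0
    · rw [← hN] at h0
      rw [← h0] at hNsq
      nlinarith
  have hαN : α ≤ N := by nlinarith
  have hβN : β ≤ N := by nlinarith
  -- Here a - b ≤ (1 - e^(-τ))a ≤ τa ≤ τN.
  have hdiff : ∀ {a b : ℝ}, 0 < a → a ≤ N → a ≤ Real.exp τ * b → a - b ≤ τ * N := by
    intro a b ha haN hab
    have h3 : Real.exp (-τ) * a ≤ b := by
      rw [Real.exp_neg, inv_mul_le_iff₀ (Real.exp_pos τ)]; exact hab
    have h4 := Real.add_one_le_exp (-τ)
    nlinarith
  have hab : |α - β| ≤ τ * N := abs_le.2 ⟨by linarith [hdiff hβ hβN h2], hdiff hα hαN h1⟩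
  refine abs_le_of_sq_le_sq' ?_ hτ |>.2
  rw [norm_sq_of_support_pair hp]
  · have e1 : ((N : ℂ)⁻¹ • φ - (((√2 : ℝ) : ℂ)⁻¹) •
        (EuclideanSpace.single p (1 : ℂ) + EuclideanSpace.single p' (1 : ℂ))) p =
        ((α / N - 1 / √2 : ℝ) : ℂ) := by
      simp [hφ, hp]; ring
    have e2 : ((N : ℂ)⁻¹ • φ - (((√2 : ℝ) : ℂ)⁻¹) •
        (EuclideanSpace.single p (1 : ℂ) + EuclideanSpace.single p' (1 : ℂ))) p' =
        ((β / N - 1 / √2 : ℝ) : ℂ) := by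
      simp [hφ', hp.symm]; ring
    rw [e1, e2, Complex.norm_real, Complex.norm_real, Real.norm_eq_abs, Real.norm_eq_abs, sq_abs, sq_abs]
    have hA : (α / N) ^ 2 + (β / N) ^ 2 = 1 := by
      rw [div_pow, div_pow, ← add_div, hNsq, div_self]
      rw [← hNsq]; positivity
    have hAB : (α / N - β / N) ^ 2 ≤ τ ^ 2 := by
      rw [← sub_div, div_pow, div_le_iff₀ (by positivity), ← mul_pow]
      exact sq_le_sq.2 (hab.trans (le_abs_self _))
    have hA0 : 0 < α / N := by positivity
    have hB0 : 0 < β / N := by positivity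
    set a := α / N
    set b := β / N
    have hs : (√2 : ℝ) ^ 2 = 2 := Real.sq_sqrt (by norm_num)
    have hs0 : (0 : ℝ) < √2 := by positivity
    have hinv : 1 / √2 = √2 / 2 := by
      rw [div_eq_div_iff hs0.ne' (by norm_num)]; linarith [hs]
    rw [hinv]
    have hS : a + b ≤ √2 := Real.le_sqrt_of_sq_le (by nlinarith [sq_nonneg (a - b)])
    nlinarith
  · intro i hi hi'
    simp [h i hi hi', hi, hi']

end TwoPoints

/-! ### The state left by measuring the image register -/

theorem abs_valMinAbs_neg {q : ℕ} (x : ZMod q) : |(-x).valMinAbs| = |x.valMinAbs| := by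
  rw [Int.abs_eq_natAbs, Int.abs_eq_natAbs, ZMod.natAbs_valMinAbs_neg]

section Measure

variable {n m q : ℕ} [NeZero q] {P V : ℕ}

theorem norm_sq_sampSlice (B : ℝ) (A : Matrix (Fin m) (Fin n) (ZMod q)) (t y : Fin m → ZMod q) :
    ‖sampSlice B A t y‖ ^ 2 = ∑ bx : Bool × (Fin n → ZMod q),
      ntcfDensity B A t bx.1 bx.2 y / (2 * (q : ℝ) ^ n) := by
  rw [EuclideanSpace.norm_sq_eq]
  refine Finset.sum_congr rfl fun bx _ => ?_
  simp only [sampSlice, Complex.norm_real, Real.norm_eq_abs, sq_abs]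
  exact Real.sq_sqrt (div_nonneg (gaussVecDensity_nonneg _) (by positivity))

/-- For a pair (b, x) with nonzero amplitude, A(z - (x + bs)) is a combination of two noise vectors
of size at most P and an error of size at most V ≤ P, so injectivity up to 3P gives z = x + bs. The
two remaining amplitudes are square roots of densities at v and v - e; the root halves the exponent
2πmV/P. -/
theorem exists_norm_sampSlice_sub_le (hP : 1 ≤ P) (hVP : V ≤ P) (hq : 2 * (P + V) < q)
    {A : Matrix (Fin m) (Fin n) (ZMod q)} (s : Fin n → ZMod q) {e y : Fin m → ZMod q}
    (he : ∀ i, |(e i).valMinAbs| ≤ V)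
    (hinj : ∀ z, (∀ i, Near q (3 * P) (A.mulVec z i)) → z = 0) {z : Fin n → ZMod q}
    (hv : ∀ i, |((y - A.mulVec z) i).valMinAbs| ≤ P)
    (hw : ∀ i, |((y - A.mulVec z - e) i).valMinAbs| ≤ P) {ε : ℝ}
    (hε : Real.pi * (m * (V / P)) ≤ ε) :
    ∃ x, ‖((‖sampSlice (P : ℝ) A (A.mulVec s + e) y‖ : ℂ)⁻¹) • sampSlice (P : ℝ) A (A.mulVec s + e) y -
      dcpState (-s) x‖ ≤ ε := by
  refine ⟨z, le_trans ?_ hε⟩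
  have hq0 : (0 : ℝ) < q := by exact_mod_cast Nat.pos_of_neZero q
  set v := y - A.mulVec z with hvd
  set w := v - e with hwd
  set c : ℝ := 2 * (q : ℝ) ^ n with hc
  have hc0 : 0 < c := by positivity
  have harg : ∀ (b : Bool) (x : Fin n → ZMod q),
      y - A.mulVec x - (if b then A.mulVec s + e else 0) =
        v + A.mulVec (z - (x + if b then s else 0)) - if b then e else 0 := by
    intro b x
    cases b <;> simp [hvd, Matrix.mulVec_sub, Matrix.mulVec_add]
    abel
  have hslice : ∀ b x, sampSlice (P : ℝ) A (A.mulVec s + e) y (b, x) =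
      ((√(gaussVecDensity (P : ℝ) (v + A.mulVec (z - (x + if b then s else 0)) - if b then e else 0) /
        c) : ℝ) : ℂ) := by
    intro b x
    rw [← harg]
    rfl
  have hshift : ∀ i, |(w i).valMinAbs - (v i).valMinAbs| ≤ V := by
    intro i
    have h1 : w i = v i + -e i := by rw [hwd, Pi.sub_apply, sub_eq_add_neg]
    have h2 : |(-e i).valMinAbs| ≤ V := by rw [abs_valMinAbs_neg]; exact he i
    rw [h1, valMinAbs_add_of_lt (hv i) h2 hq, add_sub_cancel_left]
    exact h2
  have hsqrt : ∀ {a b τ : ℝ}, a ≤ Real.exp (2 * τ) * b → √(a / c) ≤ Real.exp τ * √(b / c) := by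
    intro a b τ h
    rw [← Real.sqrt_sq (Real.exp_pos τ).le, ← Real.sqrt_mul (sq_nonneg _)]
    apply Real.sqrt_le_sqrt
    rw [← Real.exp_nat_mul, mul_div_assoc']
    gcongr
    exact_mod_cast h
  refine norm_normalize_sub_le (p := (false, z)) (p' := (true, z + -s)) (by simp) ?_
    (α := √(gaussVecDensity (P : ℝ) v / c)) (β := √(gaussVecDensity (P : ℝ) w / c))
    (Real.sqrt_pos.2 (div_pos (gaussVecDensity_pos hv) hc0))
    (Real.sqrt_pos.2 (div_pos (gaussVecDensity_pos hw) hc0)) ?_ ?_ (by positivity)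
    (hsqrt (gaussVecDensity_le_exp_mul hP hw hv fun i => by rw [abs_sub_comm]; exact hshift i))
    (hsqrt (gaussVecDensity_le_exp_mul hP hv hw hshift))
  · rintro ⟨b, x⟩ h1 h2
    by_contra h3
    rw [hslice] at h3
    set u := v + A.mulVec (z - (x + if b then s else 0)) - if b then e else 0 with hu
    have h4 : gaussVecDensity (P : ℝ) u ≠ 0 := fun h => h3 (by simp [h])
    have h5 : z - (x + if b then s else 0) = 0 := by
      refine hinj _ fun i => ⟨(u i).valMinAbs + (if b then (e i).valMinAbs else 0) -
        (v i).valMinAbs, ?_, ?_⟩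
      · have g1 : |(u i).valMinAbs| ≤ (P : ℤ) := by
          exact_mod_cast abs_le_of_gaussVecDensity_ne_zero h4 i
        have g2 : |(if b then (e i).valMinAbs else 0 : ℤ)| ≤ P := by
          split_ifs
          · exact (he i).trans (by exact_mod_cast hVP)
          · simp
        have g3 := hv i
        rw [abs_le] at *
        push_cast
        constructor <;> linarith [g1.1, g1.2, g2.1, g2.2, g3.1, g3.2]
      · have g1 : ((if b then (e i).valMinAbs else 0 : ℤ) : ZMod q) = (if b then e else 0) i := by
          cases b <;> simp
        push_cast at g1 ⊢
        rw [g1, hu]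
        simp
    have h6 : z = x + if b then s else 0 := sub_eq_zero.1 h5
    cases b
    · exact h1 (by simp [h6])
    · exact h2 (by simp [h6])
  · rw [hslice]; simp
  · rw [hslice]; simp [hwd]

/-- The measured y is distributed as the image of a uniform pair (b, x) plus noise. For each fixed
pair the noise is such that y also lies in the support of the partner, up to the mass of the
boundary shell, and every such y leaves a state close to a coset state. -/
theorem le_sampCosetProb (hP : 1 ≤ P) (hVP : V ≤ P) (hq : 2 * (P + V) < q)
    {A : Matrix (Fin m) (Fin n) (ZMod q)} (s : Fin n → ZMod q) {e : Fin m → ZMod q}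
    (he : ∀ i, |(e i).valMinAbs| ≤ V)
    (hinj : ∀ z, (∀ i, Near q (3 * P) (A.mulVec z i)) → z = 0) {ε : ℝ}
    (hε : Real.pi * (m * (V / P)) ≤ ε) :
    1 - m * (2 * V * (Real.exp Real.pi / P)) ≤ sampCosetProb (P : ℝ) A (A.mulVec s + e) s ε := by
  have hq0 : (0 : ℝ) < q := by exact_mod_cast Nat.pos_of_neZero q
  set c : ℝ := 2 * (q : ℝ) ^ n with hc
  have hc0 : 0 < c := by positivity
  set η := m * (2 * V * (Real.exp Real.pi / P)) with hη
  set t := A.mulVec s + e with ht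
  let Box : (Fin m → ZMod q) → Prop := fun v => ∀ i, |(v i).valMinAbs| ≤ (P : ℤ)
  -- The same y seen from the partner has noise v - e if b = 0 and v + e if b = 1.
  let σ : Bool → Fin m → ZMod q := fun b => if b then e else -e
  have hσ : ∀ b i, |(σ b i).valMinAbs| ≤ V := by
    rintro (_ | _) i
    · show |(-e i).valMinAbs| ≤ V
      rw [abs_valMinAbs_neg]; exact he i
    · exact he i
  have hite : ∀ (p : Prop) [Decidable p] {a : ℝ}, 0 ≤ a → (if p then a else 0) ≤ a :=
    fun p _ a ha => by split_ifs <;> simp [ha]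
  classical
  calc 1 - η = ∑ bx : Bool × (Fin n → ZMod q), (1 - η) / c := by
        rw [Finset.sum_const, nsmul_eq_mul]
        simp only [Finset.card_univ, Fintype.card_prod, Fintype.card_bool, Fintype.card_fun,
          ZMod.card, Fintype.card_fin]
        push_cast
        rw [← hc]; field_simp
    _ ≤ ∑ bx : Bool × (Fin n → ZMod q), (∑ v : Fin m → ZMod q,
        if Box v ∧ Box (v + σ bx.1) then gaussVecDensity (P : ℝ) v else 0) / c :=
        Finset.sum_le_sum fun bx _ => div_le_div_of_nonneg_right
          (sum_gaussVecDensity_shift hP hVP (by omega) (hσ bx.1)) hc0.le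
    _ = ∑ bx : Bool × (Fin n → ZMod q), ∑ y : Fin m → ZMod q,
        (if Box (y - A.mulVec bx.2 - (if bx.1 then t else 0)) ∧
          Box (y - A.mulVec bx.2 - (if bx.1 then t else 0) + σ bx.1) then
          ntcfDensity (P : ℝ) A t bx.1 bx.2 y else 0) / c := by
        refine Finset.sum_congr rfl fun bx _ => ?_
        rw [← Finset.sum_div]
        congr 1
        symm
        -- Substitution of the noise v = y - Ax - bt for y.
        refine Fintype.sum_equiv
          (Equiv.subRight (A.mulVec bx.2 + (if bx.1 then t else 0))) _ _ fun y => ?_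
        simp only [Equiv.subRight_apply, ntcfDensity, sub_sub]
    _ = ∑ y : Fin m → ZMod q, ∑ bx : Bool × (Fin n → ZMod q),
        (if Box (y - A.mulVec bx.2 - (if bx.1 then t else 0)) ∧
          Box (y - A.mulVec bx.2 - (if bx.1 then t else 0) + σ bx.1) then
          ntcfDensity (P : ℝ) A t bx.1 bx.2 y else 0) / c := Finset.sum_comm
    _ ≤ _ := by
        unfold sampCosetProb
        refine Finset.sum_le_sum fun y _ => ?_
        by_cases hy : ∃ x, ‖((‖sampSlice (P : ℝ) A t y‖ : ℂ)⁻¹) • sampSlice (P : ℝ) A t y -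
            dcpState (-s) x‖ ≤ ε
        · rw [if_pos hy, norm_sq_sampSlice]
          refine Finset.sum_le_sum fun bx _ => div_le_div_of_nonneg_right
            (hite _ (gaussVecDensity_nonneg _)) hc0.le
        · rw [if_neg hy]
          refine le_of_eq (Finset.sum_eq_zero fun bx _ => ?_)
          rw [if_neg, zero_div]
          rintro ⟨h1, h2⟩
          apply hy
          obtain ⟨b, x⟩ := bx
          cases b
          · refine exists_norm_sampSlice_sub_le hP hVP hq s he hinj (z := x) ?_ ?_ hε
            · simpa [Box] using h1
            · simpa [Box, σ, sub_eq_add_neg] using h2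
          · have e1 : y - A.mulVec (x + s) - e = y - A.mulVec x - t := by
              rw [Matrix.mulVec_add, ht]; abel
            have e2 : y - A.mulVec (x + s) = y - A.mulVec x - t + e := by
              rw [← e1]; abel
            refine exists_norm_sampSlice_sub_le hP hVP hq s he hinj (z := x + s) ?_ ?_ hε
            · rw [e2]; simpa [Box, σ] using h2
            · rw [e1]; simpa [Box] using h1

theorem sampCosetProb_nonneg (B : ℝ) (A : Matrix (Fin m) (Fin n) (ZMod q)) (t : Fin m → ZMod q)
    (s : Fin n → ZMod q) (ε : ℝ) : 0 ≤ sampCosetProb B A t s ε :=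
  Finset.sum_nonneg fun y _ => by split_ifs <;> positivity

theorem lweCosetProb_nonneg (BV BP : ℝ) (s : Fin n → ZMod q) (ε : ℝ) :
    0 ≤ lweCosetProb (m := m) BV BP s ε :=
  Finset.sum_nonneg fun A _ => Finset.sum_nonneg fun e _ =>
    mul_nonneg (mul_nonneg (by positivity) (gaussVecDensity_nonneg e)) (sampCosetProb_nonneg _ _ _ _ _)

end Measure

/-! ### Averaging over the keys -/

section Average

variable {n m q : ℕ} {P V : ℕ}

open Classical in
theorem card_not_injective [Fact q.Prime] (W : ℕ) :
    ((Finset.univ.filter fun A : Matrix (Fin m) (Fin n) (ZMod q) =>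
      ¬ ∀ z, (∀ i, Near q W (A.mulVec z i)) → z = 0).card : ℝ) ≤
      (q : ℝ) ^ n * ((q : ℝ) ^ (m * n) * ((2 * W + 1) / q) ^ m) := by
  have h1 : (Finset.univ.filter fun A : Matrix (Fin m) (Fin n) (ZMod q) =>
      ¬ ∀ z, (∀ i, Near q W (A.mulVec z i)) → z = 0) =
      (Finset.univ.filter (· ≠ 0)).biUnion fun z =>
        Finset.univ.filter fun A : Matrix (Fin m) (Fin n) (ZMod q) =>
          ∀ i, Near q W (A.mulVec z i) := by
    ext A; simp [and_comm]
  rw [h1]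
  calc _ ≤ ∑ z ∈ Finset.univ.filter (· ≠ 0),
        ((Finset.univ.filter fun A : Matrix (Fin m) (Fin n) (ZMod q) =>
          ∀ i, Near q W (A.mulVec z i)).card : ℝ) := by
        exact_mod_cast Finset.card_biUnion_le
    _ ≤ ∑ z ∈ Finset.univ.filter (fun z : Fin n → ZMod q => z ≠ 0),
        (q : ℝ) ^ (m * n) * ((2 * W + 1) / q) ^ m :=
        Finset.sum_le_sum fun z hz => card_near_mulVec (Finset.mem_filter.1 hz).2 W
    _ ≤ _ := by
        rw [Finset.sum_const, nsmul_eq_mul]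
        gcongr
        have := Finset.card_le_univ (Finset.univ.filter fun z : Fin n → ZMod q => z ≠ 0)
        simp only [Fintype.card_fun, ZMod.card, Fintype.card_fin] at this
        exact_mod_cast this

/-- Matrices that are not injective on short images are given up entirely; their share is the last
term on the left. For all others the bound does not depend on the key. -/
theorem le_lweCosetProb [Fact q.Prime] (hP : 1 ≤ P) (hVP : V ≤ P) (hq : 2 * (P + V) < q)
    (s : Fin n → ZMod q) {ε : ℝ} (hε : Real.pi * (m * (V / P)) ≤ ε) :
    1 - m * (2 * V * (Real.exp Real.pi / P)) -
      (q : ℝ) ^ n * ((2 * (3 * P : ℕ) + 1) / q) ^ m ≤ lweCosetProb (m := m) (V : ℝ) (P : ℝ) s ε := by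
  classical
  have hq0 : (0 : ℝ) < q := by exact_mod_cast (Fact.out : q.Prime).pos
  set η := m * (2 * V * (Real.exp Real.pi / P)) with hη
  have hη0 : 0 ≤ η := by positivity
  let Inj : Matrix (Fin m) (Fin n) (ZMod q) → Prop := fun A =>
    ∀ z, (∀ i, Near q (3 * P) (A.mulVec z i)) → z = 0
  have hmain : ∀ (A : Matrix (Fin m) (Fin n) (ZMod q)) (e : Fin m → ZMod q),
      gaussVecDensity (V : ℝ) e * (1 - η - if ¬ Inj A then 1 else 0) ≤
        gaussVecDensity (V : ℝ) e * sampCosetProb (P : ℝ) A (A.mulVec s + e) s ε := by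
    intro A e
    by_cases he : gaussVecDensity (V : ℝ) e = 0
    · simp [he]
    refine mul_le_mul_of_nonneg_left ?_ (gaussVecDensity_nonneg e)
    by_cases hA : Inj A
    · rw [if_neg (not_not.2 hA), sub_zero]
      exact le_sampCosetProb hP hVP hq s
        (fun i => by exact_mod_cast abs_le_of_gaussVecDensity_ne_zero he i) hA hε
    · rw [if_pos hA]
      have := sampCosetProb_nonneg (P : ℝ) A (A.mulVec s + e) s ε
      linarith
  calc _ ≤ ∑ A : Matrix (Fin m) (Fin n) (ZMod q),
        ((q : ℝ) ^ (m * n))⁻¹ * (1 - η - if ¬ Inj A then 1 else 0) := by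
        rw [← Finset.mul_sum, Finset.sum_sub_distrib, ← Finset.sum_filter, Finset.sum_const,
          Finset.sum_const, Finset.card_univ, card_matrix_zmod, nsmul_eq_mul, nsmul_eq_mul, mul_one]
        have h1 := card_not_injective (n := n) (m := m) (q := q) (3 * P)
        push_cast
        have hQ : (0 : ℝ) < (q : ℝ) ^ (m * n) := by positivity
        rw [mul_sub, inv_mul_cancel_left₀ hQ.ne']
        refine sub_le_sub_left ?_ _
        rw [inv_mul_le_iff₀ hQ]
        refine h1.trans (le_of_eq ?_)
        push_cast; ring
    _ = ∑ A : Matrix (Fin m) (Fin n) (ZMod q), ∑ e : Fin m → ZMod q, ((q : ℝ) ^ (m * n))⁻¹ *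
        (gaussVecDensity (V : ℝ) e * (1 - η - if ¬ Inj A then 1 else 0)) := by
        refine Finset.sum_congr rfl fun A _ => ?_
        rw [← Finset.mul_sum, ← Finset.sum_mul, sum_gaussVecDensity (Nat.cast_nonneg V), one_mul]
    _ ≤ _ := by
        unfold lweCosetProb
        refine Finset.sum_le_sum fun A _ => Finset.sum_le_sum fun e _ => ?_
        rw [mul_assoc]
        exact mul_le_mul_of_nonneg_left (hmain A e) (by positivity)

end Average

/-! ### Coset states from range superpositions, asymptotically -/

namespace NTCFParams

variable {CT : ℝ} {n m q BL BV BP : ℕ → ℕ} [hq : ∀ k, Fact (q k).Prime]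

theorem exists_negl_lweCosetProb (hCT : 0 < CT) (h : NTCFParams CT n m q BL BV BP) :
    ∃ ε : ℕ → ℝ, Negl ε ∧ ∀ (k : ℕ) (s : Fin (n k) → ZMod (q k)),
      1 - ε k ≤ lweCosetProb (m := m k) (BV k : ℝ) (BP k : ℝ) s (ε k) := by
  obtain ⟨c, hc, hm⟩ := h.m_large
  obtain ⟨L, hL⟩ : ∃ L : ℕ, 2 ≤ L * c := by
    obtain ⟨L, hL⟩ := exists_nat_ge (2 / c)
    exact ⟨L, (div_le_iff₀ hc).1 hL⟩
  -- The three summands pay for the boundary shell, the distance to the balanced state, and the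
  -- matrices that are not injective on short images.
  set C : ℝ := 2 * Real.exp Real.pi + Real.pi + 1 / (2 * CT) with hC
  have hC0 : 0 ≤ C := by positivity
  -- The 7 comes from 2 · 3B_P + 1 ≤ 7B_P; the same estimate yields 2(B_P + B_V) < q, which rules
  -- out wrap-around.
  have hev : ∀ᶠ k in atTop, c * (n k * Real.logb 2 (q k)) ≤ m k ∧
      (BP k : ℝ) / q k ≤ (1 / 2) ^ L / 7 :=
    hm.and ((h.tendsto_BP_div_q hCT).eventually_le_const (by positivity))
  classical
  let Large : ℕ → Prop := fun k => c * (n k * Real.logb 2 (q k)) ≤ m k ∧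
      (BP k : ℝ) / q k ≤ (1 / 2) ^ L / 7
  -- The claim is for every parameter, the estimates only for large ones; the value 1 at the
  -- finitely many others makes it trivial there and does not affect negligibility.
  refine ⟨fun k => if Large k then C * (m k * ((BV k : ℝ) / BP k)) else 1, ?_, ?_⟩
  · refine negl_of_le C h.m_poly h.BP_div_BV (fun k => ?_) ?_
    · split_ifs <;> positivity
    · filter_upwards [hev] with k hk
      rw [if_pos hk, div_div_eq_mul_div, mul_div_assoc]
  · intro k s
    by_cases hk : Large k
    · simp only [if_pos hk]
      obtain ⟨h1, h2⟩ := hk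
      have hqk := one_lt_q (q := q) k
      have hq0 : (0 : ℝ) < q k := by exact_mod_cast hqk.le.trans_lt' zero_lt_one
      have hV : (1 : ℝ) ≤ BV k := by exact_mod_cast h.BV_pos k
      have hP : (1 : ℝ) ≤ BP k := by exact_mod_cast h.BP_pos k
      have hm1 : (1 : ℝ) ≤ m k := by exact_mod_cast h.m_pos k
      rw [div_le_iff₀ hq0] at h2
      have hW : (2 * ((3 * BP k : ℕ) : ℝ) + 1) / q k ≤ (1 / 2) ^ L := by
        rw [div_le_iff₀ hq0]
        push_cast
        linarith
      have hpow := pow_le_of_sample_bound hqk (by positivity) hW hL h1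
      have hL1 : (1 / 2 : ℝ) ^ L ≤ 1 := pow_le_one₀ (by norm_num) (by norm_num)
      have hlt : 2 * (BP k + BV k) < q k := by
        have h3 : (7 : ℝ) * BP k ≤ q k := by nlinarith
        have h4 : 7 * BP k ≤ q k := by exact_mod_cast h3
        have := h.BV_lt_BP k
        have := h.BP_pos k
        omega
      have hρ0 : 0 ≤ (m k : ℝ) * ((BV k : ℝ) / BP k) := by positivity
      refine le_trans ?_ (le_lweCosetProb (h.BP_pos k) (h.BV_lt_BP k).le hlt s ?_)
      · have hQ : (q k : ℝ) ≤ (q k : ℝ) ^ n k :=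
          le_self_pow₀ (by exact_mod_cast hqk.le) (by have := h.n_pos k; omega)
        have h5 : (q k : ℝ) ^ n k * ((2 * ((3 * BP k : ℕ) : ℝ) + 1) / q k) ^ m k ≤
            1 / (2 * CT) * (m k * ((BV k : ℝ) / BP k)) := by
          calc _ ≤ (q k : ℝ) ^ n k * (1 / ((q k : ℝ) ^ n k * (q k : ℝ) ^ n k)) := by gcongr
            _ = 1 / (q k : ℝ) ^ n k := by field_simp
            _ ≤ 1 / q k := by gcongr
            _ ≤ BV k / q k := by gcongr
            _ ≤ 1 / (2 * CT) * (BV k / BP k) := h.BV_div_q_le hCT k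
            _ ≤ _ := by
              gcongr
              exact le_mul_of_one_le_left (by positivity) hm1
        have h6 : (m k : ℝ) * (2 * BV k * (Real.exp Real.pi / BP k)) =
            2 * Real.exp Real.pi * (m k * ((BV k : ℝ) / BP k)) := by ring
        have h7 : 0 ≤ Real.pi * (m k * ((BV k : ℝ) / BP k)) := by positivity
        rw [h6, hC]
        linarith
      · gcongr
        rw [hC]
        have : 0 ≤ 2 * Real.exp Real.pi + 1 / (2 * CT) := by positivity
        linarith
    · simp only [if_neg hk, sub_self]
      exact lweCosetProb_nonneg _ _ _ _

end NTCFParams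

theorem theorem3p3 (CT : ℝ) (hCT : 0 < CT) (n m q BL BV BP : ℕ → ℕ)
    [hq : ∀ k, Fact (q k).Prime] (hpar : NTCFParams CT n m q BL BV BP) :
    (EfficientlySolvesDCP n q → EfficientlySolvesLWE n m q (fun k => (BV k : ℝ))) ∧
    (∃ ε : ℕ → ℝ, Negl ε ∧ ∀ (k : ℕ) (s : Fin (n k) → ZMod (q k)),
      1 - ε k ≤ lweCosetProb (m := m k) (BV k : ℝ) (BP k : ℝ) s (ε k)) :=
  ⟨hpar.efficientlySolvesLWE hCT, hpar.exists_negl_lweCosetProb hCT⟩
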